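/- **Setting.** Consider the kagome lattice on an $L_1\times L_2$ torus ($3L_1L_2$ vertices; its triangles are the $A$ (up) and $B$ (down) sites of the dual honeycomb lattice). Let $V=\mathbf 1\oplus\mathbf 3\oplus\bar{\mathbf 3}$ be a representation of $\mathrm{SU}(3)$, and for $\zeta>0$ let $|\tau\rangle\in V^{\otimes 3}$ be the sum of the normalised singlets in $\mathbf 1\otimes\mathbf 1\otimes\mathbf 1$ and in the six orderings of $\mathbf 1\otimes\mathbf 3\otimes\bar{\mathbf 3}$, plus $i\zeta$ times the normalised (antisymmetric) singlet in $\mathbf 3\otimes\mathbf 3\otimes\mathbf 3$. For a site map $\mathcal P$ on $V\otimes V$, the state $|\Psi_{\mathcal P}\rangle$ is obtained by placing $|\tau\rangle$ counterclockwise on every triangle and applying $\mathcal P$ to the two virtual legs ($A$ leg first) at each vertex. We use the following site maps. * *$\mathcal P_1\to\mathcal P_2$:* for $s\in[0,1]$, $\mathcal P^{(s)}$ projects onto $(\mathbf 1\otimes\mathbf 3)\oplus(\mathbf 3\otimes\mathbf 1)\oplus(\bar{\mathbf 3}\otimes\bar{\mathbf 3})$ and acts on $\bar{\mathbf 3}\otimes\bar{\mathbf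 3}=\mathbf 3\oplus\bar{\mathbf 6}$ as $\sqrt{3/(1+2s^2)}\,(\Pi_{\mathbf 3}+s\,\Pi_{\bar{\mathbf 6}})$. Here $\mathcal P_1=\mathcal P^{(1)}$ (orthogonal trimer model) and $\mathcal P_2=\mathcal P^{(0)}$ (trimers carrying $\mathrm{SU}(3)$ singlets, different trimer patterns orthogonal). $\mathcal P_2$ is also regarded as a map into its range $\mathbf 3\oplus\mathbf 3\oplus\mathbf 3\cong\mathbb C^3\otimes\mathbf 3$, where $\mathbb C^3$ is the arrow degree of freedom $\{\blacktriangleright,\blacktriangleleft,\circ\}$, with the signs of the three copies of $\mathbf 3$ chosen such that their equal weight superposition is odd under exchange of the two legs. * *$\mathcal P_2\to\mathcal P_3$:* for $\theta\in[0,1]$, $\mathcal P_{2,\theta}=(\Lambda_\theta\otimes 1)\mathcal P_2$ with $\Lambda_\theta=(1-\theta)1+\theta|+\rangle\langle+|$ acting on the arrow degree of freedom, $|+\rangle$ being the normalised equal weight superposition of the three arrow states. $\theta=1$ is the $\mathrm{SU}(3)$ model $\mathcal P_3$; for $\theta<1$, $\Lambda_\theta$ is invertible. Each term in $|\Psi_{\mathcal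 P}\rangle$ has a loop configuration with values in $\mathbb Z_3$ (at each vertex: $1$, $2$, $0$ if the $A$ leg is in $\mathbf 1$, $\mathbf 3$, $\bar{\mathbf 3}$). The *topological space* $\mathcal T_{\mathcal P}$ is the span of the nine states obtained from $|\Psi_{\mathcal P}\rangle$ by giving each loop configuration the phase $e^{2\pi i(\nu_1N_1+\nu_2N_2)/3}$, $\nu_1,\nu_2\in\mathbb Z_3$, where $N_1,N_2$ are the sums of the loop variables along two fixed noncontractible loops in the two lattice directions. The *ice space* $\mathcal I_{\mathcal P}$ is the span of the six parts of $|\Psi_{\mathcal P}\rangle$ that belong to a single translation invariant loop configuration whose values on the three kinds of kagome vertices are a permutation of $0,1,2$ (the crystals). An *outer vertex* of a hexagon, or of two adjacent hexagons, is a vertex not on it that shares a triangle with it; there are $6$, respectively $8$, of these. **Statement.** There is an $N_0$, independent of $\zeta,s,\theta$, such that for every $\zeta>0$ the following holds. All Hamiltonians are sums over all lattice translations of finitely many positive semidefinite local terms which do not depend on $L_1,L_2$; the claims on ground spaces (the kernels of these positive semidefinite operators) hold on all tori with $L_1,L_2\ge N_0$. 1. *(Along $\mathcal P_1\to\mathcal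 P_2$.)* For $\mathcal P=\mathcal P^{(s)}$ with any $s\in[0,1]$, and for $\mathcal P_2$ as a map into $\mathbb C^3\otimes\mathbf 3$: (a) there is a Hamiltonian made of projectors that each act on at most $8$ vertices, namely one hexagon and at most two of its outer vertices, whose ground space is exactly $\mathcal T_{\mathcal P}+\mathcal I_{\mathcal P}$, with $\dim\mathcal T_{\mathcal P}=9$ and $\dim(\mathcal T_{\mathcal P}+\mathcal I_{\mathcal P})=15$; (b) there is a Hamiltonian made of projectors that each act on at most $12$ vertices, namely two adjacent hexagons and one of their outer vertices, whose ground space is exactly $\mathcal T_{\mathcal P}$, of dimension $9$. 2. *(Along $\mathcal P_2\to\mathcal P_3$.)* Let the regions be either (a) all $12$-vertex regions consisting of a hexagon and its outer vertices, or (b) all $19$-vertex regions consisting of two adjacent hexagons and their outer vertices. There are projectors $h$ on these regions (one up to translation in (a), one for each of the three directions of a pair in (b)) such that the deformed terms $$h'_\theta=\big((\Lambda_\theta^{-1})^\dagger\big)^{\otimes k}\,h\,(\Lambda_\theta^{-1})^{\otimes k},\qquad k=12\text{ or }19,$$ depend smoothly on $\theta\in[0,1)$, and for every $\theta\in[0,1)$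 the Hamiltonian $\sum h'_\theta$ has the ground space $\mathcal T_{\mathcal P_{2,\theta}}+\mathcal I_{\mathcal P_{2,\theta}}$, of dimension $9+6=15$, in case (a), and exactly $\mathcal T_{\mathcal P_{2,\theta}}$, of dimension $9$, in case (b). Moreover there are projectors $h''_\theta$ on the same regions, depending smoothly on $\theta\in[0,1]$ (thus with a limit at $\theta=1$), with $\ker h''_\theta=\ker h'_\theta$ for $\theta<1$, such that $\sum h''_\theta$ has the same ground spaces for $\theta<1$; at $\theta=1$ the spaces $\mathcal T_{\mathcal P_3}+\mathcal I_{\mathcal P_3}$, respectively $\mathcal T_{\mathcal P_3}$, still consist of ground states (there may be others). -/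

import Mathlib

open scoped ContDiff BigOperators ComplexOrder

/-! ### Virtual and physical site spaces -/

/-- Basis of the virtual space `1 ⊕ 3 ⊕ 3̄`. -/
inductive Virt where
  | one : Virt
  | three : Fin 3 → Virt
  | bar : Fin 3 → Virt
  deriving DecidableEq, Fintype

/-- The `ℤ₃` charge (loop variable) carried by a virtual state. -/
def Virt.charge : Virt → ZMod 3
  | .one => 1
  | .three _ => 2
  | .bar _ => 0

/-- Orthonormal basis of the physical site space `(1 ⊗ 3) ⊕ (3 ⊗ 1) ⊕ (3̄ ⊗ 3̄)`. The first tensor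
factor is the virtual leg towards the `A` (up) triangle, the second one that towards the `B` (down)
triangle. Arrows point from `1` to `3`. -/
inductive PairSpin where
  | toB : Fin 3 → PairSpin
  | toA : Fin 3 → PairSpin
  | circ : Fin 3 → Fin 3 → PairSpin
  deriving DecidableEq, Fintype

/-- The arrow degree of freedom: into the `B` triangle, into the `A` triangle, or no arrow. -/
inductive Arrow where
  | toB : Arrow
  | toA : Arrow
  | circ : Arrow
  deriving DecidableEq

instance : Fintype Arrow := ⟨{.toB, .toA, .circ}, fun x => by cases x <;> decide⟩

/-- Orthonormal product basis of the effective site space `ℂ³ ⊗ 3` that is left when the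
`6̄` in `3̄ ⊗ 3̄ = 3 ⊕ 6̄` has been removed. -/
abbrev ArrowSpin := Arrow × Fin 3

noncomputable section

/-- The Levi-Civita symbol on `{0, 1, 2}`. -/
def leviCivita (i j k : Fin 3) : ℂ :=
  (((j : ℕ) : ℂ) - ((i : ℕ) : ℂ)) * (((k : ℕ) : ℂ) - ((j : ℕ) : ℂ)) *
    (((k : ℕ) : ℂ) - ((i : ℕ) : ℂ)) / 2

/-- The Kronecker delta. -/
def kron {α : Type*} [DecidableEq α] (i j : α) : ℂ := if i = j then 1 else 0

/-- The triangle state: the sum of the normalised singlets in `1 ⊗ 1 ⊗ 1`, in the six orderings of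
`1 ⊗ 3 ⊗ 3̄`, and `i ζ` times the normalised singlet in `3 ⊗ 3 ⊗ 3`; no `3̄ ⊗ 3̄ ⊗ 3̄`. -/
def tau (ζ : ℝ) : Virt → Virt → Virt → ℂ
  | .one, .one, .one => 1
  | .one, .three i, .bar j => kron i j / (Real.sqrt 3 : ℂ)
  | .one, .bar i, .three j => kron i j / (Real.sqrt 3 : ℂ)
  | .three i, .one, .bar j => kron i j / (Real.sqrt 3 : ℂ)
  | .bar i, .one, .three j => kron i j / (Real.sqrt 3 : ℂ)
  | .three i, .bar j, .one => kron i j / (Real.sqrt 3 : ℂ)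
  | .bar i, .three j, .one => kron i j / (Real.sqrt 3 : ℂ)
  | .three i, .three j, .three k =>
      Complex.I * (ζ : ℂ) * leviCivita i j k / (Real.sqrt 6 : ℂ)
  | _, _, _ => 0

/-- Site maps of the first interpolation, `s` being the amplitude of the `6̄` in `3̄ ⊗ 3̄` relative
to the `3`. The prefactor keeps the total weight `‖W_s‖² = 9` of the subspace `3̄ ⊗ 3̄` constant.
At `s = 1` this is the projection on `(1 ⊗ 3) ⊕ (3 ⊗ 1) ⊕ (3̄ ⊗ 3̄)` (orthogonal trimers), at
`s = 0` it is `√3` times the antisymmetriser on `3̄ ⊗ 3̄` (trimers carrying `SU(3)` singlets). -/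
def pairMap (s : ℝ) : PairSpin → Virt → Virt → ℂ
  | .toB i, .one, .three j => kron i j
  | .toA i, .three j, .one => kron i j
  | .circ i j, .bar k, .bar l =>
      (Real.sqrt (3 / (1 + 2 * s ^ 2)) : ℂ) *
        ((kron i k * kron j l - kron i l * kron j k) / 2 +
          (s : ℂ) * ((kron i k * kron j l + kron i l * kron j k) / 2))
  | _, _, _ => 0

/-- The site map with singlet-decorated trimers, written in the effective space `ℂ³ ⊗ 3`. The sign
of the second line is such that the equal weight superposition of the three arrow states is odd
under exchange of the two virtual legs. -/
def singletMap : ArrowSpin → Virt → Virt → ℂ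
  | (.toB, i), .one, .three j => kron i j
  | (.toA, i), .three j, .one => -kron i j
  | (.circ, i), .bar j, .bar k => (Real.sqrt 3 : ℂ) * (leviCivita i j k / (Real.sqrt 2 : ℂ))
  | _, _, _ => 0

/-- The filtering `Λ_θ ⊗ 1`, with `Λ_θ = (1 - θ) 1 + θ |+⟩⟨+|` acting on the arrow degree of
freedom and `|+⟩` the normalised equal weight superposition of the three arrow states. -/
def siteFilter (θ : ℝ) : Matrix ArrowSpin ArrowSpin ℂ :=
  fun x y => ((1 - (θ : ℂ)) * kron x.1 y.1 + (θ : ℂ) / 3) * kron x.2 y.2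

/-- Site maps of the second interpolation, from singlet-decorated trimers (`θ = 0`) to the
`SU(3)` model (`θ = 1`). -/
def filterMap (θ : ℝ) (x : ArrowSpin) (v w : Virt) : ℂ :=
  ∑ y, siteFilter θ x y * singletMap y v w

end

/-! ### The kagome lattice

Hexagons are the points of the triangular lattice with lattice vectors `latVec 0, latVec 1, latVec 2` at angles
`0°, 120°, 240°`. The kagome vertex `(p, d)` is the midpoint of the edge from `p` to `p + latVec d`. -/

/-- Vertices of the infinite kagome lattice. -/
abbrev KSite := (ℤ × ℤ) × Fin 3

/-- Vertices of the kagome lattice on the `L₁ × L₂` torus. -/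
abbrev Site (L₁ L₂ : ℕ) := (ZMod L₁ × ZMod L₂) × Fin 3

/-- The three lattice vectors, with sum zero. -/
def latVec : Fin 3 → ℤ × ℤ := ![(1, 0), (-1, 1), (0, -1)]

/-- Reduction of a point of the infinite triangular lattice to the torus. -/
def red (L₁ L₂ : ℕ) (p : ℤ × ℤ) : ZMod L₁ × ZMod L₂ := ((p.1 : ZMod L₁), (p.2 : ZMod L₂))

/-- Placement of the infinite lattice, translated by `p`, on the torus. -/
def wrap {L₁ L₂ : ℕ} (p : ZMod L₁ × ZMod L₂) (x : KSite) : Site L₁ L₂ :=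
  (p + red L₁ L₂ x.1, x.2)

/-- The `k`-th corner (counterclockwise) of the up triangle at `p`. -/
def upCorner (p : ℤ × ℤ) : Fin 3 → KSite :=
  ![(p, 0), (p + latVec 0, 1), (p - latVec 2, 2)]

/-- The `k`-th corner (counterclockwise) of the down triangle at `p`. -/
def downCorner (p : ℤ × ℤ) : Fin 3 → KSite :=
  ![(p - latVec 0, 0), (p + latVec 2, 1), (p, 2)]

/-- The six vertices of the hexagon `p`. -/
def hexagon (p : ℤ × ℤ) : Finset KSite :=
  (Finset.univ.image fun d => (p, d)) ∪ (Finset.univ.image fun d => (p - latVec d, d))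

/-- The corners of the two triangles that contain the vertex `x`. -/
def triangles (x : KSite) : Finset KSite :=
  Finset.univ.image (upCorner (![x.1, x.1 - latVec 0, x.1 + latVec 2] x.2)) ∪
    Finset.univ.image (downCorner (![x.1 + latVec 0, x.1 - latVec 2, x.1] x.2))

/-- A region together with its outer vertices: all vertices of triangles that meet the region.
This is the 12-vertex star for one hexagon, and has 19 vertices for two adjacent hexagons. -/
def starOf (R : Finset KSite) : Finset KSite := R.biUnion triangles

/-- The two adjacent hexagons at `0` and `latVec d`. -/
def doubleHexagon (d : Fin 3) : Finset KSite := hexagon 0 ∪ hexagon (latVec d)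

/-- At most eight vertices: a hexagon and at most two outer vertices. -/
def IsHexagonRegion (R : Finset KSite) : Prop :=
  ∃ O : Finset KSite, O ⊆ starOf (hexagon 0) \ hexagon 0 ∧ O.card ≤ 2 ∧ R ⊆ hexagon 0 ∪ O

/-- At most twelve vertices: two adjacent hexagons and one outer vertex. -/
def IsDoubleHexagonRegion (R : Finset KSite) : Prop :=
  ∃ d : Fin 3, ∃ o ∈ starOf (doubleHexagon d) \ doubleHexagon d, R ⊆ insert o (doubleHexagon d)

noncomputable section

/-! ### Wave functions on the torus -/

/-- The (unnormalised) tensor network state on the torus obtained by placing `tau ζ` on all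
triangles and applying the site map `P` to the two virtual legs at every vertex. The coefficient
function `c` weights the terms according to their loop configuration. -/
def networkState {σ : Type} (L₁ L₂ : ℕ) [NeZero L₁] [NeZero L₂] (ζ : ℝ)
    (P : σ → Virt → Virt → ℂ) (c : (Site L₁ L₂ → ZMod 3) → ℂ) : (Site L₁ L₂ → σ) → ℂ :=
  fun φ => ∑ a : Site L₁ L₂ → Virt, ∑ b : Site L₁ L₂ → Virt,
    c (fun x => (a x).charge) *
      (∏ p : ZMod L₁ × ZMod L₂, tau ζ (a (wrap p (upCorner 0 0))) (a (wrap p (upCorner 0 1)))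
        (a (wrap p (upCorner 0 2)))) *
      (∏ p : ZMod L₁ × ZMod L₂, tau ζ (b (wrap p (downCorner 0 0))) (b (wrap p (downCorner 0 1)))
        (b (wrap p (downCorner 0 2)))) *
      ∏ x, P (φ x) (a x) (b x)

/-- Sum of the loop variables along the first noncontractible loop of the torus. -/
def windingOne {L₁ L₂ : ℕ} [NeZero L₁] (l : Site L₁ L₂ → ZMod 3) : ZMod 3 :=
  ∑ k : ZMod L₁, l ((k, 0), 0)

/-- Sum of the loop variables along the second noncontractible loop of the torus. -/
def windingTwo {L₁ L₂ : ℕ} [NeZero L₂] (l : Site L₁ L₂ → ZMod 3) : ZMod 3 :=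
  ∑ k : ZMod L₂, l ((0, k), 2)

/-- The topological siblings: the loop configuration `l` gets the phase `ω^(ν₁ N₁ + ν₂ N₂)` with
`ω = e^{2πi/3}`; `ν = 0` is the original state. -/
def sibling {σ : Type} (L₁ L₂ : ℕ) [NeZero L₁] [NeZero L₂] (ζ : ℝ)
    (P : σ → Virt → Virt → ℂ) (ν : ZMod 3 × ZMod 3) : (Site L₁ L₂ → σ) → ℂ :=
  networkState L₁ L₂ ζ P fun l =>
    Complex.exp (2 * Real.pi * Complex.I / 3) ^ (ν.1 * windingOne l + ν.2 * windingTwo l).val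

/-- The six crystals: the single, translation invariant loop configuration in which the loop
variables on the three kinds of vertices are a permutation of `0, 1, 2`. -/
def crystal {σ : Type} (L₁ L₂ : ℕ) [NeZero L₁] [NeZero L₂] (ζ : ℝ)
    (P : σ → Virt → Virt → ℂ) (e : Equiv.Perm (Fin 3)) : (Site L₁ L₂ → σ) → ℂ :=
  networkState L₁ L₂ ζ P fun l => if (∀ x, l x = (((e x.2 : Fin 3) : ℕ) : ZMod 3)) then 1 else 0

/-- The topological space, spanned by the state and its siblings. -/
def topSpace {σ : Type} (L₁ L₂ : ℕ) [NeZero L₁] [NeZero L₂] (ζ : ℝ)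
    (P : σ → Virt → Virt → ℂ) : Submodule ℂ ((Site L₁ L₂ → σ) → ℂ) :=
  Submodule.span ℂ (Set.range (sibling L₁ L₂ ζ P))

/-- The space of the crystals ("ice" sector). -/
def iceSpace {σ : Type} (L₁ L₂ : ℕ) [NeZero L₁] [NeZero L₂] (ζ : ℝ)
    (P : σ → Virt → Virt → ℂ) : Submodule ℂ ((Site L₁ L₂ → σ) → ℂ) :=
  Submodule.span ℂ (Set.range (crystal L₁ L₂ ζ P))

/-! ### Local Hamiltonians -/

/-- Orthogonal projectors. -/
def IsOrthProj {α : Type*} [Fintype α] (h : Matrix α α ℂ) : Prop := h.IsHermitian ∧ h * h = h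

/-- The operator `h`, which acts on the vertices in `R`, placed at position `p` of the torus; it
acts as the identity on all other vertices. -/
def place {σ : Type} (L₁ L₂ : ℕ) (R : Finset KSite) (h : Matrix (R → σ) (R → σ) ℂ)
    (p : ZMod L₁ × ZMod L₂) : Matrix (Site L₁ L₂ → σ) (Site L₁ L₂ → σ) ℂ :=
  open Classical in
  fun φ ψ => if (∀ x, (∀ r ∈ R, x ≠ wrap p r) → φ x = ψ x) then
    h (fun r => φ (wrap p r)) (fun r => ψ (wrap p r)) else 0

/-- The translation invariant Hamiltonian on the torus with the local terms `h k`. -/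
def hamiltonian {σ : Type} (L₁ L₂ : ℕ) [NeZero L₁] [NeZero L₂] {n : ℕ} (R : Fin n → Finset KSite)
    (h : ∀ k, Matrix (R k → σ) (R k → σ) ℂ) : Matrix (Site L₁ L₂ → σ) (Site L₁ L₂ → σ) ℂ :=
  ∑ k, ∑ p : ZMod L₁ × ZMod L₂, place L₁ L₂ (R k) (h k) p

/-- `H` is positive semidefinite with zero energy space (ground space) `G`. -/
def HasGroundSpace {α : Type} [Fintype α] [DecidableEq α] (H : Matrix α α ℂ)
    (G : Submodule ℂ (α → ℂ)) : Prop :=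
  H.PosSemidef ∧ LinearMap.ker H.mulVecLin = G

/-- The product operator `⊗ M` on the vertices in `R`. -/
def tensorPower {σ : Type} (R : Finset KSite) (M : Matrix σ σ ℂ) : Matrix (R → σ) (R → σ) ℂ :=
  fun φ ψ => ∏ r, M (φ r) (ψ r)

/-- The deformed local term `(Λ_θ⁻¹)^† ⊗ … h … ⊗ Λ_θ⁻¹`. -/
def deform (R : Finset KSite) (θ : ℝ) (h : Matrix (R → ArrowSpin) (R → ArrowSpin) ℂ) :
    Matrix (R → ArrowSpin) (R → ArrowSpin) ℂ :=
  (tensorPower R (siteFilter θ)⁻¹).conjTranspose * h * tensorPower R (siteFilter θ)⁻¹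

/-- For the orthogonal trimer states given by the site map `P` there are, independently of the
torus, finitely many projectors on at most 8 vertices (a hexagon and at most two outer vertices)
whose Hamiltonian has as its ground space the nine topological states and the six crystals, and
finitely many projectors on at most 12 vertices (two hexagons and one outer vertex) whose
Hamiltonian has exactly the nine topological states as its ground space. -/
def HasTrimerParents {σ : Type} [Fintype σ] [DecidableEq σ] (N₀ : ℕ) (ζ : ℝ)
    (P : σ → Virt → Virt → ℂ) : Prop :=
  (∃ (n : ℕ) (R : Fin n → Finset KSite) (h : ∀ k, Matrix (R k → σ) (R k → σ) ℂ),
    (∀ k, IsHexagonRegion (R k) ∧ IsOrthProj (h k)) ∧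
    ∀ (L₁ L₂ : ℕ) [NeZero L₁] [NeZero L₂], N₀ ≤ L₁ → N₀ ≤ L₂ →
      HasGroundSpace (hamiltonian L₁ L₂ R h) (topSpace L₁ L₂ ζ P ⊔ iceSpace L₁ L₂ ζ P) ∧
      Module.finrank ℂ (topSpace L₁ L₂ ζ P) = 9 ∧
      Module.finrank ℂ ↥(topSpace L₁ L₂ ζ P ⊔ iceSpace L₁ L₂ ζ P) = 15) ∧
  (∃ (n : ℕ) (R : Fin n → Finset KSite) (h : ∀ k, Matrix (R k → σ) (R k → σ) ℂ),
    (∀ k, IsDoubleHexagonRegion (R k) ∧ IsOrthProj (h k)) ∧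
    ∀ (L₁ L₂ : ℕ) [NeZero L₁] [NeZero L₂], N₀ ≤ L₁ → N₀ ≤ L₂ →
      HasGroundSpace (hamiltonian L₁ L₂ R h) (topSpace L₁ L₂ ζ P) ∧
      Module.finrank ℂ (topSpace L₁ L₂ ζ P) = 9)

/-- On the regions `R k` there are projectors `h k`, whose deformations `deform θ (h k)` depend
smoothly on `θ ∈ [0, 1)`, and projectors `g θ k` which depend smoothly on `θ ∈ [0, 1]`
and have the same kernel as the deformed terms for `θ < 1`, such that for all `θ ∈ [0, 1)` both
families give Hamiltonians on the torus with the ground space `G θ`, of dimension `m`. For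
`θ = 1` the limit Hamiltonian still has the states in `G 1` among its ground states. -/
def HasSmoothParents (N₀ m n : ℕ) (R : Fin n → Finset KSite)
    (G : ∀ (L₁ L₂ : ℕ) [NeZero L₁] [NeZero L₂], ℝ →
      Submodule ℂ ((Site L₁ L₂ → ArrowSpin) → ℂ)) : Prop :=
  ∃ (h : ∀ k, Matrix (R k → ArrowSpin) (R k → ArrowSpin) ℂ)
    (g : ℝ → ∀ k, Matrix (R k → ArrowSpin) (R k → ArrowSpin) ℂ),
    (∀ k, IsOrthProj (h k)) ∧
    (∀ k φ ψ, ContDiffOn ℝ ∞ (fun θ => deform (R k) θ (h k) φ ψ) (Set.Ico 0 1)) ∧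
    (∀ θ ∈ Set.Icc (0 : ℝ) 1, ∀ k, IsOrthProj (g θ k)) ∧
    (∀ k φ ψ, ContDiffOn ℝ ∞ (fun θ => g θ k φ ψ) (Set.Icc 0 1)) ∧
    (∀ θ ∈ Set.Ico (0 : ℝ) 1, ∀ k,
      LinearMap.ker (g θ k).mulVecLin = LinearMap.ker (deform (R k) θ (h k)).mulVecLin) ∧
    ∀ (L₁ L₂ : ℕ) [NeZero L₁] [NeZero L₂], N₀ ≤ L₁ → N₀ ≤ L₂ →
      (∀ θ ∈ Set.Ico (0 : ℝ) 1,
        HasGroundSpace (hamiltonian L₁ L₂ R fun k => deform (R k) θ (h k)) (G L₁ L₂ θ) ∧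
        HasGroundSpace (hamiltonian L₁ L₂ R (g θ)) (G L₁ L₂ θ) ∧
        Module.finrank ℂ (G L₁ L₂ θ) = m) ∧
      G L₁ L₂ 1 ≤ LinearMap.ker (hamiltonian L₁ L₂ R (g 1)).mulVecLin

end

/-! The Hamiltonians are built from exchange relations. For two basis configurations ρ, ρ' of a
region R, the relation a ψ(ρ, ·) = b ψ(ρ', ·) is admitted (`Exchange`) if it holds for all states
that are to be ground states, on all tori of size at least 20 and for arbitrary surroundings of R.
The kernel of the local projector consists of the vectors that obey all admitted relations on R
(`exists_exchangeProj`). As the terms are positive semidefinite, the ground states are the vectors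
all of whose slices obey the relations (`Saturated`). The desired states are ground states by
construction; the content of the theorem is that there are no others, and that they have the stated
dimensions.

In a basis of definite arrows and colours, a physical configuration fixes all virtual legs that
contribute, so every network state is a coefficient of the loop configuration times a product of
triangle and vertex weights, the amplitude (`sum_networkTerm`). Uniqueness then has four
ingredients.

(i) Within a loop configuration, the state of a trimer, or of a triangle with three legs in 3,
enters the amplitude only through a number. The relations on the two triangles of a vertex therefore
make every ground state a coefficient c times the amplitude
(`LocallySaturated.exists_eq_networkState`).

(ii) Changing the loop variables around one hexagon leaves c invariant. For suitable colours, the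
state of the hexagon and of two opposite outer vertices already forces the legs of the other outer
vertices, so that the change multiplies the amplitude by a fixed nonzero number
(`amplitude_exchange_pattern`, `exists_ringForced_aux`).

(iii) Loop configurations are differences of ℤ₃ valued heights on the triangular lattice without
monochromatic triangles, and a change around a hexagon recolours one point. All such heights with
given periods, except those of the crystals, are connected by recolourings
(`heightReach_of_not_isCrystal`). Hence c is constant on the nine winding sectors, apart from free
values on the six crystals: 9 + 6 = 15 dimensions.

(iv) No single hexagon of a crystal can be changed, but two adjacent hexagons can be changed at once
(`exists_crystalChange`). With these regions the values on the crystals are tied to their sectors,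
and 9 dimensions remain.

Connectedness in (iii) is shown by minimising the number of monochromatic horizontal bonds. At the
minimum, a monochromatic segment that ends somewhere would be blocked through all rows by a rigid
strip, which a few moves can break (`RecolouringGame.not_rightEndBlocked`). So either whole rows are
monochromatic, which gives a crystal, or there are no such bonds. In the latter case each row is a
sequence of ascents and descents, which can be sorted and flipped three at a time until a form is
reached that depends only on the periods.

In the second interpolation the site filter is invertible for θ < 1, and its product over the
vertices carries the local kernels along (`slices_productMatrix`). The transported kernels are
spanned by polynomials in θ. Dividing out powers of X - 1 continues them to θ = 1 with the same
dimension (`exists_saturation`), which gives the smooth projectors, and continuity keeps the states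
at θ = 1 in the kernel. -/

/-! ### Local operators on the torus -/

section LocalOperators

set_option linter.unusedSectionVars false

open Matrix

/-- The projector onto the orthogonal complement of the range of a matrix of full column rank. -/
noncomputable def complProj {α β : Type*} [Fintype α] [DecidableEq α] [Fintype β] [DecidableEq β]
    (B : Matrix α β ℂ) : Matrix α α ℂ := 1 - B * (Bᴴ * B)⁻¹ * Bᴴ

/-- A null vector of the Gram matrix is a null vector of `B` itself, because c* (B* B) c = ‖B c‖².
-/
theorem isUnit_det_conjTranspose_mul_self {α β : Type*} [Fintype α] [Fintype β] [DecidableEq β]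
    {B : Matrix α β ℂ} (hB : ∀ c, B *ᵥ c = 0 → c = 0) : IsUnit (Bᴴ * B).det := by
  rw [← Matrix.isUnit_iff_isUnit_det, ← Matrix.mulVec_injective_iff_isUnit]
  have : Function.Injective (Bᴴ * B).mulVecLin := by
    rw [← LinearMap.ker_eq_bot, LinearMap.ker_eq_bot']
    intro c hc
    exact hB c ((Matrix.conjTranspose_mul_self_mulVec_eq_zero B c).1 hc)
  exact this

theorem complProj_spec {α β : Type*} [Fintype α] [DecidableEq α] [Fintype β] [DecidableEq β]
    {B : Matrix α β ℂ} (hB : ∀ c, B *ᵥ c = 0 → c = 0) :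
    IsOrthProj (complProj B) ∧ ∀ u, complProj B *ᵥ u = 0 ↔ ∃ c, u = B *ᵥ c := by
  have hu := isUnit_det_conjTranspose_mul_self hB
  have hs : (Bᴴ * B)⁻¹ᴴ = (Bᴴ * B)⁻¹ := by
    rw [conjTranspose_nonsing_inv, conjTranspose_mul, conjTranspose_conjTranspose]
  have hBB : B * (Bᴴ * B)⁻¹ * Bᴴ * (B * (Bᴴ * B)⁻¹ * Bᴴ) = B * (Bᴴ * B)⁻¹ * Bᴴ := by
    calc B * (Bᴴ * B)⁻¹ * Bᴴ * (B * (Bᴴ * B)⁻¹ * Bᴴ)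
        = B * ((Bᴴ * B)⁻¹ * (Bᴴ * B)) * (Bᴴ * B)⁻¹ * Bᴴ := by simp only [Matrix.mul_assoc]
      _ = _ := by rw [nonsing_inv_mul _ hu, Matrix.mul_one]
  refine ⟨⟨?_, ?_⟩, fun u => ⟨fun h => ⟨((Bᴴ * B)⁻¹ * Bᴴ) *ᵥ u, ?_⟩, ?_⟩⟩
  · simp only [complProj, IsHermitian, conjTranspose_sub, conjTranspose_one, conjTranspose_mul,
      conjTranspose_conjTranspose, hs, Matrix.mul_assoc]
  · simp only [complProj, sub_mul, mul_sub, Matrix.one_mul, Matrix.mul_one, hBB, sub_self, sub_zero]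
  · rw [complProj, sub_mulVec, one_mulVec, sub_eq_zero] at h
    rw [mulVec_mulVec, ← Matrix.mul_assoc]; exact h
  · rintro ⟨c, rfl⟩
    rw [complProj, sub_mulVec, one_mulVec, mulVec_mulVec, Matrix.mul_assoc, Matrix.mul_assoc,
      nonsing_inv_mul _ hu, Matrix.mul_one, sub_self]

/-- Every subspace is the range of a matrix of full column rank. -/
theorem exists_columnMatrix {α : Type*} [Fintype α] (K : Submodule ℂ (α → ℂ)) :
    ∃ (m : ℕ) (B : Matrix α (Fin m) ℂ), (∀ c, B *ᵥ c = 0 → c = 0) ∧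
      ∀ u, u ∈ K ↔ ∃ c, u = B *ᵥ c := by
  let b := Module.finBasis ℂ K
  have key : ∀ c : Fin (Module.finrank ℂ K) → ℂ,
      (Matrix.of fun a j => (b j : α → ℂ) a) *ᵥ c = ((∑ j, c j • b j : K) : α → ℂ) := by
    intro c
    ext a
    simp [Matrix.mulVec, dotProduct, mul_comm]
  refine ⟨_, Matrix.of fun a j => (b j : α → ℂ) a, fun c hc => ?_, fun u => ⟨fun hu => ?_, ?_⟩⟩
  · rw [key] at hc
    have h0 : (∑ j, c j • b j : K) = 0 := Subtype.ext hc
    exact funext fun j => Fintype.linearIndependent_iff.1 b.linearIndependent c h0 j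
  · refine ⟨b.repr ⟨u, hu⟩, ?_⟩
    rw [key, b.sum_repr]
  · rintro ⟨c, rfl⟩
    rw [key]; exact Subtype.coe_prop _

theorem exists_orthProj {α : Type*} [Fintype α] [DecidableEq α] (K : Submodule ℂ (α → ℂ)) :
    ∃ h : Matrix α α ℂ, IsOrthProj h ∧ ∀ u, h *ᵥ u = 0 ↔ u ∈ K := by
  obtain ⟨m, B, hB, hK⟩ := exists_columnMatrix K
  exact ⟨complProj B, (complProj_spec hB).1, fun u => ((complProj_spec hB).2 u).trans (hK u).symm⟩

theorem IsOrthProj.conjTranspose_mul_self {α : Type*} [Fintype α] {h : Matrix α α ℂ}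
    (hh : IsOrthProj h) : hᴴ * h = h := by rw [hh.1.eq, hh.2]

/-- Frustration-freeness: the expectation values in `x` are nonnegative with sum zero, so each
vanishes, and a positive semidefinite matrix annihilates a vector of zero expectation. -/
theorem sum_mulVec_eq_zero_iff {α ι : Type*} [Fintype α] [DecidableEq α] (s : Finset ι)
    (M : ι → Matrix α α ℂ) (hM : ∀ i ∈ s, (M i).PosSemidef) (x : α → ℂ) :
    (∑ i ∈ s, M i) *ᵥ x = 0 ↔ ∀ i ∈ s, M i *ᵥ x = 0 := by
  constructor
  · intro h i hi
    rw [← (hM i hi).dotProduct_mulVec_zero_iff]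
    have h0 : ∑ i ∈ s, star x ⬝ᵥ (M i *ᵥ x) = 0 := by
      rw [← dotProduct_sum, ← sum_mulVec, h, dotProduct_zero]
    exact (Finset.sum_eq_zero_iff_of_nonneg
      (fun i hi => (hM i hi).dotProduct_mulVec_nonneg x)).1 h0 i hi
  · intro h
    rw [sum_mulVec, Finset.sum_eq_zero h]

variable {σ : Type} {L₁ L₂ : ℕ}

/-- The region `R` is embedded in the torus when it is placed at `p`. -/
def Embeds (p : ZMod L₁ × ZMod L₂) (R : Finset KSite) : Prop := Set.InjOn (wrap p) (R : Set KSite)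

open Classical in
/-- The configuration that is `ρ` on the region `R` placed at `p`, and `φ` elsewhere. -/
noncomputable def patch (φ : Site L₁ L₂ → σ) (p : ZMod L₁ × ZMod L₂) (R : Finset KSite)
    (ρ : R → σ) : Site L₁ L₂ → σ :=
  fun x => if h : ∃ r : R, wrap p r.1 = x then ρ h.choose else φ x

theorem patch_wrap {p : ZMod L₁ × ZMod L₂} {R : Finset KSite} (hR : Embeds p R)
    (φ : Site L₁ L₂ → σ) (ρ : R → σ) (r : R) : patch φ p R ρ (wrap p r.1) = ρ r := by
  have h : ∃ r' : R, wrap p r'.1 = wrap p r.1 := ⟨r, rfl⟩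
  rw [patch, dif_pos h]
  exact congrArg ρ (Subtype.ext (hR h.choose.2 r.2 h.choose_spec))

theorem patch_of_ne {p : ZMod L₁ × ZMod L₂} {R : Finset KSite}
    (φ : Site L₁ L₂ → σ) (ρ : R → σ) {x : Site L₁ L₂} (hx : ∀ r ∈ R, x ≠ wrap p r) :
    patch φ p R ρ x = φ x := by
  rw [patch, dif_neg]
  rintro ⟨r, hr⟩
  exact hx r.1 r.2 hr.symm

theorem eq_patch_iff {p : ZMod L₁ × ZMod L₂} {R : Finset KSite} (hR : Embeds p R)
    (φ φ' : Site L₁ L₂ → σ) (ρ : R → σ) :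
    φ' = patch φ p R ρ ↔ (∀ r : R, φ' (wrap p r.1) = ρ r) ∧
      ∀ x, (∀ r ∈ R, x ≠ wrap p r) → φ' x = φ x := by
  constructor
  · rintro rfl
    exact ⟨fun r => patch_wrap hR φ ρ r, fun x hx => patch_of_ne φ ρ hx⟩
  · rintro ⟨h1, h2⟩
    funext x
    by_cases hx : ∀ r ∈ R, x ≠ wrap p r
    · rw [patch_of_ne φ ρ hx, h2 x hx]
    · push Not at hx
      obtain ⟨r, hr, rfl⟩ := hx
      rw [patch_wrap hR φ ρ ⟨r, hr⟩, h1 ⟨r, hr⟩]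

theorem patch_patch {p : ZMod L₁ × ZMod L₂} {R : Finset KSite} (hR : Embeds p R)
    (φ : Site L₁ L₂ → σ) (ρ ρ' : R → σ) : patch (patch φ p R ρ) p R ρ' = patch φ p R ρ' := by
  rw [eq_patch_iff hR]
  exact ⟨fun r => patch_wrap hR _ ρ' r,
    fun x hx => (patch_of_ne _ ρ' hx).trans (patch_of_ne _ ρ hx)⟩

theorem patch_self {p : ZMod L₁ × ZMod L₂} {R : Finset KSite} (hR : Embeds p R)
    (φ : Site L₁ L₂ → σ) : patch φ p R (fun r => φ (wrap p r.1)) = φ :=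
  ((eq_patch_iff hR _ _ _).2 ⟨fun _ => rfl, fun _ _ => rfl⟩).symm

variable [Fintype σ] [DecidableEq σ] [NeZero L₁] [NeZero L₂]

/-- The reduction of operators on the torus to slices: with the surroundings fixed by `φ`, the wave
function becomes a vector on the region, on which `h` acts directly. -/
theorem place_mulVec {p : ZMod L₁ × ZMod L₂} {R : Finset KSite} (hR : Embeds p R)
    (h : Matrix (R → σ) (R → σ) ℂ) (ψ : (Site L₁ L₂ → σ) → ℂ) (φ : Site L₁ L₂ → σ) :
    (place L₁ L₂ R h p *ᵥ ψ) φ =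
      (h *ᵥ fun ρ => ψ (patch φ p R ρ)) (fun r => φ (wrap p r.1)) := by
  classical
  simp only [mulVec, dotProduct]
  symm
  refine Fintype.sum_of_injective (patch φ p R) ?_ _ _ ?_ ?_
  · intro ρ ρ' hρ
    funext r
    rw [← patch_wrap hR φ ρ r, hρ, patch_wrap hR φ ρ' r]
  · intro φ' hφ'
    rw [place, if_neg, zero_mul]
    intro hc
    refine hφ' ⟨fun r => φ' (wrap p r.1), ?_⟩
    exact ((eq_patch_iff hR _ _ _).2 ⟨fun _ => rfl, fun x hx => (hc x hx).symm⟩).symm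
  · intro ρ
    rw [place, if_pos fun x hx => (patch_of_ne φ ρ hx).symm]
    simp only [patch_wrap hR]

theorem place_mul {p : ZMod L₁ × ZMod L₂} {R : Finset KSite} (hR : Embeds p R)
    (h k : Matrix (R → σ) (R → σ) ℂ) :
    place L₁ L₂ R (h * k) p = place L₁ L₂ R h p * place L₁ L₂ R k p := by
  refine Matrix.ext_of_mulVec_single fun i => ?_
  rw [← mulVec_mulVec]
  funext φ
  rw [place_mulVec hR, place_mulVec hR, ← mulVec_mulVec]
  refine congrFun (congrArg (h *ᵥ ·) (funext fun ρ => ?_)) _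
  rw [place_mulVec hR]
  simp only [patch_wrap hR, patch_patch hR]

theorem place_conjTranspose (p : ZMod L₁ × ZMod L₂) (R : Finset KSite)
    (h : Matrix (R → σ) (R → σ) ℂ) :
    place L₁ L₂ R hᴴ p = (place L₁ L₂ R h p)ᴴ := by
  classical
  ext φ ψ
  simp only [place, conjTranspose_apply]
  by_cases hc : ∀ x, (∀ r ∈ R, x ≠ wrap p r) → φ x = ψ x
  · rw [if_pos hc, if_pos fun x hx => (hc x hx).symm]
  · rw [if_neg hc, if_neg fun h' => hc fun x hx => (h' x hx).symm, star_zero]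

theorem place_mulVec_eq_zero_iff {p : ZMod L₁ × ZMod L₂} {R : Finset KSite} (hR : Embeds p R)
    (h : Matrix (R → σ) (R → σ) ℂ) (ψ : (Site L₁ L₂ → σ) → ℂ) :
    place L₁ L₂ R h p *ᵥ ψ = 0 ↔ ∀ φ, (h *ᵥ fun ρ => ψ (patch φ p R ρ)) = 0 := by
  constructor
  · intro h0 φ
    funext ρ
    have := congrFun h0 (patch φ p R ρ)
    rw [place_mulVec hR] at this
    simp only [patch_wrap hR, patch_patch hR] at this
    exact this
  · intro h0
    funext φ
    rw [place_mulVec hR, h0 φ]; rfl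

/-- Ground spaces of Hamiltonians with local terms of the form `Bᴴ B`. -/
theorem hasGroundSpace_hamiltonian {n : ℕ} {R : Fin n → Finset KSite}
    (hR : ∀ k (p : ZMod L₁ × ZMod L₂), Embeds p (R k))
    {h B : ∀ k, Matrix (R k → σ) (R k → σ) ℂ} (hB : ∀ k, h k = (B k)ᴴ * B k)
    {G : Submodule ℂ ((Site L₁ L₂ → σ) → ℂ)}
    (hG : ∀ ψ, ψ ∈ G ↔ ∀ k (p : ZMod L₁ × ZMod L₂) φ,
      (B k *ᵥ fun ρ => ψ (patch φ p (R k) ρ)) = 0) :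
    HasGroundSpace (hamiltonian L₁ L₂ R h) G := by
  have hterm : ∀ k (p : ZMod L₁ × ZMod L₂), (place L₁ L₂ (R k) (h k) p).PosSemidef := by
    intro k p
    rw [hB, place_mul (hR k p), place_conjTranspose]
    exact posSemidef_conjTranspose_mul_self _
  have hsum : ∀ k, (∑ p : ZMod L₁ × ZMod L₂, place L₁ L₂ (R k) (h k) p).PosSemidef :=
    fun k => posSemidef_sum _ fun p _ => hterm k p
  refine ⟨posSemidef_sum _ fun k _ => hsum k, ?_⟩
  ext ψ
  rw [LinearMap.mem_ker, mulVecLin_apply, hG, hamiltonian,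
    sum_mulVec_eq_zero_iff _ _ fun k _ => hsum k]
  refine forall_congr' fun k => ?_
  rw [sum_mulVec_eq_zero_iff _ _ fun p _ => hterm k p]
  simp only [Finset.mem_univ, true_imp_iff]
  refine forall_congr' fun p => ?_
  rw [← place_mulVec_eq_zero_iff (hR k p), hB, place_mul (hR k p), place_conjTranspose]
  exact Matrix.conjTranspose_mul_self_mulVec_eq_zero _ _

end LocalOperators

/-! ### Limits of polynomial families of subspaces -/

section SmoothFamilies

open Matrix Polynomial

theorem updateCol_mulVec_eq {α β R : Type*} [Fintype β] [DecidableEq β] [CommRing R]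
    (M : Matrix α β R) (j : β) (w : α → R) (c : β → R) :
    M.updateCol j w *ᵥ c = M *ᵥ Function.update c j 0 + c j • w := by
  funext a
  simp only [mulVec, dotProduct, Pi.add_apply, Pi.smul_apply, smul_eq_mul]
  rw [← Finset.add_sum_erase _ _ (Finset.mem_univ j), ← Finset.add_sum_erase (a := j) _ _ (Finset.mem_univ j)]
  have : ∀ i ∈ Finset.univ.erase j, M.updateCol j w a i * c i = M a i * Function.update c j 0 i := by
    intro i hi
    have hij := Finset.ne_of_mem_erase hi
    rw [updateCol_ne hij, Function.update_of_ne hij]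
  rw [Finset.sum_congr rfl this]
  simp; ring

/-- A polynomial family of subspaces whose dimension drops at most at `1` can be continued to `1`
without a drop of the dimension. -/
theorem exists_saturation {α : Type*} [Fintype α] {m : ℕ} (L : Matrix (Fin m) α ℂ) :
    ∀ (n : ℕ) (V : Matrix α (Fin m) ℂ[X]), (L.map C * V).det ≠ 0 → (L.map C * V).det.natDegree = n →
      (∀ z : ℂ, z ≠ 1 → ∀ c, V.map (eval z) *ᵥ c = 0 → c = 0) →
      ∃ W : Matrix α (Fin m) ℂ[X], (∀ z : ℂ, ∀ c, W.map (eval z) *ᵥ c = 0 → c = 0) ∧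
        ∀ z : ℂ, z ≠ 1 → ∀ u, (∃ c, u = V.map (eval z) *ᵥ c) ↔ ∃ c, u = W.map (eval z) *ᵥ c := by
  intro n
  -- The degree of the minor det(L V) measures how often a factor X - 1 can still be divided out, so
  -- the process terminates.
  induction n using Nat.strong_induction_on with
  | _ n ih =>
  intro V hV hn hinj
  by_cases h1 : ∀ c, V.map (eval 1) *ᵥ c = 0 → c = 0
  · refine ⟨V, fun z c hc => ?_, fun z _ u => Iff.rfl⟩
    by_cases hz : z = 1
    · subst hz; exact h1 c hc
    · exact hinj z hz c hc
  push Not at h1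
  obtain ⟨c, hc, hc0⟩ := h1
  obtain ⟨j, hj⟩ := Function.ne_iff.1 hc0
  -- The combination of columns with coefficients `c` vanishes at 1, hence is divisible by X - 1;
  -- the quotient `w` will replace a column `j` with `c j ≠ 0`.
  have hdvd : ∀ a, ∃ w : ℂ[X], ∑ i, C (c i) * V a i = (X - C 1) * w := by
    intro a
    have := congrFun hc a
    simp only [mulVec, dotProduct, map_apply, Pi.zero_apply] at this
    refine dvd_iff_isRoot.2 ?_
    rw [IsRoot, eval_finsetSum, ← this]
    exact Finset.sum_congr rfl fun i _ => by rw [eval_mul, eval_C, mul_comm]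
  choose w hw using hdvd
  have hwz : ∀ z : ℂ, V.map (eval z) *ᵥ c = (z - 1) • fun a => (w a).eval z := by
    intro z
    funext a
    have := congrArg (eval z) (hw a)
    rw [eval_finsetSum] at this
    simp only [mulVec, dotProduct, map_apply, Pi.smul_apply, smul_eq_mul]
    rw [eval_mul, eval_sub, eval_X, eval_C] at this
    rw [← this]
    exact Finset.sum_congr rfl fun i _ => by rw [eval_mul, eval_C, mul_comm]
  have hV'z : ∀ z, (V.updateCol j w).map (eval z) =
      (V.map (eval z)).updateCol j fun a => (w a).eval z := by
    intro z
    ext a i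
    by_cases hij : i = j
    · subst hij; simp
    · simp [hij]
  have hLV : L.map C * V.updateCol j w = (L.map C * V).updateCol j (L.map C *ᵥ w) := by
    ext a i
    by_cases hij : i = j
    · subst hij; simp [Matrix.mul_apply, mulVec, dotProduct]
    · simp [Matrix.mul_apply, hij]
  -- Replacing column `j` by V c multiplies the determinant by `c j`; as V c = (X - 1) w, exactly
  -- one factor X - 1 splits off.
  have hdet : C (c j) * (L.map C * V).det = (X - C 1) * (L.map C * V.updateCol j w).det := by
    rw [hLV, ← det_updateCol_smul, ← smul_eq_mul, ← det_updateCol_sum (L.map C * V) j fun i => C (c i)]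
    congr 2
    funext a
    simp only [Matrix.mul_apply, mulVec, dotProduct, Pi.smul_apply, smul_eq_mul, Finset.mul_sum]
    rw [Finset.sum_comm]
    refine Finset.sum_congr rfl fun b _ => ?_
    rw [mul_left_comm, ← hw b, Finset.mul_sum]
    exact Finset.sum_congr rfl fun i _ => by ring
  have hCc : C (c j) ≠ 0 := C_ne_zero.2 hj
  have hV' : (L.map C * V.updateCol j w).det ≠ 0 := by
    intro h0
    rw [h0, mul_zero] at hdet
    exact mul_ne_zero hCc hV hdet
  have hdeg : (L.map C * V.updateCol j w).det.natDegree < n := by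
    have := congrArg natDegree hdet
    rw [natDegree_mul hCc hV, natDegree_C, natDegree_mul (X_sub_C_ne_zero 1) hV', natDegree_X_sub_C,
      hn] at this
    omega
  -- Away from 1 the span of the columns is unchanged, since there w(z) = V(z) c / (z - 1).
  have hback : ∀ z : ℂ, z ≠ 1 → ∀ d, (V.updateCol j w).map (eval z) *ᵥ d =
      V.map (eval z) *ᵥ (Function.update d j 0 + (d j / (z - 1)) • c) := by
    intro z hz d
    have hz' : z - 1 ≠ 0 := sub_ne_zero.2 hz
    rw [hV'z, updateCol_mulVec_eq, mulVec_add, mulVec_smul, hwz, smul_smul, div_mul_cancel₀ _ hz']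
  obtain ⟨W, hW1, hW2⟩ := ih _ hdeg _ hV' rfl (by
    intro z hz d hd
    have hz' : z - 1 ≠ 0 := sub_ne_zero.2 hz
    rw [hback z hz] at hd
    have h0 := hinj z hz _ hd
    have hdj : d j = 0 := by
      have := congrFun h0 j
      have hj' : c j ≠ 0 := hj
      simpa [hj', hz'] using this
    rw [hdj, zero_div, zero_smul, add_zero] at h0
    rw [← h0, ← hdj, Function.update_eq_self])
  refine ⟨W, hW1, fun z hz u => Iff.trans ⟨?_, ?_⟩ (hW2 z hz u)⟩
  · rintro ⟨d, rfl⟩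
    have hz' : z - 1 ≠ 0 := sub_ne_zero.2 hz
    refine ⟨Function.update (d - (d j / c j) • c) j ((z - 1) * (d j / c j)), ?_⟩
    rw [hback z hz, Function.update_self, Function.update_idem, mul_div_cancel_left₀ _ hz']
    have : Function.update (d - (d j / c j) • c) j 0 = d - (d j / c j) • c := by
      rw [Function.update_eq_self_iff]
      have hj' : c j ≠ 0 := hj
      simp [hj']
    rw [this, sub_add_cancel]
  · rintro ⟨d, rfl⟩
    exact ⟨_, hback z hz d⟩

theorem contDiffOn_det {s : Set ℝ} {β : Type*} [Fintype β] [DecidableEq β]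
    {B : ℝ → Matrix β β ℂ} (hB : ∀ a b, ContDiffOn ℝ ∞ (fun θ => B θ a b) s) :
    ContDiffOn ℝ ∞ (fun θ => (B θ).det) s := by
  simp only [det_apply']
  refine ContDiffOn.sum fun τ _ => contDiffOn_const.mul ?_
  exact contDiffOn_prod fun i _ => hB _ _

theorem contDiffOn_mul_matrix {s : Set ℝ} {α β γ : Type*} [Fintype β]
    {A : ℝ → Matrix α β ℂ} {B : ℝ → Matrix β γ ℂ}
    (hA : ∀ a b, ContDiffOn ℝ ∞ (fun θ => A θ a b) s)
    (hB : ∀ a b, ContDiffOn ℝ ∞ (fun θ => B θ a b) s) (a : α) (c : γ) :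
    ContDiffOn ℝ ∞ (fun θ => (A θ * B θ) a c) s := by
  simp only [Matrix.mul_apply]
  exact ContDiffOn.sum fun b _ => (hA a b).mul (hB b c)

theorem contDiffOn_conjTranspose {s : Set ℝ} {α β : Type*}
    {A : ℝ → Matrix α β ℂ} (hA : ∀ a b, ContDiffOn ℝ ∞ (fun θ => A θ a b) s) (b : β) (a : α) :
    ContDiffOn ℝ ∞ (fun θ => (A θ)ᴴ b a) s := by
  simp only [conjTranspose_apply]
  exact Complex.conjCLE.contDiff.comp_contDiffOn (hA a b)

theorem contDiffOn_complProj {s : Set ℝ} {α β : Type*} [Fintype α] [DecidableEq α] [Fintype β]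
    [DecidableEq β] {B : ℝ → Matrix α β ℂ} (hB : ∀ a b, ContDiffOn ℝ ∞ (fun θ => B θ a b) s)
    (hinj : ∀ θ ∈ s, ∀ c, B θ *ᵥ c = 0 → c = 0) (a a' : α) :
    ContDiffOn ℝ ∞ (fun θ => complProj (B θ) a a') s := by
  have hG := contDiffOn_mul_matrix (contDiffOn_conjTranspose hB) hB
  have hinv : ∀ b b', ContDiffOn ℝ ∞ (fun θ => ((B θ)ᴴ * B θ)⁻¹ b b') s := by
    intro b b'
    -- Cramer's rule: the entries of the inverse are determinants of smooth entries divided by a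
    -- determinant without zeros.
    simp only [inv_def, Ring.inverse_eq_inv', Matrix.smul_apply, smul_eq_mul, adjugate_apply]
    refine ContDiffOn.mul (ContDiffOn.inv (contDiffOn_det hG) fun θ hθ =>
      (isUnit_det_conjTranspose_mul_self (hinj θ hθ)).ne_zero) (contDiffOn_det fun i k => ?_)
    by_cases hi : i = b'
    · subst hi; simp only [updateRow_self]; exact contDiffOn_const
    · simp only [updateRow_ne hi]; exact hG i k
  simp only [complProj, Matrix.sub_apply]
  exact contDiffOn_const.sub (contDiffOn_mul_matrix (contDiffOn_mul_matrix hB hinv)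
    (contDiffOn_conjTranspose hB) a a')

/-- The orthogonal complements of the images of a subspace under a polynomial family of invertible
operators have projectors that depend smoothly on the parameter, also where the operators cease
to be invertible. -/
theorem exists_smooth_projectors {α : Type*} [Fintype α] [DecidableEq α] (K : Submodule ℂ (α → ℂ))
    (M : Matrix α α ℂ[X]) (hM0 : M.map (eval 0) = 1)
    (hM : ∀ z : ℂ, z ≠ 1 → ∀ u, M.map (eval z) *ᵥ u = 0 → u = 0) :
    ∃ g : ℝ → Matrix α α ℂ, (∀ θ, IsOrthProj (g θ)) ∧
      (∀ a b, ContDiff ℝ ∞ fun θ => g θ a b) ∧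
      ∀ θ : ℝ, θ ≠ 1 → ∀ u, g θ *ᵥ u = 0 ↔ ∃ k ∈ K, u = M.map (eval (θ : ℂ)) *ᵥ k := by
  obtain ⟨m, B, hB, hK⟩ := exists_columnMatrix K
  have hVz : ∀ z : ℂ, (M * B.map C).map (eval z) = M.map (eval z) * B := by
    intro z
    ext a b
    simp [Matrix.mul_apply, eval_finsetSum]
  -- The auxiliary matrix is a left inverse of `B`. At z = 0 the family is `B` itself, so the minor
  -- has the value 1 there and is not the zero polynomial.
  obtain ⟨W, hW1, hW2⟩ := exists_saturation ((Bᴴ * B)⁻¹ * Bᴴ) _ (M * B.map C) (by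
      intro h0
      have h1 := congrArg (eval 0) h0
      rw [← coe_evalRingHom, RingHom.map_det, RingHom.mapMatrix_apply, Matrix.map_mul] at h1
      have h2 : (((Bᴴ * B)⁻¹ * Bᴴ).map C).map (evalRingHom (0 : ℂ)) = (Bᴴ * B)⁻¹ * Bᴴ := by
        ext a b; rw [map_apply, map_apply, coe_evalRingHom, eval_C]
      have h3 : (M * B.map C).map (evalRingHom (0 : ℂ)) = B := by
        rw [coe_evalRingHom, hVz, hM0, Matrix.one_mul]
      rw [h2, h3, Matrix.mul_assoc, nonsing_inv_mul _ (isUnit_det_conjTranspose_mul_self hB),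
        det_one] at h1
      simp at h1) rfl (by
      intro z hz c hc
      rw [hVz, ← mulVec_mulVec] at hc
      exact hB c (hM z hz _ hc))
  refine ⟨fun θ => complProj (W.map (eval (θ : ℂ))), fun θ => (complProj_spec (hW1 θ)).1,
    fun a b => ?_, fun θ hθ u => ?_⟩
  · rw [← contDiffOn_univ]
    refine contDiffOn_complProj (fun a b => ?_) (fun θ _ => hW1 θ) a b
    rw [contDiffOn_univ]
    have h : ContDiff ℂ ∞ fun z => (W a b).eval z := by
      simpa using (W a b).contDiff_aeval (𝕜 := ℂ) ∞
    exact (h.restrict_scalars ℝ).comp Complex.ofRealCLM.contDiff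
  · rw [(complProj_spec (hW1 θ)).2 u, ← hW2 θ (by exact_mod_cast hθ) u, hVz]
    constructor
    · rintro ⟨c, rfl⟩
      exact ⟨_, (hK _).2 ⟨c, rfl⟩, by rw [mulVec_mulVec]⟩
    · rintro ⟨k, hk, rfl⟩
      obtain ⟨c, rfl⟩ := (hK k).1 hk
      exact ⟨c, by rw [mulVec_mulVec]⟩

end SmoothFamilies

/-! ### Recolouring games on the triangular lattice

The loop variables are differences of a height function with values in `ℤ₃` on the triangular
lattice; no triangle is monochromatic. In oblique coordinates the neighbours of `(m, n)` are
`(m ± 1, n)`, `(m, n ± 1)` and `(m ± 1, n ∓ 1)`. -/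

section Recolouring

/-- The colour `c` does not occur at two consecutive neighbours of `(m, n)`. -/
def RingFree (H : ℤ → ℤ → ZMod 3) (m n : ℤ) (c : ZMod 3) : Prop :=
  ¬(H (m + 1) n = c ∧ H m (n + 1) = c) ∧ ¬(H m (n + 1) = c ∧ H (m - 1) (n + 1) = c) ∧
  ¬(H (m - 1) (n + 1) = c ∧ H (m - 1) n = c) ∧ ¬(H (m - 1) n = c ∧ H m (n - 1) = c) ∧
  ¬(H m (n - 1) = c ∧ H (m + 1) (n - 1) = c) ∧ ¬(H (m + 1) (n - 1) = c ∧ H (m + 1) n = c)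

/-- A family of pairs of a height function and an energy that is closed under recolourings, where
the energy counts monochromatic bonds in the first direction and is bounded below by `E₀`. -/
structure RecolouringGame (S : (ℤ → ℤ → ZMod 3) → ℤ → Prop) (E₀ : ℤ) : Prop where
  bound : ∀ H E, S H E → E₀ ≤ E
  move : ∀ H E, S H E → ∀ m n c, RingFree H m n c → ∃ H' E', S H' E' ∧
    -- Only a window is controlled, because on a torus all translates of the point are recoloured
    -- together.
    (∀ i j, |i - m| ≤ 6 → |j - n| ≤ 6 → H' i j = if i = m ∧ j = n then c else H i j) ∧
    E' = E + ((if c = H (m + 1) n then 1 else 0) + (if c = H (m - 1) n then 1 else 0)) -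
      ((if H m n = H (m + 1) n then 1 else 0) + (if H m n = H (m - 1) n then 1 else 0))

variable {S : (ℤ → ℤ → ZMod 3) → ℤ → Prop} {E₀ : ℤ} {H : ℤ → ℤ → ZMod 3}

/-- The right end of a monochromatic row segment, with two vertices of the third colour below. -/
def RightEndBlocked (H : ℤ → ℤ → ZMod 3) (m n : ℤ) : Prop :=
  H (m - 1) n = H m n ∧ H (m + 1) n ≠ H m n ∧ H m (n + 1) = H (m - 1) (n + 1) ∧
    H m (n + 1) ≠ H m n ∧ H m (n + 1) ≠ H (m + 1) n

theorem ZMod.eq_of_ne_ne {a b x y : ZMod 3} (hab : a ≠ b) (hx : x ≠ a) (hx' : x ≠ b)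
    (hy : y ≠ a) (hy' : y ≠ b) : x = y := by
  have : ∀ a b x y : Fin 3, a ≠ b → x ≠ a → x ≠ b → y ≠ a → y ≠ b → x = y := by decide
  exact this a b x y hab hx hx' hy hy'

theorem ZMod.exists_third (a b : ZMod 3) : ∃ c : ZMod 3, c ≠ a ∧ c ≠ b := by
  revert a b; decide

/-- Giving the end of the segment the third colour would remove a bond and create none, so at
minimal energy that colour must sit on two consecutive neighbours. The neighbours in the row have
the other two colours; this leaves the pair in row n + 1 or the pair in row n - 1. -/
theorem RecolouringGame.rightEnd (hS : RecolouringGame S E₀) (h : S H E₀) {m n : ℤ}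
    (h1 : H (m - 1) n = H m n) (h2 : H (m + 1) n ≠ H m n) :
    RightEndBlocked H m n ∨ (H m (n - 1) = H (m + 1) (n - 1) ∧ H m (n - 1) ≠ H m n ∧
      H m (n - 1) ≠ H (m + 1) n) := by
  by_contra hcon
  push Not at hcon
  obtain ⟨hc1, hc2⟩ := hcon
  obtain ⟨c, hca, hcz⟩ := ZMod.exists_third (H m n) (H (m + 1) n)
  have hring : RingFree H m n c := by
    unfold RightEndBlocked at hc1
    unfold RingFree
    grind
  obtain ⟨H', E', hS', -, hE⟩ := hS.move H E₀ h m n c hring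
  have := hS.bound _ _ hS'
  rw [h1, if_neg hcz, if_neg hca, if_neg h2.symm, if_pos rfl] at hE
  omega

/-- Recolouring the centre of three equal vertices would remove two bonds, so each of the other two
colours is blocked by a pair of neighbours in one of the adjacent rows. -/
theorem RecolouringGame.middle (hS : RecolouringGame S E₀) (h : S H E₀) {m n : ℤ}
    (h1 : H (m - 1) n = H m n) (h2 : H (m + 1) n = H m n) {c : ZMod 3} (hc : c ≠ H m n) :
    (H m (n + 1) = c ∧ H (m - 1) (n + 1) = c) ∨ (H m (n - 1) = c ∧ H (m + 1) (n - 1) = c) := by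
  by_contra hcon
  have hring : RingFree H m n c := by
    unfold RingFree
    grind
  obtain ⟨H', E', hS', -, hE⟩ := hS.move H E₀ h m n c hring
  have := hS.bound _ _ hS'
  rw [h1, h2, if_neg hc, if_pos rfl] at hE
  omega

/-- The blocking pair in row n + 1 is itself a monochromatic bond. Below it lie the vertices (m, n)
and (m + 1, n) of different colours, which cannot block anything, so everything that blocks (m, n +
1) comes from row n + 2. If the segment continued to the right, two colours would have to be blocked
by the same pair; hence it ends, and its end is blocked from row n + 2. -/
theorem RecolouringGame.rightEndBlocked_succ (hS : RecolouringGame S E₀) (h : S H E₀) {m n : ℤ}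
    (hb : RightEndBlocked H m n) : RightEndBlocked H m (n + 1) := by
  obtain ⟨h1, h2, h3, h4, h5⟩ := hb
  by_cases h6 : H (m + 1) (n + 1) = H m (n + 1)
  · have ha := hS.middle h h3.symm h6 h4.symm
    have hz := hS.middle h h3.symm h6 h5.symm
    rw [add_sub_cancel_right] at ha hz
    grind
  · have := hS.rightEnd h h3.symm h6
    rw [add_sub_cancel_right] at this
    grind

/-- If the colours in rows n + 1, n + 2, n + 3 of column m were all different, then (m, n + 2) could
take the colour of its right neighbour. This costs nothing, as one bond is lost and one is won, but
it destroys the pair that blocks (m, n + 1), whose recolouring then lowers the energy. -/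
theorem RecolouringGame.rightEndBlocked_period (hS : RecolouringGame S E₀) (h : S H E₀) {m n : ℤ}
    (hb : RightEndBlocked H m n) : H m (n + 1) = H m (n + 3) := by
  have hb1 := hS.rightEndBlocked_succ h hb
  have hb2 := hS.rightEndBlocked_succ h hb1
  unfold RightEndBlocked at hb hb1 hb2
  simp only [add_assoc, Int.reduceAdd] at hb1 hb2
  by_contra hne
  have hz := @ZMod.eq_of_ne_ne (H m (n + 2)) (H (m + 1) (n + 2)) (H m (n + 1)) (H m (n + 3))
  -- The colour of (m + 1, n + 2) is that of (m, n + 1) here, and it occurs on these two neighbours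
  -- only, which are not consecutive.
  have hring : RingFree H m (n + 2) (H (m + 1) (n + 2)) := by
    unfold RingFree
    simp only [add_assoc, Int.reduceAdd, add_sub_assoc, Int.reduceSub]
    grind
  obtain ⟨H', E', hS', hH', hE'⟩ := hS.move H E₀ h m (n + 2) _ hring
  have e1 := hH' m (n + 1) (by simp) (by simp)
  have e2 := hH' (m + 1) (n + 1) (by simp) (by simp)
  have e3 := hH' (m - 1) (n + 1) (by simp) (by simp)
  have e4 := hH' m (n + 2) (by simp) (by simp)
  have e5 := hH' (m - 1) (n + 2) (by simp) (by simp)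
  have e6 := hH' m n (by simp) (by simp)
  have e7 := hH' (m + 1) n (by simp) (by simp)
  simp at e1 e2 e3 e4 e5 e6 e7
  -- The old colour of (m, n + 2) is the third colour at the segment end (m, n + 1), now free.
  have hring' : RingFree H' m (n + 1) (H m (n + 2)) := by
    unfold RingFree
    simp only [add_assoc, Int.reduceAdd, add_sub_assoc, Int.reduceSub, add_zero, e2, e3, e4, e5, e6, e7]
    grind
  obtain ⟨H'', E'', hS'', -, hE''⟩ := hS.move H' E' hS' m (n + 1) _ hring'
  have := hS.bound _ _ hS''
  rw [e1, e2, e3] at hE''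
  rw [if_pos rfl, if_neg (by grind), if_neg (by grind), if_pos (by grind)] at hE'
  rw [if_neg (by grind), if_neg (by grind), if_neg (by grind), if_pos (by grind)] at hE''
  omega

/-- The pairs above and below the segment of row n + 1 have the same colour. If the left neighbour
of the segment did not have the remaining colour, its vertex (m - 1, n + 1) could take that colour
and lose a bond. So the segment consists of two vertices with the third colour on both sides. -/
theorem RecolouringGame.width_two (hS : RecolouringGame S E₀) (h : S H E₀) {m n : ℤ}
    (hb : RightEndBlocked H m n)
    (hper : H m n = H m (n + 2)) : H (m - 2) (n + 1) = H (m + 1) (n + 1) := by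
  have hb1 := hS.rightEndBlocked_succ h hb
  unfold RightEndBlocked at hb hb1
  simp only [add_assoc, Int.reduceAdd] at hb1
  by_contra hne
  have hz := @ZMod.eq_of_ne_ne (H m (n + 1)) (H m n) (H (m + 1) (n + 1)) (H (m - 2) (n + 1))
  have hring : RingFree H (m - 1) (n + 1) (H (m + 1) (n + 1)) := by
    unfold RingFree
    simp only [add_assoc, Int.reduceAdd, sub_sub, add_sub_assoc, sub_add_cancel, Int.reduceSub]
    grind
  obtain ⟨H', E', hS', -, hE⟩ := hS.move H E₀ h _ _ _ hring
  have := hS.bound _ _ hS'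
  simp only [sub_add_cancel, sub_sub, Int.reduceAdd] at hE
  rw [if_neg (by grind), if_neg (by grind), if_pos (by grind)] at hE
  split_ifs at hE <;> omega

-- Blocking propagates to a rigid strip: by the preceding lemmas, columns m - 1 and m carry the same
-- alternating colours a, b, while columns m - 2 and m + 1 carry the third colour z. A few moves
-- break the strip at a net loss of energy.
set_option maxHeartbeats 800000 in
theorem RecolouringGame.not_rightEndBlocked (hS : RecolouringGame S E₀) (h : S H E₀) (m n : ℤ) :
    ¬RightEndBlocked H m n := by
  intro hb
  have hb1 := hS.rightEndBlocked_succ h hb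
  have hb2 := hS.rightEndBlocked_succ h hb1
  have hb3 := hS.rightEndBlocked_succ h hb2
  have hb4 := hS.rightEndBlocked_succ h hb3
  have p1 := hS.rightEndBlocked_period h hb
  have p2 := hS.rightEndBlocked_period h hb1
  have p3 := hS.rightEndBlocked_period h hb2
  simp only [add_assoc, Int.reduceAdd] at hb1 hb2 hb3 hb4 p1 p2 p3
  have y2 := hS.width_two h hb1 (by simpa only [add_assoc, Int.reduceAdd] using p1)
  have y3 := hS.width_two h hb2 (by simpa only [add_assoc, Int.reduceAdd] using p2)
  have y4 := hS.width_two h hb3 (by simpa only [add_assoc, Int.reduceAdd] using p3)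
  unfold RightEndBlocked at hb1 hb2 hb3 hb4
  simp only [add_assoc, Int.reduceAdd] at hb1 hb2 hb3 hb4 y2 y3 y4
  have z2 := @ZMod.eq_of_ne_ne (H m (n + 2)) (H m (n + 3)) (H (m + 1) (n + 2)) (H (m + 1) (n + 3))
  have z3 := @ZMod.eq_of_ne_ne (H m (n + 2)) (H m (n + 3)) (H (m + 1) (n + 3)) (H (m + 1) (n + 4))
  have z1 := @ZMod.eq_of_ne_ne (H m (n + 2)) (H m (n + 3)) (H (m + 1) (n + 1)) (H (m + 1) (n + 2))
  -- Let a be the colour of the strip in row n + 2 and b that in row n + 3. The vertex (m - 1, n +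
  -- 3) cannot take the colour z because of column m - 2, so (m - 2, n + 3) has to give up z. If its
  -- two left neighbours exclude a, it takes b: this costs one bond, but (m - 1, n + 3) then loses
  -- two. Otherwise it takes a.
  by_cases hp : H (m - 3) (n + 3) = H m (n + 2) ∧ H (m - 3) (n + 4) = H m (n + 2)
  · have hring : RingFree H (m - 2) (n + 3) (H m (n + 3)) := by
      unfold RingFree
      simp only [add_assoc, Int.reduceAdd, sub_sub, add_sub_assoc, sub_add, Int.reduceSub]
      grind
    obtain ⟨H', E', hS', hH', hE'⟩ := hS.move H E₀ h _ _ _ hring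
    have e1 := hH' m (n + 3) (by simp) (by simp)
    have e2 := hH' (m - 1) (n + 4) (by simp) (by simp)
    have e3 := hH' (m - 2) (n + 4) (by simp) (by simp)
    have e4 := hH' (m - 2) (n + 3) (by simp) (by simp)
    have e5 := hH' (m - 1) (n + 2) (by simp) (by simp)
    have e6 := hH' m (n + 2) (by simp) (by simp)
    have e7 := hH' (m - 1) (n + 3) (by simp) (by simp)
    simp at e1 e2 e3 e4 e5 e6 e7
    have hring' : RingFree H' (m - 1) (n + 3) (H (m + 1) (n + 3)) := by
      unfold RingFree
      simp only [add_assoc, Int.reduceAdd, sub_sub, add_sub_assoc, sub_add_cancel, Int.reduceSub,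
        e1, e2, e3, e4, e5, e6]
      grind
    obtain ⟨H'', E'', hS'', -, hE''⟩ := hS.move H' E' hS' _ _ _ hring'
    have := hS.bound _ _ hS''
    simp only [sub_add_cancel, sub_sub, Int.reduceAdd, e1, e4, e7, sub_add, Int.reduceSub] at hE' hE''
    have hle : E'' ≤ E' - 2 := by
      clear hring hring' hE'
      split_ifs at hE'' <;> first | omega | (exfalso; grind)
    clear hring hring' hE''
    split_ifs at hE' <;> first | omega | (exfalso; grind)
  · have hring : RingFree H (m - 2) (n + 3) (H m (n + 2)) := by
      unfold RingFree
      simp only [add_assoc, Int.reduceAdd, sub_sub, add_sub_assoc, sub_add, Int.reduceSub]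
      grind
    obtain ⟨H', E', hS', hH', hE'⟩ := hS.move H E₀ h _ _ _ hring
    have e1 := hH' m (n + 3) (by simp) (by simp)
    have e2 := hH' (m - 1) (n + 4) (by simp) (by simp)
    have e3 := hH' (m - 2) (n + 4) (by simp) (by simp)
    have e4 := hH' (m - 2) (n + 3) (by simp) (by simp)
    have e5 := hH' (m - 1) (n + 2) (by simp) (by simp)
    have e6 := hH' m (n + 2) (by simp) (by simp)
    have e7 := hH' (m - 1) (n + 3) (by simp) (by simp)
    have e8 := hH' (m + 1) (n + 2) (by simp) (by simp)
    have e9 := hH' m (n + 1) (by simp) (by simp)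
    have e10 := hH' (m + 1) (n + 1) (by simp) (by simp)
    simp at e1 e2 e3 e4 e5 e6 e7 e8 e9 e10
    have hring' : RingFree H' (m - 1) (n + 3) (H (m + 1) (n + 3)) := by
      unfold RingFree
      simp only [add_assoc, Int.reduceAdd, sub_sub, add_sub_assoc, sub_add_cancel, Int.reduceSub,
        e1, e2, e3, e4, e5, e6]
      grind
    obtain ⟨H'', E'', hS'', hH'', hE''⟩ := hS.move H' E' hS' _ _ _ hring'
    simp only [sub_add_cancel, sub_sub, Int.reduceAdd, e1, e4, e7, sub_add, Int.reduceSub] at hE' hE''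
    have hle : E'' ≤ E' - 1 := by
      clear hring hring' hE'
      split_ifs at hE'' <;> first | omega | (exfalso; grind)
    clear hring hring' hE''
    have hb'' := hS.bound _ _ hS''
    -- The colour a costs a bond only if the left neighbour has it. In that case the energy is
    -- merely back at the minimum, but the blocking pair of (m, n + 2) in row n + 3 is gone, and
    -- recolouring this vertex with b wins the missing bond.
    by_cases hp2 : H m (n + 2) = H (m - 3) (n + 3)
    · have f1 := hH'' m (n + 3) (by simp) (by simp)
      have f2 := hH'' (m - 1) (n + 3) (by simp) (by simp)
      have f5 := hH'' (m - 1) (n + 2) (by simp) (by simp)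
      have f6 := hH'' m (n + 2) (by simp) (by simp)
      have f8 := hH'' (m + 1) (n + 2) (by simp) (by simp)
      have f9 := hH'' m (n + 1) (by simp) (by simp)
      have f10 := hH'' (m + 1) (n + 1) (by simp) (by simp)
      simp at f1 f2 f5 f6 f8 f9 f10
      have hring'' : RingFree H'' m (n + 2) (H m (n + 3)) := by
        unfold RingFree
        simp only [add_assoc, Int.reduceAdd, add_sub_assoc, Int.reduceSub,
          e1, e5, e8, e9, e10, f1, f2, f5, f8, f9, f10]
        grind
      obtain ⟨H3, E3, hS3, -, hE3⟩ := hS.move H'' E'' hS'' _ _ _ hring''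
      have := hS.bound _ _ hS3
      simp only [e5, e6, e8, f5, f6, f8] at hE3
      have hle : E'' ≤ E₀ := by
        clear hE3 hring''
        split_ifs at hE' <;> first | omega | (exfalso; grind)
      clear hE' hring''
      split_ifs at hE3 <;> first | omega | (exfalso; grind)
    · split_ifs at hE' <;> first | omega | (exfalso; grind)

end Recolouring

/-! ### Height functions of loop configurations on the torus -/

section Heights

set_option linter.unusedSectionVars false

/-- Height functions on the infinite triangular lattice that are periodic up to constants. -/
def Twisted (L₁ L₂ : ℕ) (α β : ZMod 3) (h : ℤ × ℤ → ZMod 3) : Prop :=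
  ∀ i j, h (i + L₁, j) = h (i, j) + α ∧ h (i, j + L₂) = h (i, j) + β

/-- No triangle is monochromatic. -/
def NoMono (h : ℤ × ℤ → ZMod 3) : Prop :=
  ∀ i j, ¬(h (i, j) = h (i + 1, j) ∧ h (i, j) = h (i, j + 1)) ∧
    ¬(h (i, j) = h (i, j + 1) ∧ h (i, j) = h (i - 1, j + 1))

/-- Change of the height at a point and all its translates. -/
def bump (L₁ L₂ : ℕ) (q : ℤ × ℤ) (δ : ZMod 3) (h : ℤ × ℤ → ZMod 3) : ℤ × ℤ → ZMod 3 :=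
  fun x => h x + if red L₁ L₂ x = red L₁ L₂ q then δ else 0

/-- Elementary moves between admissible height functions. -/
def HeightStep (L₁ L₂ : ℕ) (h h' : ℤ × ℤ → ZMod 3) : Prop :=
  NoMono h ∧ NoMono h' ∧ ∃ q δ, h' = bump L₁ L₂ q δ h

/-- Reachability by elementary moves. -/
def HeightReach (L₁ L₂ : ℕ) : (ℤ × ℤ → ZMod 3) → (ℤ × ℤ → ZMod 3) → Prop :=
  Relation.ReflTransGen (HeightStep L₁ L₂)

/-- No two horizontal neighbours have the same height. -/
def RowProper (h : ℤ × ℤ → ZMod 3) : Prop := ∀ i j, h (i + 1, j) ≠ h (i, j)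

/-- Height functions of the crystals. -/
def IsCrystalHeight (h : ℤ × ℤ → ZMod 3) : Prop :=
  ∃ a : Fin 3 → ZMod 3, Function.Injective a ∧ ∀ q d, h q - h (q + latVec d) = a d

/-- Every triangle contains a horizontal bond. -/
theorem RowProper.noMono {h : ℤ × ℤ → ZMod 3} (hh : RowProper h) : NoMono h := by
  intro i j
  refine ⟨fun hc => hh i j hc.1.symm, fun hc => ?_⟩
  have := hh (i - 1) (j + 1)
  rw [sub_add_cancel] at this
  exact this (hc.1.symm.trans hc.2)

variable {L₁ L₂ : ℕ} {α β : ZMod 3} {h : ℤ × ℤ → ZMod 3}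

theorem red_eq_iff {x y : ℤ × ℤ} :
    red L₁ L₂ x = red L₁ L₂ y ↔ (L₁ : ℤ) ∣ y.1 - x.1 ∧ (L₂ : ℤ) ∣ y.2 - x.2 := by
  simp only [red, Prod.mk.injEq, ZMod.intCast_eq_intCast_iff_dvd_sub]

theorem red_ne {i j a b : ℤ} (hab : (a ≠ 0 ∧ |a| < L₁) ∨ (b ≠ 0 ∧ |b| < L₂)) :
    red L₁ L₂ (i + a, j + b) ≠ red L₁ L₂ (i, j) := by
  rw [Ne, red_eq_iff]
  rintro ⟨h1, h2⟩
  simp only [sub_add_cancel_left, dvd_neg] at h1 h2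
  rcases hab with ⟨h0, hlt⟩ | ⟨h0, hlt⟩
  · exact h0 (Int.eq_zero_of_abs_lt_dvd h1 hlt)
  · exact h0 (Int.eq_zero_of_abs_lt_dvd h2 hlt)

theorem Twisted.add_mul (hh : Twisted L₁ L₂ α β h) (i j a b : ℤ) :
    h (i + L₁ * a, j + L₂ * b) = h (i, j) + α * a + β * b := by
  have h1 : ∀ a i j : ℤ, h (i + L₁ * a, j) = h (i, j) + α * a := by
    intro a
    induction a using Int.induction_on with
    | zero => intro i j; simp
    | succ n ih =>
      intro i j
      rw [show i + (L₁ : ℤ) * (n + 1) = i + L₁ * n + L₁ by ring, (hh _ _).1, ih]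
      push_cast; ring
    | pred n ih =>
      intro i j
      have := (hh (i + L₁ * (-n - 1)) j).1
      rw [show i + (L₁ : ℤ) * (-n - 1) + L₁ = i + L₁ * (-n) by ring, ih] at this
      rw [eq_sub_of_add_eq this.symm]
      push_cast; ring
  have h2 : ∀ b i j : ℤ, h (i, j + L₂ * b) = h (i, j) + β * b := by
    intro b
    induction b using Int.induction_on with
    | zero => intro i j; simp
    | succ n ih =>
      intro i j
      rw [show j + (L₂ : ℤ) * (n + 1) = j + L₂ * n + L₂ by ring, (hh _ _).2, ih]
      push_cast; ring
    | pred n ih =>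
      intro i j
      have := (hh i (j + L₂ * (-n - 1))).2
      rw [show j + (L₂ : ℤ) * (-n - 1) + L₂ = j + L₂ * (-n) by ring, ih] at this
      rw [eq_sub_of_add_eq this.symm]
      push_cast; ring
  rw [h2, h1]

/-- The twist constants cancel in height differences, which therefore live on the torus. -/
theorem Twisted.diff_eq (hh : Twisted L₁ L₂ α β h) {x y : ℤ × ℤ}
    (hxy : red L₁ L₂ x = red L₁ L₂ y) (v : ℤ × ℤ) : h (x + v) - h x = h (y + v) - h y := by
  obtain ⟨⟨a, ha⟩, ⟨b, hb⟩⟩ := red_eq_iff.1 hxy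
  obtain ⟨x1, x2⟩ := x
  obtain ⟨y1, y2⟩ := y
  obtain ⟨v1, v2⟩ := v
  simp only at ha hb
  obtain rfl : y1 = x1 + L₁ * a := by omega
  obtain rfl : y2 = x2 + L₂ * b := by omega
  simp only [Prod.mk_add_mk]
  rw [show x1 + (L₁ : ℤ) * a + v1 = x1 + v1 + L₁ * a by ring,
    show x2 + (L₂ : ℤ) * b + v2 = x2 + v2 + L₂ * b by ring, hh.add_mul, hh.add_mul]
  ring

theorem Twisted.bump (hh : Twisted L₁ L₂ α β h) (q : ℤ × ℤ) (δ : ZMod 3) :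
    Twisted L₁ L₂ α β (bump L₁ L₂ q δ h) := by
  intro i j
  have h1 : red L₁ L₂ (i + L₁, j) = red L₁ L₂ (i, j) := by rw [red_eq_iff]; simp
  have h2 : red L₁ L₂ (i, j + L₂) = red L₁ L₂ (i, j) := by rw [red_eq_iff]; simp
  simp only [_root_.bump, h1, h2, (hh i j).1, (hh i j).2]
  constructor <;> ring

theorem bump_self (q : ℤ × ℤ) (δ : ZMod 3) : bump L₁ L₂ q δ h q = h q + δ := by simp [bump]

theorem bump_of_ne {x q : ℤ × ℤ} (δ : ZMod 3) (hx : red L₁ L₂ x ≠ red L₁ L₂ q) :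
    bump L₁ L₂ q δ h x = h x := by simp [bump, hx]

theorem bump_near (hL₁ : 20 ≤ L₁) (hL₂ : 20 ≤ L₂) (δ : ZMod 3) {m n i j : ℤ} (hi : |i - m| ≤ 14)
    (hj : |j - n| ≤ 14) : bump L₁ L₂ (m, n) δ h (i, j) =
      if i = m ∧ j = n then h (m, n) + δ else h (i, j) := by
  split_ifs with hc
  · rw [hc.1, hc.2, bump_self]
  · refine bump_of_ne δ ?_
    have h0 := @red_ne L₁ L₂ m n (i - m) (j - n)
    rw [add_sub_cancel, add_sub_cancel] at h0
    refine h0 ?_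
    by_cases hm : i = m
    · exact Or.inr ⟨fun hn => hc ⟨hm, by omega⟩, by omega⟩
    · exact Or.inl ⟨by omega, by omega⟩

theorem bump_bump_neg (q : ℤ × ℤ) (δ : ZMod 3) : bump L₁ L₂ q (-δ) (bump L₁ L₂ q δ h) = h := by
  funext x
  simp only [bump]
  split_ifs <;> simp

/-- Only triangles at a translate of the recoloured point change. Differences at a translate equal
those at (m, n), so the six triangles there are controlled by the six conditions in `RingFree`; the
size of the torus ensures that neighbours are not translates as well. -/
theorem NoMono.bump (hL₁ : 20 ≤ L₁) (hL₂ : 20 ≤ L₂) (hh : Twisted L₁ L₂ α β h) (hm : NoMono h)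
    {m n : ℤ} {c : ZMod 3} (hc : RingFree (fun i j => h (i, j)) m n c) :
    NoMono (bump L₁ L₂ (m, n) (c - h (m, n)) h) := by
  have key : ∀ i j a b a' b' : ℤ, red L₁ L₂ (i, j) = red L₁ L₂ (m, n) →
      ((a ≠ 0 ∧ |a| < L₁) ∨ (b ≠ 0 ∧ |b| < L₂)) → ((a' ≠ 0 ∧ |a'| < L₁) ∨ (b' ≠ 0 ∧ |b'| < L₂)) →
      ¬(h (m + a, n + b) = c ∧ h (m + a', n + b') = c) →
      ¬(_root_.bump L₁ L₂ (m, n) (c - h (m, n)) h (i, j) =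
          _root_.bump L₁ L₂ (m, n) (c - h (m, n)) h (i + a, j + b) ∧
        _root_.bump L₁ L₂ (m, n) (c - h (m, n)) h (i, j) =
          _root_.bump L₁ L₂ (m, n) (c - h (m, n)) h (i + a', j + b')) := by
    intro i j a b a' b' hr hab hab' hno ⟨e1, e2⟩
    have d1 := hh.diff_eq hr (a, b)
    have d2 := hh.diff_eq hr (a', b')
    simp only [Prod.mk_add_mk] at d1 d2
    rw [bump_of_ne (x := (i + a, j + b)) _ (by rw [← hr]; exact red_ne hab)] at e1
    rw [bump_of_ne (x := (i + a', j + b')) _ (by rw [← hr]; exact red_ne hab')] at e2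
    simp only [_root_.bump, if_pos hr] at e1 e2
    refine hno ⟨?_, ?_⟩
    · linear_combination -d1 - e1
    · linear_combination -d2 - e2
  have hone : ∀ {L : ℕ}, 20 ≤ L → ((1 : ℤ) < L) := fun h => by omega
  have h1 := hone hL₁
  have h2 := hone hL₂
  obtain ⟨c1, c2, c3, c4, c5, c6⟩ := hc
  simp only [sub_eq_add_neg] at c1 c2 c3 c4 c5 c6
  intro i j
  constructor
  · by_cases r1 : red L₁ L₂ (i, j) = red L₁ L₂ (m, n)
    · simpa using key i j 1 0 0 1 r1 (by simp [h1]) (by simp [h2]) (by simpa using c1)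
    by_cases r2 : red L₁ L₂ (i + 1, j) = red L₁ L₂ (m, n)
    · have := key (i + 1) j (-1) 0 (-1) 1 r2 (by simp [h1]) (by simp [h1])
        (by simpa [and_comm] using c3)
      rintro ⟨e1, e2⟩
      refine this ⟨?_, ?_⟩
      · simpa using e1.symm
      · simpa using e1.symm.trans e2
    by_cases r3 : red L₁ L₂ (i, j + 1) = red L₁ L₂ (m, n)
    · have := key i (j + 1) 0 (-1) 1 (-1) r3 (by simp [h2]) (by simp [h2])
        (by simpa using c5)
      rintro ⟨e1, e2⟩
      refine this ⟨?_, ?_⟩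
      · simpa using e2.symm
      · simpa using e2.symm.trans e1
    rw [bump_of_ne _ r1, bump_of_ne _ r2, bump_of_ne _ r3]
    exact (hm i j).1
  · by_cases r1 : red L₁ L₂ (i, j) = red L₁ L₂ (m, n)
    · simpa [sub_eq_add_neg] using
        key i j 0 1 (-1) 1 r1 (by simp [h2]) (by simp [h1]) (by simpa using c2)
    by_cases r2 : red L₁ L₂ (i, j + 1) = red L₁ L₂ (m, n)
    · have := key i (j + 1) 0 (-1) (-1) 0 r2 (by simp [h2]) (by simp [h1])
        (by simpa [and_comm] using c4)
      rintro ⟨e1, e2⟩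
      refine this ⟨?_, ?_⟩
      · simpa using e1.symm
      · simpa [sub_eq_add_neg] using e1.symm.trans e2
    by_cases r3 : red L₁ L₂ (i - 1, j + 1) = red L₁ L₂ (m, n)
    · have := key (i - 1) (j + 1) 1 (-1) 1 0 r3 (by simp [h1]) (by simp [h1])
        (by simpa using c6)
      rintro ⟨e1, e2⟩
      refine this ⟨?_, ?_⟩
      · simpa using e2.symm
      · simpa using e2.symm.trans e1
    rw [bump_of_ne _ r1, bump_of_ne _ r2, bump_of_ne _ r3]
    exact (hm i j).2

end Heights

/-! ### Minimal row energy: rows without monochromatic bonds, or crystals -/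

section Heights

set_option linter.unusedSectionVars false

variable {L₁ L₂ : ℕ} {α β : ZMod 3} {h h' : ℤ × ℤ → ZMod 3}

theorem HeightStep.symm (hs : HeightStep L₁ L₂ h h') : HeightStep L₁ L₂ h' h := by
  obtain ⟨h1, h2, q, δ, rfl⟩ := hs
  exact ⟨h2, h1, q, -δ, (bump_bump_neg q δ).symm⟩

theorem HeightReach.symm (hr : HeightReach L₁ L₂ h h') : HeightReach L₁ L₂ h' h := by
  induction hr with
  | refl => exact Relation.ReflTransGen.refl
  | tail _ hs ih => exact Relation.ReflTransGen.head hs.symm ih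

theorem HeightReach.twisted (hr : HeightReach L₁ L₂ h h') (hh : Twisted L₁ L₂ α β h) :
    Twisted L₁ L₂ α β h' := by
  induction hr with
  | refl => exact hh
  | tail _ hs ih =>
    obtain ⟨-, -, q, δ, rfl⟩ := hs
    exact ih.bump q δ

theorem HeightReach.noMono (hr : HeightReach L₁ L₂ h h') (hh : NoMono h) : NoMono h' := by
  induction hr with
  | refl => exact hh
  | tail _ hs _ => exact hs.2.1

theorem heightReach_bump (hL₁ : 20 ≤ L₁) (hL₂ : 20 ≤ L₂) (hh : Twisted L₁ L₂ α β h)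
    (hm : NoMono h) {m n : ℤ} {c : ZMod 3} (hc : RingFree (fun i j => h (i, j)) m n c) :
    HeightReach L₁ L₂ h (bump L₁ L₂ (m, n) (c - h (m, n)) h) :=
  Relation.ReflTransGen.single ⟨hm, hm.bump hL₁ hL₂ hh hc, _, _, rfl⟩

/-- A canonical representative of a point of the torus. -/
def torusLift (x : ZMod L₁ × ZMod L₂) : ℤ × ℤ := (x.1.val, x.2.val)

variable [NeZero L₁] [NeZero L₂]

theorem red_torusLift (x : ZMod L₁ × ZMod L₂) : red L₁ L₂ (torusLift x) = x := by
  simp [red, torusLift]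

/-- The number of monochromatic horizontal bonds. -/
def rowEnergy (L₁ L₂ : ℕ) [NeZero L₁] [NeZero L₂] (h : ℤ × ℤ → ZMod 3) : ℤ :=
  ∑ x : ZMod L₁ × ZMod L₂, if h (torusLift x) = h (torusLift x + (1, 0)) then 1 else 0

theorem rowEnergy_nonneg (h : ℤ × ℤ → ZMod 3) : 0 ≤ rowEnergy L₁ L₂ h :=
  Finset.sum_nonneg fun x _ => by split_ifs <;> norm_num

theorem rowEnergy_bump (hL₁ : 20 ≤ L₁) (hh : Twisted L₁ L₂ α β h) (m n : ℤ) (c : ZMod 3) :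
    rowEnergy L₁ L₂ (bump L₁ L₂ (m, n) (c - h (m, n)) h) = rowEnergy L₁ L₂ h +
      ((if c = h (m + 1, n) then 1 else 0) + (if c = h (m - 1, n) then 1 else 0)) -
      ((if h (m, n) = h (m + 1, n) then 1 else 0) +
        (if h (m, n) = h (m - 1, n) then 1 else 0)) := by
  have h1 : (1 : ℤ) < L₁ := by omega
  set h' := bump L₁ L₂ (m, n) (c - h (m, n)) h with hdef
  have hh' : Twisted L₁ L₂ α β h' := hh.bump _ _
  have hind : ∀ f : ℤ × ℤ → ZMod 3, Twisted L₁ L₂ α β f → ∀ i j,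
      (f (torusLift (red L₁ L₂ (i, j))) = f (torusLift (red L₁ L₂ (i, j)) + (1, 0)) ↔
        f (i, j) = f (i + 1, j)) := by
    intro f hf i j
    have := hf.diff_eq (red_torusLift (red L₁ L₂ (i, j))) (1, 0)
    rw [show ((i, j) : ℤ × ℤ) + (1, 0) = (i + 1, j) by simp] at this
    rw [eq_comm, ← sub_eq_zero, this, sub_eq_zero, eq_comm]
  have hne : red L₁ L₂ (m, n) ≠ red L₁ L₂ (m - 1, n) := by
    have := @red_ne L₁ L₂ m n (-1) 0 (Or.inl (by simp [h1]))
    rw [add_zero] at this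
    exact this.symm
  have hsum := Fintype.sum_eq_add
    (f := fun x => (if h' (torusLift x) = h' (torusLift x + (1, 0)) then (1 : ℤ) else 0) -
      if h (torusLift x) = h (torusLift x + (1, 0)) then 1 else 0)
    (red L₁ L₂ (m, n)) (red L₁ L₂ (m - 1, n)) hne (by
      rintro x ⟨hx1, hx2⟩
      have e1 : h' (torusLift x) = h (torusLift x) :=
        bump_of_ne _ (by rw [red_torusLift]; exact hx1)
      have e2 : h' (torusLift x + (1, 0)) = h (torusLift x + (1, 0)) := by
        refine bump_of_ne _ fun hr => hx2 ?_
        rw [← red_torusLift x, red_eq_iff]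
        rw [red_eq_iff] at hr
        simp only [Prod.fst_add, Prod.snd_add, add_zero] at hr ⊢
        exact ⟨by convert hr.1 using 1; ring, hr.2⟩
      simp only [e1, e2, sub_self])
  rw [Finset.sum_sub_distrib] at hsum
  have e0 : h' (m, n) = c := by rw [hdef, bump_self]; ring
  have e1 : h' (m + 1, n) = h (m + 1, n) := by
    refine bump_of_ne _ ?_
    have := @red_ne L₁ L₂ m n 1 0 (Or.inl (by simp [h1]))
    rwa [add_zero] at this
  have e2 : h' (m - 1, n) = h (m - 1, n) := bump_of_ne _ hne.symm
  simp only [hind _ hh, hind _ hh', sub_add_cancel, e0, e1, e2] at hsum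
  simp only [@eq_comm _ (h (m - 1, n))] at hsum
  unfold rowEnergy
  linarith

theorem exists_rowEnergy_min (h : ℤ × ℤ → ZMod 3) :
    ∃ h', HeightReach L₁ L₂ h h' ∧
      ∀ h'', HeightReach L₁ L₂ h' h'' → rowEnergy L₁ L₂ h' ≤ rowEnergy L₁ L₂ h'' := by
  obtain ⟨h', hr, hmin⟩ := WellFounded.has_min
    (InvImage.wf (fun h => (rowEnergy L₁ L₂ h).toNat) Nat.lt_wfRel.wf)
    {h' | HeightReach L₁ L₂ h h'} ⟨h, Relation.ReflTransGen.refl⟩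
  refine ⟨h', hr, fun h'' hr' => ?_⟩
  have := hmin h'' (hr.trans hr')
  simp only [InvImage] at this
  have h1 := rowEnergy_nonneg (L₁ := L₁) (L₂ := L₂) h'
  have h2 := rowEnergy_nonneg (L₁ := L₁) (L₂ := L₂) h''
  change ¬ (rowEnergy L₁ L₂ h'').toNat < (rowEnergy L₁ L₂ h').toNat at this
  omega

theorem heightReach_game (hL₁ : 20 ≤ L₁) (hL₂ : 20 ≤ L₂) (hh : Twisted L₁ L₂ α β h)
    (hm : NoMono h)
    (hmin : ∀ h'', HeightReach L₁ L₂ h h'' → rowEnergy L₁ L₂ h ≤ rowEnergy L₁ L₂ h'') :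
    RecolouringGame (fun H E => ∃ f, HeightReach L₁ L₂ h f ∧ E = rowEnergy L₁ L₂ f ∧
      H = fun i j => f (i, j)) (rowEnergy L₁ L₂ h) := by
  refine ⟨?_, ?_⟩
  · rintro H E ⟨f, hf, rfl, -⟩
    exact hmin f hf
  · rintro H E ⟨f, hf, rfl, rfl⟩ m n c hc
    have hft := hf.twisted hh
    refine ⟨_, _, ⟨_, hf.trans (heightReach_bump hL₁ hL₂ hft (hf.noMono hm) hc), rfl, rfl⟩, ?_, ?_⟩
    · intro i j hi hj
      rw [bump_near hL₁ hL₂ _ (by omega) (by omega)]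
      split_ifs
      · ring
      · rfl
    · exact rowEnergy_bump hL₁ hft m n c

/-- The reflection (i, j) ↦ (i + j, -j) is a symmetry of the triangular lattice that keeps the
direction of the rows and exchanges the rows above and below. It turns right ends blocked from row n
- 1 into right ends blocked from row n + 1. -/
theorem heightReach_game_mirror (hL₁ : 20 ≤ L₁) (hL₂ : 20 ≤ L₂) (hh : Twisted L₁ L₂ α β h)
    (hm : NoMono h)
    (hmin : ∀ h'', HeightReach L₁ L₂ h h'' → rowEnergy L₁ L₂ h ≤ rowEnergy L₁ L₂ h'') :
    RecolouringGame (fun H E => ∃ f, HeightReach L₁ L₂ h f ∧ E = rowEnergy L₁ L₂ f ∧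
      H = fun i j => f (i + j, -j)) (rowEnergy L₁ L₂ h) := by
  refine ⟨?_, ?_⟩
  · rintro H E ⟨f, hf, rfl, -⟩
    exact hmin f hf
  · rintro H E ⟨f, hf, rfl, rfl⟩ m n c hc
    have hft := hf.twisted hh
    have hc' : RingFree (fun i j => f (i, j)) (m + n) (-n) c := by
      obtain ⟨c1, c2, c3, c4, c5, c6⟩ := hc
      simp only [show m + 1 + n = m + n + 1 by ring, show m + (n + 1) = m + n + 1 by ring,
        show m - 1 + (n + 1) = m + n by ring, show m - 1 + n = m + n - 1 by ring,
        show m + (n - 1) = m + n - 1 by ring, show m + 1 + (n - 1) = m + n by ring,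
        show -(n + 1) = -n - 1 by ring, show -(n - 1) = -n + 1 by ring] at c1 c2 c3 c4 c5 c6
      exact ⟨fun hx => c6 hx.symm, fun hx => c5 hx.symm, fun hx => c4 hx.symm, fun hx => c3 hx.symm,
        fun hx => c2 hx.symm, fun hx => c1 hx.symm⟩
    refine ⟨_, _, ⟨_, hf.trans (heightReach_bump hL₁ hL₂ hft (hf.noMono hm) hc'), rfl, rfl⟩, ?_, ?_⟩
    · intro i j hi hj
      rw [abs_le] at hi hj
      rw [bump_near hL₁ hL₂ _ (abs_le.2 ⟨by omega, by omega⟩) (abs_le.2 ⟨by omega, by omega⟩)]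
      by_cases hc : i = m ∧ j = n
      · rw [if_pos (by omega), if_pos hc]; ring
      · rw [if_neg (by omega), if_neg hc]
    · have := rowEnergy_bump hL₁ hft (m + n) (-n) c
      simp only [show m + 1 + n = m + n + 1 by ring, show m - 1 + n = m + n - 1 by ring]
      exact this

/-- Every admissible height function can be deformed either into one without monochromatic
horizontal bonds, or into a crystal. -/
theorem exists_heightReach_rowProper (hL₁ : 20 ≤ L₁) (hL₂ : 20 ≤ L₂) (hh : Twisted L₁ L₂ α β h)
    (hm : NoMono h) : ∃ h', HeightReach L₁ L₂ h h' ∧ (RowProper h' ∨ IsCrystalHeight h') := by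
  obtain ⟨f, hf, hmin⟩ := exists_rowEnergy_min (L₁ := L₁) (L₂ := L₂) h
  have hft := hf.twisted hh
  have hfm := hf.noMono hm
  have g1 := heightReach_game hL₁ hL₂ hft hfm hmin
  have g2 := heightReach_game_mirror hL₁ hL₂ hft hfm hmin
  have s1 : (fun H E => ∃ f', HeightReach L₁ L₂ f f' ∧ E = rowEnergy L₁ L₂ f' ∧
      H = fun i j => f' (i, j)) (fun i j => f (i, j)) (rowEnergy L₁ L₂ f) :=
    ⟨f, Relation.ReflTransGen.refl, rfl, rfl⟩
  have s2 : (fun H E => ∃ f', HeightReach L₁ L₂ f f' ∧ E = rowEnergy L₁ L₂ f' ∧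
      H = fun i j => f' (i + j, -j)) (fun i j => f (i + j, -j)) (rowEnergy L₁ L₂ f) :=
    ⟨f, Relation.ReflTransGen.refl, rfl, rfl⟩
  -- A monochromatic segment cannot end: its end would be blocked from one of the two sides, which
  -- is excluded directly or in the mirror image.
  have hright : ∀ i j, f (i - 1, j) = f (i, j) → f (i + 1, j) = f (i, j) := by
    intro i j h1
    by_contra h2
    rcases g1.rightEnd s1 h1 h2 with hb | ⟨e1, e2, e3⟩
    · exact g1.not_rightEndBlocked s1 i j hb
    · refine g2.not_rightEndBlocked s2 (i + j) (-j) ?_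
      unfold RightEndBlocked
      simp only [neg_neg, show i + j - 1 + -j = i - 1 by ring, show i + j + -j = i by ring,
        show i + j + 1 + -j = i + 1 by ring, show i + j + (-j + 1) = i + 1 by ring,
        show i + j - 1 + (-j + 1) = i by ring, show -(-j + 1) = j - 1 by ring]
      exact ⟨h1, h2, e1.symm, e1 ▸ e2, e1 ▸ e3⟩
  -- To the right this is `hright`. A point to the left is first shifted to the right of i by a
  -- multiple of L₁, which changes nothing because a row that is constant to the right has twist
  -- zero.
  have hconst : ∀ i j, f (i + 1, j) = f (i, j) → ∀ k, f (k, j) = f (i, j) := by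
    intro i j h0
    have hnat : ∀ k : ℕ, f (i + k + 1, j) = f (i + k, j) ∧ f (i + k, j) = f (i, j) := by
      intro k
      induction k with
      | zero => simpa using h0
      | succ k ih =>
        have := hright (i + k + 1) j (by rw [add_sub_cancel_right]; exact ih.1.symm)
        push_cast
        rw [← add_assoc]
        exact ⟨this, ih.1.trans ih.2⟩
    have hα : α = 0 := by
      have := (hft i j).1
      rw [(hnat L₁).2] at this
      simpa using this
    intro k
    have h1 := hft.add_mul k j (|i| + |k|) 0
    rw [hα, zero_mul, add_zero, mul_zero, add_zero, Int.cast_zero, mul_zero, add_zero] at h1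
    have hge : (|i| + |k|) ≤ L₁ * (|i| + |k|) := by
      have : (1 : ℤ) ≤ L₁ := by omega
      nlinarith [abs_nonneg i, abs_nonneg k]
    have h2 := (hnat (k + L₁ * (|i| + |k|) - i).toNat).2
    have hpos : 0 ≤ k + L₁ * (|i| + |k|) - i := by
      have := neg_abs_le k
      have := le_abs_self i
      omega
    rw [Int.toNat_of_nonneg hpos, show i + (k + L₁ * (|i| + |k|) - i) = k + L₁ * (|i| + |k|) by ring,
      h1] at h2
    exact h2
  refine ⟨f, hf, ?_⟩
  by_cases hp : RowProper f
  · exact Or.inl hp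
  right
  unfold RowProper at hp
  push Not at hp
  obtain ⟨i₀, j₀, h0⟩ := hp
  -- Every vertex of a constant row is the middle of a segment, so both other colours are blocked,
  -- one by a pair in row j + 1 and the other by a pair in row j - 1. Hence the adjacent rows are
  -- constant too, and the three rows have different colours.
  have hstep : ∀ j, (∀ k k', f (k, j) = f (k', j)) → (∀ k k', f (k, j + 1) = f (k', j + 1)) ∧
      (∀ k k', f (k, j - 1) = f (k', j - 1)) ∧ f (0, j + 1) ≠ f (0, j) ∧
      f (0, j + 1) - f (0, j) = f (0, j) - f (0, j - 1) := by
    intro j hj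
    have hmid : ∀ k c, c ≠ f (k, j) → (f (k, j + 1) = c ∧ f (k - 1, j + 1) = c) ∨
        (f (k, j - 1) = c ∧ f (k + 1, j - 1) = c) := fun k c hc =>
      g1.middle s1 (m := k) (n := j) (hj _ _) (hj _ _) hc
    have hupne : ∀ k, f (k, j + 1) ≠ f (k, j) := fun k hk => (hfm k j).1 ⟨hj _ _, hk.symm⟩
    have hcases : ∀ a u d : ZMod 3, (∀ c, c ≠ a → u = c ∨ d = c) → u ≠ a → u - a = a - d := by
      have : ∀ a u d : Fin 3, (∀ c, c ≠ a → u = c ∨ d = c) → u ≠ a → u - a = a - d := by decide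
      exact this
    have hcases' : ∀ a u u' d d' : ZMod 3, (∀ c, c ≠ a → (u = c ∧ u' = c) ∨ (d = c ∧ d' = c)) →
        u = u' ∧ d = d' := by
      have : ∀ a u u' d d' : Fin 3, (∀ c, c ≠ a → (u = c ∧ u' = c) ∨ (d = c ∧ d' = c)) →
        u = u' ∧ d = d' := by decide
      exact this
    have hup : ∀ k, f (k, j + 1) = f (k - 1, j + 1) := fun k => (hcases' _ _ _ _ _ (hmid k)).1
    have hdn : ∀ k, f (k, j - 1) = f (k + 1, j - 1) := fun k => (hcases' _ _ _ _ _ (hmid k)).2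
    have hup' := hconst (-1) (j + 1) (by have := hup 0; simpa using this)
    have hdn' := hconst 0 (j - 1) (by have := hdn 0; simpa using this.symm)
    refine ⟨fun k k' => (hup' k).trans (hup' k').symm, fun k k' => (hdn' k).trans (hdn' k').symm,
      hupne 0, hcases _ _ _ (fun c hc => ?_) (hupne 0)⟩
    exact (hmid 0 c hc).imp And.left And.left
  have hrow : ∀ j k k', f (k, j) = f (k', j) := by
    have hj₀ : ∀ k k', f (k, j₀) = f (k', j₀) := fun k k' =>
      (hconst i₀ j₀ h0 k).trans (hconst i₀ j₀ h0 k').symm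
    intro j
    induction j using Int.inductionOn' (b := j₀) with
    | zero => exact hj₀
    | succ k _ ih => exact (hstep k ih).1
    | pred k _ ih => exact (hstep k ih).2.1
  set ε := f (0, 1) - f (0, 0) with hε
  have hdiff : ∀ j, f (0, j + 1) - f (0, j) = ε := by
    intro j
    induction j using Int.induction_on with
    | zero => simp [hε]
    | succ n ih =>
      have := (hstep (n + 1) (hrow _)).2.2.2
      rw [this, add_sub_cancel_right, ih]
    | pred n ih =>
      have := (hstep (-n) (hrow _)).2.2.2
      rw [sub_add_cancel, ← this, ih]
  have hε0 : ε ≠ 0 := by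
    have := (hstep 0 (hrow 0)).2.2.1
    rw [hε]
    simpa [sub_ne_zero] using this
  refine ⟨![0, -ε, ε], ?_, ?_⟩
  · have : ∀ ε : Fin 3, ε ≠ 0 → Function.Injective ![0, -ε, ε] := by decide
    exact this ε hε0
  · rintro ⟨i, j⟩ d
    fin_cases d
    · simp [latVec, hrow j (i + 1) i]
    · have := hdiff j
      simp only [latVec, Prod.mk_add_mk, Fin.mk_one, Matrix.cons_val_one, Matrix.cons_val_zero]
      rw [hrow (j + 1) (i + -1) 0, hrow j i 0, ← this]
      ring
    · have := hdiff (j - 1)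
      rw [sub_add_cancel] at this
      simp [latVec, ← sub_eq_add_neg]
      rw [hrow (j - 1) i 0, hrow j i 0, this]

end Heights

/-! ### Rows without monochromatic bonds -/

section Rows

set_option linter.unusedSectionVars false

variable {L₁ L₂ : ℕ} {α β : ZMod 3} {h h' h'' : ℤ × ℤ → ZMod 3} {j : ℤ}

/-- Reachability by moves that change only the rows at heights congruent to `j`. -/
def RowReach (L₁ L₂ : ℕ) (j : ℤ) (h h' : ℤ × ℤ → ZMod 3) : Prop :=
  HeightReach L₁ L₂ h h' ∧ ∀ i k, ¬((L₂ : ℤ) ∣ k - j) → h' (i, k) = h (i, k)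

theorem RowReach.refl (j : ℤ) (h : ℤ × ℤ → ZMod 3) : RowReach L₁ L₂ j h h :=
  ⟨Relation.ReflTransGen.refl, fun _ _ _ => rfl⟩

theorem RowReach.trans (h1 : RowReach L₁ L₂ j h h') (h2 : RowReach L₁ L₂ j h' h'') :
    RowReach L₁ L₂ j h h'' :=
  ⟨h1.1.trans h2.1, fun i k hk => (h2.2 i k hk).trans (h1.2 i k hk)⟩

/-- The weighted number of ascents in a row. -/
def ascents (L₁ : ℕ) (W : ℕ → ℤ) (h : ℤ × ℤ → ZMod 3) (j : ℤ) : ℤ :=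
  ∑ k ∈ Finset.range L₁, if h (k + 1, j) - h (k, j) = 1 then W k else 0

theorem bump_row_eq_of_not_dvd {i k : ℤ} {p : ℤ} (δ : ZMod 3) (hk : ¬((L₂ : ℤ) ∣ k - j)) :
    bump L₁ L₂ (p, j) δ h (i, k) = h (i, k) := by
  refine bump_of_ne _ fun hr => hk ?_
  rw [red_eq_iff] at hr
  have := hr.2
  rw [← dvd_neg]; simpa using this

theorem bump_row {i k : ℤ} (δ : ZMod 3) :
    bump L₁ L₂ (i, j) δ h (k, j) = h (k, j) + if (L₁ : ℤ) ∣ k - i then δ else 0 := by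
  have : red L₁ L₂ (k, j) = red L₁ L₂ (i, j) ↔ (L₁ : ℤ) ∣ k - i := by
    rw [red_eq_iff, ← dvd_neg]; simp
  simp only [bump, this]

/-- Here `a` and `b` represent the columns i and i - 1 in the range of summation: only the bonds to
the right and to the left of the changed point matter. -/
theorem ascents_bump {W : ℕ → ℤ} (hL₁ : 20 ≤ L₁) {i : ℤ} {a b : ℕ} (ha : a < L₁)
    (hb : b < L₁) (hai : (L₁ : ℤ) ∣ a - i) (hbi : (L₁ : ℤ) ∣ b - (i - 1)) (δ : ZMod 3) :
    ascents L₁ W (bump L₁ L₂ (i, j) δ h) j = ascents L₁ W h j +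
      ((if h (a + 1, j) - (h (a, j) + δ) = 1 then W a else 0) -
        (if h (a + 1, j) - h (a, j) = 1 then W a else 0)) +
      ((if h (b + 1, j) + δ - h (b, j) = 1 then W b else 0) -
        (if h (b + 1, j) - h (b, j) = 1 then W b else 0)) := by
  have small : ∀ x : ℤ, (L₁ : ℤ) ∣ x → |x| < L₁ → x = 0 := fun x h1 h2 =>
    Int.eq_zero_of_abs_lt_dvd h1 h2
  have hab : a ≠ b := by
    rintro rfl
    have := small _ (dvd_sub hbi hai) (by rw [abs_lt]; constructor <;> omega)
    omega
  have ha1 : ¬((L₁ : ℤ) ∣ (a : ℤ) + 1 - i) := fun hd => by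
    have := small _ (dvd_sub hd hai) (by rw [abs_lt]; constructor <;> omega)
    omega
  have hb1 : (L₁ : ℤ) ∣ (b : ℤ) + 1 - i := by convert hbi using 1; ring
  have hb0 : ¬((L₁ : ℤ) ∣ (b : ℤ) - i) := fun hd => by
    have := small _ (dvd_sub hbi hd) (by rw [abs_lt]; constructor <;> omega)
    omega
  have hsum := Finset.sum_eq_add (s := Finset.range L₁)
    (f := fun k : ℕ => (if bump L₁ L₂ (i, j) δ h (k + 1, j) - bump L₁ L₂ (i, j) δ h (k, j) = 1
      then W k else 0) - if h (k + 1, j) - h (k, j) = 1 then W k else 0) a b hab (by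
      rintro k hk ⟨hka, hkb⟩
      rw [Finset.mem_range] at hk
      have h1 : ¬((L₁ : ℤ) ∣ (k : ℤ) - i) := fun hd => by
        have := small _ (dvd_sub hd hai) (by rw [abs_lt]; constructor <;> omega)
        omega
      have h2 : ¬((L₁ : ℤ) ∣ (k : ℤ) + 1 - i) := fun hd => by
        have := small _ (dvd_sub hd hb1) (by rw [abs_lt]; constructor <;> omega)
        omega
      simp only [bump_row, if_neg h1, if_neg h2, add_zero, sub_self])
    (fun hn => absurd (Finset.mem_range.2 ha) hn) (fun hn => absurd (Finset.mem_range.2 hb) hn)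
  rw [Finset.sum_sub_distrib] at hsum
  simp only [bump_row, if_neg ha1, if_pos hai, if_neg hb0, if_pos hb1, add_zero] at hsum
  simp only [ascents, bump_row]
  linarith

theorem RowProper.bump (hL₁ : 20 ≤ L₁) (hh : Twisted L₁ L₂ α β h) (hp : RowProper h) {i : ℤ}
    {c : ZMod 3} (h1 : h (i - 1, j) ≠ c) (h2 : h (i + 1, j) ≠ c) :
    RowProper (bump L₁ L₂ (i, j) (c - h (i, j)) h) := by
  intro k l
  have hL : (1 : ℤ) < L₁ := by omega
  by_cases r1 : red L₁ L₂ (k, l) = red L₁ L₂ (i, j)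
  · have r2 : red L₁ L₂ (k + 1, l) ≠ red L₁ L₂ (i, j) := by
      rw [← r1]
      simpa using @red_ne L₁ L₂ k l 1 0 (Or.inl (by simp [hL]))
    rw [bump_of_ne _ r2]
    have := hh.diff_eq r1 (1, 0)
    simp only [Prod.mk_add_mk, add_zero] at this
    simp only [_root_.bump, if_pos r1]
    intro he
    exact h2 (by linear_combination he - this)
  · rw [bump_of_ne _ r1]
    by_cases r2 : red L₁ L₂ (k + 1, l) = red L₁ L₂ (i, j)
    · have := hh.diff_eq r2 (-1, 0)
      simp only [Prod.mk_add_mk, add_zero, add_neg_cancel_right] at this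
      simp only [_root_.bump, if_pos r2]
      intro he
      exact h1 (by rw [sub_eq_add_neg]; linear_combination -he - this)
    · rw [bump_of_ne _ r2]
      exact hp k l

/-- As properness of the rows excludes monochromatic triangles, such moves are legal whatever the
adjacent rows are. -/
theorem RowProper.rowReach_bump (hL₁ : 20 ≤ L₁) (hh : Twisted L₁ L₂ α β h)
    (hp : RowProper h) {i : ℤ} {c : ZMod 3} (h1 : h (i - 1, j) ≠ c) (h2 : h (i + 1, j) ≠ c) :
    RowReach L₁ L₂ j h (_root_.bump L₁ L₂ (i, j) (c - h (i, j)) h) :=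
  ⟨Relation.ReflTransGen.single ⟨hp.noMono, (hp.bump hL₁ hh h1 h2).noMono, _, _, rfl⟩,
    fun _ _ hk => bump_row_eq_of_not_dvd _ hk⟩

theorem RowProper.slope_eq (hp : RowProper h) (i j : ℤ) :
    h (i + 1, j) - h (i, j) = 1 ∨ h (i + 1, j) - h (i, j) = 2 := by
  have h0 : h (i + 1, j) - h (i, j) ≠ 0 := sub_ne_zero.2 (hp i j)
  have : ∀ x : Fin 3, x ≠ 0 → x = 1 ∨ x = 2 := by decide
  exact this _ h0

/-- The row `j` ascends `n` times, then descends. -/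
def RowSorted (L₁ : ℕ) (h : ℤ × ℤ → ZMod 3) (j : ℤ) (n : ℤ) : Prop :=
  ∀ k : ℕ, k < L₁ → ((k : ℤ) < n ↔ h (k + 1, j) - h (k, j) = 1)

/-- Bubble sort. A descent followed by an ascent is a local minimum; adding 2 = -1 to the height
there, modulo 3 the same as turning it into the local maximum, exchanges the two bonds. The sum of
the positions of the ascents drops by one, their number stays the same, and column 0 is never
touched. -/
theorem RowProper.exists_sorted (hL₁ : 20 ≤ L₁) (j : ℤ) (N : ℕ) :
    ∀ h, Twisted L₁ L₂ α β h → RowProper h → (ascents L₁ (fun k => k) h j).toNat = N →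
      ∃ h', RowReach L₁ L₂ j h h' ∧ RowProper h' ∧ h' (0, j) = h (0, j) ∧
        ascents L₁ (fun _ => 1) h' j = ascents L₁ (fun _ => 1) h j ∧
        RowSorted L₁ h' j (ascents L₁ (fun _ => 1) h' j) := by
  induction N using Nat.strong_induction_on with
  | _ N ih =>
  intro h hh hp hN
  by_cases hinv : ∃ i : ℕ, 1 ≤ i ∧ i < L₁ ∧ h (i, j) - h (i - 1, j) ≠ 1 ∧
      h (i + 1, j) - h (i, j) = 1
  · obtain ⟨i, hi1, hi2, hs1, hs2⟩ := hinv
    have hs1' := hp.slope_eq (i - 1) j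
    rw [sub_add_cancel] at hs1'
    have hs1'' := hs1'.resolve_left hs1
    set c := h (i, j) + 2 with hc
    have n1 : h ((i : ℤ) - 1, j) ≠ c := by
      intro he; rw [he, hc] at hs1''; revert hs1''; generalize h ((i : ℤ), j) = x
      have : ∀ x : Fin 3, ¬ x - (x + 2) = 2 := by decide
      exact this x
    have n2 : h ((i : ℤ) + 1, j) ≠ c := by
      intro he; rw [he, hc] at hs2; revert hs2; generalize h ((i : ℤ), j) = x
      have : ∀ x : Fin 3, ¬ (x + 2) - x = 1 := by decide
      exact this x
    have hasc : ∀ W : ℕ → ℤ, ascents L₁ W (_root_.bump L₁ L₂ ((i : ℤ), j) (c - h (i, j)) h) j =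
        ascents L₁ W h j - W i + W (i - 1) := by
      intro W
      rw [ascents_bump hL₁ hi2 (show i - 1 < L₁ by omega) (by simp)
        (by rw [Nat.cast_sub hi1]; simp)]
      rw [Nat.cast_sub hi1, Nat.cast_one, sub_add_cancel, if_pos hs2, if_neg hs1]
      have e1 : h ((i : ℤ) + 1, j) - (h ((i : ℤ), j) + (c - h ((i : ℤ), j))) ≠ 1 := by
        rw [hc]; intro he
        have : (2 : ZMod 3) = 0 := by linear_combination hs2 - he
        exact absurd this (by decide)
      have e2 : h ((i : ℤ), j) + (c - h ((i : ℤ), j)) - h ((i : ℤ) - 1, j) = 1 := by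
        rw [hc]
        have : (4 : ZMod 3) = 1 := by decide
        linear_combination hs1'' + this
      rw [if_neg e1, if_pos e2]
      ring
    have hge : ∀ W : ℕ → ℤ, (∀ k, 0 ≤ W k) → ∀ f, 0 ≤ ascents L₁ W f j := fun W hW f =>
      Finset.sum_nonneg fun k _ => by split_ifs; exacts [hW k, le_rfl]
    have hlt : (ascents L₁ (fun k => (k : ℤ))
        (_root_.bump L₁ L₂ ((i : ℤ), j) (c - h (i, j)) h) j).toNat < N := by
      have h1 := hasc fun k => (k : ℤ)
      have h2 := hge (fun k => (k : ℤ)) (fun k => by positivity) h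
      have h3 := hge (fun k => (k : ℤ)) (fun k => by positivity)
        (_root_.bump L₁ L₂ ((i : ℤ), j) (c - h (i, j)) h)
      simp only [Nat.cast_sub hi1, Nat.cast_one] at h1
      omega
    obtain ⟨h', hr, hp', hb, hn, hs⟩ := ih _ hlt _ (hh.bump _ _) (hp.bump hL₁ hh n1 n2) rfl
    refine ⟨h', (hp.rowReach_bump hL₁ hh n1 n2).trans hr, hp', ?_, ?_, hs⟩
    · rw [hb, bump_row, if_neg, add_zero]
      intro hd
      have := Int.eq_zero_of_abs_lt_dvd hd (by rw [abs_lt]; constructor <;> omega)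
      omega
    · rw [hn, hasc]; ring
  · push Not at hinv
    refine ⟨h, RowReach.refl _ _, hp, rfl, rfl, ?_⟩
    obtain ⟨n, hn, hsort⟩ : ∃ n ≤ L₁, ∀ k : ℕ, k < L₁ →
        (k < n ↔ h (k + 1, j) - h (k, j) = 1) := by
      have : ∀ M ≤ L₁, ∃ n ≤ M, ∀ k : ℕ, k < M → (k < n ↔ h (k + 1, j) - h (k, j) = 1) := by
        intro M
        induction M with
        | zero => exact fun _ => ⟨0, le_rfl, fun k hk => absurd hk (Nat.not_lt_zero k)⟩
        | succ M ihM =>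
          intro hM
          obtain ⟨n, hn, hk⟩ := ihM (by omega)
          by_cases hasc : h ((M : ℤ) + 1, j) - h (M, j) = 1
          · have hnM : n = M := by
              by_contra hne
              have hM1 : 1 ≤ M := by omega
              have h1 : ¬(M - 1 < n) := by omega
              rw [hk (M - 1) (by omega)] at h1
              rw [Nat.cast_sub hM1, Nat.cast_one, sub_add_cancel] at h1
              exact hinv M hM1 (by omega) h1 hasc
            refine ⟨M + 1, le_rfl, fun k hk' => ⟨fun _ => ?_, fun _ => hk'⟩⟩
            rcases Nat.lt_succ_iff_lt_or_eq.1 hk' with h1 | rfl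
            · exact (hk k h1).1 (by omega)
            · exact hasc
          · refine ⟨n, by omega, fun k hk' => ?_⟩
            rcases Nat.lt_succ_iff_lt_or_eq.1 hk' with h1 | rfl
            · exact hk k h1
            · exact ⟨fun hlt => by omega, fun hc => absurd hc hasc⟩
      exact this L₁ le_rfl
    have hcount : ascents L₁ (fun _ => 1) h j = n := by
      have : ∀ k ∈ Finset.range L₁, (if h ((k : ℤ) + 1, j) - h (k, j) = 1 then (1 : ℤ) else 0) =
          if k < n then 1 else 0 := fun k hk => by
        simp only [hsort k (Finset.mem_range.1 hk)]
      rw [ascents, Finset.sum_congr rfl this, ← Finset.sum_filter, Finset.sum_const, nsmul_one]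
      congr 1
      rw [show (Finset.range L₁).filter (· < n) = Finset.range n by
        ext k; simp only [Finset.mem_filter, Finset.mem_range]; omega, Finset.card_range]
    intro k hk
    rw [hcount, ← hsort k hk]
    exact Nat.cast_lt

/-- A row with ascents and descents can be brought into sorted form with any initial value. -/
theorem RowProper.exists_sorted_base (hL₁ : 20 ≤ L₁) (j : ℤ)
    (hh : Twisted L₁ L₂ α β h) (hp : RowProper h) (h0 : 0 < ascents L₁ (fun _ => 1) h j)
    (h1 : ascents L₁ (fun _ => 1) h j < L₁) (k : ZMod 3) :
    ∃ h', RowReach L₁ L₂ j h h' ∧ RowProper h' ∧ h' (0, j) = k ∧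
        ascents L₁ (fun _ => 1) h' j = ascents L₁ (fun _ => 1) h j ∧
        RowSorted L₁ h' j (ascents L₁ (fun _ => 1) h' j) := by
  -- In a sorted row the bond before column 0 descends and the bond after it ascends. Exchanging
  -- these two bonds adds 2 to the initial value and keeps the number of ascents; the row is then
  -- sorted again.
  have key : ∀ t : ℕ, ∃ h', RowReach L₁ L₂ j h h' ∧ RowProper h' ∧ h' (0, j) = h (0, j) + 2 * t ∧
        ascents L₁ (fun _ => 1) h' j = ascents L₁ (fun _ => 1) h j ∧
        RowSorted L₁ h' j (ascents L₁ (fun _ => 1) h' j) := by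
    intro t
    induction t with
    | zero => simpa using RowProper.exists_sorted hL₁ j _ h hh hp rfl
    | succ t ih =>
      obtain ⟨f, hr, hpf, hb, hn, hs⟩ := ih
      have hft := hr.1.twisted hh
      have s0 : f (0 + 1, j) - f (0, j) = 1 := by
        have := (hs 0 (by omega)).1 (by rw [hn]; simpa using h0)
        simpa using this
      have sl : f (((L₁ - 1 : ℕ) : ℤ) + 1, j) - f (((L₁ - 1 : ℕ) : ℤ), j) ≠ 1 := by
        intro hc
        have := (hs (L₁ - 1) (by omega)).2 hc
        rw [hn] at this
        omega
      have hd := hft.diff_eq (L₁ := L₁) (L₂ := L₂) (x := (((L₁ - 1 : ℕ) : ℤ), j)) (y := (-1, j)) (by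
        rw [red_eq_iff]; constructor
        · rw [Nat.cast_sub (by omega)]; exact ⟨-1, by push_cast; ring⟩
        · simp) (1, 0)
      simp only [Prod.mk_add_mk, add_zero] at hd
      rw [hd] at sl
      have sl' := (hpf.slope_eq (-1) j).resolve_left sl
      rw [neg_add_cancel] at sl'
      rw [neg_add_cancel] at hd
      rw [zero_add] at s0
      set c := f (0, j) + 2 with hc
      have n1 : f ((0 : ℤ) - 1, j) ≠ c := by
        intro he; rw [zero_sub] at he; rw [he, hc] at sl'; revert sl'; generalize f ((0 : ℤ), j) = x
        have : ∀ x : Fin 3, ¬ x - (x + 2) = 2 := by decide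
        exact this x
      have n2 : f ((0 : ℤ) + 1, j) ≠ c := by
        intro he; rw [zero_add] at he; rw [he, hc] at s0; revert s0; generalize f ((0 : ℤ), j) = x
        have : ∀ x : Fin 3, ¬ (x + 2) - x = 1 := by decide
        exact this x
      have hasc : ascents L₁ (fun _ => 1) (_root_.bump L₁ L₂ (0, j) (c - f (0, j)) f) j =
          ascents L₁ (fun _ => 1) f j := by
        rw [ascents_bump hL₁ (a := 0) (b := L₁ - 1) (by omega) (by omega) (by simp)
          (by rw [Nat.cast_sub (by omega)]; exact ⟨1, by push_cast; ring⟩)]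
        have e1 : f (((0 : ℕ) : ℤ) + 1, j) - (f (((0 : ℕ) : ℤ), j) + (c - f (0, j))) ≠ 1 := by
          rw [hc, Nat.cast_zero, zero_add]; intro he
          have : (2 : ZMod 3) = 0 := by linear_combination s0 - he
          exact absurd this (by decide)
        have e2 : f (((L₁ - 1 : ℕ) : ℤ) + 1, j) + (c - f (0, j)) - f (((L₁ - 1 : ℕ) : ℤ), j) = 1 := by
          rw [hc]
          have : (4 : ZMod 3) = 1 := by decide
          linear_combination hd + sl' + this
        have e3 : f (((L₁ - 1 : ℕ) : ℤ) + 1, j) - f (((L₁ - 1 : ℕ) : ℤ), j) ≠ 1 := by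
          rw [hd, sl']; decide
        have e4 : f (((0 : ℕ) : ℤ) + 1, j) - f (((0 : ℕ) : ℤ), j) = 1 := by simpa using s0
        rw [if_neg e1, if_pos e2, if_neg e3, if_pos e4]
        ring
      obtain ⟨h', hr', hp', hb', hn', hs'⟩ := RowProper.exists_sorted hL₁ j _ _ (hft.bump (0, j) (c - f (0, j)))
        (hpf.bump hL₁ hft n1 n2) rfl
      refine ⟨h', (hr.trans (hpf.rowReach_bump hL₁ hft n1 n2)).trans hr', hp', ?_, ?_, hs'⟩
      · rw [hb', bump_self, hc, hb]; push_cast; ring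
      · rw [hn', hasc, hn]
  -- In ℤ₃ one has 2 · 2 = 1, so this number of rounds gives the desired initial value.
  obtain ⟨h', hr, hp', hb, hn, hs⟩ := key (2 * (k - h (0, j))).val
  refine ⟨h', hr, hp', ?_, hn, hs⟩
  rw [hb, ZMod.natCast_val, ZMod.cast_id]
  have : (4 : ZMod 3) = 1 := by decide
  linear_combination (k - h (0, j)) * this

end Rows

/-! ### Flips of three bonds, and rows with both ascents and descents -/

section Rows

set_option linter.unusedSectionVars false

variable {L₁ L₂ : ℕ} {α β : ZMod 3} {h h' h'' : ℤ × ℤ → ZMod 3} {i j : ℤ}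

theorem bump_comm (p q : ℤ × ℤ) (δ ε : ZMod 3) :
    bump L₁ L₂ p δ (bump L₁ L₂ q ε h) = bump L₁ L₂ q ε (bump L₁ L₂ p δ h) := by
  funext x
  simp only [bump]
  ring

/-- Exchange of the two inner colours of three consecutive bonds. -/
def swapInner (L₁ L₂ : ℕ) (i j : ℤ) (h : ℤ × ℤ → ZMod 3) : ℤ × ℤ → ZMod 3 :=
  bump L₁ L₂ (i + 2, j) (h (i + 1, j) - h (i + 2, j))
    (bump L₁ L₂ (i + 1, j) (h (i + 2, j) - h (i + 1, j)) h)

theorem swapInner_near (hL₁ : 20 ≤ L₁) (hL₂ : 20 ≤ L₂) {m : ℤ} (hm : |m| ≤ 9) :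
    swapInner L₁ L₂ i j h (i + m, j) = if m = 1 then h (i + 2, j) else
      if m = 2 then h (i + 1, j) else h (i + m, j) := by
  have hm' := abs_le.1 hm
  have a1 : |i + m - (i + 2)| ≤ 14 := abs_le.2 ⟨by omega, by omega⟩
  have a2 : |i + m - (i + 1)| ≤ 14 := abs_le.2 ⟨by omega, by omega⟩
  have a3 : |i + 2 - (i + 1)| ≤ 14 := abs_le.2 ⟨by omega, by omega⟩
  have a4 : |j - j| ≤ 14 := by simp
  rw [swapInner, bump_near hL₁ hL₂ _ a1 a4, bump_near hL₁ hL₂ _ a3 a4,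
    bump_near hL₁ hL₂ _ a2 a4]
  simp only [and_true]
  rw [if_neg (show ¬(i + 2 = i + 1) by omega)]
  rcases eq_or_ne m 1 with rfl | h1
  · rw [if_neg (by omega), if_pos rfl, if_pos rfl]; ring
  rcases eq_or_ne m 2 with rfl | h2
  · rw [if_pos rfl, if_neg h1, if_pos rfl]; ring
  · rw [if_neg (by omega), if_neg (by omega), if_neg h1, if_neg h2]

theorem swapInner_of_not_dvd {k l : ℤ} (hk : ¬((L₂ : ℤ) ∣ l - j)) :
    swapInner L₁ L₂ i j h (k, l) = h (k, l) := by
  rw [swapInner, bump_row_eq_of_not_dvd _ hk, bump_row_eq_of_not_dvd _ hk]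

/-- The two inner vertices lie between equal outer colours, so their colours can be exchanged
without creating a monochromatic bond. -/
theorem RowProper.swapInner (hL₁ : 20 ≤ L₁) (hL₂ : 20 ≤ L₂) (hh : Twisted L₁ L₂ α β h)
    (hp : RowProper h) (he : h (i + 3, j) = h (i, j)) :
    RowProper (swapInner L₁ L₂ i j h) := by
  have hT : Twisted L₁ L₂ α β (_root_.swapInner L₁ L₂ i j h) := (hh.bump _ _).bump _ _
  have near : ∀ m : ℤ, |m| ≤ 9 → _ := fun m hm => swapInner_near (h := h) (i := i) (j := j) hL₁ hL₂ hm
  have v0 := near 0 (by norm_num)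
  have v1 := near 1 (by norm_num)
  have v2 := near 2 (by norm_num)
  have v3 := near 3 (by norm_num)
  norm_num at v0 v1 v2 v3
  have p0 := hp i j
  have p1 := hp (i + 1) j
  have p2 := hp (i + 2) j
  rw [show i + 1 + 1 = i + 2 by ring] at p1
  rw [show i + 2 + 1 = i + 3 by ring] at p2
  intro k l hcon
  have hcon' := sub_eq_zero.2 hcon
  have move : ∀ m : ℤ, red L₁ L₂ (k, l) = red L₁ L₂ (i + m, j) →
      _root_.swapInner L₁ L₂ i j h (i + m + 1, j) =
        _root_.swapInner L₁ L₂ i j h (i + m, j) := fun m hm => by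
    have := hT.diff_eq hm (1, 0)
    simp only [Prod.mk_add_mk, add_zero] at this
    exact sub_eq_zero.1 (this.symm.trans hcon')
  by_cases r0 : red L₁ L₂ (k, l) = red L₁ L₂ (i, j)
  · have := move 0 (by simpa using r0)
    rw [add_zero, v0, v1] at this
    exact p2 (he.trans this.symm)
  by_cases r1 : red L₁ L₂ (k, l) = red L₁ L₂ (i + 1, j)
  · have := move 1 r1
    rw [show i + 1 + 1 = i + 2 by ring, v1, v2] at this
    exact p1 this.symm
  by_cases r2 : red L₁ L₂ (k, l) = red L₁ L₂ (i + 2, j)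
  · have := move 2 r2
    rw [show i + 2 + 1 = i + 3 by ring, v2, v3] at this
    exact p0 (this.symm.trans he)
  have s : ∀ m : ℤ, red L₁ L₂ (k + 1, l) = red L₁ L₂ (i + m + 1, j) →
      red L₁ L₂ (k, l) = red L₁ L₂ (i + m, j) := by
    intro m hm
    rw [red_eq_iff] at hm ⊢
    exact ⟨by have := hm.1; simp only at this ⊢; ring_nf at this ⊢; exact this, hm.2⟩
  have r1' : red L₁ L₂ (k + 1, l) ≠ red L₁ L₂ (i + 1, j) := fun hc =>
    r0 (by simpa using s 0 (by simpa using hc))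
  have r2' : red L₁ L₂ (k + 1, l) ≠ red L₁ L₂ (i + 2, j) := fun hc =>
    r1 (s 1 (by rw [hc]; congr 2; ring))
  rw [_root_.swapInner, bump_of_ne _ r2, bump_of_ne _ r2', bump_of_ne _ r1, bump_of_ne _ r1'] at hcon
  exact hp _ _ hcon

/-- The exchange takes two recolourings, between which both inner vertices have the colour `c`. The
single monochromatic bond of the intermediate state belongs to two triangles, and the hypotheses say
that their tips (i + 1, j + 1) and (i + 2, j - 1) do not have the colour `c`. -/
theorem RowProper.rowReach_swapInner (hL₁ : 20 ≤ L₁) (hL₂ : 20 ≤ L₂) (hh : Twisted L₁ L₂ α β h)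
    (hp : RowProper h) (he : h (i + 3, j) = h (i, j)) (_ : h (i + 2, j) ≠ h (i, j))
    {c : ZMod 3} (hc : c = h (i + 1, j) ∨ c = h (i + 2, j)) (hu : h (i + 1, j + 1) ≠ c)
    (hd : h (i + 2, j - 1) ≠ c) : RowReach L₁ L₂ j h (_root_.swapInner L₁ L₂ i j h) := by
  refine ⟨?_, fun _ _ hk => swapInner_of_not_dvd hk⟩
  have hn := (hp.swapInner hL₁ hL₂ hh he).noMono
  have p0 := hp i j
  have p1 := hp (i + 1) j
  have p2 := hp (i + 2) j
  rw [show i + 1 + 1 = i + 2 by ring] at p1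
  rw [show i + 2 + 1 = i + 3 by ring] at p2
  rcases hc with rfl | rfl
  · rw [_root_.swapInner, bump_comm] at hn ⊢
    have hm := hp.noMono.bump hL₁ hL₂ hh (m := i + 2) (n := j) (c := h (i + 1, j)) (by
      unfold RingFree
      rw [show i + 2 + 1 = i + 3 by ring, show i + 2 - 1 = i + 1 by ring]
      have : h (i + 3, j) ≠ h (i + 1, j) := he ▸ p0.symm
      grind)
    exact (Relation.ReflTransGen.single ⟨hp.noMono, hm, _, _, rfl⟩).tail ⟨hm, hn, _, _, rfl⟩
  · rw [_root_.swapInner] at hn ⊢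
    have hm := hp.noMono.bump hL₁ hL₂ hh (m := i + 1) (n := j) (c := h (i + 2, j)) (by
      unfold RingFree
      rw [show i + 1 + 1 = i + 2 by ring, show i + 1 - 1 = i by ring]
      grind)
    exact (Relation.ReflTransGen.single ⟨hp.noMono, hm, _, _, rfl⟩).tail ⟨hm, hn, _, _, rfl⟩

/-- A row with both ascents and descents. -/
def Flexible (h : ℤ × ℤ → ZMod 3) (j : ℤ) : Prop :=
  (∃ i, h (i + 1, j) - h (i, j) = 1) ∧ ∃ i, h (i + 1, j) - h (i, j) = 2

theorem Twisted.exists_nat_slope (hL₁ : 20 ≤ L₁) (hh : Twisted L₁ L₂ α β h) (i j : ℤ) :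
    ∃ k : ℕ, k < L₁ ∧ h (k + 1, j) - h (k, j) = h (i + 1, j) - h (i, j) := by
  have hpos : (0 : ℤ) < L₁ := by omega
  refine ⟨(i % L₁).toNat, ?_, ?_⟩
  · have := Int.emod_lt_of_pos i hpos
    have := Int.emod_nonneg i hpos.ne'
    omega
  · rw [Int.toNat_of_nonneg (Int.emod_nonneg i hpos.ne')]
    have := hh.diff_eq (x := (i % L₁, j)) (y := (i, j)) (by
      rw [red_eq_iff]; exact ⟨Int.dvd_self_sub_emod, by simp⟩) (1, 0)
    simpa using this

theorem RowProper.flexible_iff (hL₁ : 20 ≤ L₁) (hh : Twisted L₁ L₂ α β h) (hp : RowProper h)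
    (j : ℤ) : Flexible h j ↔
      0 < ascents L₁ (fun _ => 1) h j ∧ ascents L₁ (fun _ => 1) h j < L₁ := by
  have hsum : (∑ k ∈ Finset.range L₁, (1 : ℤ)) = L₁ := by simp
  constructor
  · rintro ⟨⟨a, ha⟩, ⟨b, hb⟩⟩
    obtain ⟨k, hk, hk'⟩ := hh.exists_nat_slope hL₁ a j
    obtain ⟨m, hm, hm'⟩ := hh.exists_nat_slope hL₁ b j
    constructor
    · refine Finset.sum_pos' (fun x _ => by split_ifs <;> norm_num) ⟨k, Finset.mem_range.2 hk, ?_⟩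
      rw [if_pos (hk'.trans ha)]; norm_num
    · rw [← hsum]
      refine Finset.sum_lt_sum (fun x _ => by split_ifs <;> norm_num) ⟨m, Finset.mem_range.2 hm, ?_⟩
      rw [if_neg (by rw [hm', hb]; decide)]; norm_num
  · rintro ⟨h0, h1⟩
    constructor
    · by_contra hcon
      push Not at hcon
      rw [ascents, Finset.sum_eq_zero fun (k : ℕ) _ => if_neg (hcon k)] at h0
      exact lt_irrefl _ h0
    · by_contra hcon
      push Not at hcon
      rw [ascents, Finset.sum_congr rfl fun (k : ℕ) _ =>
        if_pos ((hp.slope_eq k j).resolve_right (hcon k)), hsum] at h1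
      exact lt_irrefl _ h1

theorem RowReach.flexible (hr : RowReach L₁ L₂ j h h') {k : ℤ} (hk : ¬((L₂ : ℤ) ∣ k - j))
    (hf : Flexible h k) : Flexible h' k := by
  simpa only [Flexible, hr.2 _ _ hk] using hf

theorem Flexible.of_dvd (hh : Twisted L₁ L₂ α β h) {k : ℤ} (hk : (L₂ : ℤ) ∣ k - j)
    (hf : Flexible h j) : Flexible h k := by
  have : ∀ i, h (i + 1, k) - h (i, k) = h (i + 1, j) - h (i, j) := fun i => by
    have := hh.diff_eq (x := (i, k)) (y := (i, j)) (by
      rw [red_eq_iff]; exact ⟨by simp, by rw [← dvd_neg]; simpa using hk⟩) (1, 0)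
    simpa using this
  simpa only [Flexible, this] using hf

/-- The row `j` starts with the colour `b`, ascends `n` times and then descends. -/
def RowCanonical (L₁ : ℕ) (h : ℤ × ℤ → ZMod 3) (b : ZMod 3) (j n : ℤ) : Prop :=
  h (0, j) = b ∧ RowSorted L₁ h j n

theorem RowReach.rowCanonical (hr : RowReach L₁ L₂ j h h') {k n : ℤ} {b : ZMod 3}
    (hk : ¬((L₂ : ℤ) ∣ k - j)) (hf : RowCanonical L₁ h b k n) : RowCanonical L₁ h' b k n := by
  simpa only [RowCanonical, RowSorted, hr.2 _ _ hk] using hf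

/-- A sorted row with more than three ascents starts with three ascents, whose inner colours differ
from the initial one. If the initial colour is chosen as that of the tip (1, j + 1) above, this tip
obstructs neither inner colour and the tip below at most one, so the three ascents can be turned
into descents. With more than three ascents at least one is left, so the row remains flexible. -/
theorem RowProper.exists_canonical_aux (hL₁ : 20 ≤ L₁) (hL₂ : 20 ≤ L₂) (j : ℤ) (N : ℕ) :
    ∀ h, Twisted L₁ L₂ α β h → RowProper h → Flexible h j →
      ascents L₁ (fun _ => 1) h j = N → ∃ h', RowReach L₁ L₂ j h h' ∧ RowProper h' ∧
        Flexible h' j ∧ ascents L₁ (fun _ => 1) h' j ≤ 3 := by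
  induction N using Nat.strong_induction_on with
  | _ N ih =>
  intro h hh hp hf hN
  by_cases hN3 : N ≤ 3
  · exact ⟨h, RowReach.refl _ _, hp, hf, by omega⟩
  have hf' := (hp.flexible_iff hL₁ hh j).1 hf
  obtain ⟨f, hr, hpf, hb, hn, hs⟩ :=
    hp.exists_sorted_base hL₁ j hh hf'.1 hf'.2 (h (1, j + 1))
  have hft := hr.1.twisted hh
  have nd : ¬((L₂ : ℤ) ∣ j + 1 - j) := fun hd => by
    have := Int.le_of_dvd (by omega) hd; omega
  have hu : f (1, j + 1) = f (0, j) := by rw [hr.2 _ _ nd, hb]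
  have s0 := (hs 0 (by omega)).1 (by push_cast; omega)
  have s1 := (hs 1 (by omega)).1 (by push_cast; omega)
  have s2 := (hs 2 (by omega)).1 (by push_cast; omega)
  norm_num at s0 s1 s2
  have t3 : (3 : ZMod 3) = 0 := by decide
  have e3 : f (0 + 3, j) = f (0, j) := by
    rw [zero_add]; linear_combination s0 + s1 + s2 + t3
  have e1 : f (0 + 2, j) ≠ f (0, j) := by
    rw [zero_add]; intro he
    have : (2 : ZMod 3) = 0 := by linear_combination he - s0 - s1
    exact absurd this (by decide)
  have q0 := hpf 0 j
  have q1 := hpf 1 j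
  norm_num at q0 q1
  obtain ⟨c, hc, hcu, hcd⟩ : ∃ c, (c = f (0 + 1, j) ∨ c = f (0 + 2, j)) ∧
      f (0 + 1, j + 1) ≠ c ∧ f (0 + 2, j - 1) ≠ c := by
    simp only [zero_add] at e1 ⊢
    rw [hu]
    by_cases hd : f (2, j - 1) = f (1, j)
    · exact ⟨f (2, j), Or.inr rfl, e1.symm, fun he => q1 (he.symm.trans hd)⟩
    · exact ⟨f (1, j), Or.inl rfl, fun he => q0 he.symm, hd⟩
  have hr2 := hpf.rowReach_swapInner hL₁ hL₂ hft e3 e1 hc hcu hcd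
  have hp2 := hpf.swapInner hL₁ hL₂ hft e3
  have hasc : ascents L₁ (fun _ => 1) (_root_.swapInner L₁ L₂ 0 j f) j =
      ascents L₁ (fun _ => 1) f j - 3 := by
    have n2 : ¬((L₁ : ℤ) ∣ 1) := fun hd => by have := Int.le_of_dvd (by omega) hd; omega
    have n3 : ¬((L₁ : ℤ) ∣ 2) := fun hd => by have := Int.le_of_dvd (by omega) hd; omega
    rw [_root_.swapInner, ascents_bump hL₁ (a := 2) (b := 1) (by omega) (by omega) (by simp) (by simp),
      ascents_bump hL₁ (a := 1) (b := 0) (by omega) (by omega) (by simp) (by simp)]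
    push_cast
    norm_num only [zero_add, bump_row, sub_self, dvd_zero, if_true, add_zero]
    simp only [if_neg n2, if_neg n3, add_zero]
    have z0 : f (1, j) = f (0, j) + 1 := by linear_combination s0
    have z1 : f (2, j) = f (0, j) + 2 := by linear_combination s0 + s1
    have z2 : f (3, j) = f (0, j) := by linear_combination s0 + s1 + s2 + t3
    rw [z0, z1, z2]
    generalize f (0, j) = x
    have g1 : ¬(x + 2 - (x + 1 + (x + 2 - (x + 1))) = 1) := by
      intro hc; ring_nf at hc; exact absurd hc (by decide)
    have g2 : x + 2 - (x + 1) = 1 := by ring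
    have g3 : ¬(x + 1 + (x + 2 - (x + 1)) - x = 1) := by
      intro hc; ring_nf at hc; exact absurd hc (by decide)
    have g4 : x + 1 - x = 1 := by ring
    have g5 : ¬(x - (x + 2 + (x + 1 - (x + 2))) = 1) := by
      intro hc; ring_nf at hc; exact absurd hc (by decide)
    have g6 : x - (x + 2) = 1 := by ring_nf; decide
    have g7 : ¬(x + 2 + (x + 1 - (x + 2)) - (x + 1 + (x + 2 - (x + 1))) = 1) := by
      intro hc; ring_nf at hc; exact absurd hc (by decide)
    rw [if_neg g1, if_pos g2, if_neg g3, if_pos g4, if_neg g5, if_pos g6, if_neg g7]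
    ring
  rw [hn, hN] at hasc
  have hf2 : Flexible (_root_.swapInner L₁ L₂ 0 j f) j :=
    (hp2.flexible_iff hL₁ (hr2.1.twisted hft) j).2 (by rw [hasc]; constructor <;> omega)
  obtain ⟨h', hr3, hp3, hf3, hn3⟩ := ih (N - 3) (by omega) _ (hr2.1.twisted hft) hp2 hf2
    (by rw [hasc]; omega)
  exact ⟨h', (hr.trans hr2).trans hr3, hp3, hf3, hn3⟩

theorem RowProper.exists_canonical (hL₁ : 20 ≤ L₁) (hL₂ : 20 ≤ L₂) (hh : Twisted L₁ L₂ α β h)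
    (hp : RowProper h) (j : ℤ) (hf : Flexible h j) (b : ZMod 3) :
    ∃ h' n, RowReach L₁ L₂ j h h' ∧ RowProper h' ∧ 0 < n ∧ n ≤ 3 ∧ RowCanonical L₁ h' b j n := by
  have hf' := (hp.flexible_iff hL₁ hh j).1 hf
  obtain ⟨f, hr, hpf, hff, hn⟩ := hp.exists_canonical_aux hL₁ hL₂ j
    (ascents L₁ (fun _ => 1) h j).toNat h hh hf (by omega)
  have hft := hr.1.twisted hh
  have hff' := (hpf.flexible_iff hL₁ hft j).1 hff
  obtain ⟨f', hr', hpf', hb, hn', hs⟩ := hpf.exists_sorted_base hL₁ j hft hff'.1 hff'.2 b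
  exact ⟨f', _, hr.trans hr', hpf', by omega, by omega, hb, hs⟩

/-- The flip reverses the slope of three bonds, and the next bond keeps the old slope. -/
theorem RowProper.swapInner_flexible (hL₁ : 20 ≤ L₁) (hL₂ : 20 ≤ L₂) {ε : ZMod 3} (hε : ε ≠ 0)
    (hs : ∀ i, h (i + 1, j) - h (i, j) = ε) (i : ℤ) :
    Flexible (_root_.swapInner L₁ L₂ i j h) j := by
  have near : ∀ m : ℤ, |m| ≤ 9 → _ := fun m hm => swapInner_near (h := h) (i := i) (j := j) hL₁ hL₂ hm
  have v0 := near 0 (by norm_num)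
  have v1 := near 1 (by norm_num)
  have v3 := near 3 (by norm_num)
  have v4 := near 4 (by norm_num)
  norm_num at v0 v1 v3 v4
  have s0 := hs i
  have s1 := hs (i + 1)
  have s3 := hs (i + 3)
  rw [show i + 1 + 1 = i + 2 by ring] at s1
  rw [show i + 3 + 1 = i + 4 by ring] at s3
  have a1 : _root_.swapInner L₁ L₂ i j h (i + 1, j) - _root_.swapInner L₁ L₂ i j h (i, j) = ε + ε := by
    rw [v0, v1]; linear_combination s0 + s1
  have a2 : _root_.swapInner L₁ L₂ i j h (i + 3 + 1, j) -
      _root_.swapInner L₁ L₂ i j h (i + 3, j) = ε := by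
    rw [show i + 3 + 1 = i + 4 by ring, v3, v4]; exact s3
  have : ∀ e : Fin 3, e ≠ 0 → (e = 1 ∧ e + e = 2) ∨ (e = 2 ∧ e + e = 1) := by decide
  rcases this ε hε with ⟨e1, e2⟩ | ⟨e1, e2⟩
  · exact ⟨⟨_, a2.trans e1⟩, ⟨_, a1.trans e2⟩⟩
  · exact ⟨⟨_, a1.trans e2⟩, ⟨_, a2.trans e1⟩⟩

theorem RowProper.exists_slope (hp : RowProper h) (hf : ¬Flexible h j) :
    ∃ ε : ZMod 3, ε ≠ 0 ∧ ∀ i, h (i + 1, j) - h (i, j) = ε := by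
  rw [Flexible, not_and_or] at hf
  push Not at hf
  rcases hf with hf | hf
  · exact ⟨2, by decide, fun i => (hp.slope_eq i j).resolve_left (hf i)⟩
  · exact ⟨1, by decide, fun i => (hp.slope_eq i j).resolve_right (hf i)⟩

/-- In a row of constant slope three bonds can be flipped unless the colours above and below are
the two inner colours. -/
theorem RowProper.exists_flip (hL₁ : 20 ≤ L₁) (hL₂ : 20 ≤ L₂) (hh : Twisted L₁ L₂ α β h)
    (hp : RowProper h) {ε : ZMod 3} (hε : ε ≠ 0) (hs : ∀ i, h (i + 1, j) - h (i, j) = ε) (i : ℤ)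
    {c : ZMod 3} (hc : c = h (i + 1, j) ∨ c = h (i + 2, j)) (hu : h (i + 1, j + 1) ≠ c)
    (hd : h (i + 2, j - 1) ≠ c) :
    ∃ h', RowReach L₁ L₂ j h h' ∧ RowProper h' ∧ Flexible h' j := by
  have s0 := hs i
  have s1 := hs (i + 1)
  have s2 := hs (i + 2)
  rw [show i + 1 + 1 = i + 2 by ring] at s1
  rw [show i + 2 + 1 = i + 3 by ring] at s2
  have t3 : (3 : ZMod 3) = 0 := by decide
  have e3 : h (i + 3, j) = h (i, j) := by linear_combination s0 + s1 + s2 + ε * t3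
  have e1 : h (i + 2, j) ≠ h (i, j) := by
    intro he
    have : ∀ e : Fin 3, e ≠ 0 → e + e ≠ 0 := by decide
    exact this ε hε (show ε + ε = 0 by linear_combination he - s0 - s1)
  exact ⟨_, hp.rowReach_swapInner hL₁ hL₂ hh e3 e1 hc hu hd, hp.swapInner hL₁ hL₂ hh e3,
    RowProper.swapInner_flexible hL₁ hL₂ hε hs i⟩

/-- The initial colour of the flexible row j can be chosen freely. It is made equal to that of (-1,
j + 2); then the two tips at the bonds of row j + 1 that are to be flipped have the same colour, and
one inner colour is unobstructed. -/
theorem RowProper.exists_flexible_above (hL₁ : 20 ≤ L₁) (hL₂ : 20 ≤ L₂)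
    (hh : Twisted L₁ L₂ α β h) (hp : RowProper h) (hf : Flexible h j) :
    ∃ h', HeightReach L₁ L₂ h h' ∧ RowProper h' ∧ Flexible h' j ∧ Flexible h' (j + 1) ∧
      ∀ k, ¬((L₂ : ℤ) ∣ k - j) → ¬((L₂ : ℤ) ∣ k - (j + 1)) → Flexible h k → Flexible h' k := by
  by_cases hf1 : Flexible h (j + 1)
  · exact ⟨h, Relation.ReflTransGen.refl, hp, hf, hf1, fun _ _ _ h => h⟩
  have hf' := (hp.flexible_iff hL₁ hh j).1 hf
  obtain ⟨f, hr, hpf, hb, hn, -⟩ :=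
    hp.exists_sorted_base hL₁ j hh hf'.1 hf'.2 (h (-1, j + 2))
  have hft := hr.1.twisted hh
  have hff : Flexible f j := (hpf.flexible_iff hL₁ hft j).2 (by rw [hn]; exact hf')
  have nd : ∀ m : ℤ, |m| ≤ 9 → m ≠ 0 → ¬((L₂ : ℤ) ∣ m) := fun m hm h0 hd =>
    h0 (Int.eq_zero_of_abs_lt_dvd hd (by omega))
  obtain ⟨ε, hε, hs⟩ := hp.exists_slope hf1
  have row1 : ∀ i, f (i, j + 1) = h (i, j + 1) := fun i =>
    hr.2 _ _ (nd _ (by simp) (by simp))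
  have hs' : ∀ i, f (i + 1, j + 1) - f (i, j + 1) = ε := fun i => by
    rw [row1, row1]; exact hs i
  have hu : f (-1, j + 2) = h (-1, j + 2) := hr.2 _ _ (nd _ (by simp) (by simp))
  obtain ⟨c, hc, hcu⟩ : ∃ c, (c = f (-2 + 1, j + 1) ∨ c = f (-2 + 2, j + 1)) ∧
      h (-1, j + 2) ≠ c := by
    by_cases hx : h (-1, j + 2) = f (-2 + 1, j + 1)
    · refine ⟨_, Or.inr rfl, fun he => ?_⟩
      have := hpf (-1) (j + 1)
      norm_num at this he hx
      exact this (he.symm.trans hx)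
    · exact ⟨_, Or.inl rfl, hx⟩
  obtain ⟨h', hr', hp', hf2⟩ := hpf.exists_flip hL₁ hL₂ hft hε hs' (-2) hc
    (by rw [show ((-2 : ℤ) + 1, j + 1 + 1) = (-1, j + 2) by ring_nf, hu]; exact hcu)
    (by rw [show ((-2 : ℤ) + 2, j + 1 - 1) = (0, j) by ring_nf, hb]; exact hcu)
  exact ⟨h', hr.1.trans hr'.1, hp', hr'.flexible (nd _ (by simp) (by simp)) hff, hf2,
    fun k h1 h2 hk => hr'.flexible h2 (hr.flexible h1 hk)⟩

/-- If every row has constant slope and no three bonds of any row can be flipped, then at each place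
the two tips have the two different inner colours. These conditions make the height affine, with the
slopes of a crystal. -/
theorem RowProper.exists_flexible (hL₁ : 20 ≤ L₁) (hL₂ : 20 ≤ L₂)
    (hh : Twisted L₁ L₂ α β h) (hp : RowProper h) (hc : ¬IsCrystalHeight h) :
    ∃ h' j, HeightReach L₁ L₂ h h' ∧ RowProper h' ∧ Flexible h' j := by
  by_cases hf : ∃ j, Flexible h j
  · obtain ⟨j, hf⟩ := hf
    exact ⟨h, j, Relation.ReflTransGen.refl, hp, hf⟩
  push Not at hf
  choose ε hε hs using fun j => hp.exists_slope (hf j)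
  by_contra hcon
  have blocked : ∀ i j c, (c = h (i + 1, j) ∨ c = h (i + 2, j)) →
      h (i + 1, j + 1) = c ∨ h (i + 2, j - 1) = c := by
    intro i j c h1
    by_contra h2
    rw [not_or] at h2
    obtain ⟨h', hr, hp', hf'⟩ := hp.exists_flip hL₁ hL₂ hh (hε j) (hs j) i h1 h2.1 h2.2
    exact hcon ⟨h', j, hr.1, hp', hf'⟩
  have alt : ∀ i j, (h (i + 1, j + 1) = h (i + 1, j) ∧ h (i + 2, j - 1) = h (i + 2, j)) ∨
      (h (i + 1, j + 1) = h (i + 2, j) ∧ h (i + 2, j - 1) = h (i + 1, j)) := by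
    intro i j
    have b1 := blocked i j _ (Or.inl rfl)
    have b2 := blocked i j _ (Or.inr rfl)
    have hne := hp (i + 1) j
    rw [show i + 1 + 1 = i + 2 by ring] at hne
    grind
  refine hc ?_
  have up : ∀ i j, h (i, j + 1) - h (i, j) = 0 ∨ h (i, j + 1) - h (i, j) = ε j := by
    intro i j
    have s := hs j i
    have := alt (i - 1) j
    rw [sub_add_cancel, show i - 1 + 2 = i + 1 by ring] at this
    rcases this with h1 | h1
    · exact Or.inl (by linear_combination h1.1)
    · exact Or.inr (by linear_combination h1.1 + s)
  -- The difference between rows j + 1 and j takes only the two values 0 and ε j. If the slopes of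
  -- the rows differed, it would run through all of ℤ₃.
  have heps : ∀ j, ε (j + 1) = ε j := by
    intro j
    have u0 := up 0 j
    have u1 := up 1 j
    have u2 := up 2 j
    have s0 := hs j 0
    have s1 := hs j 1
    have s0' := hs (j + 1) 0
    have s1' := hs (j + 1) 1
    norm_num at s0 s1 s0' s1'
    have d1 : h (1, j + 1) - h (1, j) = h (0, j + 1) - h (0, j) + (ε (j + 1) - ε j) := by
      linear_combination s0' - s0
    have d2 : h (2, j + 1) - h (2, j) = h (0, j + 1) - h (0, j) + (ε (j + 1) - ε j) * 2 := by
      linear_combination s0' - s0 + s1' - s1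
    rw [d1] at u1
    rw [d2] at u2
    have : ∀ D e e' : Fin 3, e ≠ 0 → e' ≠ 0 → (D = 0 ∨ D = e) →
      (D + (e' - e) = 0 ∨ D + (e' - e) = e) →
      (D + (e' - e) * 2 = 0 ∨ D + (e' - e) * 2 = e) → e' = e := by decide
    exact this _ (ε j) (ε (j + 1)) (hε j) (hε _) u0 u1 u2
  have hconst : ∀ j, ε j = ε 0 := by
    intro j
    induction j using Int.induction_on with
    | zero => rfl
    | succ n ih => rw [heps, ih]
    | pred n ih => rw [← ih, ← heps (-n - 1), sub_add_cancel]
  -- In both alternatives the colours of the tips above and below change in step, so the vertical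
  -- difference is the same on both sides of row j.
  have hD : ∀ i j, h (i, j + 1) - h (i, j) = h (i, j) - h (i, j - 1) := by
    intro i j
    have a := alt (i - 1) j
    have s1 := hs j i
    rw [sub_add_cancel, show i - 1 + 2 = i + 1 by ring] at a
    have sj2 := hs (j - 1) i
    rw [hconst] at sj2 s1
    rcases a with ⟨a1, a2⟩ | ⟨a1, a2⟩
    · linear_combination a1 + a2 - sj2 + s1
    · linear_combination a1 + a2 - sj2 + s1
  have hD1 : ∀ i j, h (i, j + 1) - h (i, j) = h (0, j + 1) - h (0, j) := by
    intro i j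
    have : ∀ i, h (i + 1, j + 1) - h (i + 1, j) = h (i, j + 1) - h (i, j) := fun i => by
      have s1 := hs j i
      have s2 := hs (j + 1) i
      rw [hconst] at s1 s2
      linear_combination s2 - s1
    induction i using Int.induction_on with
    | zero => rfl
    | succ n ih => rw [this, ih]
    | pred n ih => rw [← ih, ← this (-n - 1), sub_add_cancel]
  have hD2 : ∀ i j, h (i, j + 1) - h (i, j) = h (0, 1) - h (0, 0) := by
    intro i j
    rw [hD1]
    induction j using Int.induction_on with
    | zero => rw [zero_add]
    | succ n ih => rw [hD, add_sub_cancel_right, ih]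
    | pred n ih => rw [← ih, hD 0 (-n), sub_add_cancel]
  have hDv := up 0 0
  rw [zero_add] at hDv
  refine ⟨![-ε 0, ε 0 - (h (0, 1) - h (0, 0)), h (0, 1) - h (0, 0)], ?_, ?_⟩
  · have e0 := hε 0
    generalize h (0, 1) - h (0, 0) = D at hDv ⊢
    generalize ε 0 = e at hDv e0 ⊢
    revert D e
    have : ∀ D : Fin 3, ∀ e : Fin 3, D = 0 ∨ D = e → e ≠ 0 →
        Function.Injective ![-e, e - D, D] := by decide
    exact this
  · rintro ⟨i, j⟩ d
    have s1 := hs j i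
    rw [hconst] at s1
    have d1 := hD2 i (j - 1)
    have d2 := hD2 (i - 1) j
    have s2 := hs j (i - 1)
    rw [hconst] at s2
    rw [sub_add_cancel] at d1 s2
    fin_cases d <;> simp [latVec]
    · linear_combination -s1
    · rw [← sub_eq_add_neg]; linear_combination s2 - d2
    · rw [← sub_eq_add_neg]; exact d1

end Rows

/-! ### Canonical height functions, isolated crystals and connectedness -/

section Rows

set_option linter.unusedSectionVars false

variable {L₁ L₂ : ℕ} {α β : ZMod 3} {h h' h'' : ℤ × ℤ → ZMod 3} {i j : ℤ}

theorem not_dvd_of_abs_lt {L : ℕ} {m : ℤ} (hm : |m| < L) (h0 : m ≠ 0) : ¬((L : ℤ) ∣ m) :=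
  fun hd => h0 (Int.eq_zero_of_abs_lt_dvd hd hm)

theorem RowProper.exists_all_flexible (hL₁ : 20 ≤ L₁) (hL₂ : 20 ≤ L₂)
    (hh : Twisted L₁ L₂ α β h) (hp : RowProper h) (hf : Flexible h j) :
    ∃ h', HeightReach L₁ L₂ h h' ∧ RowProper h' ∧ ∀ k, Flexible h' k := by
  have key : ∀ t : ℕ, t < L₂ → ∃ h', HeightReach L₁ L₂ h h' ∧ RowProper h' ∧
      ∀ k, j ≤ k → k ≤ j + t → Flexible h' k := by
    intro t
    induction t with
    | zero =>
      refine fun _ => ⟨h, Relation.ReflTransGen.refl, hp, fun k h1 h2 => ?_⟩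
      rwa [show k = j by push_cast at h2; omega]
    | succ t ih =>
      intro ht
      obtain ⟨f, hr, hpf, hff⟩ := ih (by omega)
      obtain ⟨h', hr', hp', hf0, hf1, hf2⟩ := hpf.exists_flexible_above hL₁ hL₂
        (hr.twisted hh) (hff (j + t) (by omega) (by omega))
      refine ⟨h', hr.trans hr', hp', fun k h1 h2 => ?_⟩
      push_cast at h2
      by_cases e1 : k = j + t
      · exact e1 ▸ hf0
      by_cases e2 : k = j + t + 1
      · exact e2 ▸ hf1
      exact hf2 k (not_dvd_of_abs_lt (abs_lt.2 ⟨by omega, by omega⟩) (by omega))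
        (not_dvd_of_abs_lt (abs_lt.2 ⟨by omega, by omega⟩) (by omega)) (hff k h1 (by omega))
  obtain ⟨h', hr, hp', hf'⟩ := key (L₂ - 1) (by omega)
  refine ⟨h', hr, hp', fun k => ?_⟩
  have hpos : (0 : ℤ) < L₂ := by omega
  have h1 := Int.emod_nonneg (k - j) hpos.ne'
  have h2 := Int.emod_lt_of_pos (k - j) hpos
  refine Flexible.of_dvd (hr.twisted hh) ?_ (hf' (j + (k - j) % L₂) (by omega) (by omega))
  rw [← sub_sub]
  exact Int.dvd_self_sub_emod

theorem RowProper.exists_all_canonical (hL₁ : 20 ≤ L₁) (hL₂ : 20 ≤ L₂)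
    (hh : Twisted L₁ L₂ α β h) (hp : RowProper h) (hf : ∀ k, Flexible h k) :
    ∃ h', HeightReach L₁ L₂ h h' ∧ RowProper h' ∧
      ∀ k : ℕ, k < L₂ → ∃ n, 0 < n ∧ n ≤ 3 ∧ RowCanonical L₁ h' 0 k n := by
  have key : ∀ t : ℕ, t ≤ L₂ → ∃ h', HeightReach L₁ L₂ h h' ∧ RowProper h' ∧
      (∀ k : ℕ, k < t → ∃ n, 0 < n ∧ n ≤ 3 ∧ RowCanonical L₁ h' 0 k n) ∧
      ∀ k : ℕ, t ≤ k → k < L₂ → Flexible h' k := by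
    intro t
    induction t with
    | zero =>
      exact fun _ => ⟨h, Relation.ReflTransGen.refl, hp, fun k hk => absurd hk (Nat.not_lt_zero k),
        fun k _ _ => hf k⟩
    | succ t ih =>
      intro ht
      obtain ⟨f, hr, hpf, hfc, hff⟩ := ih (by omega)
      obtain ⟨h', n, hr', hp', hn0, hn3, hc⟩ := hpf.exists_canonical hL₁ hL₂ (hr.twisted hh) t
        (hff t le_rfl ht) 0
      have nd : ∀ k : ℕ, k < L₂ → k ≠ t → ¬((L₂ : ℤ) ∣ (k : ℤ) - t) := fun k hk hne =>
        not_dvd_of_abs_lt (abs_lt.2 ⟨by omega, by omega⟩) (by omega)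
      refine ⟨h', hr.trans hr'.1, hp', fun k hk => ?_, fun k h1 h2 =>
        hr'.flexible (nd k h2 (by omega)) (hff k (by omega) h2)⟩
      by_cases e : k = t
      · exact ⟨n, hn0, hn3, e ▸ hc⟩
      · obtain ⟨m, hm0, hm3, hm⟩ := hfc k (by omega)
        exact ⟨m, hm0, hm3, hr'.rowCanonical (nd k (by omega) e) hm⟩
  obtain ⟨h', hr, hp', hc, -⟩ := key L₂ le_rfl
  exact ⟨h', hr, hp', hc⟩

theorem RowCanonical.apply (hp : RowProper h) {b : ZMod 3} {n : ℕ} (hc : RowCanonical L₁ h b j n)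
    (k : ℕ) (hk : k ≤ L₁) : h (k, j) = b + 2 * k - (min k n : ℕ) := by
  induction k with
  | zero => simpa using hc.1
  | succ k ih =>
    have h1 := ih (by omega)
    have h2 := hc.2 k (by omega)
    push_cast
    by_cases hkn : k < n
    · have := h2.1 (by exact_mod_cast hkn)
      rw [min_eq_left hkn.le] at h1
      rw [min_eq_left (by omega)]
      push_cast
      linear_combination this + h1
    · have := (hp.slope_eq k j).resolve_left fun hc => hkn (by exact_mod_cast h2.2 hc)
      rw [min_eq_right (by omega)] at h1
      rw [min_eq_right (by omega)]
      linear_combination this + h1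

/-- The height gained along a row with n ascents is 2 L₁ - n, which must equal α. So n is known
modulo 3, and 1, 2, 3 represent each class once. -/
theorem Twisted.eq_of_canonical (hL₁ : 20 ≤ L₁) (hL₂ : 20 ≤ L₂) (hh : Twisted L₁ L₂ α β h)
    (hh' : Twisted L₁ L₂ α β h') (hp : RowProper h) (hp' : RowProper h')
    (hc : ∀ k : ℕ, k < L₂ → ∃ n, 0 < n ∧ n ≤ 3 ∧ RowCanonical L₁ h 0 k n)
    (hc' : ∀ k : ℕ, k < L₂ → ∃ n, 0 < n ∧ n ≤ 3 ∧ RowCanonical L₁ h' 0 k n) : h = h' := by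
  have box : ∀ i j : ℕ, i < L₁ → j < L₂ → h (i, j) = h' (i, j) := by
    intro i j hi hj
    obtain ⟨n, hn0, hn3, hn⟩ := hc j hj
    obtain ⟨m, hm0, hm3, hm⟩ := hc' j hj
    lift n to ℕ using hn0.le
    lift m to ℕ using hm0.le
    have e1 := hn.apply hp L₁ le_rfl
    have e2 := hm.apply hp' L₁ le_rfl
    have t1 := (hh 0 j).1
    have t2 := (hh' 0 j).1
    rw [zero_add] at t1 t2
    rw [t1, hn.1, min_eq_right (by omega)] at e1
    rw [t2, hm.1, min_eq_right (by omega)] at e2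
    have hnm : (n : ZMod 3) = m := by linear_combination e1 - e2
    obtain rfl : n = m := by
      rw [ZMod.natCast_eq_natCast_iff'] at hnm
      omega
    rw [hn.apply hp i hi.le, hm.apply hp' i hi.le]
  funext ⟨i, j⟩
  have p1 : (0 : ℤ) < L₁ := by omega
  have p2 : (0 : ℤ) < L₂ := by omega
  have e1 := hh.add_mul (i % L₁) (j % L₂) (i / L₁) (j / L₂)
  have e2 := hh'.add_mul (i % L₁) (j % L₂) (i / L₁) (j / L₂)
  rw [Int.emod_add_mul_ediv, Int.emod_add_mul_ediv] at e1 e2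
  have a1 := Int.emod_nonneg i p1.ne'
  have a2 := Int.emod_lt_of_pos i p1
  have b1 := Int.emod_nonneg j p2.ne'
  have b2 := Int.emod_lt_of_pos j p2
  have := box (i % L₁).toNat (j % L₂).toNat (by omega) (by omega)
  rw [Int.toNat_of_nonneg a1, Int.toNat_of_nonneg b1] at this
  rw [e1, e2, this]

/-- In a crystal, going around any point, each of the two other colours occurs on two consecutive
neighbours. Thus no recolouring is possible. -/
theorem HeightStep.eq_of_isCrystal (hL₁ : 20 ≤ L₁) (hL₂ : 20 ≤ L₂) (hs : HeightStep L₁ L₂ h h')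
    (hc : IsCrystalHeight h) : h' = h := by
  obtain ⟨-, hm, ⟨m, n⟩, δ, rfl⟩ := hs
  suffices δ = 0 by
    subst this
    funext x
    simp [bump]
  obtain ⟨a, ha, hd⟩ := hc
  by_contra hδ
  have t1 := (hm m n).1
  have t2 := (hm m n).2
  have t3 := (hm (m - 1) n).1
  have t4 := (hm m (n - 1)).2
  have t5 := (hm m (n - 1)).1
  have t6 := (hm (m + 1) (n - 1)).2
  rw [sub_add_cancel] at t3 t4 t5 t6
  rw [add_sub_cancel_right] at t6
  have near : ∀ x y : ℤ, |x - m| ≤ 14 → |y - n| ≤ 14 → _ := fun x y hx hy =>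
    bump_near (h := h) hL₁ hL₂ δ hx hy
  have v0 := near m n (by simp) (by simp)
  have v1 := near (m + 1) n (by simp) (by simp)
  have v2 := near m (n + 1) (by simp) (by simp)
  have v3 := near (m - 1) (n + 1) (by simp) (by simp)
  have v4 := near (m - 1) n (by simp) (by simp)
  have v5 := near m (n - 1) (by simp) (by simp)
  have v6 := near (m + 1) (n - 1) (by simp) (by simp)
  simp only [and_self, if_true, add_eq_left, sub_eq_self, one_ne_zero, false_and, and_false, if_false] at v0 v1 v2 v3 v4 v5 v6
  have d1 := hd (m, n) 0
  have d2 := hd (m, n + 1) 2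
  have d3 := hd (m, n) 1
  have d4 := hd (m - 1, n) 0
  have d5 := hd (m, n) 2
  have d6 := hd (m + 1, n - 1) 1
  simp [latVec] at d1 d2 d3 d4 d5 d6
  rw [← sub_eq_add_neg] at d3 d5
  have w1 : h (m + 1, n) = h (m, n) - a 0 := by linear_combination -d1
  have w2 : h (m, n + 1) = h (m, n) + a 2 := by linear_combination d2
  have w3 : h (m - 1, n + 1) = h (m, n) - a 1 := by linear_combination -d3
  have w4 : h (m - 1, n) = h (m, n) + a 0 := by linear_combination d4
  have w5 : h (m, n - 1) = h (m, n) - a 2 := by linear_combination -d5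
  have w6 : h (m + 1, n - 1) = h (m, n) + a 1 := by linear_combination d6
  rw [v0, v1, v2, w1, w2] at t1
  rw [v0, v2, v3, w2, w3] at t2
  rw [v0, v4, v3, w4, w3] at t3
  rw [v0, v4, v5, w4, w5] at t4
  rw [v0, v5, v6, w5, w6] at t5
  rw [v0, v6, v1, w6, w1] at t6
  have i1 : a 0 ≠ a 1 := fun e => absurd (ha e) (by decide)
  have i2 : a 0 ≠ a 2 := fun e => absurd (ha e) (by decide)
  have i3 : a 1 ≠ a 2 := fun e => absurd (ha e) (by decide)
  clear v0 v1 v2 v3 v4 v5 v6 d1 d2 d3 d4 d5 d6 w1 w2 w3 w4 w5 w6 near hm hd ha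
  generalize h (m, n) = x at *
  generalize a 0 = a0 at *
  generalize a 1 = a1 at *
  generalize a 2 = a2 at *
  -- Each alternative is one of the six triangles around the point that would become monochromatic
  -- for the change `δ`.
  have fin : ∀ a0 a1 a2 δ : Fin 3, a0 ≠ a1 → a0 ≠ a2 → a1 ≠ a2 → δ ≠ 0 →
      (δ = -a0 ∧ δ = a2) ∨ (δ = a2 ∧ δ = -a1) ∨ (δ = a0 ∧ δ = -a1) ∨ (δ = -a2 ∧ δ = a0) ∨
      (δ = -a2 ∧ δ = a1) ∨ (δ = a1 ∧ δ = -a0) := by decide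
  have key : (δ = -a0 ∧ δ = a2) ∨ (δ = a2 ∧ δ = -a1) ∨ (δ = a0 ∧ δ = -a1) ∨
      (δ = -a2 ∧ δ = a0) ∨ (δ = -a2 ∧ δ = a1) ∨ (δ = a1 ∧ δ = -a0) := fin a0 a1 a2 δ i1 i2 i3 hδ
  rcases key with ⟨e1, e2⟩ | ⟨e1, e2⟩ | ⟨e1, e2⟩ | ⟨e1, e2⟩ | ⟨e1, e2⟩ |
    ⟨e1, e2⟩
  · exact t1 ⟨by linear_combination e1, by linear_combination e2⟩
  · exact t2 ⟨by linear_combination e1, by linear_combination e2⟩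
  · exact t3 ⟨by linear_combination -e1, by linear_combination e2 - e1⟩
  · exact t4 ⟨by linear_combination -e1, by linear_combination e2 - e1⟩
  · exact t5 ⟨by linear_combination e2 - e1, by linear_combination -e1⟩
  · exact t6 ⟨by linear_combination e2 - e1, by linear_combination -e1⟩

theorem HeightStep.isCrystal (hL₁ : 20 ≤ L₁) (hL₂ : 20 ≤ L₂) (hs : HeightStep L₁ L₂ h h')
    (hc : IsCrystalHeight h) : IsCrystalHeight h' := hs.eq_of_isCrystal hL₁ hL₂ hc ▸ hc

theorem HeightReach.isCrystal_iff (hL₁ : 20 ≤ L₁) (hL₂ : 20 ≤ L₂) (hr : HeightReach L₁ L₂ h h') :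
    IsCrystalHeight h ↔ IsCrystalHeight h' := by
  induction hr with
  | refl => rfl
  | tail _ hs ih =>
    exact ih.trans ⟨hs.isCrystal hL₁ hL₂, hs.symm.isCrystal hL₁ hL₂⟩

/-- Two admissible height functions with the same periods that are not crystals can be deformed
into each other. -/
theorem heightReach_of_not_isCrystal [NeZero L₁] [NeZero L₂] (hL₁ : 20 ≤ L₁) (hL₂ : 20 ≤ L₂)
    (hh : Twisted L₁ L₂ α β h) (hh' : Twisted L₁ L₂ α β h') (hm : NoMono h) (hm' : NoMono h')
    (hc : ¬IsCrystalHeight h) (hc' : ¬IsCrystalHeight h') : HeightReach L₁ L₂ h h' := by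
  -- Since moves are reversible, it is enough to move every height function to a canonical one.
  have key : ∀ h, Twisted L₁ L₂ α β h → NoMono h → ¬IsCrystalHeight h → ∃ f,
      HeightReach L₁ L₂ h f ∧ RowProper f ∧
        ∀ k : ℕ, k < L₂ → ∃ n, 0 < n ∧ n ≤ 3 ∧ RowCanonical L₁ f 0 k n := by
    intro h hh hm hc
    obtain ⟨f, hf, hp | hfc⟩ := exists_heightReach_rowProper hL₁ hL₂ hh hm
    · have hfn : ¬IsCrystalHeight f := fun h => hc ((hf.isCrystal_iff hL₁ hL₂).2 h)
      obtain ⟨f1, j, hf1, hp1, hx1⟩ := hp.exists_flexible hL₁ hL₂ (hf.twisted hh) hfn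
      have ht1 := hf1.twisted (hf.twisted hh)
      obtain ⟨f2, hf2, hp2, hx2⟩ := hp1.exists_all_flexible hL₁ hL₂ ht1 hx1
      obtain ⟨f3, hf3, hp3, hx3⟩ := hp2.exists_all_canonical hL₁ hL₂ (hf2.twisted ht1) hx2
      exact ⟨f3, ((hf.trans hf1).trans hf2).trans hf3, hp3, hx3⟩
    · exact absurd ((hf.isCrystal_iff hL₁ hL₂).2 hfc) hc
  obtain ⟨f, hf, hp, hx⟩ := key h hh hm hc
  obtain ⟨f', hf', hp', hx'⟩ := key h' hh' hm' hc'
  obtain rfl := (hf.twisted hh).eq_of_canonical hL₁ hL₂ (hf'.twisted hh') hp hp' hx hx'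
  exact hf.trans hf'.symm

/-- The canonical height function with given periods. -/
def canonicalHeight (L₁ L₂ : ℕ) (α β : ZMod 3) (n : ℕ) (x : ℤ × ℤ) : ZMod 3 :=
  β * (x.2 / L₂ : ℤ) + α * (x.1 / L₁ : ℤ) + 2 * (x.1 % L₁ : ℤ) - (min (x.1 % L₁) n : ℤ)

/-- The canonical height function itself: choosing n in {1, 2, 3} with n = 2 L₁ - α gives the
prescribed twist, and a row with both slopes does not belong to a crystal. -/
theorem exists_not_isCrystal (hL₁ : 20 ≤ L₁) (hL₂ : 20 ≤ L₂) (α β : ZMod 3) :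
    ∃ h, Twisted L₁ L₂ α β h ∧ NoMono h ∧ ¬IsCrystalHeight h := by
  have p1 : (0 : ℤ) < L₁ := by omega
  have p2 : (0 : ℤ) < L₂ := by omega
  obtain ⟨n, hn0, hn3, hn⟩ : ∃ n : ℕ, 0 < n ∧ n ≤ 3 ∧ (n : ZMod 3) = 2 * L₁ - α := by
    refine ⟨if (2 * L₁ - α : ZMod 3) = 0 then 3 else (2 * L₁ - α : ZMod 3).val, ?_, ?_, ?_⟩ <;>
      split_ifs with h0
    · omega
    · exact Nat.pos_of_ne_zero fun h => h0 ((ZMod.val_eq_zero _).1 h)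
    · omega
    · exact (ZMod.val_lt _).le
    · rw [h0]; decide
    · rw [ZMod.natCast_val, ZMod.cast_id]
  have t3 : (3 : ZMod 3) = 0 := by decide
  have slope : ∀ i j, canonicalHeight L₁ L₂ α β n (i + 1, j) - canonicalHeight L₁ L₂ α β n (i, j) =
      if i % L₁ < n then 1 else 2 := by
    intro i j
    have a1 := Int.emod_nonneg i p1.ne'
    have a2 := Int.emod_lt_of_pos i p1
    have e := Int.emod_add_mul_ediv i L₁
    -- At the seam of the fundamental domain the increase of the quotient contributes α, which by
    -- the choice of n makes the slope equal to 2, as at other descents.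
    by_cases hlast : i % L₁ + 1 = L₁
    · have d := Int.ediv_emod_unique p1 (a := i + 1) (r := 0) (q := i / L₁ + 1)
      obtain ⟨d1, d2⟩ := d.2 ⟨by linear_combination e - hlast, le_rfl, p1⟩
      rw [if_neg (by omega)]
      simp only [canonicalHeight, d1, d2]
      rw [min_eq_left (by omega), min_eq_right (by omega)]
      have hl : ((i % L₁ : ℤ) : ZMod 3) = L₁ - 1 := by
        rw [eq_sub_of_add_eq hlast]; push_cast; ring
      rw [hl]
      push_cast
      linear_combination hn
    · obtain ⟨d1, d2⟩ := (Int.ediv_emod_unique p1 (a := i + 1) (r := i % L₁ + 1) (q := i / L₁)).2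
        ⟨by linear_combination e, by omega, by omega⟩
      simp only [canonicalHeight, d1, d2]
      split_ifs with hlt
      · rw [min_eq_left (by omega), min_eq_left (by omega)]; push_cast; ring
      · rw [min_eq_right (by omega), min_eq_right (by omega)]; push_cast; ring
  refine ⟨canonicalHeight L₁ L₂ α β n, fun i j => ?_, RowProper.noMono fun i j hc => ?_, ?_⟩
  · simp only [canonicalHeight, Int.add_emod_right, Int.add_ediv_of_dvd_right (dvd_refl _),
      Int.ediv_self p1.ne', Int.ediv_self p2.ne']
    constructor <;> push_cast <;> ring
  · have := slope i j
    rw [hc, sub_self] at this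
    split_ifs at this <;> exact absurd this (by decide)
  · rintro ⟨a, -, ha⟩
    have h1 := slope 0 0
    have h2 := slope ((L₁ : ℤ) - 1) 0
    rw [if_pos (by simpa using hn0)] at h1
    rw [Int.emod_eq_of_lt (by omega) (by omega), if_neg (by omega)] at h2
    have e1 := ha (0, 0) 0
    have e2 := ha ((L₁ : ℤ) - 1, 0) 0
    simp only [latVec, Matrix.cons_val_zero, Prod.mk_add_mk, add_zero] at e1 e2
    have : (1 : ZMod 3) = 2 := by linear_combination e2 + h2 - e1 - h1
    exact absurd this (by decide)

end Rows

/-! ### Loop configurations and height functions -/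

section Loops

set_option linter.unusedSectionVars false

variable {L₁ L₂ : ℕ} {α β : ZMod 3} {h h' : ℤ × ℤ → ZMod 3} {l l' : Site L₁ L₂ → ZMod 3}

theorem red_add (x y : ℤ × ℤ) : red L₁ L₂ (x + y) = red L₁ L₂ x + red L₁ L₂ y := by simp [red]

theorem red_sub (x y : ℤ × ℤ) : red L₁ L₂ (x - y) = red L₁ L₂ x - red L₁ L₂ y := by simp [red]

theorem red_zero : red L₁ L₂ 0 = 0 := by simp [red]

/-- The three values of the loop variables around a triangle add up to zero, and do not all vanish. -/
def TriangleValid (f : Fin 3 → ZMod 3) : Prop := ∑ k, f k = 0 ∧ ∃ k, f k ≠ 0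

/-- Loop configurations that occur in the network states. -/
def LoopValid (l : Site L₁ L₂ → ZMod 3) : Prop :=
  ∀ p, TriangleValid (fun k => l (wrap p (upCorner 0 k))) ∧
    TriangleValid (fun k => l (wrap p (downCorner 0 k)))

/-- Elementary change of a loop configuration around a hexagon. -/
def hexMove (p : ZMod L₁ × ZMod L₂) (δ : ZMod 3) (l : Site L₁ L₂ → ZMod 3) :
    Site L₁ L₂ → ZMod 3 :=
  fun x => l x + (if x.1 = p then δ else 0) - if x.1 + red L₁ L₂ (latVec x.2) = p then δ else 0

/-- Elementary changes between admissible loop configurations. -/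
def LoopStep (l l' : Site L₁ L₂ → ZMod 3) : Prop :=
  LoopValid l ∧ LoopValid l' ∧ ∃ p δ, l' = hexMove p δ l

/-- The crystalline loop configurations. -/
def crystalLoop (L₁ L₂ : ℕ) (e : Equiv.Perm (Fin 3)) : Site L₁ L₂ → ZMod 3 :=
  fun x => (((e x.2 : Fin 3) : ℕ) : ZMod 3)

/-- `h` is a height function of the loop configuration `l`. -/
def IsHeightOf (h : ℤ × ℤ → ZMod 3) (l : Site L₁ L₂ → ZMod 3) : Prop :=
  ∀ q d, l (red L₁ L₂ q, d) = h q - h (q + latVec d)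

theorem IsHeightOf.bump (hl : IsHeightOf h l) (q : ℤ × ℤ) (δ : ZMod 3) :
    IsHeightOf (bump L₁ L₂ q δ h) (hexMove (red L₁ L₂ q) δ l) := by
  intro x d
  simp only [hexMove, _root_.bump, hl x d, red_add]
  ring

theorem IsHeightOf.eq [NeZero L₁] [NeZero L₂] (hl : IsHeightOf h l) (hl' : IsHeightOf h l') :
    l = l' := by
  funext ⟨x, d⟩
  rw [← red_torusLift x, hl, hl']

theorem triangleValid_iff {f : Fin 3 → ZMod 3} {a b c : ZMod 3} (h0 : f 0 = a - b)
    (h1 : f 1 = b - c) (h2 : f 2 = c - a) : TriangleValid f ↔ ¬(a = b ∧ a = c) := by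
  constructor
  · rintro ⟨-, k, hk⟩ ⟨rfl, rfl⟩
    fin_cases k
    · exact hk (h0.trans (sub_self _))
    · exact hk (h1.trans (sub_self _))
    · exact hk (h2.trans (sub_self _))
  · intro hne
    refine ⟨by rw [Fin.sum_univ_three, h0, h1, h2]; ring, ?_⟩
    by_contra hcon
    push Not at hcon
    refine hne ⟨sub_eq_zero.1 (h0.symm.trans (hcon 0)), (sub_eq_zero.1 (h2.symm.trans (hcon 2))).symm⟩

theorem IsHeightOf.up_iff (hl : IsHeightOf h l) (i j : ℤ) :
    TriangleValid (fun k => l (wrap (red L₁ L₂ (i, j)) (upCorner 0 k))) ↔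
      ¬(h (i, j) = h (i + 1, j) ∧ h (i, j) = h (i, j + 1)) := by
  apply triangleValid_iff
  · simp [wrap, upCorner, red_zero, hl _ _, latVec]
  all_goals
    simp only [wrap, upCorner, Matrix.cons_val, ← red_add, hl _ _]
    simp [latVec]

theorem IsHeightOf.down_iff (hl : IsHeightOf h l) (i j : ℤ) :
    TriangleValid (fun k => l (wrap (red L₁ L₂ (i, j + 1)) (downCorner 0 k))) ↔
      ¬(h (i, j) = h (i, j + 1) ∧ h (i, j) = h (i - 1, j + 1)) := by
  have e0 : l (wrap (red L₁ L₂ (i, j + 1)) (downCorner 0 0)) =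
      h (i - 1, j + 1) - h (i, j + 1) := by
    simp only [wrap, downCorner, Matrix.cons_val, ← red_add, hl _ _]
    simp [latVec, sub_eq_add_neg]
  have e1 : l (wrap (red L₁ L₂ (i, j + 1)) (downCorner 0 1)) =
      h (i, j) - h (i - 1, j + 1) := by
    simp only [wrap, downCorner, Matrix.cons_val, ← red_add, hl _ _]
    simp [latVec, sub_eq_add_neg]
  have e2 : l (wrap (red L₁ L₂ (i, j + 1)) (downCorner 0 2)) =
      h (i, j + 1) - h (i, j) := by
    simp only [wrap, downCorner, Matrix.cons_val, ← red_add, hl _ _]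
    simp [latVec]
  constructor
  · rintro ⟨-, k, hk⟩ ⟨h1, h2⟩
    fin_cases k
    · exact hk (e0.trans (by rw [← h1, ← h2, sub_self]))
    · exact hk (e1.trans (by rw [← h2, sub_self]))
    · exact hk (e2.trans (by rw [← h1, sub_self]))
  · intro hne
    refine ⟨by rw [Fin.sum_univ_three, e0, e1, e2]; ring, ?_⟩
    by_contra hcon
    push Not at hcon
    exact hne ⟨(sub_eq_zero.1 (e2.symm.trans (hcon 2))).symm, sub_eq_zero.1 (e1.symm.trans (hcon 1))⟩

theorem IsHeightOf.loopValid_iff [NeZero L₁] [NeZero L₂] (hl : IsHeightOf h l) :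
    LoopValid l ↔ NoMono h := by
  constructor
  · exact fun hv i j => ⟨(hl.up_iff i j).1 (hv _).1, (hl.down_iff i j).1 (hv _).2⟩
  · intro hm p
    rw [← red_torusLift p]
    refine ⟨(hl.up_iff _ _).2 (hm _ _).1, ?_⟩
    have := (hl.down_iff (torusLift p).1 ((torusLift p).2 - 1)).2 (hm _ _).2
    rwa [sub_add_cancel] at this

theorem exists_antidifference (f : ℤ → ZMod 3) :
    ∃ F : ℤ → ZMod 3, F 0 = 0 ∧ ∀ i, F (i + 1) = F i + f i := by
  refine ⟨fun i => ∑ k ∈ Finset.range i.toNat, f k -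
    ∑ k ∈ Finset.range (-i).toNat, f (-(k + 1)), by simp, fun i => ?_⟩
  rcases lt_or_ge i 0 with hi | hi
  · have e1 : i.toNat = 0 := by omega
    have e2 : (i + 1).toNat = 0 := by omega
    have e3 : (-i).toNat = (-(i + 1)).toNat + 1 := by omega
    have e4 : -(((-(i + 1)).toNat : ℤ) + 1) = i := by omega
    simp only [e1, e2, e3, Finset.sum_range_succ, e4]
    ring
  · have e1 : (-i).toNat = 0 := by omega
    have e2 : (-(i + 1)).toNat = 0 := by omega
    have e3 : (i + 1).toNat = i.toNat + 1 := by omega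
    have e4 : (i.toNat : ℤ) = i := by omega
    simp only [e1, e2, e3, Finset.sum_range_succ, e4]
    ring

theorem eq_of_shift_eq {f : ℤ → ZMod 3} (hf : ∀ i, f (i + 1) = f i) (i : ℤ) : f i = f 0 := by
  induction i using Int.induction_on with
  | zero => rfl
  | succ n ih => rw [hf, ih]
  | pred n ih => rw [← ih, ← hf (-n - 1), sub_add_cancel]

/-- The sum rules of the up and down triangles say that the loop variables are curl-free. They are
integrated along column 0 and then along the rows. -/
theorem LoopValid.exists_height (hl : LoopValid l) :
    ∃ h α β, Twisted L₁ L₂ α β h ∧ IsHeightOf h l := by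
  have up : ∀ i j : ℤ, l (red L₁ L₂ (i, j), 0) + l (red L₁ L₂ (i + 1, j), 1) +
      l (red L₁ L₂ (i, j + 1), 2) = 0 := by
    intro i j
    have := (hl (red L₁ L₂ (i, j))).1.1
    simp only [Fin.sum_univ_three, wrap, upCorner, Matrix.cons_val, ← red_add] at this
    simpa [latVec] using this
  have down : ∀ i j : ℤ, l (red L₁ L₂ (i - 1, j), 0) + l (red L₁ L₂ (i, j - 1), 1) +
      l (red L₁ L₂ (i, j), 2) = 0 := by
    intro i j
    have := (hl (red L₁ L₂ (i, j))).2.1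
    simp only [Fin.sum_univ_three, wrap, downCorner, Matrix.cons_val, ← red_add] at this
    simpa [latVec, sub_eq_add_neg] using this
  obtain ⟨A, -, hA⟩ := exists_antidifference fun j => l (red L₁ L₂ (0, j + 1), 2)
  choose B hB0 hB using fun j => exists_antidifference fun i => -l (red L₁ L₂ (i, j), 0)
  have hx : ∀ i j, A j + B j (i + 1) = A j + B j i - l (red L₁ L₂ (i, j), 0) := fun i j => by
    rw [hB]; ring
  -- Path independence: the defect of the vertical difference is the same in neighbouring columns,
  -- by one up and one down triangle, and vanishes in column 0.
  have hy : ∀ i j, A (j + 1) + B (j + 1) i = A j + B j i + l (red L₁ L₂ (i, j + 1), 2) := by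
    intro i j
    have := eq_of_shift_eq (f := fun i => A (j + 1) + B (j + 1) i - (A j + B j i) -
      l (red L₁ L₂ (i, j + 1), 2)) (fun i => by
        have u := up i j
        have d := down (i + 1) (j + 1)
        rw [add_sub_cancel_right, add_sub_cancel_right] at d
        simp only [hx]
        linear_combination u - d) i
    simp only [hB0, hA] at this
    linear_combination this + hA j
  have per1 : ∀ i j : ℤ, red L₁ L₂ (i + L₁, j) = red L₁ L₂ (i, j) := fun i j => by
    rw [red_eq_iff]; simp
  have per2 : ∀ i j : ℤ, red L₁ L₂ (i, j + L₂) = red L₁ L₂ (i, j) := fun i j => by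
    rw [red_eq_iff]; simp
  refine ⟨fun x => A x.2 + B x.2 x.1, A 0 + B 0 (0 + L₁) - (A 0 + B 0 0),
    A (0 + L₂) + B (0 + L₂) 0 - (A 0 + B 0 0), fun i j => ⟨?_, ?_⟩, ?_⟩
  -- The difference between the shifted and the original height is constant, because both have the
  -- same increments.
  · have e1 := eq_of_shift_eq (f := fun i => A j + B j (i + L₁) - (A j + B j i)) (fun i => by
      simp only [add_right_comm i 1 (L₁ : ℤ), hx, per1]; ring) i
    have e2 := eq_of_shift_eq (f := fun j => A j + B j (0 + L₁) - (A j + B j 0)) (fun j => by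
      simp only [hy, per1]; ring) j
    simp only at e1 e2 ⊢
    linear_combination e1 + e2
  · have e1 := eq_of_shift_eq (f := fun i => A (j + L₂) + B (j + L₂) i - (A j + B j i)) (fun i => by
      simp only [hx, per2]; ring) i
    have e2 := eq_of_shift_eq (f := fun j => A (j + L₂) + B (j + L₂) 0 - (A j + B j 0)) (fun j => by
      simp only [add_right_comm j 1 (L₂ : ℤ), hy]
      rw [show j + (L₂ : ℤ) + 1 = j + 1 + L₂ by ring, per2]; ring) j
    simp only at e1 e2 ⊢
    linear_combination e1 + e2
  · rintro ⟨i, j⟩ d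
    have u := up i j
    have u1 := up (i - 1) j
    have y1 := hy i (j - 1)
    have x1 := hx (i - 1) j
    have y2 := hy (i - 1) j
    rw [sub_add_cancel] at u1 y1 x1
    fin_cases d
    · simp [latVec]
      linear_combination hx i j
    · simp [latVec, ← sub_eq_add_neg]
      linear_combination u1 + y2 - x1
    · simp [latVec, ← sub_eq_add_neg]
      linear_combination -y1

theorem sum_zmod_eq_sum_range {L : ℕ} [NeZero L] (f : ZMod L → ZMod 3) :
    ∑ k, f k = ∑ k ∈ Finset.range L, f (k : ℕ) := by
  obtain ⟨n, rfl⟩ := Nat.exists_eq_succ_of_ne_zero (NeZero.ne L)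
  rw [← Fin.sum_univ_eq_sum_range (fun k : ℕ => f (k : ZMod (n + 1)))]
  exact Finset.sum_congr rfl fun k _ => congrArg f (ZMod.natCast_zmod_val k).symm

variable [NeZero L₁] [NeZero L₂]

theorem IsHeightOf.windingOne (hl : IsHeightOf h l) (hh : Twisted L₁ L₂ α β h) :
    windingOne l = -α := by
  have : ∀ k ∈ Finset.range L₁, l (((k : ℕ), 0), 0) = -(h ((k + 1 : ℕ), 0) - h ((k : ℕ), 0)) :=
    fun k _ => by
      have := hl (k, 0) 0
      simp [red, latVec] at this
      rw [this]; push_cast; ring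
  rw [_root_.windingOne, sum_zmod_eq_sum_range (fun k => l ((k, 0), 0)), Finset.sum_congr rfl this,
    Finset.sum_neg_distrib, Finset.sum_range_sub (fun k : ℕ => h ((k : ℤ), 0))]
  have := (hh 0 0).1
  rw [zero_add] at this
  rw [this]; push_cast; ring

theorem IsHeightOf.windingTwo (hl : IsHeightOf h l) (hh : Twisted L₁ L₂ α β h) :
    windingTwo l = β := by
  have hp : ∀ k : ℕ, l ((0, ((k + 1 : ℕ) : ZMod L₂)), 2) = h (0, ((k + 1 : ℕ) : ℤ)) - h (0, (k : ℤ)) :=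
    fun k => by
      have := hl (0, (k : ℤ) + 1) 2
      simp [red, latVec] at this
      push_cast
      exact this
  have hs : _root_.windingTwo l = ∑ k : ZMod L₂, l ((0, k + 1), 2) :=
    (Equiv.sum_comp (Equiv.addRight (1 : ZMod L₂)) fun k => l ((0, k), 2)).symm
  have hp' : ∀ k ∈ Finset.range L₂, l ((0, (k : ZMod L₂) + 1), 2) =
      h (0, ((k + 1 : ℕ) : ℤ)) - h (0, (k : ℤ)) := fun k _ => by rw [← hp k]; push_cast; rfl
  rw [hs, sum_zmod_eq_sum_range (fun k => l ((0, k + 1), 2)), Finset.sum_congr rfl hp',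
    Finset.sum_range_sub (fun k : ℕ => h (0, (k : ℤ)))]
  have := (hh 0 0).2
  rw [zero_add] at this
  rw [this]; push_cast; ring

theorem exists_isHeightOf (hh : Twisted L₁ L₂ α β h) :
    ∃ l : Site L₁ L₂ → ZMod 3, IsHeightOf h l := by
  refine ⟨fun x => h (torusLift x.1) - h (torusLift x.1 + latVec x.2), fun q d => ?_⟩
  have := hh.diff_eq (red_torusLift (red L₁ L₂ q)) (latVec d)
  simp only
  linear_combination -this

theorem IsHeightOf.isCrystal_iff (hl : IsHeightOf h l) :
    IsCrystalHeight h ↔ ∃ e, l = crystalLoop L₁ L₂ e := by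
  have hinj : Function.Injective fun k : Fin 3 => ((k : ℕ) : ZMod 3) := by decide
  constructor
  · rintro ⟨a, ha, hd⟩
    have hcast : ∀ x : ZMod 3, ∃ k : Fin 3, ((k : ℕ) : ZMod 3) = x := by decide
    choose e he using fun d => hcast (a d)
    have hei : Function.Injective e := fun x y hxy => ha (by rw [← he, ← he, hxy])
    refine ⟨Equiv.ofBijective e (Finite.injective_iff_bijective.1 hei), ?_⟩
    funext ⟨x, d⟩
    rw [← red_torusLift x, hl, hd]
    exact (he d).symm
  · rintro ⟨e, rfl⟩
    exact ⟨fun d => ((e d : ℕ) : ZMod 3), hinj.comp e.injective, fun q d => (hl q d).symm⟩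

theorem HeightReach.loopReach (hr : HeightReach L₁ L₂ h h') (hl : IsHeightOf h l)
    (hl' : IsHeightOf h' l') : Relation.ReflTransGen LoopStep l l' := by
  induction hr generalizing l' with
  | refl => rw [hl.eq hl']
  | @tail f f' _ hs ih =>
    obtain ⟨hm, hm', q, δ, rfl⟩ := hs
    have hf : IsHeightOf f (hexMove (red L₁ L₂ q) (-δ) l') := by
      simpa only [bump_bump_neg] using hl'.bump q (-δ)
    refine (ih hf).tail ⟨hf.loopValid_iff.2 hm, hl'.loopValid_iff.2 hm', red L₁ L₂ q, δ, ?_⟩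
    funext x
    simp only [hexMove]
    split_ifs <;> ring

theorem crystalLoop_valid (e : Equiv.Perm (Fin 3)) : LoopValid (crystalLoop L₁ L₂ e) := by
  have : ∀ e : Equiv.Perm (Fin 3), TriangleValid fun k => ((e k : ℕ) : ZMod 3) := by
    unfold TriangleValid
    decide
  refine fun p => ⟨?_, ?_⟩ <;> convert this e using 2 with k <;>
    (simp only [crystalLoop]; congr 2; fin_cases k <;> rfl)

/-- Two admissible loop configurations with the same winding numbers that are not crystals can be
changed into each other by elementary moves. -/
theorem LoopValid.reach (hL₁ : 20 ≤ L₁) (hL₂ : 20 ≤ L₂) (hl : LoopValid l) (hl' : LoopValid l')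
    (hc : ∀ e, l ≠ crystalLoop L₁ L₂ e) (hc' : ∀ e, l' ≠ crystalLoop L₁ L₂ e)
    (h1 : windingOne l = windingOne l') (h2 : windingTwo l = windingTwo l') :
    Relation.ReflTransGen LoopStep l l' := by
  obtain ⟨h, α, β, hh, hlh⟩ := hl.exists_height
  obtain ⟨h', α', β', hh', hlh'⟩ := hl'.exists_height
  rw [hlh.windingOne hh, hlh'.windingOne hh'] at h1
  rw [hlh.windingTwo hh, hlh'.windingTwo hh'] at h2
  obtain rfl := neg_injective h1
  obtain rfl := h2
  exact (heightReach_of_not_isCrystal hL₁ hL₂ hh hh' (hlh.loopValid_iff.1 hl)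
    (hlh'.loopValid_iff.1 hl') (by rw [hlh.isCrystal_iff]; exact fun ⟨e, he⟩ => hc e he)
    (by rw [hlh'.isCrystal_iff]; exact fun ⟨e, he⟩ => hc' e he)).loopReach hlh hlh'

theorem exists_loopValid (hL₁ : 20 ≤ L₁) (hL₂ : 20 ≤ L₂) (w₁ w₂ : ZMod 3) :
    ∃ l : Site L₁ L₂ → ZMod 3, LoopValid l ∧ (∀ e, l ≠ crystalLoop L₁ L₂ e) ∧
      windingOne l = w₁ ∧ windingTwo l = w₂ := by
  obtain ⟨h, hh, hm, hc⟩ := exists_not_isCrystal hL₁ hL₂ (-w₁) w₂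
  obtain ⟨l, hl⟩ := exists_isHeightOf (L₁ := L₁) (L₂ := L₂) hh
  refine ⟨l, hl.loopValid_iff.2 hm, fun e he => hc (hl.isCrystal_iff.2 ⟨e, he⟩), ?_,
    hl.windingTwo hh⟩
  rw [hl.windingOne hh, neg_neg]

theorem LoopStep.symm (hs : LoopStep l l') : LoopStep l' l := by
  obtain ⟨h1, h2, p, δ, rfl⟩ := hs
  refine ⟨h2, h1, p, -δ, ?_⟩
  funext x
  simp only [hexMove]
  split_ifs <;> ring

theorem LoopStep.eq_of_crystal (hL₁ : 20 ≤ L₁) (hL₂ : 20 ≤ L₂) (hs : LoopStep l l')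
    (hc : ∃ e, l = crystalLoop L₁ L₂ e) : l' = l := by
  obtain ⟨hl, hl', p, δ, rfl⟩ := hs
  obtain ⟨h, α, β, -, hh⟩ := hl.exists_height
  have hh' := hh.bump (torusLift p) δ
  rw [red_torusLift] at hh'
  have := HeightStep.eq_of_isCrystal hL₁ hL₂ ⟨hh.loopValid_iff.1 hl, hh'.loopValid_iff.1 hl', _, _, rfl⟩
    (hh.isCrystal_iff.2 hc)
  rw [this] at hh'
  exact hh'.eq hh

/-- Along the loop the contributions δ and -δ of the move are the same function of the position,
shifted by one, and cancel in the sum. -/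
theorem windingOne_hexMove (p : ZMod L₁ × ZMod L₂) (δ : ZMod 3) :
    windingOne (hexMove p δ l) = windingOne l := by
  have hs (F : ZMod L₁ → ZMod 3) : ∑ k, F (k + 1) = ∑ k, F k :=
    Equiv.sum_comp (Equiv.addRight (1 : ZMod L₁)) F
  have hl (k : ZMod L₁) : hexMove p δ l ((k, 0), 0) = l ((k, 0), 0) +
      (fun k => if (k, (0 : ZMod L₂)) = p then δ else 0) k -
      (fun k => if (k, (0 : ZMod L₂)) = p then δ else 0) (k + 1) := by
    simp [hexMove, red, latVec]
  simp only [windingOne, hl, Finset.sum_add_distrib, Finset.sum_sub_distrib]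
  rw [hs (fun k => if (k, (0 : ZMod L₂)) = p then δ else 0), add_sub_cancel_right]

theorem windingTwo_hexMove (p : ZMod L₁ × ZMod L₂) (δ : ZMod 3) :
    windingTwo (hexMove p δ l) = windingTwo l := by
  have hs (F : ZMod L₂ → ZMod 3) : ∑ k, F (k - 1) = ∑ k, F k :=
    Equiv.sum_comp (Equiv.subRight (1 : ZMod L₂)) F
  have hl (k : ZMod L₂) : hexMove p δ l ((0, k), 2) = l ((0, k), 2) +
      (fun k => if ((0 : ZMod L₁), k) = p then δ else 0) k -
      (fun k => if ((0 : ZMod L₁), k) = p then δ else 0) (k - 1) := by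
    simp [hexMove, red, latVec, sub_eq_add_neg]
  simp only [windingTwo, hl, Finset.sum_add_distrib, Finset.sum_sub_distrib]
  rw [hs (fun k => if ((0 : ZMod L₁), k) = p then δ else 0), add_sub_cancel_right]

end Loops

/-! ### Evaluation of the tensor networks -/

section Network

set_option linter.unusedSectionVars false

/-- The virtual legs at a vertex, up to the colours of the legs in `3̄`. -/
inductive Tag where
  | one : Tag
  | three : Fin 3 → Tag
  | bar : Tag
  deriving DecidableEq

/-- Site tensors with definite arrow. -/
inductive Gen where
  | toB : ℂ → Fin 3 → Gen
  | toA : ℂ → Fin 3 → Gen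
  | circ : (Fin 3 → Fin 3 → ℂ) → Gen

/-- The virtual leg towards the up (`true`) or down (`false`) triangle. -/
def Gen.tag : Bool → Gen → Tag
  | true, .toB _ _ => .one
  | true, .toA _ i => .three i
  | false, .toB _ i => .three i
  | false, .toA _ _ => .one
  | _, .circ _ => .bar

/-- The loop variable. -/
def Gen.charge : Gen → ZMod 3
  | .toB _ _ => 1
  | .toA _ _ => 2
  | .circ _ => 0

/-- The entries of a site tensor. -/
noncomputable def Gen.entry : Gen → Virt → Virt → ℂ
  | .toB c i, .one, .three j => c * kron i j
  | .toA c i, .three j, .one => c * kron i j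
  | .circ M, .bar j, .bar k => M j k
  | _, _, _ => 0

/-- The entry of a site tensor for legs of the given colours. -/
def Gen.weight : Gen → Fin 3 → Fin 3 → ℂ
  | .toB c _, _, _ => c
  | .toA c _, _, _ => c
  | .circ M, j, k => M j k

/-- The colour of a triangle: that of its first leg in `3`. -/
def colour (t : Fin 3 → Tag) : Fin 3 :=
  match t 0, t 1, t 2 with
  | .three i, _, _ => i
  | _, .three i, _ => i
  | _, _, .three i => i
  | _, _, _ => 0

/-- The virtual state of a leg in a triangle of the given colour. -/
def Tag.complete : Tag → Fin 3 → Virt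
  | .one, _ => .one
  | .three i, _ => .three i
  | .bar, j => .bar j

/-- The weight of a triangle. -/
noncomputable def triangleWeight (ζ : ℝ) (t : Fin 3 → Tag) : ℂ :=
  tau ζ ((t 0).complete (colour t)) ((t 1).complete (colour t)) ((t 2).complete (colour t))

/-- The corners of the up (`true`) and down (`false`) triangles at the origin. -/
def corner : Bool → Fin 3 → KSite
  | true => upCorner 0
  | false => downCorner 0

theorem corner_snd (s : Bool) (k : Fin 3) : (corner s k).2 = k := by
  cases s <;> fin_cases k <;> rfl

variable {L₁ L₂ : ℕ} {ζ : ℝ}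

/-- The triangle that contains a vertex. -/
def triangleOf (s : Bool) (x : Site L₁ L₂) : ZMod L₁ × ZMod L₂ :=
  x.1 - red L₁ L₂ (corner s x.2).1

theorem wrap_triangleOf (s : Bool) (x : Site L₁ L₂) :
    wrap (triangleOf s x) (corner s x.2) = x := by
  simp [wrap, triangleOf, corner_snd]

theorem triangleOf_wrap (s : Bool) (P : ZMod L₁ × ZMod L₂) (k : Fin 3) :
    triangleOf s (wrap P (corner s k)) = P := by
  simp [wrap, triangleOf, corner_snd]

/-- The legs in a triangle. -/
def tags (g : Site L₁ L₂ → Gen) (t : Bool × (ZMod L₁ × ZMod L₂)) (k : Fin 3) : Tag :=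
  (g (wrap t.2 (corner t.1 k))).tag t.1

/-- The weight of a vertex. -/
def siteWeight (g : Site L₁ L₂ → Gen) (x : Site L₁ L₂) : ℂ :=
  (g x).weight (colour (tags g (true, triangleOf true x)))
    (colour (tags g (false, triangleOf false x)))

/-- The value of the tensor network with given site tensors. -/
noncomputable def amplitude [NeZero L₁] [NeZero L₂] (ζ : ℝ) (g : Site L₁ L₂ → Gen) : ℂ :=
  (∏ t : Bool × (ZMod L₁ × ZMod L₂), triangleWeight ζ (tags g t)) * ∏ x, siteWeight g x

/-- The virtual state `v` is compatible with a leg. -/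
def Tag.Matches : Tag → Virt → Prop
  | .one, v => v = .one
  | .three i, v => v = .three i
  | .bar, v => ∃ j, v = .bar j

theorem Gen.matches_of_entry_ne_zero {g : Gen} {v w : Virt} (hg : g.entry v w ≠ 0) :
    (g.tag true).Matches v ∧ (g.tag false).Matches w := by
  cases g <;> cases v <;> cases w <;>
    simp_all [Gen.entry, Gen.tag, Tag.Matches, kron]

/-- In the triangle state, 3̄ occurs only together with one 1 and one 3 of the same colour. Thus the
colour of the leg in 3 determines that of the leg in 3̄. -/
theorem eq_complete_of_tau_ne_zero {t : Fin 3 → Tag} {v : Fin 3 → Virt}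
    (hv : ∀ k, (t k).Matches (v k)) (h0 : tau ζ (v 0) (v 1) (v 2) ≠ 0) (k : Fin 3) :
    v k = (t k).complete (colour t) := by
  have h1 := hv 0
  have h2 := hv 1
  have h3 := hv 2
  have : v 0 = (t 0).complete (colour t) ∧ v 1 = (t 1).complete (colour t) ∧
      v 2 = (t 2).complete (colour t) := by
    unfold colour
    generalize v 0 = v0 at *
    generalize v 1 = v1 at *
    generalize v 2 = v2 at *
    generalize t 0 = t0 at *
    generalize t 1 = t1 at *
    generalize t 2 = t2 at *
    clear hv
    have cases_of : ∀ {t : Tag} {w : Virt}, t.Matches w → (t = .one ∧ w = .one) ∨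
        (∃ i, t = .three i ∧ w = .three i) ∨ ∃ i, t = .bar ∧ w = .bar i := by
      intro t w h
      cases t <;> simpa [Tag.Matches] using h
    rcases cases_of h1 with ⟨rfl, rfl⟩ | ⟨i1, rfl, rfl⟩ | ⟨i1, rfl, rfl⟩ <;>
      rcases cases_of h2 with ⟨rfl, rfl⟩ | ⟨i2, rfl, rfl⟩ | ⟨i2, rfl, rfl⟩ <;>
      rcases cases_of h3 with ⟨rfl, rfl⟩ | ⟨i3, rfl, rfl⟩ | ⟨i3, rfl, rfl⟩ <;>
      simp_all [tau, kron, Tag.complete]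
  fin_cases k
  exacts [this.1, this.2.1, this.2.2]

theorem Gen.entry_complete (g : Gen) (i j : Fin 3) :
    g.entry ((g.tag true).complete i) ((g.tag false).complete j) = g.weight i j := by
  cases g <;> simp [Gen.entry, Gen.tag, Tag.complete, Gen.weight, kron]

theorem Gen.charge_complete (g : Gen) (i : Fin 3) :
    ((g.tag true).complete i).charge = g.charge := by
  cases g <;> rfl

/-- The virtual legs that are determined by the site tensors. -/
def virtLegs (g : Site L₁ L₂ → Gen) (s : Bool) (x : Site L₁ L₂) : Virt :=
  ((g x).tag s).complete (colour (tags g (s, triangleOf s x)))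

theorem virtLegs_wrap (g : Site L₁ L₂ → Gen) (s : Bool) (P : ZMod L₁ × ZMod L₂) (k : Fin 3) :
    virtLegs g s (wrap P (corner s k)) = (tags g (s, P) k).complete (colour (tags g (s, P))) := by
  rw [virtLegs, triangleOf_wrap, tags]

variable [NeZero L₁] [NeZero L₂]

theorem virtLegs_unique {g : Site L₁ L₂ → Gen} {s : Bool} {a : Site L₁ L₂ → Virt}
    (hm : ∀ x, ((g x).tag s).Matches (a x))
    (h0 : ∀ P, tau ζ (a (wrap P (corner s 0))) (a (wrap P (corner s 1))) (a (wrap P (corner s 2))) ≠ 0) :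
    a = virtLegs g s := by
  funext x
  have := eq_complete_of_tau_ne_zero (t := tags g (s, triangleOf s x))
    (v := fun k => a (wrap (triangleOf s x) (corner s k))) (fun k => hm _) (h0 _) x.2
  simp only [wrap_triangleOf] at this
  rw [this, virtLegs, tags]
  simp only [wrap_triangleOf]

/-- For site tensors of definite arrow, every term except one vanishes: the legs in 1 and 3 are
given by the site tensors, and those in 3̄ by the triangles. -/
theorem sum_networkTerm (c : (Site L₁ L₂ → ZMod 3) → ℂ) (g : Site L₁ L₂ → Gen) :
    (∑ a : Site L₁ L₂ → Virt, ∑ b : Site L₁ L₂ → Virt,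
      c (fun x => (a x).charge) *
      (∏ p : ZMod L₁ × ZMod L₂, tau ζ (a (wrap p (upCorner 0 0))) (a (wrap p (upCorner 0 1)))
        (a (wrap p (upCorner 0 2)))) *
      (∏ p : ZMod L₁ × ZMod L₂, tau ζ (b (wrap p (downCorner 0 0))) (b (wrap p (downCorner 0 1)))
        (b (wrap p (downCorner 0 2)))) *
      ∏ x, (g x).entry (a x) (b x)) = c (fun x => (g x).charge) * amplitude ζ g := by
  have hzero : ∀ a b : Site L₁ L₂ → Virt, (a ≠ virtLegs g true ∨ b ≠ virtLegs g false) →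
      c (fun x => (a x).charge) *
      (∏ p : ZMod L₁ × ZMod L₂, tau ζ (a (wrap p (upCorner 0 0))) (a (wrap p (upCorner 0 1)))
        (a (wrap p (upCorner 0 2)))) *
      (∏ p : ZMod L₁ × ZMod L₂, tau ζ (b (wrap p (downCorner 0 0))) (b (wrap p (downCorner 0 1)))
        (b (wrap p (downCorner 0 2)))) *
      ∏ x, (g x).entry (a x) (b x) = 0 := by
    intro a b hab
    by_contra hne
    simp only [mul_ne_zero_iff, Finset.prod_ne_zero_iff, Finset.mem_univ, true_imp_iff] at hne
    obtain ⟨⟨⟨-, ha⟩, hb⟩, hg⟩ := hne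
    rcases hab with h | h
    · exact h (virtLegs_unique (s := true) (fun x => (Gen.matches_of_entry_ne_zero (hg x)).1) ha)
    · exact h (virtLegs_unique (s := false) (fun x => (Gen.matches_of_entry_ne_zero (hg x)).2) hb)
  rw [Finset.sum_eq_single (virtLegs g true) (fun a _ ha =>
      Finset.sum_eq_zero fun b _ => hzero a b (Or.inl ha)) (by simp),
    Finset.sum_eq_single (virtLegs g false) (fun b _ hb => hzero _ b (Or.inr hb)) (by simp)]
  have hu : ∀ (P : ZMod L₁ × ZMod L₂) (k : Fin 3), virtLegs g true (wrap P (upCorner 0 k)) = _ :=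
    virtLegs_wrap g true
  have hd : ∀ (P : ZMod L₁ × ZMod L₂) (k : Fin 3), virtLegs g false (wrap P (downCorner 0 k)) = _ :=
    virtLegs_wrap g false
  simp only [hu, hd, amplitude, Fintype.prod_prod_type, Fintype.prod_bool, triangleWeight]
  simp only [virtLegs, Gen.entry_complete, Gen.charge_complete, siteWeight]
  ring

/-- A site map all of whose physical basis states have a definite arrow, with basis states for
every arrow and colour. -/
structure ArrowMap {σ : Type} (P : σ → Virt → Virt → ℂ) where
  gen : σ → Gen
  entry_gen : ∀ x v w, P x v w = (gen x).entry v w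
  state : ArrowSpin → σ
  toB : ∀ i, ∃ c ≠ 0, gen (state (.toB, i)) = .toB c i
  toA : ∀ i, ∃ c ≠ 0, gen (state (.toA, i)) = .toA c i
  -- Row 0 and column 1 contain no other nonzero entry than (0, 1). So colour 0 in the up triangle
  -- forces colour 1 in the down triangle, and conversely; this passes colour information across a
  -- vertex without an arrow.
  circ : ∀ i, ∃ M, gen (state (.circ, i)) = .circ M ∧ M 0 1 ≠ 0 ∧ (∀ j ≠ 0, M j 1 = 0) ∧
    ∀ k ≠ 1, M 0 k = 0

theorem networkState_eq {σ : Type} {P : σ → Virt → Virt → ℂ} (D : ArrowMap P)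
    (c : (Site L₁ L₂ → ZMod 3) → ℂ) (φ : Site L₁ L₂ → σ) :
    networkState L₁ L₂ ζ P c φ =
      c (fun x => (D.gen (φ x)).charge) * amplitude ζ (fun x => D.gen (φ x)) := by
  rw [← sum_networkTerm]
  simp only [networkState, D.entry_gen]

/-- The site map with amplitude `s` for the `6̄`. -/
noncomputable def arrowMapPair {s : ℝ} (hs : s ∈ Set.Icc (0 : ℝ) 1) : ArrowMap (pairMap s) where
  gen
    | .toB i => .toB 1 i
    | .toA i => .toA 1 i
    | .circ i j => .circ fun k l => pairMap s (.circ i j) (.bar k) (.bar l)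
  entry_gen x v w := by
    cases x <;> cases v <;> cases w <;> simp [pairMap, Gen.entry]
  state
    | (.toB, i) => .toB i
    | (.toA, i) => .toA i
    | (.circ, _) => .circ 0 1
  toB i := ⟨1, one_ne_zero, rfl⟩
  toA i := ⟨1, one_ne_zero, rfl⟩
  circ i := by
    refine ⟨_, rfl, ?_, ?_, ?_⟩
    · have h1 : (Real.sqrt (3 / (1 + 2 * s ^ 2)) : ℂ) ≠ 0 := by
        rw [Complex.ofReal_ne_zero]; positivity
      have h2 : ((1 : ℂ) + s) / 2 ≠ 0 := by
        have : (1 + s) / 2 ≠ 0 := by have := hs.1; positivity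
        exact_mod_cast this
      have : pairMap s (.circ 0 1) (.bar 0) (.bar 1) =
          (Real.sqrt (3 / (1 + 2 * s ^ 2)) : ℂ) * ((1 + s) / 2) := by
        simp only [pairMap]; congr 1; simp [kron]; ring
      rw [this]
      exact mul_ne_zero h1 h2
    · intro j hj
      simp [pairMap, kron, hj.symm]
    · intro k hk
      simp [pairMap, kron, hk.symm]

/-- The site map of the trimers carrying singlets. -/
noncomputable def arrowMapSinglet : ArrowMap singletMap where
  gen
    | (.toB, i) => .toB 1 i
    | (.toA, i) => .toA (-1) i
    | (.circ, i) => .circ fun k l => singletMap (.circ, i) (.bar k) (.bar l)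
  entry_gen x v w := by
    obtain ⟨a, i⟩ := x
    cases a <;> cases v <;> cases w <;> simp [singletMap, Gen.entry]
  state
    | (.toB, i) => (.toB, i)
    | (.toA, i) => (.toA, i)
    -- The Levi-Civita tensor with first index 2 has only the entries (0, 1) and (1, 0).
    | (.circ, _) => (.circ, 2)
  toB i := ⟨1, one_ne_zero, rfl⟩
  toA i := ⟨-1, by simp, rfl⟩
  circ i := by
    refine ⟨_, rfl, ?_, ?_, ?_⟩
    · simp [singletMap, leviCivita]
      norm_num
    · intro j hj
      fin_cases j <;> simp_all [singletMap, leviCivita]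
    · intro k hk
      fin_cases k <;> simp_all [singletMap, leviCivita]

end Network

/-! ### Exchange of the states of a trimer and of a triangle with three legs in 3 -/

section Exchange

set_option linter.unusedSectionVars false

variable {L₁ L₂ : ℕ} {ζ : ℝ}

theorem wrap_corner_snd (s : Bool) (P : ZMod L₁ × ZMod L₂) (k : Fin 3) :
    (wrap P (corner s k)).2 = k := corner_snd s k

theorem colour_of_trimer {t : Fin 3 → Tag} {k₀ k₁ : Fin 3} {i : Fin 3} (h0 : t k₀ = .bar)
    (h1 : t k₁ = .three i) (h2 : ∀ k, k ≠ k₀ → k ≠ k₁ → t k = .one) : colour t = i := by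
  have h3 := h2 0
  have h4 := h2 1
  have h5 := h2 2
  unfold colour
  clear h2
  fin_cases k₀ <;> fin_cases k₁ <;> simp_all

theorem triangleWeight_of_trimer {t : Fin 3 → Tag} {k₀ k₁ : Fin 3} {i : Fin 3} (h0 : t k₀ = .bar)
    (h1 : t k₁ = .three i) (h2 : ∀ k, k ≠ k₀ → k ≠ k₁ → t k = .one) :
    triangleWeight ζ t = 1 / (Real.sqrt 3 : ℂ) := by
  have hc := colour_of_trimer h0 h1 h2
  have h3 := h2 0
  have h4 := h2 1
  have h5 := h2 2
  unfold triangleWeight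
  rw [hc]
  clear h2 hc
  fin_cases k₀ <;> fin_cases k₁ <;> simp_all [Tag.complete, tau, kron]

theorem triangleWeight_of_threes {t : Fin 3 → Tag} {i : Fin 3 → Fin 3}
    (h : ∀ k, t k = .three (i k)) :
    triangleWeight ζ t = Complex.I * ζ * leviCivita (i 0) (i 1) (i 2) / (Real.sqrt 6 : ℂ) := by
  simp [triangleWeight, h, Tag.complete, tau]

theorem Gen.tag_circ {g : Gen} {s : Bool} (h : g.tag s = .bar) : ∃ M, g = .circ M := by
  cases g <;> cases s <;> simp_all [Gen.tag]

theorem Gen.weight_congr {g : Gen} {i j i' j' : Fin 3}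
    (h : ∀ s, g.tag s = .bar → i = i' ∧ j = j') : g.weight i j = g.weight i' j' := by
  cases g with
  | circ M => obtain ⟨rfl, rfl⟩ := h true rfl; rfl
  | _ => rfl

theorem exists_corner {s : Bool} {P : ZMod L₁ × ZMod L₂} {w : Site L₁ L₂}
    (h : triangleOf s w = P) : w = wrap P (corner s w.2) := by rw [← h, wrap_triangleOf]

variable [NeZero L₁] [NeZero L₂]

/-- Equal factors cancel. The cross-multiplied form needs no assumption that the weights are
nonzero. -/
theorem amplitude_exchange {g g' : Site L₁ L₂ → Gen}
    (T : Finset (Bool × (ZMod L₁ × ZMod L₂))) (K : Finset (Site L₁ L₂))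
    (hT : ∀ t ∉ T, triangleWeight ζ (tags g t) = triangleWeight ζ (tags g' t))
    (hK : ∀ x ∉ K, siteWeight g x = siteWeight g' x) :
    amplitude ζ g * ((∏ t ∈ T, triangleWeight ζ (tags g' t)) * ∏ x ∈ K, siteWeight g' x) =
      amplitude ζ g' * ((∏ t ∈ T, triangleWeight ζ (tags g t)) * ∏ x ∈ K, siteWeight g x) := by
  unfold amplitude
  rw [← Finset.prod_mul_prod_compl T fun t => triangleWeight ζ (tags g t),
    ← Finset.prod_mul_prod_compl T fun t => triangleWeight ζ (tags g' t),
    ← Finset.prod_mul_prod_compl K (siteWeight g), ← Finset.prod_mul_prod_compl K (siteWeight g'),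
    Finset.prod_congr rfl fun t ht => hT t (Finset.mem_compl.1 ht),
    Finset.prod_congr rfl fun x hx => hK x (Finset.mem_compl.1 hx)]
  ring

/-- The amplitude depends on the state of a trimer only through a number. -/
theorem amplitude_exchange_trimer {g g' : Site L₁ L₂ → Gen} {x y z : Site L₁ L₂}
    {M M' : Fin 3 → Fin 3 → ℂ} {c₁ c₁' c₂ c₂' : ℂ} {i i' j j' : Fin 3}
    (hx : g x = .circ M) (hx' : g' x = .circ M')
    (hy : g y = .toA c₁ i) (hy' : g' y = .toA c₁' i') (hyx : triangleOf true y = triangleOf true x)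
    (hz : g z = .toB c₂ j) (hz' : g' z = .toB c₂' j') (hzx : triangleOf false z = triangleOf false x)
    (hU : ∀ w, triangleOf true w = triangleOf true x → w ≠ x → w ≠ y → (g w).tag true = .one)
    (hD : ∀ w, triangleOf false w = triangleOf false x → w ≠ x → w ≠ z → (g w).tag false = .one)
    (hoff : ∀ w, w ≠ x → w ≠ y → w ≠ z → g w = g' w) :
    amplitude ζ g * (M' i' j' * c₁' * c₂') = amplitude ζ g' * (M i j * c₁ * c₂) := by
  have hxy : x ≠ y := fun h => by rw [h, hy] at hx; cases hx
  have hxz : x ≠ z := fun h => by rw [h, hz] at hx; cases hx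
  have hyz : y ≠ z := fun h => by rw [h, hz] at hy; cases hy
  have hU' : ∀ w, triangleOf true w = triangleOf true x → w ≠ x → w ≠ y → (g' w).tag true = .one := by
    intro w h1 h2 h3
    by_cases h4 : w = z
    · rw [h4, hz']; rfl
    · rw [← hoff w h2 h3 h4]; exact hU w h1 h2 h3
  have hD' : ∀ w, triangleOf false w = triangleOf false x → w ≠ x → w ≠ z → (g' w).tag false = .one := by
    intro w h1 h2 h3
    by_cases h4 : w = y
    · rw [h4, hy']; rfl
    · rw [← hoff w h2 h4 h3]; exact hD w h1 h2 h3
  have tri : ∀ (s : Bool) (f : Site L₁ L₂ → Gen) (u : Site L₁ L₂) (N : Fin 3 → Fin 3 → ℂ) (k : Fin 3),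
      triangleOf s u = triangleOf s x → f x = .circ N → (f u).tag s = .three k →
      (∀ w, triangleOf s w = triangleOf s x → w ≠ x → w ≠ u → (f w).tag s = .one) →
      tags f (s, triangleOf s x) x.2 = .bar ∧ tags f (s, triangleOf s x) u.2 = .three k ∧
      ∀ m, m ≠ x.2 → m ≠ u.2 → tags f (s, triangleOf s x) m = .one := by
    intro s f u N k hu hfx hfu hrest
    refine ⟨?_, ?_, fun m h1 h2 => ?_⟩
    · simp only [tags, wrap_triangleOf, hfx]; cases s <;> rfl
    · simp only [tags, ← hu, wrap_triangleOf, hfu]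
    · refine hrest _ (triangleOf_wrap _ _ _) (fun h => h1 ?_) (fun h => h2 ?_)
      · rw [← h, wrap_corner_snd]
      · rw [← h, wrap_corner_snd]
  obtain ⟨a1, a2, a3⟩ := tri true g y M i hyx hx (by rw [hy]; rfl) hU
  obtain ⟨a1', a2', a3'⟩ := tri true g' y M' i' hyx hx' (by rw [hy']; rfl) hU'
  obtain ⟨b1, b2, b3⟩ := tri false g z M j hzx hx (by rw [hz]; rfl) hD
  obtain ⟨b1', b2', b3'⟩ := tri false g' z M' j' hzx hx' (by rw [hz']; rfl) hD'
  -- The legs of the trimer that point away from its two triangles are in 1 before and after the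
  -- change, so no other triangle notices it.
  have htags : ∀ t, t ≠ (true, triangleOf true x) → t ≠ (false, triangleOf false x) →
      tags g t = tags g' t := by
    rintro ⟨s, P⟩ h1 h2
    funext k
    simp only [tags]
    by_cases e1 : wrap P (corner s k) = x
    · rw [e1, hx, hx']; cases s <;> rfl
    by_cases e2 : wrap P (corner s k) = y
    · rw [e2, hy, hy']
      cases s
      · rfl
      · exact absurd (by rw [← hyx, ← e2, triangleOf_wrap]) h1
    by_cases e3 : wrap P (corner s k) = z
    · rw [e3, hz, hz']
      cases s
      · exact absurd (by rw [← hzx, ← e3, triangleOf_wrap]) h2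
      · rfl
    rw [hoff _ e1 e2 e3]
  have hsite : ∀ w ∉ ({x, y, z} : Finset (Site L₁ L₂)), siteWeight g w = siteWeight g' w := by
    intro w hw
    simp only [Finset.mem_insert, Finset.mem_singleton, not_or] at hw
    obtain ⟨w1, w2, w3⟩ := hw
    simp only [siteWeight, ← hoff w w1 w2 w3]
    refine Gen.weight_congr fun s hs => ?_
    have hne : ∀ s, (g w).tag s = .bar := by
      obtain ⟨N, hN⟩ := Gen.tag_circ hs
      intro s; rw [hN]; cases s <;> rfl
    have t1 : triangleOf true w ≠ triangleOf true x := fun h => by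
      have := hU w h w1 w2; rw [hne] at this; cases this
    have t2 : triangleOf false w ≠ triangleOf false x := fun h => by
      have := hD w h w1 w3; rw [hne] at this; cases this
    rw [htags _ (by simpa using t1) (by simp), htags _ (by simp) (by simpa using t2)]
    exact ⟨rfl, rfl⟩
  have key := amplitude_exchange (ζ := ζ) (g := g) (g' := g') ∅ {x, y, z} (fun t _ => by
    by_cases e1 : t = (true, triangleOf true x)
    · rw [e1, triangleWeight_of_trimer a1 a2 a3, triangleWeight_of_trimer a1' a2' a3']
    by_cases e2 : t = (false, triangleOf false x)
    · rw [e2, triangleWeight_of_trimer b1 b2 b3, triangleWeight_of_trimer b1' b2' b3']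
    rw [htags t e1 e2]) hsite
  have prod : ∀ f : Site L₁ L₂ → ℂ, ∏ w ∈ ({x, y, z} : Finset (Site L₁ L₂)), f w = f x * f y * f z := by
    intro f
    rw [Finset.prod_insert (by simp [hxy, hxz]), Finset.prod_insert (by simp [hyz]),
      Finset.prod_singleton, mul_assoc]
  simp only [prod, Finset.prod_empty, one_mul, siteWeight, hx, hx', hy, hy', hz, hz', Gen.weight,
    colour_of_trimer a1 a2 a3, colour_of_trimer a1' a2' a3', colour_of_trimer b1 b2 b3,
    colour_of_trimer b1' b2' b3'] at key
  exact key

/-- The coefficient of a site tensor with an arrow. -/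
def Gen.coef : Gen → ℂ
  | .toB c _ => c
  | .toA c _ => c
  | .circ _ => 1

/-- The amplitude depends on the state of a triangle of three legs in `3` only through a number. -/
theorem amplitude_exchange_threes {g g' : Site L₁ L₂ → Gen} {s : Bool} {P : ZMod L₁ × ZMod L₂}
    {i i' : Fin 3 → Fin 3} (h : ∀ k, tags g (s, P) k = .three (i k))
    (h' : ∀ k, tags g' (s, P) k = .three (i' k))
    (hoff : ∀ w, triangleOf s w ≠ P → g w = g' w) :
    amplitude ζ g * (Complex.I * ζ * leviCivita (i' 0) (i' 1) (i' 2) / (Real.sqrt 6 : ℂ) *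
        ∏ k, (g' (wrap P (corner s k))).coef) =
      amplitude ζ g' * (Complex.I * ζ * leviCivita (i 0) (i 1) (i 2) / (Real.sqrt 6 : ℂ) *
        ∏ k, (g (wrap P (corner s k))).coef) := by
  -- A vertex with a leg in 3 on one side has its leg in 1 on the other side, so the colours in the
  -- triangle are invisible elsewhere.
  have other : ∀ (s' : Bool) {f : Gen} {m : Fin 3}, s' ≠ s → f.tag s = .three m →
      f.tag s' = .one := by
    intro s' f m h1 h2
    cases f <;> cases s <;> cases s' <;> simp_all [Gen.tag]
  have hcorner : ∀ {w : Site L₁ L₂}, triangleOf s w = P → (∃ m, (g w).tag s = .three m) ∧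
      ∃ m, (g' w).tag s = .three m := by
    intro w hw
    have e1 := h w.2
    have e2 := h' w.2
    simp only [tags, ← hw, wrap_triangleOf] at e1 e2
    exact ⟨⟨_, e1⟩, ⟨_, e2⟩⟩
  have htags : ∀ t, t ≠ (s, P) → tags g t = tags g' t := by
    rintro ⟨s', P'⟩ ht
    funext k
    simp only [tags]
    by_cases hw : triangleOf s (wrap P' (corner s' k)) = P
    · obtain ⟨⟨m, hm⟩, m', hm'⟩ := hcorner hw
      have hs : s' ≠ s := by
        rintro rfl
        rw [triangleOf_wrap] at hw
        exact ht (by rw [hw])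
      rw [other s' hs hm, other s' hs hm']
    · rw [hoff _ hw]
  have hsite : ∀ w ∉ Finset.univ.image fun k => wrap P (corner s k),
      siteWeight g w = siteWeight g' w := by
    intro w hw
    have hw' : triangleOf s w ≠ P := fun hc => hw (Finset.mem_image.2
      ⟨w.2, Finset.mem_univ _, (exists_corner hc).symm⟩)
    simp only [siteWeight, ← hoff w hw']
    rw [htags, htags]
    · intro hc
      simp only [Prod.mk.injEq] at hc
      exact hw' (by rw [← hc.1]; exact hc.2)
    · intro hc
      simp only [Prod.mk.injEq] at hc
      exact hw' (by rw [← hc.1]; exact hc.2)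
  have key := amplitude_exchange (ζ := ζ) {(s, P)} _ (fun t ht => by
    rw [htags t (by simpa using ht)]) hsite
  have hw : ∀ (f : Site L₁ L₂ → Gen) (k m : Fin 3), tags f (s, P) k = .three m →
      siteWeight f (wrap P (corner s k)) = (f (wrap P (corner s k))).coef := by
    intro f k m hk
    simp only [tags] at hk
    rw [siteWeight]
    generalize f (wrap P (corner s k)) = u at *
    cases u <;> cases s <;> simp_all [Gen.tag, Gen.weight, Gen.coef]
  have hinj : ∀ k ∈ (Finset.univ : Finset (Fin 3)), ∀ m ∈ (Finset.univ : Finset (Fin 3)),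
      wrap P (corner s k) = wrap P (corner s m) → k = m := by
    intro k _ m _ hkm
    rw [← wrap_corner_snd s P k, hkm, wrap_corner_snd]
  rw [Finset.prod_singleton, Finset.prod_singleton, Finset.prod_image hinj, Finset.prod_image hinj,
    triangleWeight_of_threes h, triangleWeight_of_threes h',
    Finset.prod_congr rfl fun k _ => hw g k _ (h k),
    Finset.prod_congr rfl fun k _ => hw g' k _ (h' k)] at key
  exact key

end Exchange

/-! ### Local changes of the loop configuration -/

section LocalMoves

set_option linter.unusedSectionVars false

/-- The virtual leg of a state with given arrow and colour. -/
def spinTag : Bool → ArrowSpin → Tag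
  | true, (.toB, _) => .one
  | true, (.toA, i) => .three i
  | false, (.toB, i) => .three i
  | false, (.toA, _) => .one
  | _, (.circ, _) => .bar

/-- The canonical colour of trimer legs in up and down triangles. -/
def baseColour : Bool → Fin 3
  | true => 0
  | false => 1

/-- The legs of a triangle form a canonical state. -/
def GoodTags (s : Bool) (t : Fin 3 → Tag) : Prop :=
  (∀ k, t k = .one) ∨
  (∃ k₀ k₁, t k₀ = .bar ∧ t k₁ = .three (baseColour s) ∧ ∀ k, k ≠ k₀ → k ≠ k₁ → t k = .one) ∨
  ((∀ k, ∃ i, t k = .three i) ∧ ∀ k k', t k = t k' → k = k')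

variable {ζ : ℝ} {s : Bool} {t t' : Fin 3 → Tag}

theorem GoodTags.colour_eq (h : GoodTags s t) {k : Fin 3} (hk : t k = .bar) :
    colour t = baseColour s := by
  rcases h with h | ⟨k₀, k₁, h0, h1, h2⟩ | ⟨h, -⟩
  · rw [h] at hk; cases hk
  · exact colour_of_trimer h0 h1 h2
  · obtain ⟨i, hi⟩ := h k
    rw [hi] at hk; cases hk

theorem leviCivita_ne_zero {i j k : Fin 3} (h1 : i ≠ j) (h2 : j ≠ k) (h3 : i ≠ k) :
    leviCivita i j k ≠ 0 := by
  have hc : ∀ {a b : Fin 3}, a ≠ b → ((b : ℕ) : ℂ) - ((a : ℕ) : ℂ) ≠ 0 := fun hab => by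
    rw [sub_ne_zero, Ne, Nat.cast_inj]
    exact fun h => hab (Fin.ext h.symm)
  unfold leviCivita
  exact div_ne_zero (mul_ne_zero (mul_ne_zero (hc h1) (hc h2)) (hc h3)) two_ne_zero

theorem leviCivita_eq_zero {i : Fin 3 → Fin 3} {a b : Fin 3} (hab : a ≠ b) (h : i a = i b) :
    leviCivita (i 0) (i 1) (i 2) = 0 := by
  unfold leviCivita
  fin_cases a <;> fin_cases b <;> simp_all

theorem GoodTags.triangleWeight_ne_zero (hζ : 0 < ζ) (h : GoodTags s t) :
    triangleWeight ζ t ≠ 0 := by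
  rcases h with h | ⟨k₀, k₁, h0, h1, h2⟩ | ⟨h, hinj⟩
  · simp [triangleWeight, h, Tag.complete, tau]
  · rw [triangleWeight_of_trimer h0 h1 h2]
    have : (Real.sqrt 3 : ℂ) ≠ 0 := by rw [Complex.ofReal_ne_zero]; positivity
    exact one_div_ne_zero this
  · choose i hi using h
    rw [triangleWeight_of_threes hi]
    have h6 : (Real.sqrt 6 : ℂ) ≠ 0 := by rw [Complex.ofReal_ne_zero]; positivity
    have hne : ∀ a b : Fin 3, a ≠ b → i a ≠ i b := fun a b hab he =>
      hab (hinj a b (by rw [hi, hi, he]))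
    exact div_ne_zero (mul_ne_zero (mul_ne_zero Complex.I_ne_zero
      (Complex.ofReal_ne_zero.2 hζ.ne')) (leviCivita_ne_zero (hne _ _ (by decide))
      (hne _ _ (by decide)) (hne _ _ (by decide)))) h6

/-- A triangle with a leg in `3̄` and a leg in `3` has the colour of the latter. -/
theorem colour_of_bar_three {k₀ k₁ i : Fin 3} (h0 : t k₀ = .bar) (h1 : t k₁ = .three i)
    (hw : triangleWeight ζ t ≠ 0) : colour t = i := by
  refine colour_of_trimer h0 h1 fun k hk0 hk1 => ?_
  by_contra hone
  refine hw ?_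
  unfold triangleWeight colour
  have h01 : k₀ ≠ k₁ := by rintro rfl; rw [h0] at h1; cases h1
  cases hk : t k with
  | one => exact absurd hk hone
  | three j => fin_cases k₀ <;> fin_cases k₁ <;> fin_cases k <;> simp_all [Tag.complete, tau]
  | bar => fin_cases k₀ <;> fin_cases k₁ <;> fin_cases k <;> simp_all [Tag.complete, tau]

/-- Change of one leg of a triangle in a canonical state. -/
theorem GoodTags.of_change (h : GoodTags s t) {k : Fin 3} (hk : t' k ≠ t k)
    (heq : ∀ k', k' ≠ k → t' k' = t k') (hw : triangleWeight ζ t' ≠ 0) :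
    t k = .three (baseColour s) ∧ ¬(∀ k', ∃ i, t k' = .three i) ∧ colour t' ≠ baseColour s := by
  -- With three legs in 1, or three legs in 3 of different colours, every change of a single leg
  -- makes the weight vanish. In a trimer the only surviving change is a new colour of the leg in 3.
  rcases h with h | ⟨k₀, k₁, h0, h1, h2⟩ | ⟨h, hinj⟩
  · refine absurd ?_ hw
    have e : ∀ k', k' ≠ k → t' k' = .one := fun k' hk' => (heq k' hk').trans (h k')
    rw [h k] at hk
    have e0 := e 0
    have e1 := e 1
    have e2 := e 2
    unfold triangleWeight colour
    clear heq h e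
    cases hk' : t' k <;> fin_cases k <;> simp_all [Tag.complete, tau]
  · have h01 : k₀ ≠ k₁ := by rintro rfl; rw [h0] at h1; cases h1
    by_cases hk0 : k = k₀
    · refine absurd ?_ hw
      subst hk0
      rw [h0] at hk
      have e : ∀ k', k' ≠ k → k' ≠ k₁ → t' k' = .one := fun k' a b => (heq k' a).trans (h2 k' a b)
      have e' := (heq k₁ h01.symm).trans h1
      have e0 := e 0
      have e1 := e 1
      have e2 := e 2
      unfold triangleWeight colour
      clear heq h2 e h0 h1
      cases hk' : t' k <;> fin_cases k <;> fin_cases k₁ <;> simp_all [Tag.complete, tau]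
    by_cases hk1 : k = k₁
    · subst hk1
      refine ⟨h1, fun hc => ?_, ?_⟩
      · obtain ⟨i, hi⟩ := hc k₀
        rw [h0] at hi; cases hi
      · have e : ∀ k', k' ≠ k₀ → k' ≠ k → t' k' = .one := fun k' a b => (heq k' b).trans (h2 k' a b)
        have e' := (heq k₀ h01).trans h0
        cases hk' : t' k with
        | three j =>
          rw [colour_of_trimer e' hk' e]
          rintro rfl
          exact hk (hk'.trans h1.symm)
        | _ =>
          refine absurd ?_ hw
          have e0 := e 0
          have e1 := e 1
          have e2 := e 2
          unfold triangleWeight colour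
          clear heq h2 e h0 h1 hk
          fin_cases k <;> fin_cases k₀ <;> simp_all [Tag.complete, tau]
    · refine absurd ?_ hw
      have a1 := (heq k₀ (Ne.symm hk0)).trans h0
      have a2 := (heq k₁ (Ne.symm hk1)).trans h1
      have hone := h2 k hk0 hk1
      by_contra hne
      have hc := colour_of_bar_three a1 a2 hne
      rw [hone] at hk
      refine hne ?_
      unfold triangleWeight
      rw [hc]
      clear heq h2 hc hne hw
      cases hk' : t' k <;> fin_cases k <;> fin_cases k₀ <;> fin_cases k₁ <;> simp_all [Tag.complete, tau]
  · refine absurd ?_ hw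
    choose i hi using h
    cases hk' : t' k with
    | three j =>
      have hall : ∀ k', t' k' = .three (Function.update i k j k') := fun k' => by
        by_cases e : k' = k
        · subst e; simpa using hk'
        · rw [heq k' e, hi, Function.update_of_ne e]
      rw [triangleWeight_of_threes hall]
      have hji : j ≠ i k := fun e => hk (by rw [hk', hi, e])
      have hsurj : ∃ m, m ≠ k ∧ i m = j := by
        have hii : Function.Injective i := fun a b hab => hinj a b (by rw [hi, hi, hab])
        obtain ⟨m, hm⟩ := (Finite.injective_iff_surjective.1 hii) j
        exact ⟨m, fun e => hji (by rw [← hm, e]), hm⟩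
      obtain ⟨m, hmk, hm⟩ := hsurj
      rw [leviCivita_eq_zero (i := Function.update i k j) hmk (by simp [hmk, hm])]
      simp
    | _ =>
      have e : ∀ k', k' ≠ k → t' k' = .three (i k') := fun k' a => (heq k' a).trans (hi k')
      have e0 := e 0
      have e1 := e 1
      have e2 := e 2
      unfold triangleWeight colour
      clear heq e hinj
      fin_cases k <;> simp_all [Tag.complete, tau]

/-- The corners of a triangle of the infinite lattice. -/
def kcorner (t : Bool × (ℤ × ℤ)) (k : Fin 3) : KSite := (t.2 + (corner t.1 k).1, k)

/-- The triangle of the infinite lattice that contains a vertex. -/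
def ktri (s : Bool) (x : KSite) : Bool × (ℤ × ℤ) := (s, x.1 - (corner s x.2).1)

/-- The legs in a triangle of the infinite lattice. -/
def ktags (μ : KSite → ArrowSpin) (t : Bool × (ℤ × ℤ)) (k : Fin 3) : Tag :=
  spinTag t.1 (μ (kcorner t k))

theorem kcorner_ktri (s : Bool) (x : KSite) : kcorner (ktri s x) x.2 = x := by
  simp [kcorner, ktri]

theorem ktri_kcorner (t : Bool × (ℤ × ℤ)) (k : Fin 3) : ktri t.1 (kcorner t k) = t := by
  simp [kcorner, ktri]

variable {L₁ L₂ : ℕ}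

theorem wrap_kcorner (p : ZMod L₁ × ZMod L₂) (t : Bool × (ℤ × ℤ)) (k : Fin 3) :
    wrap p (kcorner t k) = wrap (p + red L₁ L₂ t.2) (corner t.1 k) := by
  simp only [wrap, kcorner, corner_snd, red_add, add_assoc]

theorem triangleOf_wrap_ktri (p : ZMod L₁ × ZMod L₂) (s : Bool) (x : KSite) :
    triangleOf s (wrap p x) = p + red L₁ L₂ (ktri s x).2 := by
  simp only [triangleOf, wrap, ktri, red_sub, add_sub_assoc]

/-- A pattern of arrows and colours around the region `R`, in which the triangles in `T` are in
canonical states. If a leg in `3` of such a triangle belongs to a vertex outside of `R`, then its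
colour is determined by the pattern in `R`. -/
structure MovePattern (R : Finset KSite) (T : Finset (Bool × (ℤ × ℤ))) (μ : KSite → ArrowSpin) :
    Prop where
  good : ∀ t ∈ T, GoodTags t.1 (ktags μ t)
  single : ∀ t ∈ T, ∀ k k', kcorner t k ∉ R → kcorner t k' ∉ R → k = k'
  forced : ∀ t ∈ T, ∀ k, kcorner t k ∉ R → ktags μ t k = .three (baseColour t.1) →
    (∀ k', ∃ i, ktags μ t k' = .three i) ∨
    ∃ k', kcorner t k' ∈ R ∧ ktags μ t k' = .bar ∧
      ∃ k'', kcorner (ktri (!t.1) (kcorner t k')) k'' ∈ R ∧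
        ktags μ (ktri (!t.1) (kcorner t k')) k'' = .three (baseColour (!t.1))

variable {σ : Type} {P : σ → Virt → Virt → ℂ}

theorem ArrowMap.tag_state (D : ArrowMap P) (s : Bool) (a : ArrowSpin) :
    (D.gen (D.state a)).tag s = spinTag s a := by
  obtain ⟨a, i⟩ := a
  cases a
  · obtain ⟨c, -, h⟩ := D.toB i
    rw [h]; cases s <;> rfl
  · obtain ⟨c, -, h⟩ := D.toA i
    rw [h]; cases s <;> rfl
  · obtain ⟨M, h, -⟩ := D.circ i
    rw [h]; cases s <;> rfl

theorem ArrowMap.weight_ne_zero (D : ArrowMap P) {a : ArrowSpin} {i j : Fin 3}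
    (h : ∀ s, spinTag s a = .bar → i = 0 ∧ j = 1) : (D.gen (D.state a)).weight i j ≠ 0 := by
  obtain ⟨a, m⟩ := a
  cases a
  · obtain ⟨c, hc, h⟩ := D.toB m
    rwa [h]
  · obtain ⟨c, hc, h⟩ := D.toA m
    rwa [h]
  · obtain ⟨M, hM, h0, -⟩ := D.circ m
    obtain ⟨rfl, rfl⟩ := h true rfl
    rwa [hM]

theorem spinTag_eq_bar {s : Bool} {a : ArrowSpin} (h : spinTag s a = .bar) (s' : Bool) :
    spinTag s' a = .bar := by
  obtain ⟨a, m⟩ := a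
  cases a <;> cases s <;> cases s' <;> simp_all [spinTag]

variable [NeZero L₁] [NeZero L₂]

/-- A state in `R` that follows the pattern forces the legs of the outer vertices, including their
colours, unless the amplitude vanishes. This is what makes regions smaller than the full star
sufficient. -/
theorem tags_of_amplitude_ne_zero (D : ArrowMap P) {R : Finset KSite}
    {T : Finset (Bool × (ℤ × ℤ))} {μ : KSite → ArrowSpin} (hμ : MovePattern R T μ)
    {g : Site L₁ L₂ → Gen} {p : ZMod L₁ × ZMod L₂}
    (hg : ∀ r ∈ R, g (wrap p r) = D.gen (D.state (μ r))) (h0 : amplitude ζ g ≠ 0)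
    {t : Bool × (ℤ × ℤ)} (ht : t ∈ T) : tags g (t.1, p + red L₁ L₂ t.2) = ktags μ t := by
  have hR : ∀ t k, kcorner t k ∈ R → tags g (t.1, p + red L₁ L₂ t.2) k = ktags μ t k := by
    intro t k hk
    simp only [tags, ktags]
    rw [← wrap_kcorner, hg _ hk, D.tag_state]
  unfold amplitude at h0
  simp only [mul_ne_zero_iff, Finset.prod_ne_zero_iff, Finset.mem_univ, true_imp_iff] at h0
  obtain ⟨hT, hS⟩ := h0
  funext k
  by_contra hne
  have hk : kcorner t k ∉ R := fun hk => hne (hR t k hk)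
  -- At most one leg of the triangle is outside of `R`, so the pattern can fail only by a wrong
  -- colour of the leg in 3 of a trimer.
  obtain ⟨h1, h2, h3⟩ := (hμ.good t ht).of_change hne (fun k' hk' => hR t k' (by
    by_contra hcon; exact hk' (hμ.single t ht _ _ hcon hk))) (hT _)
  obtain hc | ⟨k', hk', hbar, k'', hk'', h4⟩ := hμ.forced t ht k hk h1
  · exact h2 hc
  set x := kcorner t k' with hx
  have e1 := hR (ktri (!t.1) x) k'' hk''
  rw [h4] at e1
  have hbar' : spinTag t.1 (μ x) = .bar := hbar
  have e2 := hR (ktri (!t.1) x) x.2 (by rwa [kcorner_ktri])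
  rw [ktags, kcorner_ktri, spinTag_eq_bar hbar'] at e2
  have e3 := colour_of_bar_three e2 e1 (hT _)
  refine hS (wrap p x) ?_
  obtain ⟨⟨a, m⟩, hax⟩ : ∃ b, μ x = b := ⟨_, rfl⟩
  obtain rfl : a = .circ := by
    rw [hax] at hbar'
    have e := spinTag_eq_bar hbar' true
    cases a <;> first | rfl | cases e
  obtain ⟨M, hM, -, hM1, hM2⟩ := D.circ m
  rw [siteWeight, hg _ hk', hax, hM]
  have et : p + red L₁ L₂ t.2 = triangleOf t.1 (wrap p x) := by
    rw [triangleOf_wrap_ktri, hx, ktri_kcorner]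
  have et' : p + red L₁ L₂ (ktri (!t.1) x).2 = triangleOf (!t.1) (wrap p x) := by
    rw [triangleOf_wrap_ktri]
  rw [et] at h3
  rw [et'] at e3
  -- The leg in 3̄ of the trimer then has the wrong colour on this side of the vertex, while on the
  -- other side its colour is fixed by a leg in 3 within `R`. The matrix `M` vanishes for such a
  -- pair of colours.
  change M _ _ = 0
  obtain ⟨s, q⟩ := t
  cases s
  · simp only [Bool.not_false, ktri, baseColour] at h3 e3
    rw [e3]
    exact hM2 _ h3
  · simp only [Bool.not_true, ktri, baseColour] at h3 e3
    rw [e3]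
    exact hM1 _ h3

/-- The weight of a pattern. -/
noncomputable def patternWeight (ζ : ℝ) (D : ArrowMap P) (A : Finset KSite)
    (T : Finset (Bool × (ℤ × ℤ))) (μ : KSite → ArrowSpin) : ℂ :=
  (∏ t ∈ T, triangleWeight ζ (ktags μ t)) *
    ∏ x ∈ A, (D.gen (D.state (μ x))).weight (colour (ktags μ (ktri true x)))
      (colour (ktags μ (ktri false x)))

theorem GoodTags.weight_ne_zero (D : ArrowMap P) {t₁ t₂ : Fin 3 → Tag} (h1 : GoodTags true t₁)
    (h2 : GoodTags false t₂) {a : ArrowSpin} {k : Fin 3} (e1 : t₁ k = spinTag true a)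
    (e2 : t₂ k = spinTag false a) :
    (D.gen (D.state a)).weight (colour t₁) (colour t₂) ≠ 0 :=
  D.weight_ne_zero fun _ hs => ⟨h1.colour_eq (e1.trans (spinTag_eq_bar hs true)),
    h2.colour_eq (e2.trans (spinTag_eq_bar hs false))⟩

theorem MovePattern.weight_ne_zero (hζ : 0 < ζ) (D : ArrowMap P) {R A : Finset KSite}
    {T : Finset (Bool × (ℤ × ℤ))} {μ : KSite → ArrowSpin} (hμ : MovePattern R T μ)
    (hA : ∀ x ∈ A, ∀ s, ktri s x ∈ T) : patternWeight ζ D A T μ ≠ 0 := by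
  refine mul_ne_zero (Finset.prod_ne_zero_iff.2 fun t ht =>
    (hμ.good t ht).triangleWeight_ne_zero hζ) (Finset.prod_ne_zero_iff.2 fun x hx => ?_)
  exact (hμ.good _ (hA x hx true)).weight_ne_zero D (hμ.good _ (hA x hx false)) (k := x.2)
    (by rw [ktags, kcorner_ktri]; rfl) (by rw [ktags, kcorner_ktri]; rfl)

/-- A local change of the loop configuration changes the amplitude by a constant factor. -/
theorem amplitude_exchange_pattern (D : ArrowMap P) {R A : Finset KSite}
    {T : Finset (Bool × (ℤ × ℤ))} {μ μ' : KSite → ArrowSpin} (hμ : MovePattern R T μ)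
    (hμ' : MovePattern R T μ') (hAR : A ⊆ R) (hA : ∀ x ∈ A, ∀ s, ktri s x ∈ T)
    (hoff : ∀ t ∈ T, ∀ k, kcorner t k ∉ R → μ (kcorner t k) = μ' (kcorner t k))
    {g g' : Site L₁ L₂ → Gen} {p : ZMod L₁ × ZMod L₂}
    (hg : ∀ r ∈ R, g (wrap p r) = D.gen (D.state (μ r)))
    (hg' : ∀ r ∈ R, g' (wrap p r) = D.gen (D.state (μ' r)))
    (hgg : ∀ w, (∀ x ∈ A, w ≠ wrap p x) → g w = g' w)
    (hTi : Set.InjOn (fun t : Bool × (ℤ × ℤ) => (t.1, p + red L₁ L₂ t.2)) T)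
    (hAi : Set.InjOn (wrap p) (A : Set KSite)) :
    amplitude ζ g * patternWeight ζ D A T μ' = amplitude ζ g' * patternWeight ζ D A T μ := by
  classical
  -- If the surroundings complete both patterns, the ratio of the amplitudes is that of the pattern
  -- weights. Vertices outside of `A` notice nothing, since each triangle shows the same base colour
  -- to its leg in 3̄ in both patterns.
  by_cases hmatch : (∀ t ∈ T, tags g (t.1, p + red L₁ L₂ t.2) = ktags μ t) ∧
      ∀ t ∈ T, tags g' (t.1, p + red L₁ L₂ t.2) = ktags μ' t
  · obtain ⟨m, m'⟩ := hmatch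
    have htags : ∀ t ∉ T.image fun t => (t.1, p + red L₁ L₂ t.2), tags g t = tags g' t := by
      intro t ht
      funext k
      simp only [tags]
      rw [hgg]
      rintro x hx hw
      refine ht (Finset.mem_image.2 ⟨ktri t.1 x, hA x hx _, ?_⟩)
      have := congrArg (triangleOf t.1) hw
      rw [triangleOf_wrap, triangleOf_wrap_ktri] at this
      rw [← this]; rfl
    have key := amplitude_exchange (ζ := ζ) (g := g) (g' := g')
      (T.image fun t => (t.1, p + red L₁ L₂ t.2)) (A.image (wrap p))
      (fun t ht => by rw [htags t ht]) (fun w hw => by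
        have hw' := hgg w fun x hx he => hw (Finset.mem_image.2 ⟨x, hx, he.symm⟩)
        simp only [siteWeight, ← hw']
        refine Gen.weight_congr fun s hs => ?_
        have hbar : ∀ s, (g w).tag s = .bar := by
          obtain ⟨N, hN⟩ := Gen.tag_circ hs
          intro s; rw [hN]; cases s <;> rfl
        have : ∀ s, colour (tags g (s, triangleOf s w)) = colour (tags g' (s, triangleOf s w)) := by
          intro s
          by_cases hin : (s, triangleOf s w) ∈ T.image fun t => (t.1, p + red L₁ L₂ t.2)
          · obtain ⟨t, ht, he⟩ := Finset.mem_image.1 hin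
            have b : tags g (s, triangleOf s w) w.2 = .bar := by
              simp only [tags, wrap_triangleOf, hbar]
            have b' : tags g' (s, triangleOf s w) w.2 = .bar := by
              simp only [tags, wrap_triangleOf, ← hw', hbar]
            rw [← he] at b b' ⊢
            rw [m t ht] at b ⊢
            rw [m' t ht] at b' ⊢
            rw [(hμ.good t ht).colour_eq b, (hμ'.good t ht).colour_eq b']
          · rw [htags _ hin]
        exact ⟨this true, this false⟩)
    have hsite : ∀ (f : Site L₁ L₂ → Gen) (ν : KSite → ArrowSpin),
        (∀ r ∈ R, f (wrap p r) = D.gen (D.state (ν r))) →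
        (∀ t ∈ T, tags f (t.1, p + red L₁ L₂ t.2) = ktags ν t) → ∀ x ∈ A, siteWeight f (wrap p x) =
          (D.gen (D.state (ν x))).weight (colour (ktags ν (ktri true x)))
            (colour (ktags ν (ktri false x))) := by
      intro f ν h1 h2 x hx
      rw [siteWeight, h1 x (hAR hx), triangleOf_wrap_ktri, triangleOf_wrap_ktri,
        ← h2 _ (hA x hx true), ← h2 _ (hA x hx false)]
      rfl
    rw [Finset.prod_image hTi, Finset.prod_image hTi, Finset.prod_image hAi,
      Finset.prod_image hAi, Finset.prod_congr rfl fun t ht => by rw [m' t ht],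
      Finset.prod_congr rfl (hsite g' μ' hg' m'), Finset.prod_congr rfl (hsite g μ hg m)] at key
    rw [patternWeight, key, patternWeight]
    congr 2
    exact Finset.prod_congr rfl fun t ht => by rw [m t ht]
  -- Outside of `R` the two patterns agree, and so do `g` and `g'` at the corners of the triangles
  -- in `T`. Hence a nonzero amplitude of either would make the surroundings complete both patterns.
  · have hz : amplitude ζ g = 0 ∧ amplitude ζ g' = 0 := by
      by_contra hcon
      refine hmatch ?_
      have hin : ∀ (f : Site L₁ L₂ → Gen) (ν : KSite → ArrowSpin),
          (∀ r ∈ R, f (wrap p r) = D.gen (D.state (ν r))) → ∀ t k, kcorner t k ∈ R →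
          tags f (t.1, p + red L₁ L₂ t.2) k = ktags ν t k := by
        intro f ν h1 t k hk
        simp only [tags, ktags]
        rw [← wrap_kcorner, h1 _ hk, D.tag_state]
      have hout : ∀ t ∈ T, ∀ k, kcorner t k ∉ R → tags g (t.1, p + red L₁ L₂ t.2) k =
          tags g' (t.1, p + red L₁ L₂ t.2) k ∧ ktags μ t k = ktags μ' t k := by
        intro t ht k hk
        simp only [tags, ktags]
        rw [hoff t ht k hk, hgg]
        · exact ⟨rfl, rfl⟩
        · rw [← wrap_kcorner]
          intro x hx hw
          refine hk (hAR ?_)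
          have h1 := congrArg (triangleOf t.1) hw
          rw [triangleOf_wrap_ktri, triangleOf_wrap_ktri, ktri_kcorner] at h1
          have h2 := hTi ht (hA x hx t.1) (Prod.ext_iff.2 ⟨rfl, h1⟩)
          have h3 : k = x.2 := congrArg Prod.snd hw
          rw [h2, h3, kcorner_ktri]
          exact hx
      have hfull : ∀ (f f' : Site L₁ L₂ → Gen) (ν ν' : KSite → ArrowSpin),
          (∀ t ∈ T, tags f (t.1, p + red L₁ L₂ t.2) = ktags ν t) →
          (∀ r ∈ R, f' (wrap p r) = D.gen (D.state (ν' r))) →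
          (∀ t ∈ T, ∀ k, kcorner t k ∉ R → tags f (t.1, p + red L₁ L₂ t.2) k =
            tags f' (t.1, p + red L₁ L₂ t.2) k ∧ ktags ν t k = ktags ν' t k) →
          ∀ t ∈ T, tags f' (t.1, p + red L₁ L₂ t.2) = ktags ν' t := by
        intro f f' ν ν' h1 h2 h3 t ht
        funext k
        by_cases hk : kcorner t k ∈ R
        · exact hin f' ν' h2 t k hk
        · rw [← (h3 t ht k hk).1, h1 t ht, (h3 t ht k hk).2]
      by_cases h0 : amplitude ζ g = 0
      · have h1 := fun t ht => tags_of_amplitude_ne_zero (t := t) D hμ' hg' (fun h => hcon ⟨h0, h⟩) ht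
        exact ⟨hfull g' g μ' μ h1 hg fun t ht k hk =>
          ⟨(hout t ht k hk).1.symm, (hout t ht k hk).2.symm⟩, h1⟩
      · have h1 := fun t ht => tags_of_amplitude_ne_zero (t := t) D hμ hg h0 ht
        exact ⟨h1, hfull g g' μ μ' h1 hg' hout⟩
    rw [hz.1, hz.2, zero_mul, zero_mul]

end LocalMoves

/-! ### Canonical states of loop configurations -/

section Patterns

set_option linter.unusedSectionVars false

/-- The charge of a leg. -/
def Tag.charge : Tag → ZMod 3
  | .one => 1
  | .three _ => 2
  | .bar => 0

/-- The charge of the leg towards an up or down triangle, in terms of the loop variable. -/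
def sideCharge : Bool → ZMod 3 → ZMod 3
  | true, z => z
  | false, z => -z

theorem Gen.charge_tag (g : Gen) (s : Bool) : (g.tag s).charge = sideCharge s g.charge := by
  cases g <;> cases s <;> simp only [Gen.tag, Tag.charge, sideCharge, Gen.charge] <;> decide

theorem TriangleValid.cases {c : Fin 3 → ZMod 3} (hc : TriangleValid c) :
    (∀ k, c k = 1) ∨ (∃ k₀ k₁, c k₀ = 0 ∧ c k₁ = 2 ∧ ∀ k, k ≠ k₀ → k ≠ k₁ → c k = 1) ∨
      ∀ k, c k = 2 := by
  have : ∀ c : Fin 3 → Fin 3, (∑ k, c k = 0 ∧ ∃ k, c k ≠ 0) →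
      (∀ k, c k = 1) ∨ (∃ k₀ k₁, c k₀ = 0 ∧ c k₁ = 2 ∧ ∀ k, k ≠ k₀ → k ≠ k₁ → c k = 1) ∨
      ∀ k, c k = 2 := by decide
  exact this c hc

theorem triangleValid_sideCharge {s : Bool} {c : Fin 3 → ZMod 3} :
    TriangleValid (fun k => sideCharge s (c k)) ↔ TriangleValid c := by
  cases s
  · simp [TriangleValid, sideCharge]
  · rfl

theorem triangleValid_of_triangleWeight_ne_zero {ζ : ℝ} {t : Fin 3 → Tag}
    (h : triangleWeight ζ t ≠ 0) : TriangleValid fun k => (t k).charge := by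
  unfold triangleWeight colour at h
  rw [TriangleValid, Fin.sum_univ_three]
  generalize h0 : t 0 = t0 at *
  generalize h1 : t 1 = t1 at *
  generalize h2 : t 2 = t2 at *
  cases t0 <;> cases t1 <;> cases t2 <;> first
    | exact absurd rfl h
    | exact ⟨by simp only [Tag.charge]; decide, 0, by rw [h0]; simp only [Tag.charge]; decide⟩
    | exact ⟨by simp only [Tag.charge]; decide, 1, by rw [h1]; simp only [Tag.charge]; decide⟩

/-- The leg with given charge. -/
def tagOf (z : ZMod 3) (i : Fin 3) : Tag :=
  if z = 0 then .bar else if z = 1 then .one else .three i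

/-- The canonical colour of a leg in `3`. In a triangle of three such legs the colours are
assigned such that the corner `r t` has the same colour as in the other triangles. -/
def legColour (l : KSite → ZMod 3) (r : Bool × (ℤ × ℤ) → Fin 3) (t : Bool × (ℤ × ℤ)) (k : Fin 3) :
    Fin 3 :=
  if ∀ k', sideCharge t.1 (l (kcorner t k')) = 2 then baseColour t.1 + (k - r t) else baseColour t.1

/-- The canonical state of a loop configuration. -/
def patternOf (l : KSite → ZMod 3) (r : Bool × (ℤ × ℤ) → Fin 3) (x : KSite) : ArrowSpin :=
  if l x = 0 then (.circ, 2) else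
    if l x = 1 then (.toB, legColour l r (ktri false x) x.2) else
      (.toA, legColour l r (ktri true x) x.2)

theorem spinTag_patternOf (l : KSite → ZMod 3) (r : Bool × (ℤ × ℤ) → Fin 3) (s : Bool) (x : KSite) :
    spinTag s (patternOf l r x) = tagOf (sideCharge s (l x)) (legColour l r (ktri s x) x.2) := by
  unfold patternOf
  have h3 : ∀ z : ZMod 3, z = 0 ∨ z = 1 ∨ z = 2 := by decide
  have h01 : ¬((1 : ZMod 3) = 0) := by decide
  have h20 : ¬((2 : ZMod 3) = 0) := by decide
  have h21 : ¬((2 : ZMod 3) = 1) := by decide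
  have n1 : (-1 : ZMod 3) = 2 := by decide
  have n2 : (-2 : ZMod 3) = 1 := by decide
  rcases h3 (l x) with h | h | h <;> rw [h] <;> cases s
  · rw [if_pos rfl, sideCharge, neg_zero, tagOf, if_pos rfl]; rfl
  · rw [if_pos rfl, sideCharge, tagOf, if_pos rfl]; rfl
  · rw [if_neg h01, if_pos rfl, sideCharge, n1, tagOf, if_neg h20, if_neg h21]; rfl
  · rw [if_neg h01, if_pos rfl, sideCharge, tagOf, if_neg h01, if_pos rfl]; rfl
  · rw [if_neg h20, if_neg h21, sideCharge, n2, tagOf, if_neg h01, if_pos rfl]; rfl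
  · rw [if_neg h20, if_neg h21, sideCharge, tagOf, if_neg h20, if_neg h21]; rfl

theorem ktags_patternOf (l : KSite → ZMod 3) (r : Bool × (ℤ × ℤ) → Fin 3) (t : Bool × (ℤ × ℤ))
    (k : Fin 3) : ktags (patternOf l r) t k =
      tagOf (sideCharge t.1 (l (kcorner t k))) (legColour l r t k) := by
  rw [ktags, spinTag_patternOf, ktri_kcorner]; rfl

theorem goodTags_patternOf {l : KSite → ZMod 3} {r : Bool × (ℤ × ℤ) → Fin 3} {t : Bool × (ℤ × ℤ)}
    (h : TriangleValid fun k => l (kcorner t k)) : GoodTags t.1 (ktags (patternOf l r) t) := by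
  have h01 : ¬((1 : ZMod 3) = 0) := by decide
  have h20 : ¬((2 : ZMod 3) = 0) := by decide
  have h21 : ¬((2 : ZMod 3) = 1) := by decide
  rcases (triangleValid_sideCharge.2 h : TriangleValid fun k => sideCharge t.1 _).cases with
    h | ⟨k₀, k₁, h0, h1, h2⟩ | h
  · refine Or.inl fun k => ?_
    rw [ktags_patternOf, h, tagOf, if_neg h01, if_pos rfl]
  · refine Or.inr (Or.inl ⟨k₀, k₁, ?_, ?_, fun k hk0 hk1 => ?_⟩)
    · rw [ktags_patternOf, h0, tagOf, if_pos rfl]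
    · rw [ktags_patternOf, h1, tagOf, if_neg h20, if_neg h21, legColour, if_neg]
      intro hc
      have := (hc k₀).symm.trans h0
      exact h20 this
    · rw [ktags_patternOf, h2 k hk0 hk1, tagOf, if_neg h01, if_pos rfl]
  · refine Or.inr (Or.inr ?_)
    have e : ∀ k, ktags (patternOf l r) t k = .three (baseColour t.1 + (k - r t)) := fun k => by
      rw [ktags_patternOf, h, tagOf, if_neg h20, if_neg h21, legColour, if_pos h]
    refine ⟨fun k => ⟨_, e k⟩, fun k k' hk => ?_⟩
    rw [e, e] at hk
    simpa using hk

/-- The charges of legs in `3` that belong to vertices outside of `R` force their colours. -/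
def ForcedCharges (R : Finset KSite) (T : Finset (Bool × (ℤ × ℤ))) (l : KSite → ZMod 3) : Prop :=
  ∀ t ∈ T, ∀ k, kcorner t k ∉ R → sideCharge t.1 (l (kcorner t k)) = 2 →
    (∀ k', sideCharge t.1 (l (kcorner t k')) = 2) ∨
    ∃ k', kcorner t k' ∈ R ∧ l (kcorner t k') = 0 ∧
      ∃ k'', kcorner (ktri (!t.1) (kcorner t k')) k'' ∈ R ∧
        sideCharge (!t.1) (l (kcorner (ktri (!t.1) (kcorner t k')) k'')) = 2

theorem movePattern_patternOf {R : Finset KSite} {T : Finset (Bool × (ℤ × ℤ))}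
    {l : KSite → ZMod 3} (r : Bool × (ℤ × ℤ) → Fin 3)
    (hl : ∀ t ∈ T, TriangleValid fun k => l (kcorner t k))
    (hs : ∀ t ∈ T, ∀ k k', kcorner t k ∉ R → kcorner t k' ∉ R → k = k')
    (hf : ForcedCharges R T l) : MovePattern R T (patternOf l r) := by
  have h20 : ¬((2 : ZMod 3) = 0) := by decide
  have h21 : ¬((2 : ZMod 3) = 1) := by decide
  refine ⟨fun t ht => goodTags_patternOf (hl t ht), hs, fun t ht k hk h3 => ?_⟩
  have hc : sideCharge t.1 (l (kcorner t k)) = 2 := by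
    rw [ktags_patternOf, tagOf] at h3
    split_ifs at h3 with e1 e2
    have : ∀ z : Fin 3, ¬z = 0 → ¬z = 1 → z = 2 := by decide
    exact this _ e1 e2
  rcases hf t ht k hk hc with h | ⟨k', hk', h0, k'', hk'', h2⟩
  · refine Or.inl fun k' => ⟨legColour l r t k', ?_⟩
    rw [ktags_patternOf, h, tagOf, if_neg h20, if_neg h21]
  · refine Or.inr ⟨k', hk', ?_, k'', hk'', ?_⟩
    · rw [ktags_patternOf, h0, tagOf, if_pos]
      cases t.1 <;> rfl
    · rw [ktags_patternOf]
      simp only [ktri] at h2 ⊢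
      rw [h2, tagOf, if_neg h20, if_neg h21, legColour, if_neg]
      intro hcon
      have := hcon k'
      rw [show kcorner (!t.1, (kcorner t k').1 - (corner (!t.1) (kcorner t k').2).1) k' =
        kcorner t k' from kcorner_ktri (!t.1) (kcorner t k'), h0] at this
      have h02 : ∀ s, sideCharge s 0 ≠ 2 := by decide
      exact h02 _ this

variable {L₁ L₂ : ℕ} {σ : Type} {P : σ → Virt → Virt → ℂ}

/-- The canonical state of a loop configuration on the torus. -/
def torusPattern (l : Site L₁ L₂ → ZMod 3) (r : Bool × (ZMod L₁ × ZMod L₂) → Fin 3)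
    (x : Site L₁ L₂) : ArrowSpin :=
  patternOf (fun y => l (wrap x.1 y)) (fun t => r (t.1, x.1 + red L₁ L₂ t.2)) (0, x.2)

theorem torusPattern_wrap (l : Site L₁ L₂ → ZMod 3) (r : Bool × (ZMod L₁ × ZMod L₂) → Fin 3)
    (p : ZMod L₁ × ZMod L₂) (x : KSite) : torusPattern l r (wrap p x) =
      patternOf (fun y => l (wrap p y)) (fun t => r (t.1, p + red L₁ L₂ t.2)) x := by
  have e0 : wrap (wrap p x).1 (0, x.2) = wrap p x := by simp [wrap, red_zero]
  have e1 : ∀ s k, wrap (wrap p x).1 (kcorner (ktri s ((0, x.2) : KSite)) k) =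
      wrap p (kcorner (ktri s x) k) := by
    intro s k
    simp only [wrap, kcorner, ktri, zero_sub, red_add, red_sub, Prod.mk.injEq, and_true]
    rw [show red L₁ L₂ (-(corner s x.2).1) = -red L₁ L₂ (corner s x.2).1 by simp [red]]
    abel
  have e2 : ∀ s, (wrap p x).1 + red L₁ L₂ (ktri s ((0, x.2) : KSite)).2 =
      p + red L₁ L₂ (ktri s x).2 := by
    intro s
    simp only [wrap, ktri, zero_sub, red_sub]
    rw [show red L₁ L₂ (-(corner s x.2).1) = -red L₁ L₂ (corner s x.2).1 by simp [red]]
    abel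
  have e3 : ∀ s k, legColour (fun y => l (wrap (wrap p x).1 y))
      (fun t => r (t.1, (wrap p x).1 + red L₁ L₂ t.2)) (ktri s ((0, x.2) : KSite)) k =
      legColour (fun y => l (wrap p y)) (fun t => r (t.1, p + red L₁ L₂ t.2)) (ktri s x) k := by
    intro s k
    unfold legColour
    simp only [e1, e2]
    rfl
  unfold torusPattern patternOf
  simp only [show (wrap p x).2 = x.2 from rfl, e0, e3]

theorem ArrowMap.charge_state (D : ArrowMap P) (a : ArrowSpin) :
    sideCharge true (D.gen (D.state a)).charge = (spinTag true a).charge := by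
  rw [← Gen.charge_tag, D.tag_state]

theorem charge_torusPattern (D : ArrowMap P) (l : Site L₁ L₂ → ZMod 3)
    (r : Bool × (ZMod L₁ × ZMod L₂) → Fin 3) (x : Site L₁ L₂) :
    (D.gen (D.state (torusPattern l r x))).charge = l x := by
  have h := D.charge_state (torusPattern l r x)
  have e := torusPattern_wrap l r x.1 (0, x.2)
  have hx : wrap x.1 (0, x.2) = x := by simp [wrap, red_zero]
  rw [hx] at e
  conv_rhs at h => rw [e, spinTag_patternOf, hx]
  refine h.trans ?_
  have : ∀ z : ZMod 3, ∀ i, (tagOf z i).charge = z := by decide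
  exact this (l x) _

theorem loopValid_wrap {l : Site L₁ L₂ → ZMod 3} (hl : LoopValid l) (p : ZMod L₁ × ZMod L₂)
    (t : Bool × (ℤ × ℤ)) : TriangleValid fun k => l (wrap p (kcorner t k)) := by
  simp only [wrap_kcorner]
  obtain ⟨s, q⟩ := t
  cases s
  · exact (hl _).2
  · exact (hl _).1

variable [NeZero L₁] [NeZero L₂] {ζ : ℝ}

theorem amplitude_torusPattern_ne_zero (hζ : 0 < ζ) (D : ArrowMap P) {l : Site L₁ L₂ → ZMod 3}
    (hl : LoopValid l) (r : Bool × (ZMod L₁ × ZMod L₂) → Fin 3) :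
    amplitude ζ (fun x => D.gen (D.state (torusPattern l r x))) ≠ 0 := by
  have key : ∀ t : Bool × (ZMod L₁ × ZMod L₂),
      GoodTags t.1 (tags (fun x => D.gen (D.state (torusPattern l r x))) t) := by
    rintro ⟨s, P⟩
    have := goodTags_patternOf (l := fun y => l (wrap P y))
      (r := fun t => r (t.1, P + red L₁ L₂ t.2)) (t := (s, 0)) (loopValid_wrap hl P (s, 0))
    convert this using 1
    funext k
    simp only [tags, ktags, D.tag_state, ← torusPattern_wrap, wrap_kcorner, red_zero, add_zero]
  refine mul_ne_zero (Finset.prod_ne_zero_iff.2 fun t _ => (key t).triangleWeight_ne_zero hζ)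
    (Finset.prod_ne_zero_iff.2 fun x _ => ?_)
  refine GoodTags.weight_ne_zero D (key (true, _)) (key (false, _)) (k := x.2) ?_ ?_ <;>
    simp only [tags, wrap_triangleOf, D.tag_state]

theorem loopValid_of_amplitude_ne_zero {g : Site L₁ L₂ → Gen} (h : amplitude ζ g ≠ 0) :
    LoopValid fun x => (g x).charge := by
  unfold amplitude at h
  simp only [mul_ne_zero_iff, Finset.prod_ne_zero_iff, Finset.mem_univ, true_imp_iff] at h
  have key : ∀ (s : Bool) (P : ZMod L₁ × ZMod L₂),
      TriangleValid fun k => (g (wrap P (corner s k))).charge := fun s P => by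
    rw [← triangleValid_sideCharge (s := s)]
    simp only [← Gen.charge_tag]
    exact triangleValid_of_triangleWeight_ne_zero (h.1 (s, P))
  exact fun P => ⟨key true P, key false P⟩

end Patterns

/-! ### Exchange relations for changes of the loop configuration -/

section Exchange

set_option linter.unusedSectionVars false

/-- The triangles that contain a vertex in `A`. -/
def trianglesOf (A : Finset KSite) : Finset (Bool × (ℤ × ℤ)) :=
  Finset.univ.biUnion fun s => A.image (ktri s)

theorem mem_trianglesOf {A : Finset KSite} {t : Bool × (ℤ × ℤ)} :
    t ∈ trianglesOf A ↔ ∃ x ∈ A, ktri t.1 x = t := by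
  simp only [trianglesOf, Finset.mem_biUnion, Finset.mem_univ, true_and, Finset.mem_image]
  constructor
  · rintro ⟨s, x, hx, rfl⟩
    exact ⟨x, hx, rfl⟩
  · rintro ⟨x, hx, h⟩
    exact ⟨_, x, hx, h⟩

/-- Points close to the origin. -/
def Near (q : ℤ × ℤ) : Prop := |q.1| ≤ 9 ∧ |q.2| ≤ 9

instance : DecidablePred Near := fun _ => inferInstanceAs (Decidable (_ ∧ _))

theorem eq_of_intCast_eq {L : ℕ} (hL : 20 ≤ L) {a b : ℤ} (ha : |a| ≤ 9) (hb : |b| ≤ 9)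
    (h : (a : ZMod L) = b) : a = b := by
  rw [ZMod.intCast_eq_intCast_iff_dvd_sub] at h
  rw [abs_le] at ha hb
  obtain ⟨k, hk⟩ := h
  have h20 : (20 : ℤ) ≤ L := by exact_mod_cast hL
  have : k = 0 := by
    by_contra hk0
    rcases lt_or_gt_of_ne hk0 with h | h
    · nlinarith
    · nlinarith
  subst this
  linarith

variable {L₁ L₂ : ℕ}

theorem Near.eq_of_red_eq (hL₁ : 20 ≤ L₁) (hL₂ : 20 ≤ L₂) {q q' : ℤ × ℤ} (hq : Near q)
    (hq' : Near q') (h : red L₁ L₂ q = red L₁ L₂ q') : q = q' :=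
  Prod.ext (eq_of_intCast_eq hL₁ hq.1 hq'.1 (congrArg Prod.fst h))
    (eq_of_intCast_eq hL₂ hq.2 hq'.2 (congrArg Prod.snd h))

theorem wrap_eq_iff (hL₁ : 20 ≤ L₁) (hL₂ : 20 ≤ L₂) {x y : KSite} (hx : Near x.1) (hy : Near y.1)
    (p : ZMod L₁ × ZMod L₂) : wrap p x = wrap p y ↔ x = y := by
  refine ⟨fun h => ?_, fun h => by rw [h]⟩
  exact Prod.ext (hx.eq_of_red_eq hL₁ hL₂ hy (add_left_cancel (congrArg Prod.fst h)))
    (show (wrap p x).2 = (wrap p y).2 by rw [h])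

theorem embeds_of_near (hL₁ : 20 ≤ L₁) (hL₂ : 20 ≤ L₂) {R : Finset KSite} (hR : ∀ x ∈ R, Near x.1)
    (p : ZMod L₁ × ZMod L₂) : Embeds p R :=
  fun x hx y hy h => (wrap_eq_iff hL₁ hL₂ (hR x hx) (hR y hy) p).1 h

/-- A triangle with a vertex in `A` has at most one vertex outside of `A`. -/
def Clustered (A : Finset KSite) : Prop :=
  ∀ x ∈ A, ∀ s k k', kcorner (ktri s x) k ∉ A → kcorner (ktri s x) k' ∉ A → k = k'

open Classical in
/-- A corner outside of `A`. -/
noncomputable def outerCorner (A : Finset KSite) (p : ZMod L₁ × ZMod L₂)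
    (t : Bool × (ZMod L₁ × ZMod L₂)) : Fin 3 :=
  if h : ∃ k, ∀ x ∈ A, wrap t.2 (corner t.1 k) ≠ wrap p x then h.choose else 0

/-- In a triangle that meets `A`, a corner outside of `A` is unique and is the one singled out by
`outerCorner`. Its leg has the base colour whether or not all three legs are in 3, so a change in
`A` does not affect the canonical state outside. -/
theorem legColour_eq_of_eq_off {A : Finset KSite} (hA : Clustered A) {p : ZMod L₁ × ZMod L₂}
    {l l' : Site L₁ L₂ → ZMod 3} (hl : ∀ w, (∀ x ∈ A, w ≠ wrap p x) → l w = l' w)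
    (q : ZMod L₁ × ZMod L₂) {y : KSite} (hy : ∀ x ∈ A, wrap q y ≠ wrap p x) (s : Bool) :
    legColour (fun z => l (wrap q z)) (fun t => outerCorner A p (t.1, q + red L₁ L₂ t.2)) (ktri s y)
      y.2 = legColour (fun z => l' (wrap q z)) (fun t => outerCorner A p (t.1, q + red L₁ L₂ t.2))
      (ktri s y) y.2 := by
  set P := q + red L₁ L₂ (ktri s y).2 with hP
  have hw : ∀ k, wrap q (kcorner (ktri s y) k) = wrap P (corner s k) := fun k => wrap_kcorner q _ k
  by_cases hmeet : ∃ x ∈ A, ∃ k, wrap P (corner s k) = wrap p x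
  · obtain ⟨x, hx, k, hk⟩ := hmeet
    have hPx : P = p + red L₁ L₂ (ktri s x).2 := by
      rw [← triangleOf_wrap_ktri, ← hk, triangleOf_wrap]
    have huniq : ∀ k k', (∀ z ∈ A, wrap P (corner s k) ≠ wrap p z) →
        (∀ z ∈ A, wrap P (corner s k') ≠ wrap p z) → k = k' := by
      intro k k' h h'
      refine hA x hx s k k' (fun hm => h _ hm ?_) (fun hm => h' _ hm ?_) <;>
        rw [hPx, wrap_kcorner] <;> rfl
    have hy' : ∀ z ∈ A, wrap P (corner s y.2) ≠ wrap p z := by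
      rw [← hw, kcorner_ktri]; exact hy
    have hr : outerCorner A p (s, P) = y.2 := by
      have hex : ∃ k, ∀ x ∈ A, wrap P (corner s k) ≠ wrap p x := ⟨_, hy'⟩
      rw [outerCorner, dif_pos hex]
      exact huniq _ _ hex.choose_spec hy'
    have : outerCorner A p ((ktri s y).1, q + red L₁ L₂ (ktri s y).2) = y.2 := hr
    unfold legColour
    simp only [this, sub_self, add_zero, ite_self]
  · have : ∀ k, l (wrap q (kcorner (ktri s y) k)) = l' (wrap q (kcorner (ktri s y) k)) :=
      fun k => hl _ fun x hx he => hmeet ⟨x, hx, k, by rw [← hw, he]⟩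
    unfold legColour
    simp only [this]

theorem torusPattern_eq_off {A : Finset KSite} (hA : Clustered A) {p : ZMod L₁ × ZMod L₂}
    {l l' : Site L₁ L₂ → ZMod 3} (hl : ∀ w, (∀ x ∈ A, w ≠ wrap p x) → l w = l' w)
    {w : Site L₁ L₂} (hw : ∀ x ∈ A, w ≠ wrap p x) :
    torusPattern l (outerCorner A p) w = torusPattern l' (outerCorner A p) w := by
  have hx : wrap w.1 ((0, w.2) : KSite) = w := by simp [wrap, red_zero]
  have h := fun s => legColour_eq_of_eq_off hA hl w.1 (y := (0, w.2)) (by rwa [hx]) s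
  unfold torusPattern patternOf
  simp only [hx, hl w hw, h]

/-- Up to constant factors, the states `ρ` and `ρ'` of the region `R` are interchangeable in all
tensor networks. -/
def AmplitudeExchange (ζ : ℝ) {σ : Type} {P : σ → Virt → Virt → ℂ} (D : ArrowMap P)
    (R : Finset KSite) (ρ ρ' : R → σ) (a b : ℂ) : Prop :=
  ∀ (L₁ L₂ : ℕ) [NeZero L₁] [NeZero L₂], 20 ≤ L₁ → 20 ≤ L₂ → ∀ (p : ZMod L₁ × ZMod L₂)
    (φ : Site L₁ L₂ → σ), a * amplitude ζ (fun x => D.gen (patch φ p R ρ x)) =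
      b * amplitude ζ (fun x => D.gen (patch φ p R ρ' x))

variable {σ : Type} {P : σ → Virt → Virt → ℂ} {ζ : ℝ}

theorem amplitudeExchange_of_movePattern (hζ : 0 < ζ) (D : ArrowMap P) {R A : Finset KSite}
    {μ μ' : KSite → ArrowSpin} (hμ : MovePattern R (trianglesOf A) μ)
    (hμ' : MovePattern R (trianglesOf A) μ') (hAR : A ⊆ R) (hR : ∀ x ∈ R, Near x.1)
    (hT : ∀ t ∈ trianglesOf A, Near t.2)
    (hoff : ∀ t ∈ trianglesOf A, ∀ k, kcorner t k ∉ R → μ (kcorner t k) = μ' (kcorner t k))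
    (hoff' : ∀ x ∈ R, x ∉ A → μ x = μ' x) :
    ∃ a b : ℂ, a ≠ 0 ∧ b ≠ 0 ∧ AmplitudeExchange ζ D R (fun r => D.state (μ r))
      (fun r => D.state (μ' r)) a b := by
  have hA : ∀ x ∈ A, ∀ s, ktri s x ∈ trianglesOf A := fun x hx s => mem_trianglesOf.2 ⟨x, hx, rfl⟩
  refine ⟨_, _, hμ'.weight_ne_zero hζ D hA, hμ.weight_ne_zero hζ D hA, ?_⟩
  intro L₁ L₂ _ _ hL₁ hL₂ p φ
  have hE := embeds_of_near hL₁ hL₂ hR p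
  rw [mul_comm, mul_comm (patternWeight ζ D A _ μ)]
  refine amplitude_exchange_pattern D hμ hμ' hAR hA hoff (p := p) (fun r hr => ?_) (fun r hr => ?_)
    (fun w hw => ?_) (fun t ht t' ht' h => ?_) (fun x hx y hy h => hE (hAR hx) (hAR hy) h)
  · exact congrArg D.gen (patch_wrap hE φ _ ⟨r, hr⟩)
  · exact congrArg D.gen (patch_wrap hE φ _ ⟨r, hr⟩)
  · by_cases h : ∃ r ∈ R, w = wrap p r
    · obtain ⟨r, hr, rfl⟩ := h
      have e := patch_wrap hE φ (fun r : R => D.state (μ r)) ⟨r, hr⟩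
      have e' := patch_wrap hE φ (fun r : R => D.state (μ' r)) ⟨r, hr⟩
      rw [e, e', hoff' r hr fun hrA => hw r hrA rfl]
    · push Not at h
      rw [patch_of_ne _ _ h, patch_of_ne _ _ h]
  · simp only [Prod.mk.injEq, add_right_inj] at h
    exact Prod.ext h.1 ((hT t ht).eq_of_red_eq hL₁ hL₂ (hT t' ht') h.2)

variable [NeZero L₁] [NeZero L₂]

/-- A local change of an admissible loop configuration can be made by a change of the state in the
region `R`. -/
theorem exists_amplitudeExchange (hζ : 0 < ζ) (D : ArrowMap P)
    {R A : Finset KSite} (hAR : A ⊆ R) (hA : Clustered A) (hR : ∀ x ∈ R, Near x.1)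
    (hT : ∀ t ∈ trianglesOf A, Near t.2 ∧ ∀ k, Near (kcorner t k).1) (hL₁ : 20 ≤ L₁) (hL₂ : 20 ≤ L₂)
    {l l' : Site L₁ L₂ → ZMod 3} (hl : LoopValid l) (hl' : LoopValid l') {p : ZMod L₁ × ZMod L₂}
    (hll : ∀ w, (∀ x ∈ A, w ≠ wrap p x) → l w = l' w)
    (hf : ForcedCharges R (trianglesOf A) fun x => l (wrap p x))
    (hf' : ForcedCharges R (trianglesOf A) fun x => l' (wrap p x)) :
    ∃ φ φ' : Site L₁ L₂ → σ, (∀ x, (D.gen (φ x)).charge = l x) ∧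
      (∀ x, (D.gen (φ' x)).charge = l' x) ∧ amplitude ζ (fun x => D.gen (φ x)) ≠ 0 ∧
      amplitude ζ (fun x => D.gen (φ' x)) ≠ 0 ∧ (∀ w, (∀ x ∈ R, w ≠ wrap p x) → φ w = φ' w) ∧
      ∃ a b : ℂ, a ≠ 0 ∧ b ≠ 0 ∧ AmplitudeExchange ζ D R (fun r => φ (wrap p r))
        (fun r => φ' (wrap p r)) a b := by
  have hs : ∀ t ∈ trianglesOf A, ∀ k k', kcorner t k ∉ R → kcorner t k' ∉ R → k = k' := by
    intro t ht k k' hk hk'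
    obtain ⟨x, hx, he⟩ := mem_trianglesOf.1 ht
    rw [← he] at hk hk'
    exact hA x hx _ k k' (fun h => hk (hAR h)) (fun h => hk' (hAR h))
  have hoff : ∀ y : KSite, Near y.1 → y ∉ A → torusPattern l (outerCorner A p) (wrap p y) =
      torusPattern l' (outerCorner A p) (wrap p y) := by
    intro y hy hyA
    refine torusPattern_eq_off hA hll fun x hx h => hyA ?_
    rwa [(wrap_eq_iff hL₁ hL₂ hy (hR x (hAR hx)) p).1 h]
  have h1 := movePattern_patternOf (fun t => outerCorner A p (t.1, p + red L₁ L₂ t.2))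
    (fun t ht => loopValid_wrap hl p t) hs hf
  have h2 := movePattern_patternOf (fun t => outerCorner A p (t.1, p + red L₁ L₂ t.2))
    (fun t ht => loopValid_wrap hl' p t) hs hf'
  simp only [torusPattern_wrap] at hoff
  obtain ⟨a, b, ha, hb, hab⟩ := amplitudeExchange_of_movePattern hζ D h1 h2 hAR hR
    (fun t ht => (hT t ht).1) (fun t ht k hk => hoff _ ((hT t ht).2 k) fun h => hk (hAR h))
    (fun x hx hxA => hoff x (hR x hx) hxA)
  refine ⟨fun x => D.state (torusPattern l (outerCorner A p) x),
    fun x => D.state (torusPattern l' (outerCorner A p) x), charge_torusPattern D l _,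
    charge_torusPattern D l' _, amplitude_torusPattern_ne_zero hζ D hl _,
    amplitude_torusPattern_ne_zero hζ D hl' _, fun w hw => ?_, a, b, ha, hb, ?_⟩
  · exact congrArg D.state (torusPattern_eq_off hA hll fun x hx => hw x (hAR hx))
  · simpa only [torusPattern_wrap] using hab

end Exchange

/-! ### Elementary moves around a hexagon -/

section HexagonMoves

set_option linter.unusedSectionVars false

/-- The vertices of the hexagon at the origin, in cyclic order. -/
def ringSite : Fin 6 → KSite :=
  ![(0, 0), (-latVec 2, 2), (0, 1), (-latVec 0, 0), (0, 2), (-latVec 1, 1)]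

/-- The triangles around the hexagon at the origin; `ringTriangle j` contains the vertices
`ringSite j` and `ringSite (j + 1)`. -/
def ringTriangle : Fin 6 → Bool × (ℤ × ℤ) :=
  ![(true, 0), (false, -latVec 2), (true, -latVec 0), (false, 0), (true, latVec 2),
    (false, latVec 0)]

/-- The outer vertices of the hexagon at the origin. -/
def ringOuter : Fin 6 → KSite :=
  ![(latVec 0, 1), (-latVec 2 - latVec 0, 0), (-latVec 0 - latVec 2, 2), (latVec 2, 1),
    (latVec 2, 0), (latVec 0, 2)]

/-- The hexagon with two opposite outer vertices. -/
def hexagonPair (i : Fin 6) : Finset KSite := hexagon 0 ∪ {ringOuter i, ringOuter (i + 3)}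

theorem trianglesOf_hexagon : trianglesOf (hexagon 0) = Finset.univ.image ringTriangle := by decide

theorem ringTriangle_fst (j : Fin 6) : (ringTriangle (j + 1)).1 = !(ringTriangle j).1 := by
  revert j; decide

theorem exists_corners (j : Fin 6) : ∃ e : Equiv.Perm (Fin 3),
    kcorner (ringTriangle j) (e 0) = ringSite j ∧
    kcorner (ringTriangle j) (e 1) = ringSite (j + 1) ∧
    kcorner (ringTriangle j) (e 2) = ringOuter j := by
  revert j; decide

theorem kcorner_notMem_hexagonPair {i j : Fin 6} {k : Fin 3}
    (h : kcorner (ringTriangle j) k ∉ hexagonPair i) :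
    kcorner (ringTriangle j) k = ringOuter j ∧ j ≠ i ∧ j ≠ i + 3 := by
  revert i j k; decide +kernel

theorem ktri_ringSite (j : Fin 6) :
    ktri (!(ringTriangle (j + 1)).1) (ringSite (j + 1)) = ringTriangle j ∧
    ktri (!(ringTriangle j).1) (ringSite (j + 1)) = ringTriangle (j + 1) := by
  revert j; decide

theorem ringSite_mem (i j : Fin 6) : ringSite j ∈ hexagonPair i := by
  revert i j; decide

theorem ringOuter_mem (i : Fin 6) : ringOuter i ∈ hexagonPair i ∧ ringOuter (i + 3) ∈ hexagonPair i := by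
  revert i; decide

/-- The condition for the colours to be fixed, in terms of the charges around the hexagon. -/
def RingForced (i : Fin 6) (a : Fin 6 → ZMod 3) : Prop :=
  ∀ j, j ≠ i → j ≠ i + 3 → a (j + 1) - a j = 2 → (a j = 2 ∧ -a (j + 1) = 2) ∨
    (a j = 0 ∧ (a (j - 1) = 2 ∨ (j - 1 = i ∨ j - 1 = i + 3) ∧ a j - a (j - 1) = 2)) ∨
    (a (j + 1) = 0 ∧ (-a (j + 2) = 2 ∨
      (j + 1 = i ∨ j + 1 = i + 3) ∧ a (j + 2) - a (j + 1) = 2))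

instance (i : Fin 6) : DecidablePred (RingForced i) := fun _ =>
  inferInstanceAs (Decidable (∀ _, _))

/-- The triangles around the hexagon are admissible. -/
def RingValid (a : Fin 6 → ZMod 3) : Prop := ∀ j, ¬(a j = 0 ∧ a (j + 1) = 0)

instance : DecidablePred RingValid := fun _ => inferInstanceAs (Decidable (∀ _, _))

-- A finite check over seven elements of ℤ₃. One and the same pair of opposite outer vertices must
-- serve before and after the move, which adds δ to all six charges; there are three such pairs.
set_option synthInstance.maxHeartbeats 200000 in
theorem exists_ringForced_aux : ∀ δ a0 a1 a2 a3 a4 a5 : ZMod 3, δ = 0 ∨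
    ¬RingValid ![a0, a1, a2, a3, a4, a5] ∨
    ¬RingValid ![a0 + δ, a1 + δ, a2 + δ, a3 + δ, a4 + δ, a5 + δ] ∨
    ∃ i : Fin 3, RingForced i.castSucc.castSucc.castSucc ![a0, a1, a2, a3, a4, a5] ∧
      RingForced i.castSucc.castSucc.castSucc
        ![a0 + δ, a1 + δ, a2 + δ, a3 + δ, a4 + δ, a5 + δ] := by
  decide +kernel

/-- Seen from the triangle j, the two legs on the hexagon have charges a j and -a (j + 1), and
neutrality gives a (j + 1) - a j for the outer leg. The alternatives in `RingForced` are three legs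
in 3, or a leg in 3̄ at one of the two ring vertices with a visible leg in 3 in the adjacent
triangle. -/
theorem forcedCharges_of_ringForced {l : KSite → ZMod 3} {i : Fin 6}
    (hl : ∀ j, ∑ k, l (kcorner (ringTriangle j) k) = 0)
    (h : RingForced i fun j => sideCharge (ringTriangle j).1 (l (ringSite j))) :
    ForcedCharges (hexagonPair i) (trianglesOf (hexagon 0)) l := by
  have hneg : ∀ s z, sideCharge (!s) z = -sideCharge s z := by decide
  have hz : ∀ s, sideCharge s 0 = 0 := by decide
  have hz' : ∀ s z, sideCharge s z = 0 → z = 0 := by decide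
  have hadd : ∀ s x y z, x + y + z = 0 → sideCharge s z = -sideCharge s y - sideCharge s x := by
    decide
  have hsucc : ∀ j, sideCharge (ringTriangle j).1 (l (ringSite (j + 1))) =
      -sideCharge (ringTriangle (j + 1)).1 (l (ringSite (j + 1))) := fun j => by
    rw [ringTriangle_fst, hneg, neg_neg]
  have hout : ∀ j, sideCharge (ringTriangle j).1 (l (ringOuter j)) =
      sideCharge (ringTriangle (j + 1)).1 (l (ringSite (j + 1))) -
        sideCharge (ringTriangle j).1 (l (ringSite j)) := fun j => by
    obtain ⟨e, e0, e1, e2⟩ := exists_corners j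
    have hs := hl j
    rw [← Equiv.sum_comp e, Fin.sum_univ_three, e0, e1, e2] at hs
    rw [hadd _ _ _ _ hs, hsucc, neg_neg]
  have hmem : ∀ j, j = i ∨ j = i + 3 → ringOuter j ∈ hexagonPair i := by
    rintro j (rfl | rfl)
    · exact (ringOuter_mem j).1
    · exact (ringOuter_mem i).2
  intro t ht k hk hc
  rw [trianglesOf_hexagon] at ht
  obtain ⟨j, -, rfl⟩ := Finset.mem_image.1 ht
  obtain ⟨hkO, hji, hji3⟩ := kcorner_notMem_hexagonPair hk
  have hc' := hc
  rw [hkO, hout] at hc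
  obtain ⟨e, e0, e1, e2⟩ := exists_corners j
  rcases h j hji hji3 hc with ⟨h1, h2⟩ | ⟨h1, h2⟩ | ⟨h1, h2⟩
  · refine Or.inl fun k' => ?_
    obtain ⟨m, rfl⟩ := e.surjective k'
    fin_cases m
    · exact (congrArg (fun x => sideCharge _ (l x)) e0).trans h1
    · exact (congrArg (fun x => sideCharge _ (l x)) e1).trans ((hsucc j).trans h2)
    · exact (congrArg (fun x => sideCharge _ (l x)) (e2.trans hkO.symm)).trans hc'
  · obtain ⟨m, rfl⟩ : ∃ m, j = m + 1 := ⟨j - 1, by simp⟩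
    have ht : ktri (!(ringTriangle (m + 1)).1) (kcorner (ringTriangle (m + 1)) (e 0)) =
        ringTriangle m := by rw [e0]; exact (ktri_ringSite m).1
    have hs : (!(ringTriangle (m + 1)).1) = (ringTriangle m).1 := by
      rw [ringTriangle_fst, Bool.not_not]
    rw [add_sub_cancel_right] at h2
    obtain ⟨e', f0, f1, f2⟩ := exists_corners m
    refine Or.inr ⟨e 0, by rw [e0]; exact ringSite_mem _ _, by rw [e0]; exact hz' _ _ h1, ?_⟩
    rw [ht, hs]
    rcases h2 with h2 | ⟨h2, h3⟩
    · exact ⟨e' 0, by rw [f0]; exact ringSite_mem _ _, by rw [f0]; exact h2⟩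
    · exact ⟨e' 2, by rw [f2]; exact hmem m h2, by rw [f2, hout]; exact h3⟩
  · have ht : ktri (!(ringTriangle j).1) (kcorner (ringTriangle j) (e 1)) =
        ringTriangle (j + 1) := by rw [e1]; exact (ktri_ringSite j).2
    have hs : (!(ringTriangle j).1) = (ringTriangle (j + 1)).1 := (ringTriangle_fst j).symm
    have h2j : j + 1 + 1 = j + 2 := by rw [add_assoc]; rfl
    obtain ⟨e', f0, f1, f2⟩ := exists_corners (j + 1)
    refine Or.inr ⟨e 1, by rw [e1]; exact ringSite_mem _ _, by rw [e1]; exact hz' _ _ h1, ?_⟩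
    rw [ht, hs]
    rcases h2 with h2 | ⟨h2, h3⟩
    · exact ⟨e' 1, by rw [f1]; exact ringSite_mem _ _, by rw [f1, hsucc, h2j]; exact h2⟩
    · exact ⟨e' 2, by rw [f2]; exact hmem _ h2, by rw [f2, hout, h2j]; exact h3⟩

variable {L₁ L₂ : ℕ}

/-- The elementary move at the origin of the infinite lattice. -/
def moveCharge (δ : ZMod 3) (x : KSite) : ZMod 3 :=
  (if x.1 = 0 then δ else 0) - if x.1 + latVec x.2 = 0 then δ else 0

theorem hexMove_wrap (hL₁ : 20 ≤ L₁) (hL₂ : 20 ≤ L₂) {x : KSite} (q : ℤ × ℤ) (hx : Near (x.1 - q))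
    (hx' : Near (x.1 - q + latVec x.2)) (p : ZMod L₁ × ZMod L₂) (δ : ZMod 3)
    (l : Site L₁ L₂ → ZMod 3) : hexMove (p + red L₁ L₂ q) δ l (wrap p x) =
      l (wrap p x) + moveCharge δ (x.1 - q, x.2) := by
  have h0 : Near 0 := by decide
  have key : ∀ y : ℤ × ℤ, Near (y - q) → (p + red L₁ L₂ y = p + red L₁ L₂ q ↔ y - q = 0) := by
    intro y hy
    rw [add_right_inj]
    refine ⟨fun h => hy.eq_of_red_eq hL₁ hL₂ h0 ?_, fun h => by rw [sub_eq_zero.1 h]⟩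
    rw [red_sub, h, sub_self, red_zero]
  have e : ∀ y : ℤ × ℤ, x.1 - q + y = x.1 + y - q := fun y => by ring
  unfold hexMove moveCharge
  simp only [wrap, key _ hx, add_assoc, ← red_add]
  rw [e] at hx' ⊢
  simp only [key _ hx', add_sub_assoc]

theorem mem_hexagon_zero (d : Fin 3) : ((0, d) : KSite) ∈ hexagon 0 ∧ (-latVec d, d) ∈ hexagon 0 := by
  revert d; decide

theorem hexMove_of_ne {p w : ZMod L₁ × ZMod L₂} {d : Fin 3} (δ : ZMod 3) (l : Site L₁ L₂ → ZMod 3)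
    (h : ∀ x ∈ hexagon 0, (w, d) ≠ wrap p x) : hexMove p δ l (w, d) = l (w, d) := by
  have h1 : w ≠ p := by
    rintro rfl
    refine h (0, d) (mem_hexagon_zero d).1 ?_
    simp [wrap, red_zero]
  have h2 : w + red L₁ L₂ (latVec d) ≠ p := by
    rintro rfl
    refine h (-latVec d, d) (mem_hexagon_zero d).2 ?_
    simp only [wrap, add_assoc, ← red_add, add_neg_cancel, red_zero, add_zero]
  simp [hexMove, h1, h2]

/-- Up and down triangles alternate around the hexagon, as do the signs of the move. Reading the
charges from the side of the triangle j makes the change uniform. -/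
theorem sideCharge_moveCharge (δ : ZMod 3) (j : Fin 6) :
    sideCharge (ringTriangle j).1 (moveCharge δ (ringSite j)) = δ := by
  revert δ j; decide +kernel

theorem ringValid_of_loopValid {l : Site L₁ L₂ → ZMod 3} (hl : LoopValid l)
    (p : ZMod L₁ × ZMod L₂) :
    RingValid fun j => sideCharge (ringTriangle j).1 (l (wrap p (ringSite j))) := by
  rintro j ⟨h1, h2⟩
  have hz : ∀ s z, sideCharge s z = 0 → z = 0 := by decide
  obtain ⟨hs, k, hk⟩ := loopValid_wrap hl p (ringTriangle j)
  obtain ⟨e, e0, e1, e2⟩ := exists_corners j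
  rw [← Equiv.sum_comp e, Fin.sum_univ_three, e0, e1, hz _ _ h1, hz _ _ h2, zero_add, zero_add]
    at hs
  obtain ⟨m, rfl⟩ := e.surjective k
  refine hk ?_
  fin_cases m
  · exact (congrArg (fun x => l (wrap p x)) e0).trans (hz _ _ h1)
  · exact (congrArg (fun x => l (wrap p x)) e1).trans (hz _ _ h2)
  · exact hs

/-- For an elementary move, one of the three hexagons with two opposite outer vertices is
sufficient. -/
theorem exists_forcedCharges_hexMove (hL₁ : 20 ≤ L₁) (hL₂ : 20 ≤ L₂) {l : Site L₁ L₂ → ZMod 3}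
    {p : ZMod L₁ × ZMod L₂} {δ : ZMod 3} (hδ : δ ≠ 0) (hl : LoopValid l)
    (hl' : LoopValid (hexMove p δ l)) : ∃ i : Fin 3,
    ForcedCharges (hexagonPair i.castSucc.castSucc.castSucc) (trianglesOf (hexagon 0))
      (fun x => l (wrap p x)) ∧
    ForcedCharges (hexagonPair i.castSucc.castSucc.castSucc) (trianglesOf (hexagon 0))
      (fun x => hexMove p δ l (wrap p x)) := by
  have hnear : ∀ j, Near ((ringSite j).1 - 0) ∧ Near ((ringSite j).1 - 0 + latVec (ringSite j).2) := by
    decide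
  have hadd : ∀ s x y, sideCharge s (x + y) = sideCharge s x + sideCharge s y := by decide
  have hmove : ∀ j, sideCharge (ringTriangle j).1 (hexMove p δ l (wrap p (ringSite j))) =
      sideCharge (ringTriangle j).1 (l (wrap p (ringSite j))) + δ := fun j => by
    have := hexMove_wrap hL₁ hL₂ 0 (hnear j).1 (hnear j).2 p δ l
    rw [red_zero, add_zero, sub_zero] at this
    rw [this, hadd, sideCharge_moveCharge]
  have h1 := ringValid_of_loopValid hl p
  have h2 := ringValid_of_loopValid hl' p
  set a : Fin 6 → ZMod 3 := fun j => sideCharge (ringTriangle j).1 (l (wrap p (ringSite j))) with ha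
  have ha0 : a = ![a 0, a 1, a 2, a 3, a 4, a 5] := by
    funext j; fin_cases j <;> rfl
  have ha1 : (fun j => sideCharge (ringTriangle j).1 (hexMove p δ l (wrap p (ringSite j)))) =
      ![a 0 + δ, a 1 + δ, a 2 + δ, a 3 + δ, a 4 + δ, a 5 + δ] := by
    funext j; rw [hmove]; fin_cases j <;> rfl
  rw [ha1] at h2
  rw [ha0] at h1
  obtain h | h | h | ⟨i, hi, hi'⟩ := exists_ringForced_aux δ (a 0) (a 1) (a 2) (a 3) (a 4) (a 5)
  · exact absurd h hδ
  · exact absurd h1 h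
  · exact absurd h2 h
  · refine ⟨i, forcedCharges_of_ringForced (fun j => (loopValid_wrap hl p _).1) ?_,
      forcedCharges_of_ringForced (fun j => (loopValid_wrap hl' p _).1) ?_⟩
    · rw [← ha0] at hi; exact hi
    · rw [ha1]; exact hi'

end HexagonMoves

/-! ### Exchange relations within a loop configuration -/

section Clusters

set_option linter.unusedSectionVars false

theorem kcorner_mem_triangles (s : Bool) (d k : Fin 3) :
    kcorner (ktri s (0, d)) k ∈ triangles (0, d) := by
  revert s d k; decide

theorem near_of_mem_triangles {d : Fin 3} : ∀ r ∈ triangles (0, d), Near r.1 := by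
  revert d; decide

variable {L₁ L₂ : ℕ} {σ : Type} {P : σ → Virt → Virt → ℂ} {ζ : ℝ}

theorem eq_wrap_kcorner {s : Bool} {p : ZMod L₁ × ZMod L₂} {x : KSite} {w : Site L₁ L₂}
    (h : triangleOf s w = triangleOf s (wrap p x)) : w = wrap p (kcorner (ktri s x) w.2) := by
  rw [triangleOf_wrap_ktri] at h
  rw [wrap_kcorner]
  exact exists_corner h

theorem patch_eq_of_eq {R : Finset KSite} {p : ZMod L₁ × ZMod L₂} (hR : Embeds p R)
    (φ : Site L₁ L₂ → σ) {f f' : KSite → σ} {w : Site L₁ L₂}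
    (h : ∀ r ∈ R, w = wrap p r → f r = f' r) :
    patch φ p R (fun r => f r) w = patch φ p R (fun r => f' r) w := by
  by_cases hw : ∃ r ∈ R, w = wrap p r
  · obtain ⟨r, hr, rfl⟩ := hw
    rw [patch_wrap hR φ _ ⟨r, hr⟩, patch_wrap hR φ _ ⟨r, hr⟩]
    exact h r hr rfl
  · push Not at hw
    rw [patch_of_ne _ _ hw, patch_of_ne _ _ hw]

theorem amplitudeExchange_trimer (D : ArrowMap P) {d ky kz : Fin 3} {f f' : KSite → σ}
    {M M' : Fin 3 → Fin 3 → ℂ} {c₁ c₁' c₂ c₂' : ℂ} {i i' j j' : Fin 3}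
    (hx : D.gen (f (0, d)) = .circ M) (hx' : D.gen (f' (0, d)) = .circ M')
    (hy : D.gen (f (kcorner (ktri true (0, d)) ky)) = .toA c₁ i)
    (hy' : D.gen (f' (kcorner (ktri true (0, d)) ky)) = .toA c₁' i')
    (hz : D.gen (f (kcorner (ktri false (0, d)) kz)) = .toB c₂ j)
    (hz' : D.gen (f' (kcorner (ktri false (0, d)) kz)) = .toB c₂' j')
    (hU : ∀ k, k ≠ d → k ≠ ky → (D.gen (f (kcorner (ktri true (0, d)) k))).tag true = .one)
    (hD : ∀ k, k ≠ d → k ≠ kz → (D.gen (f (kcorner (ktri false (0, d)) k))).tag false = .one)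
    (hoff : ∀ r ∈ triangles (0, d), r ≠ (0, d) → r ≠ kcorner (ktri true (0, d)) ky →
      r ≠ kcorner (ktri false (0, d)) kz → f r = f' r) :
    AmplitudeExchange ζ D (triangles (0, d)) (fun r => f r) (fun r => f' r)
      (M' i' j' * c₁' * c₂') (M i j * c₁ * c₂) := by
  intro L₁ L₂ _ _ hL₁ hL₂ p φ
  have hR := embeds_of_near hL₁ hL₂ (near_of_mem_triangles (d := d)) p
  have hg : ∀ (f : KSite → σ), ∀ r ∈ triangles (0, d),
      D.gen (patch φ p (triangles (0, d)) (fun r => f r) (wrap p r)) = D.gen (f r) :=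
    fun f r hr => congrArg D.gen (patch_wrap hR φ _ ⟨r, hr⟩)
  have hx0 : ((0, d) : KSite) ∈ triangles (0, d) := by
    have := kcorner_mem_triangles true d d
    rwa [show kcorner (ktri true ((0, d) : KSite)) d = (0, d) from kcorner_ktri true (0, d)] at this
  have hxd : ∀ s, wrap p (kcorner (ktri s ((0, d) : KSite)) d) = wrap p (0, d) := fun s =>
    congrArg (wrap p) (kcorner_ktri s (0, d))
  rw [mul_comm, mul_comm (M i j * c₁ * c₂)]
  refine amplitude_exchange_trimer (x := wrap p (0, d))
    (y := wrap p (kcorner (ktri true (0, d)) ky)) (z := wrap p (kcorner (ktri false (0, d)) kz))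
    ((hg f _ hx0).trans hx) ((hg f' _ hx0).trans hx')
    ((hg f _ (kcorner_mem_triangles _ _ _)).trans hy)
    ((hg f' _ (kcorner_mem_triangles _ _ _)).trans hy') ?_
    ((hg f _ (kcorner_mem_triangles _ _ _)).trans hz)
    ((hg f' _ (kcorner_mem_triangles _ _ _)).trans hz') ?_ ?_ ?_ ?_
  · rw [triangleOf_wrap_ktri, triangleOf_wrap_ktri]
    exact congrArg (fun t : Bool × (ℤ × ℤ) => p + red L₁ L₂ t.2) (ktri_kcorner (ktri true (0, d)) ky)
  · rw [triangleOf_wrap_ktri, triangleOf_wrap_ktri]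
    exact congrArg (fun t : Bool × (ℤ × ℤ) => p + red L₁ L₂ t.2) (ktri_kcorner (ktri false (0, d)) kz)
  · intro w hw hwx hwy
    rw [eq_wrap_kcorner hw] at hwx hwy ⊢
    rw [hg f _ (kcorner_mem_triangles _ _ _)]
    refine hU _ (fun h => hwx ?_) (fun h => hwy (by rw [h]))
    rw [h, hxd]
  · intro w hw hwx hwz
    rw [eq_wrap_kcorner hw] at hwx hwz ⊢
    rw [hg f _ (kcorner_mem_triangles _ _ _)]
    refine hD _ (fun h => hwx ?_) (fun h => hwz (by rw [h]))
    rw [h, hxd]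
  · intro w h1 h2 h3
    refine congrArg D.gen (patch_eq_of_eq hR φ fun r hr hw => hoff r hr ?_ ?_ ?_)
    · rintro rfl; exact h1 hw
    · rintro rfl; exact h2 hw
    · rintro rfl; exact h3 hw

theorem amplitudeExchange_threes (D : ArrowMap P) {s : Bool} {f f' : KSite → σ}
    {i i' : Fin 3 → Fin 3}
    (h : ∀ k, (D.gen (f (kcorner (ktri s (0, 0)) k))).tag s = .three (i k))
    (h' : ∀ k, (D.gen (f' (kcorner (ktri s (0, 0)) k))).tag s = .three (i' k))
    (hoff : ∀ r ∈ triangles (0, 0), ktri s r ≠ ktri s (0, 0) → f r = f' r) :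
    AmplitudeExchange ζ D (triangles (0, 0)) (fun r => f r) (fun r => f' r)
      (Complex.I * ζ * leviCivita (i' 0) (i' 1) (i' 2) / (Real.sqrt 6 : ℂ) *
        ∏ k, (D.gen (f' (kcorner (ktri s (0, 0)) k))).coef)
      (Complex.I * ζ * leviCivita (i 0) (i 1) (i 2) / (Real.sqrt 6 : ℂ) *
        ∏ k, (D.gen (f (kcorner (ktri s (0, 0)) k))).coef) := by
  intro L₁ L₂ _ _ hL₁ hL₂ p φ
  have hR := embeds_of_near hL₁ hL₂ (near_of_mem_triangles (d := 0)) p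
  have hg : ∀ (f : KSite → σ), ∀ k, D.gen (patch φ p (triangles (0, 0)) (fun r => f r)
      (wrap (p + red L₁ L₂ (ktri s (0, 0)).2) (corner s k))) =
        D.gen (f (kcorner (ktri s (0, 0)) k)) := fun f k => by
    have := wrap_kcorner p (ktri s ((0, 0) : KSite)) k
    rw [show wrap (p + red L₁ L₂ (ktri s ((0, 0) : KSite)).2) (corner s k) = _ from this.symm]
    exact congrArg D.gen (patch_wrap hR φ _ ⟨_, kcorner_mem_triangles s 0 k⟩)
  have key := amplitude_exchange_threes (ζ := ζ)
    (g := fun x => D.gen (patch φ p (triangles (0, 0)) (fun r => f r) x))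
    (g' := fun x => D.gen (patch φ p (triangles (0, 0)) (fun r => f' r) x)) (s := s)
    (P := p + red L₁ L₂ (ktri s (0, 0)).2) (i := i) (i' := i')
    (fun k => by rw [← h k, tags]; simp only [hg]) (fun k => by rw [← h' k, tags]; simp only [hg])
    (fun w hw => congrArg D.gen (patch_eq_of_eq hR φ fun r hr hwr => hoff r hr fun hk => hw (by
      rw [hwr, triangleOf_wrap_ktri, hk])))
  simp only [hg] at key
  rw [mul_comm, key, mul_comm]

/-- The relation with factors 1 and 0 expresses that an inadmissible triangle has amplitude zero, so
it forces ground states to vanish there. -/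
theorem amplitudeExchange_zero (D : ArrowMap P) {s : Bool} {d : Fin 3} {f : KSite → σ}
    (h : ¬TriangleValid fun k => (D.gen (f (kcorner (ktri s (0, d)) k))).charge) :
    AmplitudeExchange ζ D (triangles (0, d)) (fun r => f r) (fun r => f r) 1 0 := by
  intro L₁ L₂ _ _ hL₁ hL₂ p φ
  have hR := embeds_of_near hL₁ hL₂ (near_of_mem_triangles (d := d)) p
  rw [one_mul, zero_mul]
  by_contra hne
  refine h ?_
  have := loopValid_wrap (loopValid_of_amplitude_ne_zero hne) p (ktri s (0, d))
  convert this using 4 with k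
  exact (patch_wrap hR φ (fun r : triangles (0, d) => f r) ⟨_, kcorner_mem_triangles s d k⟩).symm

theorem Gen.exists_of_charge (g : Gen) : (g.charge = 0 → ∃ M, g = .circ M) ∧
    (g.charge = 1 → ∃ c i, g = .toB c i) ∧ (g.charge = 2 → ∃ c i, g = .toA c i) := by
  have h10 : (1 : ZMod 3) ≠ 0 := by decide
  have h20 : (2 : ZMod 3) ≠ 0 := by decide
  have h12 : (1 : ZMod 3) ≠ 2 := by decide
  cases g <;> simp [Gen.charge, h10, h20, h12, h12.symm, h10.symm, h20.symm]

theorem TriangleValid.exists_of_eq_zero {c : Fin 3 → ZMod 3} (hc : TriangleValid c) {d : Fin 3}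
    (hd : c d = 0) : ∃ k₁, c k₁ = 2 ∧ ∀ k, k ≠ d → k ≠ k₁ → c k = 1 := by
  have h10 : (1 : ZMod 3) ≠ 0 := by decide
  have h20 : (2 : ZMod 3) ≠ 0 := by decide
  rcases hc.cases with h | ⟨k₀, k₁, -, h1, h2⟩ | h
  · exact absurd ((h d).symm.trans hd) h10
  · by_cases hd0 : d = k₀
    · subst hd0; exact ⟨k₁, h1, h2⟩
    · by_cases hd1 : d = k₁
      · subst hd1; exact absurd (h1.symm.trans hd) h20
      · exact absurd ((h2 d hd0 hd1).symm.trans hd) h10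
  · exact absurd ((h d).symm.trans hd) h20

variable [NeZero L₁] [NeZero L₂]

/-- `φ''` arises from `φ` by a change to `φ₀` at some vertices close to each other, with an exchange
relation. -/
def ClusterStep (ζ : ℝ) (D : ArrowMap P) (φ φ₀ φ'' : Site L₁ L₂ → σ) : Prop :=
  (∀ w, φ'' w = φ w ∨ φ'' w = φ₀ w) ∧ ∃ (d : Fin 3) (p : ZMod L₁ × ZMod L₂),
    (∀ w, (∀ r ∈ triangles (0, d), w ≠ wrap p r) → φ w = φ'' w) ∧ ∃ a b : ℂ, a ≠ 0 ∧
      AmplitudeExchange ζ D (triangles (0, d)) (fun r => φ (wrap p r)) (fun r => φ'' (wrap p r)) a b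

/-- Neutrality of the triangles leaves exactly one leg in 3 in each of the two triangles of a vertex
of charge 0. The trimer formed by these three vertices is set to the reference state. -/
theorem exists_clusterStep_trimer (hL₁ : 20 ≤ L₁) (hL₂ : 20 ≤ L₂) (D : ArrowMap P)
    {φ φ₀ : Site L₁ L₂ → σ} (hc : ∀ x, (D.gen (φ x)).charge = (D.gen (φ₀ x)).charge)
    (h0 : amplitude ζ (fun x => D.gen (φ₀ x)) ≠ 0) {x : Site L₁ L₂}
    (hx : (D.gen (φ₀ x)).charge = 0) : ∃ φ'', ClusterStep ζ D φ φ₀ φ'' ∧ φ'' x = φ₀ x ∧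
      (∀ w, (D.gen (φ₀ w)).charge = 2 → triangleOf true w = triangleOf true x → φ'' w = φ₀ w) ∧
      ∀ w, (D.gen (φ₀ w)).charge = 1 → triangleOf false w = triangleOf false x → φ'' w = φ₀ w := by
  classical
  have h12 : (1 : ZMod 3) ≠ 2 := by decide
  have h02 : (0 : ZMod 3) ≠ 2 := by decide
  have h01 : (0 : ZMod 3) ≠ 1 := by decide
  have hv := loopValid_of_amplitude_ne_zero h0
  obtain ⟨p, d⟩ := x
  have hxw : wrap p ((0, d) : KSite) = (p, d) := by simp [wrap, red_zero]
  have hkd : ∀ s, wrap p (kcorner (ktri s ((0, d) : KSite)) d) = (p, d) := fun s => by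
    rw [show kcorner (ktri s ((0, d) : KSite)) d = (0, d) from kcorner_ktri s (0, d), hxw]
  obtain ⟨ky, hy, hU⟩ := (loopValid_wrap hv p (ktri true (0, d))).exists_of_eq_zero
    (d := d) (by simp only [hkd]; exact hx)
  obtain ⟨kz, hz, hD⟩ := (triangleValid_sideCharge (s := false).2
    (loopValid_wrap hv p (ktri false (0, d)))).exists_of_eq_zero
    (d := d) (by simp only [hkd]; rw [hx]; rfl)
  have hn1 : ∀ z : ZMod 3, sideCharge false z = 2 → z = 1 := by decide
  have hn2 : ∀ z : ZMod 3, sideCharge false z = 1 → z = 2 := by decide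
  replace hz := hn1 _ hz
  replace hD := fun k hk hk' => hn2 _ (hD k hk hk')
  set y := wrap p (kcorner (ktri true (0, d)) ky) with hydef
  set z := wrap p (kcorner (ktri false (0, d)) kz) with hzdef
  let φ'' : Site L₁ L₂ → σ := fun w => if w = (p, d) ∨ w = y ∨ w = z then φ₀ w else φ w
  have e1 : φ'' (p, d) = φ₀ (p, d) := if_pos (Or.inl rfl)
  have e2 : φ'' y = φ₀ y := if_pos (Or.inr (Or.inl rfl))
  have e3 : φ'' z = φ₀ z := if_pos (Or.inr (Or.inr rfl))
  obtain ⟨M, hM⟩ := (Gen.exists_of_charge _).1 ((hc _).trans hx)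
  obtain ⟨M', hM'⟩ := (Gen.exists_of_charge _).1 hx
  obtain ⟨c₁, i, hi⟩ := (Gen.exists_of_charge _).2.2 ((hc _).trans hy)
  obtain ⟨c₁', i', hi'⟩ := (Gen.exists_of_charge _).2.2 hy
  obtain ⟨c₂, j, hj⟩ := (Gen.exists_of_charge _).2.1 ((hc _).trans hz)
  obtain ⟨c₂', j', hj'⟩ := (Gen.exists_of_charge _).2.1 hz
  have hone : ∀ g : Gen, (g.charge = 1 → g.tag true = .one) ∧ (g.charge = 2 → g.tag false = .one) := by
    intro g
    constructor <;> intro h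
    · obtain ⟨c, i, rfl⟩ := (Gen.exists_of_charge _).2.1 h
      rfl
    · obtain ⟨c, i, rfl⟩ := (Gen.exists_of_charge _).2.2 h
      rfl
  have hRi := embeds_of_near hL₁ hL₂ (near_of_mem_triangles (d := d)) p
  have hmem0 : ((0, d) : KSite) ∈ triangles (0, d) := by
    have := kcorner_mem_triangles true d d
    rwa [show kcorner (ktri true ((0, d) : KSite)) d = (0, d) from kcorner_ktri true (0, d)] at this
  -- The factor in front of the old state is the weight of the reference trimer, which is nonzero
  -- because it divides a nonzero amplitude.
  have hne : M' i' j' * c₁' * c₂' ≠ 0 := by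
    unfold amplitude at h0
    simp only [mul_ne_zero_iff, Finset.prod_ne_zero_iff, Finset.mem_univ, true_imp_iff] at h0
    obtain ⟨hT, hS⟩ := h0
    have htags : ∀ s k, tags (fun x => D.gen (φ₀ x)) (s, triangleOf s (p, d)) k =
        (D.gen (φ₀ (wrap p (kcorner (ktri s (0, d)) k)))).tag s := fun s k => by
      rw [← hxw, triangleOf_wrap_ktri, wrap_kcorner]; rfl
    have hbar : ∀ s, tags (fun x => D.gen (φ₀ x)) (s, triangleOf s (p, d)) d = .bar := fun s => by
      rw [htags, hkd, hM']; cases s <;> rfl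
    refine mul_ne_zero (mul_ne_zero ?_ ?_) ?_
    · have := hS (p, d)
      rw [siteWeight, colour_of_bar_three (hbar true) (k₁ := ky) (i := i') (by rw [htags, hi']; rfl)
        (hT _), colour_of_bar_three (hbar false) (k₁ := kz) (i := j') (by rw [htags, hj']; rfl)
        (hT _), hM'] at this
      exact this
    · have := hS y
      rw [siteWeight, hi'] at this
      exact this
    · have := hS z
      rw [siteWeight, hj'] at this
      exact this
  refine ⟨φ'', ⟨fun w => ?_, d, p, fun w hw => ?_, _, _, hne,
    amplitudeExchange_trimer D (f := fun r => φ (wrap p r)) (f' := fun r => φ'' (wrap p r))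
      (ky := ky) (kz := kz) (M := M) (i := i) (j := j) (c₁ := c₁) (c₂ := c₂)
      ?_ ?_ hi ?_ hj ?_ ?_ ?_ ?_⟩, e1, fun w hw hwt => ?_, fun w hw hwt => ?_⟩
  · by_cases h : w = (p, d) ∨ w = y ∨ w = z
    · exact Or.inr (if_pos h)
    · exact Or.inl (if_neg h)
  · refine (if_neg ?_).symm
    rintro (h | h | h)
    · exact hw _ hmem0 (h.trans hxw.symm)
    · exact hw _ (kcorner_mem_triangles _ _ _) h
    · exact hw _ (kcorner_mem_triangles _ _ _) h
  · rw [hxw]; exact hM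
  · rw [hxw, e1]; exact hM'
  · exact (congrArg D.gen e2).trans hi'
  · exact (congrArg D.gen e3).trans hj'
  · exact fun k hk hk' => (hone _).1 ((hc _).trans (hU k hk hk'))
  · exact fun k hk hk' => (hone _).2 ((hc _).trans (hD k hk hk'))
  · refine fun r hr h1 h2 h3 => (if_neg ?_).symm
    rintro (h | h | h)
    · exact h1 (hRi hr hmem0 (h.trans hxw.symm))
    · exact h2 (hRi hr (kcorner_mem_triangles _ _ _) h)
    · exact h3 (hRi hr (kcorner_mem_triangles _ _ _) h)
  · have e := eq_wrap_kcorner (hwt.trans (congrArg (triangleOf true) hxw.symm))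
    have : w.2 = ky := by
      by_contra hk
      by_cases hk' : w.2 = d
      · rw [e, hk', hkd, hx] at hw; exact h02 hw
      · have := hU _ hk' hk
        rw [← e] at this
        exact h12 (this.symm.trans hw)
    rw [this] at e
    rw [e]; exact e2
  · have e := eq_wrap_kcorner (hwt.trans (congrArg (triangleOf false) hxw.symm))
    have : w.2 = kz := by
      by_contra hk
      by_cases hk' : w.2 = d
      · rw [e, hk', hkd, hx] at hw; exact h01 hw
      · have := hD _ hk' hk
        rw [← e] at this
        exact h12 (hw.symm.trans this)
    rw [this] at e
    rw [e]; exact e3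

theorem exists_clusterStep_threes (hL₁ : 20 ≤ L₁) (hL₂ : 20 ≤ L₂) (D : ArrowMap P)
    {φ φ₀ : Site L₁ L₂ → σ} (hc : ∀ x, (D.gen (φ x)).charge = (D.gen (φ₀ x)).charge)
    (h0 : amplitude ζ (fun x => D.gen (φ₀ x)) ≠ 0) {s : Bool} {Q : ZMod L₁ × ZMod L₂}
    (h2 : ∀ k, sideCharge s (D.gen (φ₀ (wrap Q (corner s k)))).charge = 2) :
    ∃ φ'', ClusterStep ζ D φ φ₀ φ'' ∧ ∀ w, triangleOf s w = Q → φ'' w = φ₀ w := by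
  classical
  have hthree : ∀ g : Gen, sideCharge s g.charge = 2 → ∃ i, g.tag s = .three i := by
    have hn1 : ∀ z : ZMod 3, sideCharge false z = 2 → z = 1 := by decide
    intro g hg
    cases s
    · obtain ⟨c, i, rfl⟩ := (Gen.exists_of_charge _).2.1 (hn1 _ hg)
      exact ⟨i, rfl⟩
    · obtain ⟨c, i, rfl⟩ := (Gen.exists_of_charge _).2.2 hg
      exact ⟨i, rfl⟩
  let φ'' : Site L₁ L₂ → σ := fun w => if triangleOf s w = Q then φ₀ w else φ w
  obtain ⟨p, hp⟩ : ∃ p, Q = p + red L₁ L₂ (ktri s ((0, 0) : KSite)).2 := ⟨_, (sub_add_cancel _ _).symm⟩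
  have hw : ∀ k, wrap p (kcorner (ktri s ((0, 0) : KSite)) k) = wrap Q (corner s k) := fun k => by
    rw [wrap_kcorner, hp]; rfl
  choose i hi using fun k => hthree _ ((congrArg (sideCharge s) (hc _)).trans (h2 k))
  choose i' hi' using fun k => hthree _ (h2 k)
  have hφ : ∀ k, φ'' (wrap Q (corner s k)) = φ₀ (wrap Q (corner s k)) := fun k =>
    if_pos (triangleOf_wrap s Q k)
  have hoff : ∀ w, triangleOf s w ≠ Q → φ w = φ'' w := fun w h => (if_neg h).symm
  refine ⟨φ'', ⟨fun w => ?_, 0, p, fun w hwr => hoff w fun h => ?_, _, _, ?_,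
    amplitudeExchange_threes D (s := s) (f := fun r => φ (wrap p r)) (f' := fun r => φ'' (wrap p r))
      (i := i) (i' := i') (fun k => by simp only [hw]; exact hi k)
      (fun k => by simp only [hw, hφ]; exact hi' k) fun r hr hne => hoff _ fun h => hne ?_⟩,
    fun w h => if_pos h⟩
  · by_cases h : triangleOf s w = Q
    · exact Or.inr (if_pos h)
    · exact Or.inl (if_neg h)
  · refine hwr _ (kcorner_mem_triangles s 0 w.2) ?_
    rw [hw]
    exact exists_corner h
  · unfold amplitude at h0
    simp only [mul_ne_zero_iff, Finset.prod_ne_zero_iff, Finset.mem_univ, true_imp_iff] at h0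
    obtain ⟨hT, hS⟩ := h0
    refine mul_ne_zero ?_ (Finset.prod_ne_zero_iff.2 fun k _ => ?_)
    · rw [← triangleWeight_of_threes (t := tags (fun x => D.gen (φ₀ x)) (s, Q)) hi']
      exact hT _
    · simp only [hw, hφ]
      have := hS (wrap Q (corner s k))
      rw [siteWeight] at this
      have h3 := h2 k
      generalize D.gen (φ₀ (wrap Q (corner s k))) = g at *
      cases g with
      | circ M => exact one_ne_zero
      | _ => exact this
  · rw [triangleOf_wrap_ktri, hp, add_right_inj] at h
    have := Near.eq_of_red_eq hL₁ hL₂ ?_ ?_ h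
    · exact Prod.ext rfl this
    · have : ∀ s, ∀ r ∈ triangles (0, 0), Near (ktri s r).2 := by decide
      exact this s r hr
    · have : ∀ s, Near (ktri s ((0, 0) : KSite)).2 := by decide
      exact this s

/-- Every vertex can be changed to the reference state. -/
theorem exists_clusterStep (hL₁ : 20 ≤ L₁) (hL₂ : 20 ≤ L₂) (D : ArrowMap P)
    {φ φ₀ : Site L₁ L₂ → σ} (hc : ∀ x, (D.gen (φ x)).charge = (D.gen (φ₀ x)).charge)
    (h0 : amplitude ζ (fun x => D.gen (φ₀ x)) ≠ 0) (x : Site L₁ L₂) :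
    ∃ φ'', ClusterStep ζ D φ φ₀ φ'' ∧ φ'' x = φ₀ x := by
  have hv := loopValid_of_amplitude_ne_zero h0
  have side : ∀ s, sideCharge s (D.gen (φ₀ x)).charge = 2 →
      ∃ φ'', ClusterStep ζ D φ φ₀ φ'' ∧ φ'' x = φ₀ x := by
    intro s hs
    have hval := triangleValid_sideCharge (s := s).2
      (loopValid_wrap hv (triangleOf s x) ((s, 0) : Bool × (ℤ × ℤ)))
    simp only [wrap_kcorner, red_zero, add_zero] at hval
    rcases hval.cases with h | ⟨k₀, k₁, hk0, hk1, h⟩ | h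
    · have := h x.2
      rw [wrap_triangleOf, hs] at this
      exact absurd this (by decide)
    · have hz : ∀ s z, sideCharge s z = 0 → z = 0 := by decide
      obtain ⟨φ'', h1, -, h3, h4⟩ := exists_clusterStep_trimer hL₁ hL₂ D hc h0 (hz _ _ hk0)
      refine ⟨φ'', h1, ?_⟩
      cases s
      · have hn1 : ∀ z : ZMod 3, sideCharge false z = 2 → z = 1 := by decide
        exact h4 x (hn1 _ hs) (triangleOf_wrap _ _ _).symm
      · exact h3 x hs (triangleOf_wrap _ _ _).symm
    · obtain ⟨φ'', h1, h2⟩ := exists_clusterStep_threes hL₁ hL₂ D hc h0 h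
      exact ⟨φ'', h1, h2 x rfl⟩
  -- Every vertex is the centre of a trimer or has a leg in 3 on one side. In the latter case the
  -- triangle on that side belongs to a trimer or has three legs in 3.
  have hz : ∀ z : ZMod 3, z = 0 ∨ sideCharge true z = 2 ∨ sideCharge false z = 2 := by decide
  rcases hz (D.gen (φ₀ x)).charge with h | h | h
  · obtain ⟨φ'', h1, h2, -⟩ := exists_clusterStep_trimer hL₁ hL₂ D hc h0 h
    exact ⟨φ'', h1, h2⟩
  · exact side true h
  · exact side false h

end Clusters

/-! ### States that satisfy all local exchange relations -/

section Saturation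

set_option linter.unusedSectionVars false

theorem comp_patch {L₁ L₂ : ℕ} {σ τ : Type} (γ : σ → τ) (φ : Site L₁ L₂ → σ)
    (p : ZMod L₁ × ZMod L₂) (R : Finset KSite) (ρ : R → σ) (x : Site L₁ L₂) :
    γ (patch φ p R ρ x) = patch (fun x => γ (φ x)) p R (fun r => γ (ρ r)) x := by
  unfold patch
  split_ifs <;> rfl

variable {σ : Type} {P : σ → Virt → Virt → ℂ} {ζ : ℝ}
  {C : ∀ (L₁ L₂ : ℕ) [NeZero L₁] [NeZero L₂], Set ((Site L₁ L₂ → ZMod 3) → ℂ)}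

/-- The states `ρ` and `ρ'` of the region `R` are interchangeable in all network states with
coefficient functions in `C`. -/
def Exchange (ζ : ℝ) (P : σ → Virt → Virt → ℂ)
    (C : ∀ (L₁ L₂ : ℕ) [NeZero L₁] [NeZero L₂], Set ((Site L₁ L₂ → ZMod 3) → ℂ))
    (R : Finset KSite) (ρ ρ' : R → σ) (a b : ℂ) : Prop :=
  ∀ (L₁ L₂ : ℕ) [NeZero L₁] [NeZero L₂], 20 ≤ L₁ → 20 ≤ L₂ → ∀ c ∈ C L₁ L₂,
    ∀ (p : ZMod L₁ × ZMod L₂) (φ : Site L₁ L₂ → σ),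
      a * networkState L₁ L₂ ζ P c (patch φ p R ρ) = b * networkState L₁ L₂ ζ P c (patch φ p R ρ')

/-- If one of the amplitudes vanishes, both sides of the relation do. So the coefficients have to be
compared only for admissible loop configurations. -/
theorem AmplitudeExchange.exchange {D : ArrowMap P} {R : Finset KSite} {ρ ρ' : R → σ} {a b : ℂ}
    (h : AmplitudeExchange ζ D R ρ ρ' a b)
    (hC : ∀ (L₁ L₂ : ℕ) [NeZero L₁] [NeZero L₂], 20 ≤ L₁ → 20 ≤ L₂ →
      ∀ c ∈ C L₁ L₂, ∀ (p : ZMod L₁ × ZMod L₂) (φ : Site L₁ L₂ → σ),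
      LoopValid (fun x => (D.gen (patch φ p R ρ x)).charge) →
      LoopValid (fun x => (D.gen (patch φ p R ρ' x)).charge) →
      c (fun x => (D.gen (patch φ p R ρ x)).charge) =
        c (fun x => (D.gen (patch φ p R ρ' x)).charge)) : Exchange ζ P C R ρ ρ' a b := by
  intro L₁ L₂ _ _ hL₁ hL₂ c hc p φ
  have key := h L₁ L₂ hL₁ hL₂ p φ
  rw [networkState_eq D, networkState_eq D]
  by_cases h1 : amplitude ζ (fun x => D.gen (patch φ p R ρ x)) = 0
  · rw [h1, mul_zero] at key
    rw [h1, mul_zero, mul_zero, mul_left_comm, ← key, mul_zero]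
  by_cases h2 : amplitude ζ (fun x => D.gen (patch φ p R ρ' x)) = 0
  · rw [h2, mul_zero] at key
    rw [h2, mul_zero, mul_zero, mul_left_comm, key, mul_zero]
  rw [hC L₁ L₂ hL₁ hL₂ c hc p φ (loopValid_of_amplitude_ne_zero h1)
    (loopValid_of_amplitude_ne_zero h2), mul_left_comm, key, mul_left_comm]

variable {L₁ L₂ : ℕ}

/-- All slices of `ψ` satisfy the exchange relations in `R`. -/
def Saturated (ζ : ℝ) (P : σ → Virt → Virt → ℂ)
    (C : ∀ (L₁ L₂ : ℕ) [NeZero L₁] [NeZero L₂], Set ((Site L₁ L₂ → ZMod 3) → ℂ))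
    (R : Finset KSite) (ψ : (Site L₁ L₂ → σ) → ℂ) : Prop :=
  ∀ (ρ ρ' : R → σ) (a b : ℂ), Exchange ζ P C R ρ ρ' a b → ∀ (p : ZMod L₁ × ZMod L₂)
    (φ : Site L₁ L₂ → σ), a * ψ (patch φ p R ρ) = b * ψ (patch φ p R ρ')

theorem patch_patch_subset {Q R : Finset KSite} (hQR : Q ⊆ R) {p : ZMod L₁ × ZMod L₂}
    (hR : Embeds p R) [DecidablePred fun r : R => r.1 ∈ Q] (φ : Site L₁ L₂ → σ) (η : R → σ)
    (ρ : Q → σ) : patch φ p R (fun r => if h : r.1 ∈ Q then ρ ⟨r, h⟩ else η r) =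
      patch (patch φ p R η) p Q ρ := by
  have hQ : Embeds p Q := fun x hx y hy h => hR (hQR hx) (hQR hy) h
  symm
  rw [eq_patch_iff hR]
  refine ⟨fun r => ?_, fun x hx => ?_⟩
  · by_cases h : r.1 ∈ Q
    · rw [dif_pos h]
      exact patch_wrap hQ _ ρ ⟨r, h⟩
    · rw [dif_neg h, patch_of_ne, patch_wrap hR]
      exact fun q hq he => h (by rwa [hR r.2 (hQR hq) he])
  · rw [patch_of_ne _ _ fun r hr => hx r (hQR hr), patch_of_ne _ _ hx]

/-- A relation in the smaller region becomes one in the larger region when the state of the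
remaining vertices is frozen. -/
theorem Saturated.mono (hL₁ : 20 ≤ L₁) (hL₂ : 20 ≤ L₂) {Q R : Finset KSite} (hQR : Q ⊆ R)
    (hR : ∀ x ∈ R, Near x.1) {ψ : (Site L₁ L₂ → σ) → ℂ} (h : Saturated ζ P C R ψ) :
    Saturated ζ P C Q ψ := by
  classical
  intro ρ ρ' a b hex p φ
  have hE := embeds_of_near hL₁ hL₂ hR p
  have key := h (fun r => if h : r.1 ∈ Q then ρ ⟨r, h⟩ else φ (wrap p r))
    (fun r => if h : r.1 ∈ Q then ρ' ⟨r, h⟩ else φ (wrap p r)) a b (by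
      intro L₁' L₂' _ _ hL₁' hL₂' c hc p' φ'
      rw [patch_patch_subset hQR (embeds_of_near hL₁' hL₂' hR p'),
        patch_patch_subset hQR (embeds_of_near hL₁' hL₂' hR p')]
      exact hex L₁' L₂' hL₁' hL₂' c hc p' _) p φ
  rwa [patch_patch_subset hQR hE, patch_patch_subset hQR hE, patch_self hE] at key

/-- A local change read off from one torus is still a hexagon move in arbitrary surroundings on
another torus. This is needed because admitted relations have to hold on all tori. -/
theorem patch_hexMove (hL₁ : 20 ≤ L₁) (hL₂ : 20 ≤ L₂) {R : Finset KSite} {q : ℤ × ℤ} {δ : ZMod 3}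
    (hR : ∀ r ∈ R, Near r.1 ∧ Near (r.1 - q) ∧ Near (r.1 - q + latVec r.2))
    (hq : ∀ x ∈ hexagon 0, (q + x.1, x.2) ∈ R) {f f' : R → ZMod 3}
    (hf : ∀ r, f' r = f r + moveCharge δ (r.1.1 - q, r.1.2)) (p : ZMod L₁ × ZMod L₂)
    (F : Site L₁ L₂ → ZMod 3) :
    patch F p R f' = hexMove (p + red L₁ L₂ q) δ (patch F p R f) := by
  have hE := embeds_of_near hL₁ hL₂ (fun r hr => (hR r hr).1) p
  symm
  rw [eq_patch_iff hE]
  refine ⟨fun r => ?_, fun x hx => ?_⟩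
  · rw [hexMove_wrap hL₁ hL₂ q (hR r r.2).2.1 (hR r r.2).2.2, patch_wrap hE, hf]
  · obtain ⟨w, d⟩ := x
    rw [hexMove_of_ne, patch_of_ne _ _ hx]
    intro y hy he
    refine hx _ (hq y hy) (he.trans ?_)
    simp only [wrap, red_add, add_assoc]

/-- The regions on which the exchange relations determine the states up to the crystals. -/
def LocallySaturated (ζ : ℝ) (P : σ → Virt → Virt → ℂ)
    (C : ∀ (L₁ L₂ : ℕ) [NeZero L₁] [NeZero L₂], Set ((Site L₁ L₂ → ZMod 3) → ℂ))
    (ψ : (Site L₁ L₂ → σ) → ℂ) : Prop :=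
  (∀ d, Saturated ζ P C (triangles (0, d)) ψ) ∧
    ∀ i : Fin 3, Saturated ζ P C (hexagonPair i.castSucc.castSucc.castSucc) ψ

variable [NeZero L₁] [NeZero L₂] {ψ : (Site L₁ L₂ → σ) → ℂ}

theorem LocallySaturated.eq_zero (hL₁ : 20 ≤ L₁) (hL₂ : 20 ≤ L₂) (D : ArrowMap P)
    (hψ : LocallySaturated ζ P C ψ) {φ : Site L₁ L₂ → σ}
    (hφ : ¬LoopValid fun x => (D.gen (φ x)).charge) : ψ φ = 0 := by
  have : ∃ s Q, ¬TriangleValid fun k => (D.gen (φ (wrap Q (corner s k)))).charge := by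
    by_contra! hcon
    exact hφ fun Q => ⟨hcon true Q, hcon false Q⟩
  obtain ⟨s, Q, hsQ⟩ := this
  obtain ⟨p, hp⟩ : ∃ p, Q = p + red L₁ L₂ (ktri s ((0, 0) : KSite)).2 :=
    ⟨_, (sub_add_cancel _ _).symm⟩
  have hw : ∀ k, wrap p (kcorner (ktri s ((0, 0) : KSite)) k) = wrap Q (corner s k) := fun k => by
    rw [wrap_kcorner, hp]; rfl
  have hE := embeds_of_near hL₁ hL₂ (near_of_mem_triangles (d := 0)) p
  have key := hψ.1 0 _ _ _ _ ((amplitudeExchange_zero (ζ := ζ) D (s := s) (d := 0)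
    (f := fun r => φ (wrap p r)) (by simp only [hw]; exact hsQ)).exchange
      fun _ _ _ _ _ _ _ _ _ _ _ _ => rfl) p φ
  rwa [one_mul, zero_mul, patch_self hE] at key

theorem patch_eq_of_eq_off {R : Finset KSite} {p : ZMod L₁ × ZMod L₂} (hR : Embeds p R)
    {φ φ' : Site L₁ L₂ → σ} (h : ∀ w, (∀ r ∈ R, w ≠ wrap p r) → φ w = φ' w) :
    patch φ p R (fun r => φ' (wrap p r)) = φ' :=
  ((eq_patch_iff hR _ _ _).2 ⟨fun _ => rfl, fun w hw => (h w hw).symm⟩).symm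

/-- Exchange relations hold for the amplitudes, and for saturated states. -/
theorem exchange_apply (hL₁ : 20 ≤ L₁) (hL₂ : 20 ≤ L₂) {D : ArrowMap P} {R : Finset KSite}
    (hR : ∀ x ∈ R, Near x.1) {φ φ' : Site L₁ L₂ → σ} {p : ZMod L₁ × ZMod L₂}
    (hoff : ∀ w, (∀ r ∈ R, w ≠ wrap p r) → φ w = φ' w) {a b : ℂ}
    (hA : AmplitudeExchange ζ D R (fun r => φ (wrap p r)) (fun r => φ' (wrap p r)) a b)
    (hex : Exchange ζ P C R (fun r => φ (wrap p r)) (fun r => φ' (wrap p r)) a b)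
    (hψ : Saturated ζ P C R ψ) : a * ψ φ = b * ψ φ' ∧
      a * amplitude ζ (fun x => D.gen (φ x)) = b * amplitude ζ (fun x => D.gen (φ' x)) := by
  have hE := embeds_of_near hL₁ hL₂ hR p
  have h1 := hA L₁ L₂ hL₁ hL₂ p φ
  have h2 := hψ _ _ _ _ hex p φ
  rw [patch_self hE, patch_eq_of_eq_off hE hoff] at h1 h2
  exact ⟨h2, h1⟩

/-- The configuration is changed to the reference one cluster at a time, within a fixed loop
configuration; the values of the state and of the amplitude get the same factors. -/
theorem LocallySaturated.mul_amplitude_eq (hL₁ : 20 ≤ L₁) (hL₂ : 20 ≤ L₂) (D : ArrowMap P)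
    (hψ : LocallySaturated ζ P C ψ) {φ φ₀ : Site L₁ L₂ → σ}
    (hc : ∀ x, (D.gen (φ x)).charge = (D.gen (φ₀ x)).charge)
    (h0 : amplitude ζ (fun x => D.gen (φ₀ x)) ≠ 0) :
    ψ φ * amplitude ζ (fun x => D.gen (φ₀ x)) = ψ φ₀ * amplitude ζ (fun x => D.gen (φ x)) := by
  classical
  induction hn : (Finset.univ.filter fun w => φ w ≠ φ₀ w).card using Nat.strong_induction_on
    generalizing φ with
  | _ n ih =>
    by_cases heq : φ = φ₀
    · rw [heq]
    obtain ⟨x, hx⟩ : ∃ x, φ x ≠ φ₀ x := by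
      by_contra! hcon
      exact heq (funext hcon)
    -- The number of vertices that differ from the reference decreases. The factor `b` may vanish;
    -- only `a` is divided out.
    obtain ⟨φ'', ⟨hor, d, p, hoff, a, b, ha, hab⟩, hx''⟩ := exists_clusterStep hL₁ hL₂ D hc h0 x
    have hc'' : ∀ w, (D.gen (φ'' w)).charge = (D.gen (φ₀ w)).charge := fun w => by
      rcases hor w with h | h
      · rw [h, hc]
      · rw [h]
    have hex : Exchange ζ P C (triangles (0, d)) (fun r => φ (wrap p r))
        (fun r => φ'' (wrap p r)) a b := by
      refine hab.exchange fun L₁' L₂' _ _ _ _ c _ p' φ' _ _ => congrArg c (funext fun w => ?_)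
      rw [comp_patch (fun x => (D.gen x).charge), comp_patch (fun x => (D.gen x).charge)]
      simp only [hc'', hc]
    obtain ⟨h1, h2⟩ := exchange_apply hL₁ hL₂ near_of_mem_triangles hoff hab hex (hψ.1 d)
    have hlt : (Finset.univ.filter fun w => φ'' w ≠ φ₀ w).card < n := by
      rw [← hn]
      refine Finset.card_lt_card (Finset.ssubset_iff_of_subset (fun w hw => ?_) |>.2 ⟨x, ?_, ?_⟩)
      · simp only [Finset.mem_filter, Finset.mem_univ, true_and] at hw ⊢
        rcases hor w with h | h
        · rwa [h] at hw
        · exact absurd h hw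
      · simpa using hx
      · simpa using hx''
    have := ih _ hlt hc'' rfl
    refine mul_left_cancel₀ ha ?_
    linear_combination (amplitude ζ (fun x => D.gen (φ₀ x))) * h1 - ψ φ₀ * h2 + b * this

/-- Saturated states are network states with suitable coefficients. -/
theorem LocallySaturated.exists_eq_networkState (hζ : 0 < ζ) (hL₁ : 20 ≤ L₁) (hL₂ : 20 ≤ L₂)
    (D : ArrowMap P) (hψ : LocallySaturated ζ P C ψ) : ∃ c, ψ = networkState L₁ L₂ ζ P c := by
  classical
  let φ₀ : (Site L₁ L₂ → ZMod 3) → Site L₁ L₂ → σ := fun l x =>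
    D.state (torusPattern l (fun _ => 0) x)
  refine ⟨fun l => ψ (φ₀ l) / amplitude ζ (fun x => D.gen (φ₀ l x)), ?_⟩
  funext φ
  rw [networkState_eq D]
  by_cases hv : LoopValid fun x => (D.gen (φ x)).charge
  · have h0 : amplitude ζ (fun x => D.gen (φ₀ (fun x => (D.gen (φ x)).charge) x)) ≠ 0 :=
      amplitude_torusPattern_ne_zero hζ D hv _
    rw [div_mul_eq_mul_div, eq_div_iff h0]
    exact hψ.mul_amplitude_eq hL₁ hL₂ D (fun x => (charge_torusPattern D (fun x => (D.gen (φ x)).charge) _ x).symm) h0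
  · rw [hψ.eq_zero hL₁ hL₂ D hv]
    by_cases h0 : amplitude ζ (fun x => D.gen (φ x)) = 0
    · rw [h0, mul_zero]
    · exact absurd (loopValid_of_amplitude_ne_zero h0) hv

/-- The coefficients of saturated states are invariant under local changes of the loop
configuration that leave the coefficient functions in `C` invariant. -/
theorem coeff_eq_of_saturated (hζ : 0 < ζ) (hL₁ : 20 ≤ L₁) (hL₂ : 20 ≤ L₂) (D : ArrowMap P)
    {R A : Finset KSite} (hAR : A ⊆ R) (hA : Clustered A) (hR : ∀ x ∈ R, Near x.1)
    (hT : ∀ t ∈ trianglesOf A, Near t.2 ∧ ∀ k, Near (kcorner t k).1)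
    {l l' : Site L₁ L₂ → ZMod 3} (hl : LoopValid l) (hl' : LoopValid l') {p : ZMod L₁ × ZMod L₂}
    (hll : ∀ w, (∀ x ∈ A, w ≠ wrap p x) → l w = l' w)
    (hf : ForcedCharges R (trianglesOf A) fun x => l (wrap p x))
    (hf' : ForcedCharges R (trianglesOf A) fun x => l' (wrap p x))
    (hC : ∀ (L₁' L₂' : ℕ) [NeZero L₁'] [NeZero L₂'], 20 ≤ L₁' → 20 ≤ L₂' → ∀ c ∈ C L₁' L₂',
      ∀ (p' : ZMod L₁' × ZMod L₂') (F : Site L₁' L₂' → ZMod 3),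
      LoopValid (patch F p' R fun r => l (wrap p r)) →
      LoopValid (patch F p' R fun r => l' (wrap p r)) →
      c (patch F p' R fun r => l (wrap p r)) = c (patch F p' R fun r => l' (wrap p r)))
    {c : (Site L₁ L₂ → ZMod 3) → ℂ} (hψ : Saturated ζ P C R (networkState L₁ L₂ ζ P c)) :
    c l = c l' := by
  obtain ⟨φ, φ', h1, h2, h3, h4, hoff, a, b, ha, hb, hab⟩ :=
    exists_amplitudeExchange hζ D hAR hA hR hT hL₁ hL₂ hl hl' hll hf hf'
  -- The amplitude relation does not depend on the surroundings, so it is admitted as soon as the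
  -- coefficient functions in `C` agree on the two loop configurations in every environment.
  have hex : Exchange ζ P C R (fun r => φ (wrap p r)) (fun r => φ' (wrap p r)) a b := by
    refine hab.exchange fun L₁' L₂' _ _ hL₁' hL₂' c hc p' F hv hv' => ?_
    simp only [comp_patch (fun x => (D.gen x).charge), h1, h2] at hv hv' ⊢
    exact hC L₁' L₂' hL₁' hL₂' c hc p' _ hv hv'
  obtain ⟨e1, e2⟩ := exchange_apply hL₁ hL₂ hR hoff hab hex hψ
  rw [networkState_eq D, networkState_eq D, funext h1, funext h2] at e1
  have h5 : a * amplitude ζ (fun x => D.gen (φ x)) ≠ 0 := mul_ne_zero ha h3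
  refine mul_right_cancel₀ h5 ?_
  linear_combination e1 - c l' * e2

end Saturation

/-! ### Changes of the crystals -/

section CrystalMoves

set_option linter.unusedSectionVars false

/-- The crystal with the values `first`, `second` on the vertices of the first two kinds can be changed
around the hexagons at the origin and at `latVec dir`, in the region of these hexagons and `outer`. -/
structure CrystalChange where
  first : Fin 3
  second : Fin 3
  dir : Fin 3
  step : ZMod 3
  step' : ZMod 3
  outer : KSite

/-- The changes of the six crystals. -/
def crystalChange : Fin 6 → CrystalChange :=
  ![⟨0, 1, 1, 2, 1, ((-1, 0), 1)⟩, ⟨0, 2, 1, 1, 2, ((1, 0), 1)⟩, ⟨1, 0, 0, 2, 1, ((-1, 1), 0)⟩,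
    ⟨1, 2, 0, 2, 1, ((0, 1), 0)⟩, ⟨2, 0, 0, 1, 2, ((1, -1), 0)⟩, ⟨2, 1, 0, 1, 2, ((0, -1), 0)⟩]

/-- The region of a change of a crystal. -/
def crystalRegion (i : Fin 6) : Finset KSite :=
  insert (crystalChange i).outer (doubleHexagon (crystalChange i).dir)

/-- The charges of a crystal. -/
def crystalCharge (e : Equiv.Perm (Fin 3)) (x : KSite) : ZMod 3 := ((e x.2 : Fin 3) : ℕ)

/-- The change of the charges of a crystal. -/
def CrystalChange.charge (m : CrystalChange) (c : KSite → ZMod 3) (x : KSite) : ZMod 3 :=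
  c x + moveCharge m.step x + moveCharge m.step' (x.1 - latVec m.dir, x.2)

instance : DecidablePred TriangleValid := fun _ => inferInstanceAs (Decidable (_ ∧ _))

instance (R : Finset KSite) (T : Finset (Bool × (ℤ × ℤ))) (l : KSite → ZMod 3) :
    Decidable (ForcedCharges R T l) := inferInstanceAs (Decidable (∀ t ∈ T, _))

/-- A finite check for the six crystals. Single hexagons are rigid, but opposite changes around two
adjacent hexagons give admissible triangles, and one outer vertex suffices to force the colours of
the others before and after. -/
theorem exists_crystalChange (e : Equiv.Perm (Fin 3)) : ∃ i,
    ((crystalChange i).first = e 0 ∧ (crystalChange i).second = e 1) ∧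
    (∀ t ∈ trianglesOf (doubleHexagon (crystalChange i).dir),
      TriangleValid fun k => (crystalChange i).charge (crystalCharge e) (kcorner t k)) ∧
    ForcedCharges (crystalRegion i) (trianglesOf (doubleHexagon (crystalChange i).dir))
      (crystalCharge e) ∧
    ForcedCharges (crystalRegion i) (trianglesOf (doubleHexagon (crystalChange i).dir))
      ((crystalChange i).charge (crystalCharge e)) ∧
    ∃ x ∈ doubleHexagon (crystalChange i).dir,
      (crystalChange i).charge (crystalCharge e) x ≠ crystalCharge e x := by
  revert e; decide +kernel

instance : DecidablePred Clustered := fun A => inferInstanceAs (Decidable (∀ x ∈ A, _))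

theorem clustered_hexagon : Clustered (hexagon 0) := by decide +kernel

theorem clustered_doubleHexagon (d : Fin 3) : Clustered (doubleHexagon d) := by
  revert d; decide +kernel

theorem mem_doubleHexagon (d : Fin 3) : ∀ x ∈ hexagon 0,
    x ∈ doubleHexagon d ∧ ((latVec d + x.1, x.2) : KSite) ∈ doubleHexagon d := by
  revert d; decide

theorem near_hexagonPair (i : Fin 6) : ∀ r ∈ hexagonPair i,
    Near r.1 ∧ Near (r.1 - 0) ∧ Near (r.1 - 0 + latVec r.2) := by
  revert i; decide +kernel

theorem near_crystalRegion (i : Fin 6) : ∀ r ∈ crystalRegion i, Near r.1 ∧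
    (Near (r.1 - 0) ∧ Near (r.1 - 0 + latVec r.2)) ∧ Near (r.1 - latVec (crystalChange i).dir) ∧
      Near (r.1 - latVec (crystalChange i).dir + latVec r.2) := by
  revert i; decide +kernel

theorem near_trianglesOf_hexagon : ∀ t ∈ trianglesOf (hexagon 0),
    Near t.2 ∧ ∀ k, Near (kcorner t k).1 := by
  decide +kernel

theorem near_trianglesOf_doubleHexagon (d : Fin 3) : ∀ t ∈ trianglesOf (doubleHexagon d),
    (Near t.2 ∧ ∀ k, Near (kcorner t k).1) ∧ ∀ k, (Near ((kcorner t k).1 - 0) ∧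
      Near ((kcorner t k).1 - 0 + latVec k)) ∧ Near ((kcorner t k).1 - latVec d) ∧
      Near ((kcorner t k).1 - latVec d + latVec k) := by
  revert d; decide +kernel

theorem ForcedCharges.congr {R : Finset KSite} {T : Finset (Bool × (ℤ × ℤ))} {l l' : KSite → ZMod 3}
    (h : ForcedCharges R T l) (hR : ∀ r ∈ R, l r = l' r)
    (hT : ∀ t ∈ T, ∀ k, l (kcorner t k) = l' (kcorner t k)) : ForcedCharges R T l' := by
  intro t ht k hk hc
  rw [← hT t ht] at hc
  rcases h t ht k hk hc with h | ⟨k', hk', h0, k'', hk'', h2⟩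
  · exact Or.inl fun k' => by rw [← hT t ht]; exact h k'
  · exact Or.inr ⟨k', hk', by rw [← hR _ hk']; exact h0, k'', hk'', by rw [← hR _ hk'']; exact h2⟩

variable {L₁ L₂ : ℕ}

theorem loopValid_of_eq_off {A : Finset KSite} {l l' : Site L₁ L₂ → ZMod 3} (hl : LoopValid l)
    {p : ZMod L₁ × ZMod L₂} (hll : ∀ w, (∀ x ∈ A, w ≠ wrap p x) → l w = l' w)
    (hA : ∀ t ∈ trianglesOf A, TriangleValid fun k => l' (wrap p (kcorner t k))) :
    LoopValid l' := by
  have key : ∀ s Q, TriangleValid fun k => l' (wrap Q (corner s k)) := by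
    intro s Q
    by_cases h : ∃ k, ∃ x ∈ A, wrap Q (corner s k) = wrap p x
    · obtain ⟨k, x, hx, he⟩ := h
      have hQ : Q = p + red L₁ L₂ (ktri s x).2 := by
        rw [← triangleOf_wrap_ktri, ← he, triangleOf_wrap]
      have := hA (ktri s x) (mem_trianglesOf.2 ⟨x, hx, rfl⟩)
      simp only [wrap_kcorner, ← hQ] at this
      exact this
    · push Not at h
      simp only [← hll _ (h _)]
      cases s
      · exact (hl Q).2
      · exact (hl Q).1
  exact fun Q => ⟨key true Q, key false Q⟩

variable {σ : Type} {P : σ → Virt → Virt → ℂ} {ζ : ℝ} [NeZero L₁] [NeZero L₂]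
  {C : ∀ (L₁ L₂ : ℕ) [NeZero L₁] [NeZero L₂], Set ((Site L₁ L₂ → ZMod 3) → ℂ)}
  {c : (Site L₁ L₂ → ZMod 3) → ℂ}

/-- One of the three hexagon regions forces the colours for the move. In other surroundings the same
change is again an elementary step, under which the coefficient functions in `C` are invariant. -/
theorem LocallySaturated.coeff_eq_of_step (hζ : 0 < ζ) (hL₁ : 20 ≤ L₁) (hL₂ : 20 ≤ L₂)
    (D : ArrowMap P) (hC : ∀ (L₁ L₂ : ℕ) [NeZero L₁] [NeZero L₂], 20 ≤ L₁ → 20 ≤ L₂ →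
      ∀ c ∈ C L₁ L₂, ∀ F F', LoopStep F F' → c F = c F')
    (hψ : LocallySaturated ζ P C (networkState L₁ L₂ ζ P c)) {l l' : Site L₁ L₂ → ZMod 3}
    (hs : LoopStep l l') : c l = c l' := by
  obtain ⟨hl, hl', p, δ, rfl⟩ := hs
  by_cases hδ : δ = 0
  · subst hδ
    congr 1
    funext x
    simp [hexMove]
  obtain ⟨i, hf, hf'⟩ := exists_forcedCharges_hexMove hL₁ hL₂ hδ hl hl'
  have hnear := near_hexagonPair i.castSucc.castSucc.castSucc
  refine coeff_eq_of_saturated hζ hL₁ hL₂ D (Finset.subset_union_left) clustered_hexagon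
    (fun x hx => (hnear x hx).1) near_trianglesOf_hexagon hl hl'
    (fun w hw => (hexMove_of_ne δ l hw).symm) hf hf' ?_ (hψ.2 i)
  intro L₁' L₂' _ _ hL₁' hL₂' c hc p' F hv hv'
  have e := patch_hexMove hL₁' hL₂' (δ := δ) hnear (fun x hx => by
    rw [zero_add]; exact Finset.mem_union_left _ hx)
    (f := fun r => l (wrap p r)) (f' := fun r => hexMove p δ l (wrap p r)) (fun r => by
      have := hexMove_wrap hL₁ hL₂ 0 (hnear r r.2).2.1 (hnear r r.2).2.2 p δ l
      rwa [red_zero, add_zero] at this) p' F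
  exact hC L₁' L₂' hL₁' hL₂' c hc _ _ ⟨hv, hv', _, δ, e⟩

/-- The composite of two hexagon moves is made in a single step inside the double hexagon, so the
intermediate configuration need not be admissible. The winding numbers are invariant under each of
the moves. -/
theorem exists_eq_coeff_crystal (hζ : 0 < ζ) (hL₁ : 20 ≤ L₁) (hL₂ : 20 ≤ L₂) (D : ArrowMap P)
    (hC : ∀ (L₁ L₂ : ℕ) [NeZero L₁] [NeZero L₂], 20 ≤ L₁ → 20 ≤ L₂ → ∀ c ∈ C L₁ L₂, ∀ F F',
      windingOne F = windingOne F' → windingTwo F = windingTwo F' → c F = c F')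
    (hψ : ∀ i, Saturated ζ P C (crystalRegion i) (networkState L₁ L₂ ζ P c))
    (e : Equiv.Perm (Fin 3)) : ∃ l', LoopValid l' ∧ (∀ e', l' ≠ crystalLoop L₁ L₂ e') ∧
      windingOne l' = windingOne (crystalLoop L₁ L₂ e) ∧
      windingTwo l' = windingTwo (crystalLoop L₁ L₂ e) ∧ c (crystalLoop L₁ L₂ e) = c l' := by
  obtain ⟨i, -, hval, hf, hf', x₀, hx₀, hne⟩ := exists_crystalChange e
  have hnearR := near_crystalRegion i
  have hnearT := near_trianglesOf_doubleHexagon (crystalChange i).dir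
  have hmem := mem_doubleHexagon (crystalChange i).dir
  set m := crystalChange i with hm
  set l := crystalLoop L₁ L₂ e
  set l₁ := hexMove (0 + red L₁ L₂ 0) m.step l with hl₁
  set l' := hexMove (0 + red L₁ L₂ (latVec m.dir)) m.step' l₁ with hl'
  have hstep : ∀ {L₁ L₂ : ℕ} (hL₁ : 20 ≤ L₁) (hL₂ : 20 ≤ L₂) (l : Site L₁ L₂ → ZMod 3)
      (p : ZMod L₁ × ZMod L₂) (x : KSite), (Near (x.1 - 0) ∧ Near (x.1 - 0 + latVec x.2)) →
      hexMove (p + red L₁ L₂ 0) m.step l (wrap p x) = l (wrap p x) + moveCharge m.step x := by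
    intro L₁ L₂ hL₁ hL₂ l p x h
    have := hexMove_wrap hL₁ hL₂ 0 h.1 h.2 p m.step l
    rwa [show ((x.1 - 0, x.2) : KSite) = x by rw [sub_zero]] at this
  have hcharge : ∀ x : KSite, (Near (x.1 - 0) ∧ Near (x.1 - 0 + latVec x.2)) ∧
      Near (x.1 - latVec m.dir) ∧ Near (x.1 - latVec m.dir + latVec x.2) →
      m.charge (crystalCharge e) x = l' (wrap 0 x) := fun x hx => by
    rw [hl', hexMove_wrap hL₁ hL₂ _ hx.2.1 hx.2.2, hl₁, hstep hL₁ hL₂ _ _ _ hx.1]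
    rfl
  have hll : ∀ w, (∀ x ∈ doubleHexagon m.dir, w ≠ wrap 0 x) → l w = l' w := by
    rintro ⟨w, d⟩ hw
    rw [hl', hexMove_of_ne, hl₁, hexMove_of_ne]
    · rw [red_zero, add_zero]
      exact fun x hx => hw x (hmem x hx).1
    · intro x hx he
      refine hw _ (hmem x hx).2 (he.trans ?_)
      simp only [wrap, red_add, add_assoc]
  have hl : LoopValid l := crystalLoop_valid e
  have hlv : LoopValid l' := loopValid_of_eq_off hl hll fun t ht => by
    have := hval t ht
    simpa only [hcharge _ ((hnearT t ht).2 _)] using this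
  have hw1 : windingOne l' = windingOne l := by rw [hl', windingOne_hexMove, hl₁, windingOne_hexMove]
  have hw2 : windingTwo l' = windingTwo l := by rw [hl', windingTwo_hexMove, hl₁, windingTwo_hexMove]
  refine ⟨l', hlv, fun e' he' => hne ?_, hw1, hw2, ?_⟩
  -- The vertices at (5, 5) are away from the two hexagons and keep the values of the original
  -- crystal. Were the result a crystal, it would be the same one, but some vertex has changed.
  · have hfar : ∀ (d' d : Fin 3), ∀ x ∈ doubleHexagon d', ((5, 5), d) ≠ x ∧ Near x.1 := by
      decide +kernel
    have h5 : Near (5, 5) := by decide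
    have hd : ∀ d, ((e d : ℕ) : ZMod 3) = ((e' d : ℕ) : ZMod 3) := fun d => by
      have := hll (wrap 0 ((5, 5), d)) fun x hx he => (hfar m.dir d x hx).1
        ((wrap_eq_iff hL₁ hL₂ h5 (hfar m.dir d x hx).2 0).1 he)
      rw [he'] at this
      exact this
    have hx := hcharge x₀ (hnearR x₀ (Finset.mem_insert_of_mem hx₀)).2
    rw [hx, he']
    exact (hd _).symm
  · have hf1 : ForcedCharges (crystalRegion i) (trianglesOf (doubleHexagon m.dir))
        (fun x => l' (wrap 0 x)) := hf'.congr (fun r hr => hcharge _ (hnearR r hr).2)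
      fun t ht k => hcharge _ ((hnearT t ht).2 k)
    refine coeff_eq_of_saturated (R := crystalRegion i) hζ hL₁ hL₂ D (Finset.subset_insert _ _)
      (clustered_doubleHexagon m.dir) (fun x hx => (hnearR x hx).1) (fun t ht => (hnearT t ht).1)
      hl hlv hll hf hf1 ?_ (hψ i)
    intro L₁' L₂' _ _ hL₁' hL₂' c hc p' F _ _
    have e1 := patch_hexMove hL₁' hL₂' (q := 0) (δ := m.step)
      (fun r hr => ⟨(hnearR r hr).1, (hnearR r hr).2.1⟩)
      (fun x hx => by rw [zero_add]; exact Finset.mem_insert_of_mem (hmem x hx).1)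
      (f := fun r => l (wrap 0 r)) (f' := fun r => l₁ (wrap 0 r))
      (fun r => by
        rw [hl₁, hstep hL₁ hL₂ _ _ _ (hnearR r r.2).2.1, sub_zero]) p' F
    have e2 := patch_hexMove hL₁' hL₂' (q := latVec m.dir) (δ := m.step')
      (fun r hr => ⟨(hnearR r hr).1, (hnearR r hr).2.2⟩)
      (fun x hx => Finset.mem_insert_of_mem (hmem x hx).2)
      (f := fun r => l₁ (wrap 0 r)) (f' := fun r => l' (wrap 0 r))
      (fun r => hexMove_wrap hL₁ hL₂ _ (hnearR r r.2).2.2.1 (hnearR r r.2).2.2.2 _ _ _) p' F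
    refine hC L₁' L₂' hL₁' hL₂' c hc _ _ ?_ ?_
    · rw [e2, windingOne_hexMove, e1, windingOne_hexMove]
    · rw [e2, windingTwo_hexMove, e1, windingTwo_hexMove]

end CrystalMoves

/-! ### Ground spaces and their dimensions -/

section GroundSpaces

set_option linter.unusedSectionVars false

/-- The characters of `ZMod 3`. -/
noncomputable def phase (z : ZMod 3) : ℂ := Complex.exp (2 * Real.pi * Complex.I / 3) ^ z.val

theorem exp_pow_three : Complex.exp (2 * Real.pi * Complex.I / 3) ^ 3 = 1 := by
  rw [← Complex.exp_nat_mul]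
  push_cast
  rw [mul_div_cancel₀ _ (by norm_num : (3 : ℂ) ≠ 0), Complex.exp_two_pi_mul_I]

theorem phase_add (x y : ZMod 3) : phase (x + y) = phase x * phase y := by
  unfold phase
  rw [ZMod.val_add, ← pow_eq_pow_mod _ exp_pow_three, pow_add]

theorem sum_phase (z : ZMod 3) : ∑ ν : ZMod 3, phase (ν * z) = if z = 0 then 3 else 0 := by
  have hprim := Complex.isPrimitiveRoot_exp 3 (by norm_num)
  have hs := hprim.geom_sum_eq_zero (by norm_num)
  simp only [Finset.sum_range_succ, Finset.sum_range_zero, Nat.cast_ofNat] at hs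
  have h3 : ∀ f : ZMod 3 → ℂ, ∑ ν, f ν = f 0 + f 1 + f 2 := Fin.sum_univ_three
  have hz : ∀ z : ZMod 3, z = 0 ∨ z = 1 ∨ z = 2 := by decide
  have v0 : (0 : ZMod 3).val = 0 := rfl
  have v1 : (1 : ZMod 3).val = 1 := rfl
  have v2 : (2 : ZMod 3).val = 2 := rfl
  have h22 : (2 * 2 : ZMod 3) = 1 := by decide
  have h10 : (1 : ZMod 3) ≠ 0 := by decide
  have h20 : (2 : ZMod 3) ≠ 0 := by decide
  rw [h3]
  rcases hz z with rfl | rfl | rfl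
  · rw [if_pos rfl]
    simp only [mul_zero, phase, v0, pow_zero]; norm_num
  · rw [if_neg h10]
    simp only [mul_one, phase, v0, v1, v2]
    linear_combination hs
  · rw [if_neg h20]
    simp only [zero_mul, one_mul, h22, phase, v0, v1, v2]
    linear_combination hs

variable {L₁ L₂ : ℕ} [NeZero L₁] [NeZero L₂]

/-- The winding numbers. -/
def windings (l : Site L₁ L₂ → ZMod 3) : ZMod 3 × ZMod 3 := (windingOne l, windingTwo l)

/-- The coefficient functions of the topological states. -/
noncomputable def siblingCoeff (ν : ZMod 3 × ZMod 3) (l : Site L₁ L₂ → ZMod 3) : ℂ :=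
  phase (ν.1 * windingOne l + ν.2 * windingTwo l)

open Classical in
/-- The coefficient functions of the crystals. -/
noncomputable def crystalCoeff (e : Equiv.Perm (Fin 3)) (l : Site L₁ L₂ → ZMod 3) : ℂ :=
  if l = crystalLoop L₁ L₂ e then 1 else 0

/-- The coefficient functions of the sectors of fixed winding numbers. -/
noncomputable def sectorCoeff (w : ZMod 3 × ZMod 3) (l : Site L₁ L₂ → ZMod 3) : ℂ :=
  if windings l = w then 1 else 0

theorem siblingCoeff_eq_sum (ν : ZMod 3 × ZMod 3) :
    (siblingCoeff ν : (Site L₁ L₂ → ZMod 3) → ℂ) =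
      ∑ w, phase (ν.1 * w.1 + ν.2 * w.2) • sectorCoeff w := by
  funext l
  simp only [Finset.sum_apply, Pi.smul_apply, sectorCoeff, smul_eq_mul, mul_ite, mul_one, mul_zero,
    Finset.sum_ite_eq, Finset.mem_univ, if_true]
  rfl

/-- Fourier inversion on ℤ₃ × ℤ₃: the nine siblings span the same space as the nine sectors. -/
theorem sectorCoeff_eq_sum (w : ZMod 3 × ZMod 3) :
    (sectorCoeff w : (Site L₁ L₂ → ZMod 3) → ℂ) =
      ∑ ν, (phase (-(ν.1 * w.1 + ν.2 * w.2)) / 9) • siblingCoeff ν := by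
  funext l
  have key : ∀ ν : ZMod 3 × ZMod 3, phase (-(ν.1 * w.1 + ν.2 * w.2)) / 9 *
      phase (ν.1 * windingOne l + ν.2 * windingTwo l) =
      phase (ν.1 * (windingOne l - w.1)) * phase (ν.2 * (windingTwo l - w.2)) / 9 := fun ν => by
    rw [div_mul_eq_mul_div, ← phase_add, ← phase_add]
    congr 2
    ring
  simp only [Finset.sum_apply, Pi.smul_apply, siblingCoeff, smul_eq_mul, key,
    Fintype.sum_prod_type, ← Finset.sum_div, ← Finset.mul_sum, ← Finset.sum_mul, sum_phase,
    sectorCoeff, windings, sub_eq_zero]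
  obtain ⟨w₁, w₂⟩ := w
  simp only [Prod.mk.injEq]
  by_cases h1 : windingOne l = w₁ <;> by_cases h2 : windingTwo l = w₂ <;> simp [h1, h2]
  norm_num

variable {σ : Type} {P : σ → Virt → Virt → ℂ} {ζ : ℝ}

/-- Network states as a linear function of the coefficients. -/
noncomputable def networkLinear (L₁ L₂ : ℕ) [NeZero L₁] [NeZero L₂] (ζ : ℝ)
    (P : σ → Virt → Virt → ℂ) :
    ((Site L₁ L₂ → ZMod 3) → ℂ) →ₗ[ℂ] (Site L₁ L₂ → σ) → ℂ where
  toFun := networkState L₁ L₂ ζ P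
  map_add' c c' := by
    funext φ
    simp only [networkState, Pi.add_apply, add_mul, Finset.sum_add_distrib]
  map_smul' a c := by
    funext φ
    simp only [networkState, Pi.smul_apply, smul_eq_mul, mul_assoc, Finset.mul_sum, RingHom.id_apply]

theorem sibling_eq (ν : ZMod 3 × ZMod 3) :
    sibling L₁ L₂ ζ P ν = networkLinear L₁ L₂ ζ P (siblingCoeff ν) := rfl

theorem crystal_eq (e : Equiv.Perm (Fin 3)) :
    crystal L₁ L₂ ζ P e = networkLinear L₁ L₂ ζ P (crystalCoeff e) := by
  unfold crystal
  refine congrArg (networkState L₁ L₂ ζ P) ?_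
  funext l
  simp only [crystalCoeff, funext_iff, crystalLoop]

theorem topSpace_eq : topSpace L₁ L₂ ζ P =
    Submodule.span ℂ (Set.range fun w => networkLinear L₁ L₂ ζ P (sectorCoeff w)) := by
  refine le_antisymm (Submodule.span_le.2 ?_) (Submodule.span_le.2 ?_)
  · rintro _ ⟨ν, rfl⟩
    rw [sibling_eq, siblingCoeff_eq_sum, map_sum]
    refine Submodule.sum_mem _ fun w _ => ?_
    rw [map_smul]
    exact Submodule.smul_mem _ _ (Submodule.subset_span ⟨w, rfl⟩)
  · rintro _ ⟨w, rfl⟩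
    simp only
    rw [sectorCoeff_eq_sum, map_sum]
    refine Submodule.sum_mem _ fun ν _ => ?_
    rw [map_smul]
    exact Submodule.smul_mem _ _ (Submodule.subset_span ⟨ν, rfl⟩)

theorem topSpace_sup_iceSpace_eq : topSpace L₁ L₂ ζ P ⊔ iceSpace L₁ L₂ ζ P =
    Submodule.span ℂ (Set.range (Sum.elim (fun w => networkLinear L₁ L₂ ζ P (sectorCoeff w))
      fun e => networkLinear L₁ L₂ ζ P (crystalCoeff e))) := by
  rw [Set.Sum.elim_range, Submodule.span_union, topSpace_eq, iceSpace, funext crystal_eq]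

theorem crystalLoop_injective : Function.Injective (crystalLoop L₁ L₂) := by
  have hinj : Function.Injective fun k : Fin 3 => ((k : ℕ) : ZMod 3) := by decide
  intro e e' h
  ext1 d
  exact hinj (congrFun h (0, d))

theorem networkLinear_apply (D : ArrowMap P) (c : (Site L₁ L₂ → ZMod 3) → ℂ) (φ : Site L₁ L₂ → σ) :
    networkLinear L₁ L₂ ζ P c φ =
      c (fun x => (D.gen (φ x)).charge) * amplitude ζ (fun x => D.gen (φ x)) :=
  networkState_eq D c φ

theorem coeff_eq_zero (hζ : 0 < ζ) (D : ArrowMap P) {c : (Site L₁ L₂ → ZMod 3) → ℂ}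
    (h : networkLinear L₁ L₂ ζ P c = 0) {l : Site L₁ L₂ → ZMod 3} (hl : LoopValid l) : c l = 0 := by
  have := congrFun h fun x => D.state (torusPattern l (fun _ => 0) x)
  rw [networkLinear_apply D, funext (charge_torusPattern D l _)] at this
  exact (mul_eq_zero.1 this).resolve_right (amplitude_torusPattern_ne_zero hζ D hl _)

/-- Coefficients on admissible loop configurations can be read off from the state, because the
canonical configuration has a nonzero amplitude. A noncrystalline configuration in each sector
isolates the sector coefficients; then each crystal isolates its own. -/
theorem linearIndependent_states (hζ : 0 < ζ) (hL₁ : 20 ≤ L₁) (hL₂ : 20 ≤ L₂) (D : ArrowMap P) :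
    LinearIndependent ℂ (Sum.elim (fun w => networkLinear L₁ L₂ ζ P (sectorCoeff w))
      fun e => networkLinear L₁ L₂ ζ P (crystalCoeff e)) := by
  rw [Fintype.linearIndependent_iff]
  intro g hg
  simp only [Fintype.sum_sum_type, Sum.elim_inl, Sum.elim_inr, ← map_smul, ← map_sum, ← map_add] at hg
  have hsec : ∀ l : Site L₁ L₂ → ZMod 3, (∑ w, g (Sum.inl w) • sectorCoeff w) l =
      g (Sum.inl (windings l)) := fun l => by simp [sectorCoeff]
  have h1 : ∀ w, g (Sum.inl w) = 0 := by
    intro w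
    obtain ⟨l, hl, hc, hw1, hw2⟩ := exists_loopValid hL₁ hL₂ w.1 w.2
    have := coeff_eq_zero hζ D hg hl
    rw [Pi.add_apply, hsec, Finset.sum_apply, windings, hw1, hw2] at this
    simpa [crystalCoeff, hc] using this
  have h2 : ∀ e, g (Sum.inr e) = 0 := by
    intro e
    have := coeff_eq_zero hζ D hg (crystalLoop_valid e)
    rw [Pi.add_apply, hsec, h1, zero_add, Finset.sum_apply] at this
    simpa [crystalCoeff, crystalLoop_injective.eq_iff] using this
  rintro (w | e)
  exacts [h1 w, h2 e]

theorem finrank_topSpace (hζ : 0 < ζ) (hL₁ : 20 ≤ L₁) (hL₂ : 20 ≤ L₂) (D : ArrowMap P) :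
    Module.finrank ℂ (topSpace L₁ L₂ ζ P) = 9 := by
  rw [topSpace_eq, finrank_span_eq_card]
  · simp [ZMod.card]
  · exact (linearIndependent_states hζ hL₁ hL₂ D).comp Sum.inl Sum.inl_injective

theorem finrank_topSpace_sup_iceSpace (hζ : 0 < ζ) (hL₁ : 20 ≤ L₁) (hL₂ : 20 ≤ L₂) (D : ArrowMap P) :
    Module.finrank ℂ ↥(topSpace L₁ L₂ ζ P ⊔ iceSpace L₁ L₂ ζ P) = 15 := by
  rw [topSpace_sup_iceSpace_eq, finrank_span_eq_card (linearIndependent_states hζ hL₁ hL₂ D)]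
  simp [ZMod.card, Fintype.card_perm, Nat.factorial]

/-- Coefficients that are constant on the sectors, apart from the crystals. -/
theorem networkLinear_mem (D : ArrowMap P) {c : (Site L₁ L₂ → ZMod 3) → ℂ}
    {F : ZMod 3 × ZMod 3 → ℂ}
    (hF : ∀ l, LoopValid l → (∀ e, l ≠ crystalLoop L₁ L₂ e) → c l = F (windings l)) :
    networkLinear L₁ L₂ ζ P c = networkLinear L₁ L₂ ζ P ((∑ w, F w • sectorCoeff w) +
      ∑ e, (c (crystalLoop L₁ L₂ e) - F (windings (crystalLoop L₁ L₂ e))) • crystalCoeff e) := by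
  funext φ
  rw [networkLinear_apply D, networkLinear_apply D]
  by_cases h0 : amplitude ζ (fun x => D.gen (φ x)) = 0
  · rw [h0, mul_zero, mul_zero]
  congr 1
  have hv := loopValid_of_amplitude_ne_zero h0
  generalize (fun x => (D.gen (φ x)).charge) = l at hv
  have hsec : (∑ w, F w • sectorCoeff w) l = F (windings l) := by simp [sectorCoeff]
  rw [Pi.add_apply, hsec, Finset.sum_apply]
  by_cases hc : ∃ e, l = crystalLoop L₁ L₂ e
  · obtain ⟨e, rfl⟩ := hc
    rw [Finset.sum_eq_single e]
    · simp [crystalCoeff]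
    · intro e' _ he'
      simp [crystalCoeff, crystalLoop_injective.eq_iff, he'.symm]
    · simp
  · push Not at hc
    rw [hF l hv hc, Finset.sum_eq_zero, add_zero]
    intro e _
    simp [crystalCoeff, hc e]

variable {C : ∀ (L₁ L₂ : ℕ) [NeZero L₁] [NeZero L₂], Set ((Site L₁ L₂ → ZMod 3) → ℂ)}
  {ψ : (Site L₁ L₂ → σ) → ℂ}

/-- The states in the span satisfy the exchange relations. -/
theorem saturated_of_mem_span (hL₁ : 20 ≤ L₁) (hL₂ : 20 ≤ L₂)
    (hψ : ψ ∈ Submodule.span ℂ (networkLinear L₁ L₂ ζ P '' C L₁ L₂)) (R : Finset KSite) :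
    Saturated ζ P C R ψ := by
  intro ρ ρ' a b hex p φ
  induction hψ using Submodule.span_induction with
  | mem ψ h =>
    obtain ⟨c, hc, rfl⟩ := h
    exact hex L₁ L₂ hL₁ hL₂ c hc p φ
  | zero => simp
  | add x y _ _ hx hy =>
    simp only [Pi.add_apply, mul_add, hx, hy]
  | smul t x _ hx =>
    simp only [Pi.smul_apply, smul_eq_mul]
    linear_combination t * hx

/-- The coefficient functions of the topological states. -/
def topCoeffs (L₁ L₂ : ℕ) [NeZero L₁] [NeZero L₂] : Set ((Site L₁ L₂ → ZMod 3) → ℂ) :=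
  Set.range siblingCoeff

/-- The coefficient functions of the topological states and the crystals. -/
def iceCoeffs (L₁ L₂ : ℕ) [NeZero L₁] [NeZero L₂] : Set ((Site L₁ L₂ → ZMod 3) → ℂ) :=
  Set.range siblingCoeff ∪ Set.range crystalCoeff

theorem span_topCoeffs : Submodule.span ℂ (networkLinear L₁ L₂ ζ P '' topCoeffs L₁ L₂) =
    topSpace L₁ L₂ ζ P := by
  rw [topCoeffs, ← Set.range_comp]
  rfl

theorem span_iceCoeffs : Submodule.span ℂ (networkLinear L₁ L₂ ζ P '' iceCoeffs L₁ L₂) =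
    topSpace L₁ L₂ ζ P ⊔ iceSpace L₁ L₂ ζ P := by
  rw [iceCoeffs, Set.image_union, Submodule.span_union, ← Set.range_comp, ← Set.range_comp,
    topSpace, iceSpace, funext crystal_eq]
  rfl

theorem topCoeffs_eq {c : (Site L₁ L₂ → ZMod 3) → ℂ} (hc : c ∈ topCoeffs L₁ L₂)
    {F F' : Site L₁ L₂ → ZMod 3} (h1 : windingOne F = windingOne F')
    (h2 : windingTwo F = windingTwo F') : c F = c F' := by
  obtain ⟨ν, rfl⟩ := hc
  simp only [siblingCoeff, h1, h2]

theorem LoopStep.windings_eq {l l' : Site L₁ L₂ → ZMod 3} (h : LoopStep l l') :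
    windingOne l = windingOne l' ∧ windingTwo l = windingTwo l' := by
  obtain ⟨-, -, p, δ, rfl⟩ := h
  rw [windingOne_hexMove, windingTwo_hexMove]
  exact ⟨rfl, rfl⟩

/-- Elementary steps preserve the winding numbers, and they neither leave nor reach a crystal, so
the indicator function of a crystal is invariant too. -/
theorem iceCoeffs_eq (hL₁ : 20 ≤ L₁) (hL₂ : 20 ≤ L₂) {c : (Site L₁ L₂ → ZMod 3) → ℂ}
    (hc : c ∈ iceCoeffs L₁ L₂) {F F' : Site L₁ L₂ → ZMod 3} (h : LoopStep F F') : c F = c F' := by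
  rcases hc with hc | ⟨e, rfl⟩
  · exact topCoeffs_eq hc h.windings_eq.1 h.windings_eq.2
  · unfold crystalCoeff
    refine if_congr ⟨fun h1 => ?_, fun h1 => ?_⟩ rfl rfl
    · rw [h.eq_of_crystal hL₁ hL₂ ⟨e, h1⟩, h1]
    · rw [h.symm.eq_of_crystal hL₁ hL₂ ⟨e, h1⟩, h1]

/-- The coefficient is constant along elementary steps, and these connect the noncrystalline
configurations of a sector. -/
theorem LocallySaturated.exists_sectors (hζ : 0 < ζ) (hL₁ : 20 ≤ L₁) (hL₂ : 20 ≤ L₂)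
    (D : ArrowMap P) (hC : ∀ (L₁ L₂ : ℕ) [NeZero L₁] [NeZero L₂], 20 ≤ L₁ → 20 ≤ L₂ →
      ∀ c ∈ C L₁ L₂, ∀ F F', LoopStep F F' → c F = c F')
    (hψ : LocallySaturated ζ P C ψ) : ∃ (c : (Site L₁ L₂ → ZMod 3) → ℂ) (F : ZMod 3 × ZMod 3 → ℂ),
      ψ = networkLinear L₁ L₂ ζ P c ∧
      ∀ l, LoopValid l → (∀ e, l ≠ crystalLoop L₁ L₂ e) → c l = F (windings l) := by
  obtain ⟨c, rfl⟩ := hψ.exists_eq_networkState hζ hL₁ hL₂ D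
  choose lw hv hcr h1 h2 using exists_loopValid (L₁ := L₁) (L₂ := L₂) hL₁ hL₂
  refine ⟨c, fun w => c (lw w.1 w.2), rfl, fun l hl hlc => ?_⟩
  have hr := hl.reach hL₁ hL₂ (hv (windingOne l) (windingTwo l)) hlc (hcr _ _) (h1 _ _).symm
    (h2 _ _).symm
  have key : ∀ l', Relation.ReflTransGen LoopStep l l' → c l = c l' := fun l' hr => by
    induction hr with
    | refl => rfl
    | tail _ hs ih => exact ih.trans (hψ.coeff_eq_of_step hζ hL₁ hL₂ D hC hs)
  exact key _ hr

/-- The kernel condition for the topological states and the crystals. -/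
theorem mem_ice_iff (hζ : 0 < ζ) (hL₁ : 20 ≤ L₁) (hL₂ : 20 ≤ L₂) (D : ArrowMap P) :
    ψ ∈ topSpace L₁ L₂ ζ P ⊔ iceSpace L₁ L₂ ζ P ↔ LocallySaturated ζ P iceCoeffs ψ := by
  constructor
  · intro h
    rw [← span_iceCoeffs] at h
    exact ⟨fun _ => saturated_of_mem_span hL₁ hL₂ h _, fun _ => saturated_of_mem_span hL₁ hL₂ h _⟩
  · intro h
    obtain ⟨c, F, rfl, hF⟩ := h.exists_sectors hζ hL₁ hL₂ D
      fun _ _ _ _ h1 h2 _ hc _ _ hs => iceCoeffs_eq h1 h2 hc hs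
    rw [networkLinear_mem D hF, map_add, map_sum, map_sum, topSpace_sup_iceSpace_eq]
    refine Submodule.add_mem _ (Submodule.sum_mem _ fun w _ => ?_)
      (Submodule.sum_mem _ fun e _ => ?_) <;> rw [map_smul] <;>
      refine Submodule.smul_mem _ _ (Submodule.subset_span ?_)
    · exact ⟨Sum.inl w, rfl⟩
    · exact ⟨Sum.inr e, rfl⟩

/-- The kernel condition for the topological states. -/
theorem mem_top_iff (hζ : 0 < ζ) (hL₁ : 20 ≤ L₁) (hL₂ : 20 ≤ L₂) (D : ArrowMap P) :
    ψ ∈ topSpace L₁ L₂ ζ P ↔ LocallySaturated ζ P topCoeffs ψ ∧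
      ∀ i, Saturated ζ P topCoeffs (crystalRegion i) ψ := by
  constructor
  · intro h
    rw [← span_topCoeffs] at h
    exact ⟨⟨fun _ => saturated_of_mem_span hL₁ hL₂ h _, fun _ => saturated_of_mem_span hL₁ hL₂ h _⟩,
      fun _ => saturated_of_mem_span hL₁ hL₂ h _⟩
  · rintro ⟨h, hcr⟩
    obtain ⟨c, F, rfl, hF⟩ := h.exists_sectors hζ hL₁ hL₂ D
      fun _ _ _ _ _ _ _ hc _ _ hs => topCoeffs_eq hc hs.windings_eq.1 hs.windings_eq.2
    -- The change on two hexagons gives each crystal the coefficient of the sector with its winding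
    -- numbers, so no independent crystal remains.
    have hce : ∀ e, c (crystalLoop L₁ L₂ e) - F (windings (crystalLoop L₁ L₂ e)) = 0 := fun e => by
      obtain ⟨l', hl', hn, h1, h2, heq⟩ := exists_eq_coeff_crystal hζ hL₁ hL₂ D
        (fun _ _ _ _ _ _ _ hc _ _ a b => topCoeffs_eq hc a b) hcr e
      rw [heq, hF l' hl' hn, windings, windings, h1, h2, sub_self]
    rw [networkLinear_mem D hF, topSpace_eq]
    simp only [hce, zero_smul, Finset.sum_const_zero, add_zero, map_sum, map_smul]
    exact Submodule.sum_mem _ fun w _ => Submodule.smul_mem _ _ (Submodule.subset_span ⟨w, rfl⟩)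

end GroundSpaces

/-! ### Parent Hamiltonians of the trimer states -/

section Parents

set_option linter.unusedSectionVars false

/-- The regions that determine the states up to the crystals. -/
def localRegion : Fin 6 → Finset KSite :=
  ![triangles (0, 0), triangles (0, 1), triangles (0, 2), hexagonPair 0, hexagonPair 1,
    hexagonPair 2]

theorem near_localRegion : ∀ k, ∀ x ∈ localRegion k, Near x.1 := by decide +kernel

theorem isHexagonRegion_localRegion (k : Fin 6) : IsHexagonRegion (localRegion k) := by
  have : ∀ k, localRegion k \ hexagon 0 ⊆ starOf (hexagon 0) \ hexagon 0 ∧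
      (localRegion k \ hexagon 0).card ≤ 2 := by decide +kernel
  exact ⟨localRegion k \ hexagon 0, (this k).1, (this k).2,
    by rw [Finset.union_sdiff_self_eq_union]; exact Finset.subset_union_right⟩

theorem isDoubleHexagonRegion_localRegion (k : Fin 6) : IsDoubleHexagonRegion (localRegion k) := by
  have : ∀ k, ∃ d : Fin 3, ∃ o ∈ starOf (doubleHexagon d) \ doubleHexagon d,
      localRegion k ⊆ insert o (doubleHexagon d) := by decide +kernel
  exact this k

theorem isDoubleHexagonRegion_crystalRegion (i : Fin 6) :
    IsDoubleHexagonRegion (crystalRegion i) := by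
  have : ∀ i, ∃ d : Fin 3, ∃ o ∈ starOf (doubleHexagon d) \ doubleHexagon d,
      crystalRegion i ⊆ insert o (doubleHexagon d) := by decide +kernel
  exact this i

variable {σ : Type} {P : σ → Virt → Virt → ℂ} {ζ : ℝ}
  {C : ∀ (L₁ L₂ : ℕ) [NeZero L₁] [NeZero L₂], Set ((Site L₁ L₂ → ZMod 3) → ℂ)}
  {L₁ L₂ : ℕ}

theorem locallySaturated_iff {ψ : (Site L₁ L₂ → σ) → ℂ} :
    LocallySaturated ζ P C ψ ↔ ∀ k, Saturated ζ P C (localRegion k) ψ := by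
  constructor
  · rintro ⟨h1, h2⟩ k
    fin_cases k
    exacts [h1 0, h1 1, h1 2, h2 0, h2 1, h2 2]
  · intro h
    refine ⟨fun d => ?_, fun i => ?_⟩
    · fin_cases d
      exacts [h 0, h 1, h 2]
    · fin_cases i
      exacts [h 3, h 4, h 5]

/-- The projector whose kernel is given by the exchange relations. -/
theorem exists_exchangeProj [Fintype σ] [DecidableEq σ] (ζ : ℝ) (P : σ → Virt → Virt → ℂ)
    (C : ∀ (L₁ L₂ : ℕ) [NeZero L₁] [NeZero L₂], Set ((Site L₁ L₂ → ZMod 3) → ℂ))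
    (R : Finset KSite) : ∃ h : Matrix (R → σ) (R → σ) ℂ, IsOrthProj h ∧
      ∀ u, h.mulVec u = 0 ↔ ∀ ρ ρ' a b, Exchange ζ P C R ρ ρ' a b → a * u ρ = b * u ρ' := by
  let K : Submodule ℂ ((R → σ) → ℂ) :=
    { carrier := {u | ∀ ρ ρ' a b, Exchange ζ P C R ρ ρ' a b → a * u ρ = b * u ρ'}
      add_mem' := fun {u v} hu hv ρ ρ' a b h => by
        simp only [Pi.add_apply, mul_add, hu ρ ρ' a b h, hv ρ ρ' a b h]
      zero_mem' := fun ρ ρ' a b h => by simp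
      smul_mem' := fun t u hu ρ ρ' a b h => by
        simp only [Pi.smul_apply, smul_eq_mul]
        linear_combination t * hu ρ ρ' a b h }
  exact exists_orthProj K

variable [NeZero L₁] [NeZero L₂]

theorem mem_ice_iff_regions {ι : Type*} {R : ι → Finset KSite} (hζ : 0 < ζ) (hL₁ : 20 ≤ L₁)
    (hL₂ : 20 ≤ L₂) (D : ArrowMap P) (hR : ∀ k, ∀ x ∈ R k, Near x.1)
    (hloc : ∀ j, ∃ k, localRegion j ⊆ R k) {ψ : (Site L₁ L₂ → σ) → ℂ} :
    ψ ∈ topSpace L₁ L₂ ζ P ⊔ iceSpace L₁ L₂ ζ P ↔ ∀ k, Saturated ζ P iceCoeffs (R k) ψ := by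
  constructor
  · intro h k
    rw [← span_iceCoeffs] at h
    exact saturated_of_mem_span hL₁ hL₂ h _
  · intro h
    rw [mem_ice_iff hζ hL₁ hL₂ D, locallySaturated_iff]
    intro j
    obtain ⟨k, hk⟩ := hloc j
    exact (h k).mono hL₁ hL₂ hk (hR k)

theorem mem_top_iff_regions {ι : Type*} {R : ι → Finset KSite} (hζ : 0 < ζ) (hL₁ : 20 ≤ L₁)
    (hL₂ : 20 ≤ L₂) (D : ArrowMap P) (hR : ∀ k, ∀ x ∈ R k, Near x.1)
    (hloc : ∀ j, ∃ k, localRegion j ⊆ R k) (hcr : ∀ j, ∃ k, crystalRegion j ⊆ R k)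
    {ψ : (Site L₁ L₂ → σ) → ℂ} :
    ψ ∈ topSpace L₁ L₂ ζ P ↔ ∀ k, Saturated ζ P topCoeffs (R k) ψ := by
  constructor
  · intro h k
    rw [← span_topCoeffs] at h
    exact saturated_of_mem_span hL₁ hL₂ h _
  · intro h
    rw [mem_top_iff hζ hL₁ hL₂ D, locallySaturated_iff]
    refine ⟨fun j => ?_, fun j => ?_⟩
    · obtain ⟨k, hk⟩ := hloc j
      exact (h k).mono hL₁ hL₂ hk (hR k)
    · obtain ⟨k, hk⟩ := hcr j
      exact (h k).mono hL₁ hL₂ hk (hR k)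

theorem saturated_iff_slices {R : Finset KSite} {ψ : (Site L₁ L₂ → σ) → ℂ} [Fintype σ] [DecidableEq σ]
    {h : Matrix (R → σ) (R → σ) ℂ} (hker : ∀ u, h.mulVec u = 0 ↔
      ∀ ρ ρ' a b, Exchange ζ P C R ρ ρ' a b → a * u ρ = b * u ρ') :
    Saturated ζ P C R ψ ↔ ∀ (p : ZMod L₁ × ZMod L₂) φ,
      h.mulVec (fun ρ => ψ (patch φ p R ρ)) = 0 := by
  simp only [hker]
  exact ⟨fun hs p φ ρ ρ' a b hex => hs ρ ρ' a b hex p φ,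
    fun hs ρ ρ' a b hex p φ => hs p φ ρ ρ' a b hex⟩

variable [Fintype σ] [DecidableEq σ]

theorem hasGroundSpace_of_saturated {n : ℕ} {R : Fin n → Finset KSite} (hL₁ : 20 ≤ L₁)
    (hL₂ : 20 ≤ L₂) (hR : ∀ k, ∀ x ∈ R k, Near x.1)
    {h : ∀ k, Matrix (R k → σ) (R k → σ) ℂ} (hh : ∀ k, IsOrthProj (h k))
    (hker : ∀ k u, (h k).mulVec u = 0 ↔
      ∀ ρ ρ' a b, Exchange ζ P C (R k) ρ ρ' a b → a * u ρ = b * u ρ')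
    {G : Submodule ℂ ((Site L₁ L₂ → σ) → ℂ)}
    (hG : ∀ ψ, ψ ∈ G ↔ ∀ k, Saturated ζ P C (R k) ψ) :
    HasGroundSpace (hamiltonian L₁ L₂ R h) G :=
  hasGroundSpace_hamiltonian (fun k p => embeds_of_near hL₁ hL₂ (hR k) p)
    (fun k => (hh k).conjTranspose_mul_self.symm) fun ψ => by
    rw [hG]
    exact forall_congr' fun k => saturated_iff_slices (hker k)

theorem hasTrimerParents (hζ : 0 < ζ) (D : ArrowMap P) : HasTrimerParents 20 ζ P := by
  constructor
  · choose h hh hker using exists_exchangeProj ζ P iceCoeffs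
    refine ⟨6, localRegion, fun k => h (localRegion k),
      fun k => ⟨isHexagonRegion_localRegion k, hh _⟩, fun L₁ L₂ _ _ hL₁ hL₂ =>
      ⟨?_, finrank_topSpace hζ hL₁ hL₂ D, finrank_topSpace_sup_iceSpace hζ hL₁ hL₂ D⟩⟩
    exact hasGroundSpace_of_saturated hL₁ hL₂ near_localRegion (fun k => hh _) (fun k => hker _)
      fun ψ => mem_ice_iff_regions hζ hL₁ hL₂ D near_localRegion fun j => ⟨j, subset_rfl⟩
  · choose h hh hker using exists_exchangeProj ζ P topCoeffs
    have hnear : ∀ k, ∀ x ∈ Fin.append localRegion crystalRegion k, Near x.1 := fun k => by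
      refine Fin.addCases (fun j => ?_) (fun j => ?_) k
      · rw [Fin.append_left]; exact near_localRegion j
      · rw [Fin.append_right]; exact fun x hx => (near_crystalRegion j x hx).1
    refine ⟨6 + 6, Fin.append localRegion crystalRegion, fun k => h _,
      fun k => ⟨?_, hh _⟩, fun L₁ L₂ _ _ hL₁ hL₂ => ⟨?_, finrank_topSpace hζ hL₁ hL₂ D⟩⟩
    · refine Fin.addCases (fun j => ?_) (fun j => ?_) k
      · rw [Fin.append_left]; exact isDoubleHexagonRegion_localRegion j
      · rw [Fin.append_right]; exact isDoubleHexagonRegion_crystalRegion j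
    · exact hasGroundSpace_of_saturated hL₁ hL₂ hnear (fun k => hh _) (fun k => hker _)
        fun ψ => mem_top_iff_regions hζ hL₁ hL₂ D hnear
          (fun j => ⟨Fin.castAdd 6 j, by rw [Fin.append_left]⟩)
          fun j => ⟨Fin.natAdd 6 j, by rw [Fin.append_right]⟩

end Parents

/-! ### Product operators -/

section ProductOperators

set_option linter.unusedSectionVars false

open Matrix

variable {σ : Type} [Fintype σ] [DecidableEq σ]

/-- The product of the operators `M` on all vertices. -/
def productMatrix (ι : Type) [Fintype ι] (M : Matrix σ σ ℂ) : Matrix (ι → σ) (ι → σ) ℂ :=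
  fun φ ψ => ∏ r, M (φ r) (ψ r)

section

variable {ι : Type} [Fintype ι] [DecidableEq ι]

theorem productMatrix_mul (M N : Matrix σ σ ℂ) :
    productMatrix ι M * productMatrix ι N = productMatrix ι (M * N) := by
  ext φ ψ
  simp only [Matrix.mul_apply, productMatrix, ← Finset.prod_mul_distrib]
  exact (Fintype.prod_sum fun r s => M (φ r) s * N s (ψ r)).symm

theorem productMatrix_one : productMatrix ι (1 : Matrix σ σ ℂ) = 1 := by
  ext φ ψ
  simp only [productMatrix, Matrix.one_apply, Finset.prod_ite_zero, Finset.prod_const_one,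
    funext_iff, Finset.mem_univ, true_imp_iff]

theorem productMatrix_transpose (M : Matrix σ σ ℂ) :
    (productMatrix ι M)ᵀ = productMatrix ι Mᵀ := rfl

end

variable {L₁ L₂ : ℕ} [NeZero L₁] [NeZero L₂]

theorem place_transpose (R : Finset KSite) (A : Matrix (R → σ) (R → σ) ℂ)
    (p : ZMod L₁ × ZMod L₂) : (place L₁ L₂ R A p)ᵀ = place L₁ L₂ R Aᵀ p := by
  classical
  ext φ ψ
  simp only [Matrix.transpose_apply, place, eq_comm]
  split_ifs <;> rfl

variable {R : Finset KSite} {p : ZMod L₁ × ZMod L₂}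

open Classical in
/-- The factor of a product operator from the vertices outside of the region. -/
noncomputable def outsideFactor (M : Matrix σ σ ℂ) (R : Finset KSite) (p : ZMod L₁ × ZMod L₂)
    (φ χ : Site L₁ L₂ → σ) : ℂ :=
  ∏ x ∈ (R.image (wrap p))ᶜ, M (φ x) (χ x)

theorem productMatrix_patch_left (hR : Embeds p R) (M : Matrix σ σ ℂ) (φ χ : Site L₁ L₂ → σ)
    (ρ : R → σ) : productMatrix (Site L₁ L₂) M (patch φ p R ρ) χ =
      tensorPower R M ρ (fun r => χ (wrap p r)) * outsideFactor M R p φ χ := by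
  classical
  rw [productMatrix, ← Finset.prod_mul_prod_compl (R.image (wrap p)), Finset.prod_image hR,
    ← Finset.prod_coe_sort, tensorPower]
  congr 1
  · exact Finset.prod_congr rfl fun r _ => by rw [patch_wrap hR]
  · refine Finset.prod_congr rfl fun x hx => ?_
    rw [patch_of_ne]
    rintro r hr rfl
    exact Finset.mem_compl.1 hx (Finset.mem_image_of_mem _ hr)

/-- Product operators and operators on a region. -/
theorem place_mul_productMatrix (hR : Embeds p R) (M : Matrix σ σ ℂ)
    (B : Matrix (R → σ) (R → σ) ℂ) (φ χ : Site L₁ L₂ → σ) :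
    (place L₁ L₂ R B p * productMatrix (Site L₁ L₂) M) φ χ =
      (B * tensorPower R M) (fun r => φ (wrap p r)) (fun r => χ (wrap p r)) *
        outsideFactor M R p φ χ := by
  have h := place_mulVec hR B (productMatrix (Site L₁ L₂) M *ᵥ Pi.single χ 1) φ
  rw [mulVec_mulVec, mulVec_single_one] at h
  refine h.trans ?_
  rw [mulVec_single_one]
  simp only [mulVec, dotProduct, Matrix.mul_apply, Finset.sum_mul, col_apply]
  refine Finset.sum_congr rfl fun ρ _ => ?_
  rw [productMatrix_patch_left hR, mul_assoc]

/-- An intertwining relation on the region extends to the torus, as the factors outside are the same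
on both sides. Transposition reduces the product in the other order to the one already computed. -/
theorem productMatrix_mul_place (hR : Embeds p R) (M : Matrix σ σ ℂ)
    {A B : Matrix (R → σ) (R → σ) ℂ} (hAB : tensorPower R M * A = B * tensorPower R M) :
    productMatrix (Site L₁ L₂) M * place L₁ L₂ R A p =
      place L₁ L₂ R B p * productMatrix (Site L₁ L₂) M := by
  ext φ χ
  rw [place_mul_productMatrix hR, ← transpose_apply (productMatrix (Site L₁ L₂) M * place L₁ L₂ R A p),
    transpose_mul, place_transpose, productMatrix_transpose, place_mul_productMatrix hR, ← hAB]
  have e : tensorPower R Mᵀ = (tensorPower R M)ᵀ := rfl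
  rw [e, ← transpose_mul, transpose_apply]
  rfl

/-- The local kernel condition is covariant under invertible product operators. -/
theorem slices_productMatrix (hR : Embeds p R) {M N : Matrix σ σ ℂ} (hMN : M * N = 1)
    (h : Matrix (R → σ) (R → σ) ℂ) (ψ : (Site L₁ L₂ → σ) → ℂ) :
    (∀ φ, h *ᵥ (fun ρ => (productMatrix (Site L₁ L₂) N *ᵥ ψ) (patch φ p R ρ)) = 0) ↔
      ∀ φ, (h * tensorPower R N) *ᵥ (fun ρ => ψ (patch φ p R ρ)) = 0 := by
  have hNM : N * M = 1 := mul_eq_one_comm.1 hMN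
  have tMN : tensorPower R M * tensorPower R N = 1 := by
    rw [show tensorPower R M * tensorPower R N = _ from productMatrix_mul M N, hMN, productMatrix_one]
  have tNM : tensorPower R N * tensorPower R M = 1 := mul_eq_one_comm.1 tMN
  have sMN : productMatrix (Site L₁ L₂) M * productMatrix (Site L₁ L₂) N = 1 := by
    rw [productMatrix_mul, hMN, productMatrix_one]
  have sNM : productMatrix (Site L₁ L₂) N * productMatrix (Site L₁ L₂) M = 1 := mul_eq_one_comm.1 sMN
  have inj : ∀ {α : Type} [Fintype α] [DecidableEq α] {A A' : Matrix α α ℂ}, A' * A = 1 →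
      ∀ v, A *ᵥ v = 0 ↔ v = 0 := fun {α} _ _ {A A'} hA v => by
    refine ⟨fun h => ?_, fun h => by rw [h, mulVec_zero]⟩
    have := congrArg (A' *ᵥ ·) h
    simpa [mulVec_mulVec, hA] using this
  rw [← place_mulVec_eq_zero_iff hR]
  -- The global product operator conjugates the local term `h` to the product of `M`, `h` and the
  -- inverse on the region only; the invertible factors on the left do not affect kernels.
  have key := productMatrix_mul_place hR M (A := h)
    (B := tensorPower R M * (h * tensorPower R N)) (by
      rw [mul_assoc, mul_assoc, tNM, mul_one])
  rw [← inj sNM, mulVec_mulVec, key, mulVec_mulVec, mul_assoc, sMN, mul_one,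
    place_mulVec_eq_zero_iff hR]
  refine forall_congr' fun φ => ?_
  rw [← mulVec_mulVec, inj tNM]

end ProductOperators

/-! ### The second interpolation -/

section Interpolation

set_option linter.unusedSectionVars false

open Matrix Polynomial

/-- The filtering for complex values of the parameter. -/
noncomputable def filterMatrix (z : ℂ) : Matrix ArrowSpin ArrowSpin ℂ :=
  fun x y => ((1 - z) * kron x.1 y.1 + z / 3) * kron x.2 y.2

/-- The inverse of the filtering. -/
noncomputable def filterInverse (z : ℂ) : Matrix ArrowSpin ArrowSpin ℂ :=
  fun x y => (1 - z)⁻¹ * (kron x.1 y.1 - z / 3) * kron x.2 y.2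

theorem kron_eq_one_apply {α : Type*} [DecidableEq α] (i j : α) :
    kron i j = (1 : Matrix α α ℂ) i j := by
  rw [kron, Matrix.one_apply]

theorem sum_arrow (f : Arrow → ℂ) : ∑ a, f a = f .toB + f .toA + f .circ := by
  rw [show (Finset.univ : Finset Arrow) = {.toB, .toA, .circ} from rfl, Finset.sum_insert (by decide),
    Finset.sum_insert (by decide), Finset.sum_singleton, add_assoc]

theorem filterMatrix_mul_inverse {z : ℂ} (hz : z ≠ 1) : filterMatrix z * filterInverse z = 1 := by
  have h1 : (1 - z) ≠ 0 := sub_ne_zero.2 hz.symm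
  ext ⟨a, i⟩ ⟨b, j⟩
  have hcol : ∑ k : Fin 3, kron i k * kron k j = kron i j := by
    simp only [kron_eq_one_apply, ← Matrix.mul_apply, mul_one]
  -- The projector Q on the equal weight superposition has all entries 1/3, and ((1 - z) + z Q)(1 -
  -- z Q) = 1 - z.
  have harr : ∑ d : Arrow, ((1 - z) * kron a d + z / 3) * ((1 - z)⁻¹ * (kron d b - z / 3)) =
      kron a b := by
    rw [sum_arrow]
    cases a <;> cases b <;> simp [kron] <;> field_simp <;> ring
  rw [Matrix.mul_apply, Fintype.sum_prod_type]
  simp only [filterMatrix, filterInverse]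
  have : ∀ (d : Arrow) (k : Fin 3), ((1 - z) * kron a d + z / 3) * kron i k *
      ((1 - z)⁻¹ * (kron d b - z / 3) * kron k j) =
      ((1 - z) * kron a d + z / 3) * ((1 - z)⁻¹ * (kron d b - z / 3)) * (kron i k * kron k j) :=
    fun d k => by ring
  simp only [this, ← Finset.mul_sum, hcol, ← Finset.sum_mul, harr]
  simp only [kron_eq_one_apply, Matrix.one_apply, Prod.mk.injEq]
  split_ifs <;> simp_all

theorem filterMatrix_zero : filterMatrix 0 = 1 := by
  ext ⟨a, i⟩ ⟨b, j⟩
  simp only [filterMatrix, kron_eq_one_apply, Matrix.one_apply, Prod.mk.injEq]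
  split_ifs <;> simp_all

theorem siteFilter_inv {θ : ℝ} (hθ : θ ≠ 1) : (siteFilter θ)⁻¹ = filterInverse θ :=
  Matrix.inv_eq_right_inv (filterMatrix_mul_inverse (by exact_mod_cast hθ))

theorem siteFilter_mul_inv {θ : ℝ} (hθ : θ ≠ 1) : siteFilter θ * (siteFilter θ)⁻¹ = 1 := by
  rw [siteFilter_inv hθ]
  exact filterMatrix_mul_inverse (by exact_mod_cast hθ)

/-- The product of the filterings as a matrix of polynomials. -/
noncomputable def filterPolynomial (R : Finset KSite) :
    Matrix (R → ArrowSpin) (R → ArrowSpin) ℂ[X] :=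
  fun φ ψ => ∏ r, ((1 - X) * C (kron (φ r).1 (ψ r).1) + X * C (1 / 3)) * C (kron (φ r).2 (ψ r).2)

theorem filterPolynomial_eval (R : Finset KSite) (z : ℂ) :
    (filterPolynomial R).map (eval z) = tensorPower R (filterMatrix z) := by
  ext φ ψ
  simp only [Matrix.map_apply, filterPolynomial, eval_prod, eval_mul, eval_add, eval_sub, eval_one,
    eval_X, eval_C, tensorPower, filterMatrix]
  refine Finset.prod_congr rfl fun r _ => ?_
  ring

theorem tensorPower_mul_inverse (R : Finset KSite) {z : ℂ} (hz : z ≠ 1) :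
    tensorPower R (filterMatrix z) * tensorPower R (filterInverse z) = 1 := by
  rw [show tensorPower R (filterMatrix z) * tensorPower R (filterInverse z) = _ from
    productMatrix_mul _ _, filterMatrix_mul_inverse hz, productMatrix_one]

theorem deform_eq (R : Finset KSite) (θ : ℝ) {h : Matrix (R → ArrowSpin) (R → ArrowSpin) ℂ}
    (hh : IsOrthProj h) : deform R θ h =
      (h * tensorPower R (siteFilter θ)⁻¹)ᴴ * (h * tensorPower R (siteFilter θ)⁻¹) := by
  rw [deform, conjTranspose_mul, mul_assoc, mul_assoc, ← mul_assoc hᴴ h, hh.conjTranspose_mul_self]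

theorem contDiffOn_deform (R : Finset KSite) (h : Matrix (R → ArrowSpin) (R → ArrowSpin) ℂ)
    (φ ψ : R → ArrowSpin) :
    ContDiffOn ℝ ∞ (fun θ => deform R θ h φ ψ) (Set.Ico 0 1) := by
  have hof : ContDiff ℝ ∞ fun θ : ℝ => (θ : ℂ) := Complex.ofRealCLM.contDiff
  have hN : ∀ x y, ContDiffOn ℝ ∞ (fun θ : ℝ => filterInverse θ x y) (Set.Ico 0 1) := fun x y => by
    unfold filterInverse
    refine ((ContDiffOn.inv (contDiff_const.sub hof).contDiffOn fun θ hθ => ?_).mul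
      (contDiff_const.sub (hof.div_const _)).contDiffOn).mul contDiffOn_const
    rw [sub_ne_zero]
    exact_mod_cast hθ.2.ne'
  have hT : ∀ φ ψ : R → ArrowSpin,
      ContDiffOn ℝ ∞ (fun θ : ℝ => tensorPower R (filterInverse θ) φ ψ) (Set.Ico 0 1) :=
    fun φ ψ => contDiffOn_prod fun r _ => hN _ _
  have hstar : ∀ φ ψ : R → ArrowSpin,
      ContDiffOn ℝ ∞ (fun θ : ℝ => star (tensorPower R (filterInverse θ) φ ψ)) (Set.Ico 0 1) :=
    fun φ ψ => Complex.conjCLE.contDiff.comp_contDiffOn (hT φ ψ)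
  have : ContDiffOn ℝ ∞ (fun θ : ℝ => ∑ ρ', (∑ ρ, star (tensorPower R (filterInverse θ) ρ φ) *
      h ρ ρ') * tensorPower R (filterInverse θ) ρ' ψ) (Set.Ico 0 1) :=
    ContDiffOn.sum fun ρ' _ => (ContDiffOn.sum fun ρ _ => (hstar _ _).mul contDiffOn_const).mul (hT _ _)
  refine this.congr fun θ hθ => ?_
  rw [deform, siteFilter_inv hθ.2.ne]
  simp only [Matrix.mul_apply, conjTranspose_apply]

variable {L₁ L₂ : ℕ} [NeZero L₁] [NeZero L₂] {ζ : ℝ}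
  {C : ∀ (L₁ L₂ : ℕ) [NeZero L₁] [NeZero L₂], Set ((Site L₁ L₂ → ZMod 3) → ℂ)}

theorem networkLinear_filterMap (θ : ℝ) (c : (Site L₁ L₂ → ZMod 3) → ℂ) :
    networkLinear L₁ L₂ ζ (filterMap θ) c =
      productMatrix (Site L₁ L₂) (siteFilter θ) *ᵥ networkLinear L₁ L₂ ζ singletMap c := by
  funext φ
  change networkState L₁ L₂ ζ (filterMap θ) c φ = ∑ χ, (∏ x, siteFilter θ (φ x) (χ x)) *
    networkState L₁ L₂ ζ singletMap c χ
  simp only [networkState, filterMap, Fintype.prod_sum, Finset.mul_sum, Finset.prod_mul_distrib]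
  symm
  rw [Finset.sum_comm]
  refine Finset.sum_congr rfl fun a _ => ?_
  rw [Finset.sum_comm]
  exact Finset.sum_congr rfl fun b _ => Finset.sum_congr rfl fun χ _ => by ring

/-- The network states of the filtered site map. -/
theorem span_filterMap (θ : ℝ) :
    Submodule.span ℂ (networkLinear L₁ L₂ ζ (filterMap θ) '' C L₁ L₂) =
      (Submodule.span ℂ (networkLinear L₁ L₂ ζ singletMap '' C L₁ L₂)).map
        (productMatrix (Site L₁ L₂) (siteFilter θ)).mulVecLin := by
  rw [Submodule.map_span, Set.image_image]
  congr 1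
  exact Set.image_congr fun c _ => networkLinear_filterMap θ c

theorem mem_span_filterMap_iff {θ : ℝ} (hθ : θ ≠ 1) (ψ : (Site L₁ L₂ → ArrowSpin) → ℂ) :
    ψ ∈ Submodule.span ℂ (networkLinear L₁ L₂ ζ (filterMap θ) '' C L₁ L₂) ↔
      productMatrix (Site L₁ L₂) (siteFilter θ)⁻¹ *ᵥ ψ ∈
        Submodule.span ℂ (networkLinear L₁ L₂ ζ singletMap '' C L₁ L₂) := by
  have h1 : productMatrix (Site L₁ L₂) (siteFilter θ) *
      productMatrix (Site L₁ L₂) (siteFilter θ)⁻¹ = 1 := by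
    rw [productMatrix_mul, siteFilter_mul_inv hθ, productMatrix_one]
  have h2 := mul_eq_one_comm.1 h1
  rw [span_filterMap]
  constructor
  · rintro ⟨ψ₀, hψ₀, rfl⟩
    rwa [mulVecLin_apply, mulVec_mulVec, h2, one_mulVec]
  · intro h
    exact ⟨_, h, by rw [mulVecLin_apply, mulVec_mulVec, h1, one_mulVec]⟩

theorem finrank_span_filterMap {θ : ℝ} (hθ : θ ≠ 1) :
    Module.finrank ℂ (Submodule.span ℂ (networkLinear L₁ L₂ ζ (filterMap θ) '' C L₁ L₂)) =
      Module.finrank ℂ (Submodule.span ℂ (networkLinear L₁ L₂ ζ singletMap '' C L₁ L₂)) := by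
  rw [span_filterMap]
  have h2 : productMatrix (Site L₁ L₂) (siteFilter θ)⁻¹ *
      productMatrix (Site L₁ L₂) (siteFilter θ) = 1 := by
    rw [productMatrix_mul, mul_eq_one_comm.1 (siteFilter_mul_inv hθ), productMatrix_one]
  refine (LinearEquiv.finrank_eq (Submodule.equivMapOfInjective _ (fun u v huv => ?_) _)).symm
  have := congrArg (productMatrix (Site L₁ L₂) (siteFilter θ)⁻¹ *ᵥ ·) huv
  simpa only [mulVecLin_apply, mulVec_mulVec, h2, one_mulVec] using this

variable {n m : ℕ} {R : Fin n → Finset KSite}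

/-- The local projectors at the start of the interpolation, and those of the interpolation, have
kernels related by the filtering. -/
theorem exists_filter_projectors {R : Finset KSite} {h : Matrix (R → ArrowSpin) (R → ArrowSpin) ℂ} :
    ∃ g : ℝ → Matrix (R → ArrowSpin) (R → ArrowSpin) ℂ, (∀ θ, IsOrthProj (g θ)) ∧
      (∀ a b, ContDiff ℝ ∞ fun θ => g θ a b) ∧
      ∀ θ : ℝ, θ ≠ 1 → ∀ u, g θ *ᵥ u = 0 ↔ (h * tensorPower R (siteFilter θ)⁻¹) *ᵥ u = 0 := by
  obtain ⟨g, h1, h2, h3⟩ := exists_smooth_projectors (LinearMap.ker h.mulVecLin)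
    (filterPolynomial R) (by
      rw [filterPolynomial_eval, filterMatrix_zero]; exact productMatrix_one) (by
      intro z hz u hu
      rw [filterPolynomial_eval] at hu
      have := congrArg (tensorPower R (filterInverse z) *ᵥ ·) hu
      simpa [mulVec_mulVec, mul_eq_one_comm.1 (tensorPower_mul_inverse R hz)] using this)
  refine ⟨g, h1, h2, fun θ hθ u => (h3 θ hθ u).trans ?_⟩
  have hθ' : (θ : ℂ) ≠ 1 := by exact_mod_cast hθ
  rw [filterPolynomial_eval, siteFilter_inv hθ]
  have e1 := tensorPower_mul_inverse R hθ'
  have e2 := mul_eq_one_comm.1 e1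
  constructor
  · rintro ⟨k, hk, rfl⟩
    rw [mulVec_mulVec, mul_assoc, e2, mul_one]
    exact hk
  · intro hu
    refine ⟨tensorPower R (filterInverse θ) *ᵥ u, ?_, ?_⟩
    · rw [LinearMap.mem_ker, mulVecLin_apply, mulVec_mulVec, hu]
    · rw [mulVec_mulVec, e1, one_mulVec]

theorem continuous_hamiltonian {g : ℝ → ∀ k, Matrix (R k → ArrowSpin) (R k → ArrowSpin) ℂ}
    (hg : ∀ k a b, Continuous fun θ => g θ k a b) (φ χ : Site L₁ L₂ → ArrowSpin) :
    Continuous fun θ => hamiltonian L₁ L₂ R (g θ) φ χ := by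
  simp only [hamiltonian, Matrix.sum_apply]
  refine continuous_finsetSum _ fun k _ => continuous_finsetSum _ fun p _ => ?_
  unfold place
  split_ifs
  · exact hg _ _ _
  · exact continuous_const

theorem continuous_siteFilter (x y : ArrowSpin) : Continuous fun θ => siteFilter θ x y := by
  unfold siteFilter
  fun_prop

/-- For θ ≠ 1 the filter is an invertible product operator, so membership in the span and the local
kernel conditions are transported alike from θ = 0. The local terms may be any family with the
transported kernels: the deformed projectors, or the orthogonal projectors continued smoothly
through θ = 1. -/
theorem hasSmoothParents (hR : ∀ k, ∀ x ∈ R k, Near x.1)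
    (hmem : ∀ (L₁ L₂ : ℕ) [NeZero L₁] [NeZero L₂], 20 ≤ L₁ → 20 ≤ L₂ →
      ∀ ψ, ψ ∈ Submodule.span ℂ (networkLinear L₁ L₂ ζ singletMap '' C L₁ L₂) ↔
        ∀ k, Saturated ζ singletMap C (R k) ψ)
    (hdim : ∀ (L₁ L₂ : ℕ) [NeZero L₁] [NeZero L₂], 20 ≤ L₁ → 20 ≤ L₂ →
      Module.finrank ℂ (Submodule.span ℂ (networkLinear L₁ L₂ ζ singletMap '' C L₁ L₂)) = m) :
    HasSmoothParents 20 m n R fun L₁ L₂ _ _ θ =>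
      Submodule.span ℂ (networkLinear L₁ L₂ ζ (filterMap θ) '' C L₁ L₂) := by
  choose h hh hker using fun k => exists_exchangeProj ζ singletMap C (R k)
  choose g hg1 hg2 hg3 using fun k => exists_filter_projectors (h := h k)
  have hE : ∀ {L₁ L₂ : ℕ}, 20 ≤ L₁ → 20 ≤ L₂ → ∀ k (p : ZMod L₁ × ZMod L₂), Embeds p (R k) :=
    fun hL₁ hL₂ k p => embeds_of_near hL₁ hL₂ (hR k) p
  have hslice : ∀ (L₁ L₂ : ℕ) [NeZero L₁] [NeZero L₂], 20 ≤ L₁ → 20 ≤ L₂ → ∀ θ : ℝ, θ ≠ 1 →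
      ∀ ψ, ψ ∈ Submodule.span ℂ (networkLinear L₁ L₂ ζ (filterMap θ) '' C L₁ L₂) ↔
        ∀ k (p : ZMod L₁ × ZMod L₂) φ, (h k * tensorPower (R k) (siteFilter θ)⁻¹) *ᵥ
          (fun ρ => ψ (patch φ p (R k) ρ)) = 0 := by
    intro L₁ L₂ _ _ hL₁ hL₂ θ hθ ψ
    rw [mem_span_filterMap_iff hθ, hmem L₁ L₂ hL₁ hL₂]
    refine forall_congr' fun k => ?_
    rw [saturated_iff_slices (hker k)]
    exact forall_congr' fun p => slices_productMatrix (hE hL₁ hL₂ k p) (siteFilter_mul_inv hθ) _ _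
  have hground : ∀ (L₁ L₂ : ℕ) [NeZero L₁] [NeZero L₂], 20 ≤ L₁ → 20 ≤ L₂ → ∀ θ : ℝ, θ ≠ 1 →
      HasGroundSpace (hamiltonian L₁ L₂ R fun k => g k θ)
        (Submodule.span ℂ (networkLinear L₁ L₂ ζ (filterMap θ) '' C L₁ L₂)) := by
    intro L₁ L₂ _ _ hL₁ hL₂ θ hθ
    refine hasGroundSpace_hamiltonian (hE hL₁ hL₂)
      (fun k => (hg1 k θ).conjTranspose_mul_self.symm) fun ψ => ?_
    simp only [hg3 _ θ hθ]
    exact hslice L₁ L₂ hL₁ hL₂ θ hθ ψ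
  refine ⟨h, fun θ k => g k θ, hh, fun k φ ψ => contDiffOn_deform _ _ _ _, fun θ _ k => hg1 k θ,
    fun k φ ψ => (hg2 k φ ψ).contDiffOn, fun θ hθ k => ?_, fun L₁ L₂ _ _ hL₁ hL₂ =>
    ⟨fun θ hθ => ⟨?_, hground L₁ L₂ hL₁ hL₂ θ hθ.2.ne, ?_⟩, ?_⟩⟩
  · ext u
    rw [LinearMap.mem_ker, LinearMap.mem_ker, mulVecLin_apply, mulVecLin_apply, deform_eq _ _ (hh k),
      conjTranspose_mul_self_mulVec_eq_zero]
    exact hg3 k θ hθ.2.ne u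
  · exact hasGroundSpace_hamiltonian (hE hL₁ hL₂) (fun k => deform_eq _ _ (hh k))
      (hslice L₁ L₂ hL₁ hL₂ θ hθ.2.ne)
  · rw [finrank_span_filterMap hθ.2.ne]
    exact hdim L₁ L₂ hL₁ hL₂
  · simp only [span_filterMap]
    rintro _ ⟨ψ₀, hψ₀, rfl⟩
    rw [LinearMap.mem_ker, mulVecLin_apply, mulVecLin_apply]
    -- The energy vector of the filtered state depends continuously on θ and vanishes on [0, 1),
    -- hence also at θ = 1. The invertibility of the filter, which fails there, is not used.
    have hcont : Continuous fun θ => hamiltonian L₁ L₂ R (fun k => g k θ) *ᵥ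
        (productMatrix (Site L₁ L₂) (siteFilter θ) *ᵥ ψ₀) := by
      refine continuous_pi fun φ => ?_
      simp only [mulVec, dotProduct]
      refine continuous_finsetSum _ fun χ _ => (continuous_hamiltonian
        (fun k a b => (hg2 k a b).continuous) φ χ).mul (continuous_finsetSum _ fun η _ => ?_)
      exact (continuous_finsetProd _ fun x _ => continuous_siteFilter _ _).mul continuous_const
    have hcl := isClosed_singleton (x := (0 : (Site L₁ L₂ → ArrowSpin) → ℂ)).preimage hcont
    have hsub : Set.Ico (0 : ℝ) 1 ⊆ (fun θ => hamiltonian L₁ L₂ R (fun k => g k θ) *ᵥ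
        (productMatrix (Site L₁ L₂) (siteFilter θ) *ᵥ ψ₀)) ⁻¹' {0} := by
      intro θ hθ
      have hm : productMatrix (Site L₁ L₂) (siteFilter θ) *ᵥ ψ₀ ∈
          Submodule.span ℂ (networkLinear L₁ L₂ ζ (filterMap θ) '' C L₁ L₂) := by
        rw [span_filterMap]
        exact ⟨ψ₀, hψ₀, rfl⟩
      rw [← (hground L₁ L₂ hL₁ hL₂ θ hθ.2.ne).2] at hm
      exact hm
    have h1 := hcl.closure_subset_iff.2 hsub
    rw [closure_Ico zero_ne_one] at h1
    exact h1 (Set.right_mem_Icc.2 zero_le_one)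

theorem star_regions : (∀ j, localRegion j ⊆ starOf (hexagon 0)) ∧
    (∀ j, ∃ d, localRegion j ⊆ starOf (doubleHexagon d)) ∧
    ∀ j, ∃ d, crystalRegion j ⊆ starOf (doubleHexagon d) := by
  decide +kernel

theorem near_star : (∀ x ∈ starOf (hexagon 0), Near x.1) ∧
    ∀ d, ∀ x ∈ starOf (doubleHexagon d), Near x.1 := by
  decide +kernel

theorem hasSmoothParents_hexagon (hζ : 0 < ζ) :
    HasSmoothParents 20 15 1 (fun _ => starOf (hexagon 0)) fun L₁ L₂ _ _ θ =>
      topSpace L₁ L₂ ζ (filterMap θ) ⊔ iceSpace L₁ L₂ ζ (filterMap θ) := by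
  have := hasSmoothParents (ζ := ζ) (C := iceCoeffs) (m := 15) (n := 1)
    (R := fun _ => starOf (hexagon 0)) (fun _ => near_star.1)
    (fun L₁ L₂ _ _ hL₁ hL₂ ψ => by
      rw [span_iceCoeffs]
      exact mem_ice_iff_regions hζ hL₁ hL₂ arrowMapSinglet (fun _ => near_star.1)
        fun j => ⟨0, star_regions.1 j⟩)
    (fun L₁ L₂ _ _ hL₁ hL₂ => by
      rw [span_iceCoeffs]
      exact finrank_topSpace_sup_iceSpace hζ hL₁ hL₂ arrowMapSinglet)
  simpa only [span_iceCoeffs] using this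

theorem hasSmoothParents_doubleHexagon (hζ : 0 < ζ) :
    HasSmoothParents 20 9 3 (fun d => starOf (doubleHexagon d)) fun L₁ L₂ _ _ θ =>
      topSpace L₁ L₂ ζ (filterMap θ) := by
  have := hasSmoothParents (ζ := ζ) (C := topCoeffs) (m := 9) (n := 3)
    (R := fun d => starOf (doubleHexagon d)) near_star.2
    (fun L₁ L₂ _ _ hL₁ hL₂ ψ => by
      rw [span_topCoeffs]
      exact mem_top_iff_regions hζ hL₁ hL₂ arrowMapSinglet near_star.2 star_regions.2.1
        star_regions.2.2)
    (fun L₁ L₂ _ _ hL₁ hL₂ => by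
      rw [span_topCoeffs]
      exact finrank_topSpace hζ hL₁ hL₂ arrowMapSinglet)
  simpa only [span_topCoeffs] using this

end Interpolation
theorem mainTheorem5 :
    ∃ N₀ : ℕ, ∀ ζ : ℝ, 0 < ζ →
      (∀ s ∈ Set.Icc (0 : ℝ) 1, HasTrimerParents N₀ ζ (pairMap s)) ∧
      HasTrimerParents N₀ ζ singletMap ∧
      HasSmoothParents N₀ 15 1 (fun _ => starOf (hexagon 0))
        (fun L₁ L₂ _ _ θ => topSpace L₁ L₂ ζ (filterMap θ) ⊔ iceSpace L₁ L₂ ζ (filterMap θ)) ∧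
      HasSmoothParents N₀ 9 3 (fun d => starOf (doubleHexagon d))
        (fun L₁ L₂ _ _ θ => topSpace L₁ L₂ ζ (filterMap θ)) :=
  ⟨20, fun _ hζ => ⟨fun _ hs => hasTrimerParents hζ (arrowMapPair hs),
    hasTrimerParents hζ arrowMapSinglet, hasSmoothParents_hexagon hζ,
    hasSmoothParents_doubleHexagon hζ⟩⟩
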